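/- **The codec.** Let $\omega$ be a positive integer whose binary representation $B$ has $n$ digits (index $1$ is the most significant digit). Let $B^*$ be the word of length $2n+1$ formed by $n$ digits $1$, the one's complement of $B$, and one digit $0$. Let $Z_0$ and $Z_1$ be the ascending sequences of the indexes of the $0$'s and of the $1$'s of $B^*$, and let $P_b=(b_1,\dots,b_{2n+1})$ be $Z_0$ followed by the reversal of $Z_1$. Let $P_s=(s_1,\dots,s_{2n+1})$ be the self-inverting permutation with $s_{b_i}=b_{2n+2-i}$ for all $i$. The watermark $G_\omega$ is the digraph with vertex set $\{0,\dots,2n+2\}$ and with the $4n+3$ edges $(u,u-1)$ for $1\le u\le 2n+2$ (path edges) and $(u,q(u))$ for $1\le u\le 2n+1$ (tree edges), where $q(u)$ is the rightmost element of $P_s$ to the left of $u$ that exceeds $u$, if there is one, and $2n+2$ otherwise. The tree edges form a tree $T$ with root $2n+2$. **The algorithm.** The input is a digraph $G'$ with $N=2n+3$ vertices, whose names carry no information, given as a list of its $M$ edges in any order. Let $k=4n+3-M$. If $k>2$, report $k$ and halt. Otherwise carry out (1)–(4) and then (5). (1) *Hamiltonian path.* Let $V_0$, $V_1$ be the sets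 of vertices of out-degree $0$ and $1$. For a choice of ends $v_0\in V_0$ and $v_1,v_1'\in V_0\cup V_1$, trace backwards the path $H(v_0)$ ending at $v_0$ (move to the in-neighbour of the current vertex that is not yet visited, as long as there is exactly one), then in the same way $H(v_1)$ and $H(v_1')$ among the vertices still unvisited (a path is omitted if its end is already visited). If all $N$ vertices have been visited, label them $0,1,2,\dots,2n+2$ in the order of the visits, so that $2n+2,\dots,0$ is the restored Hamiltonian path $H(v_1')\,\|\,H(v_1)\,\|\,H(v_0)$. The choice is rejected unless each remaining edge is a path edge $(u,u-1)$ or ascends, with at most one ascending edge leaving each vertex. Let $F$ be the forest of the ascending edges, the head of an edge being the parent of its tail. Vertices $1,\dots,n$ are *small*, vertices $n+1,\dots,2n+1$ are *large*. (2) *Fixed vertex $f$.* If $2n+1$ is a leaf of $F$ and every small vertex is a child of $2n$, except at most two, which are isolated in $F$, then $f=2n+1$. Otherwise: (i) if some large $x\le 2n$ that is not a child of $2n+2$ has a sibling in $F$, then $f$ is the greatest of these siblings ($x$ included); else (ii) for each of at most two large vertices $x\le 2n$ that have children, all of them small, put $Y'=\{x-n,\dots,n\}$: if the set of proper descendants of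 $x$ in $F$ is $Y'$, or is contained in $Y'$ with its complement in $Y'$ being the vertex set of a tree of $F$, then $f=x$; else (iii) $f$ is the large vertex that is the rightmost vertex (last in preorder, children being ordered increasingly) of a tree of $F$. (3) *Ascending vertices.* If $f=2n+1$, let $A=\{n+1,\dots,2n\}$. Otherwise let $X_c$ be the set of large vertices other than $f$ and let $A_0$ be the set of children of $2n+2$ in $F$ that lie in $X_c$. If $F[X_c\cup\{2n+2\}]$ is connected, $A=A_0$. Otherwise let $I$ be the set of vertices of $X_c$ that are isolated in $F$. If $I=\emptyset$, $A=A_0\cup\{2n+1\}$. If $|I|\ge2$, $A=A_0\cup I$. If $I=\{x\}$: when $f$ does not have exactly $2n+1-f$ proper descendants in $F$, $A=A_0\cup\{x\}$; when it does, let $y_r$ be the rightmost vertex of the subtree of $f$; then $A=A_0\cup\{x,2n+1\}$ if $2n+2$ has fewer than $y_r$ children in $F$, and $A=A_0$ otherwise. (4) *Restoring the tree.* Form the sequence $P$: the elements of $A$ in ascending order, the large vertices not in $A\cup\{f\}$ in descending order, $1,2,\dots,f-n-1$, then $f$; and for each $y\in\{f-n,\dots,n\}$ put $y$ at position $P[y]$.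 The restored tree edges are obtained from $P$ as $q$ is obtained from $P_s$. The choice of ends in (1) is accepted if $f \ge n+2$, $\{n+1,\dots,f-1\}\subseteq A$, $2n+1\in A\cup\{f\}$, and the restored tree contains $F$; otherwise the next choice of ends is tried. (5) *Key.* Return $\sum_{x\in A,\ x\ne 2n+1}2^{2n-x}$, written in binary. **The machine.** Programs are built from assignments to finitely many registers and array cells, conditionals and bounded loops (the bound being evaluated on entry); expressions use literals, registers, array cells, successor and truncated subtraction; each instruction, each operation in an expression or test and each loop iteration costs one step or a fixed number of steps. The above algorithm is written out as one explicit program of this machine. **Theorem.** There is a constant $C$ such that the following holds. Let $\omega$ be a key whose binary representation has $n>2$ digits, let $R$ be a set of at most two edges of $G_\omega$, and let the program be run on any listing, in any order, of the edges of any digraph on $\{0,\dots,2n+2\}$ that is isomorphic to $G_\omega\setminus R$ (with the same number $2n+3$ of vertices). Then it returns the binary representation of $\omega$ after at most $C\,n$ steps. -/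

import Mathlib

namespace Watermark

/-! ### The codec: from a key to its watermark -/

/-- The binary representation `B` of the key, most significant digit first. -/
def bits (ω : ℕ) : List ℕ := (Nat.digits 2 ω).reverse

/-- The size `n` of the binary representation of the key. -/
def size (ω : ℕ) : ℕ := (bits ω).length

/-- The extended binary `B*`: `n` digits `1`, the one's complement of `B`, one digit `0`. -/
def extended (ω : ℕ) : List ℕ :=
  List.replicate (size ω) 1 ++ (bits ω).map (fun d => 1 - d) ++ [0]

/-- The ascending sequence of the indexes (starting at `1`) of the digit `d` in `B*`. -/
def indexes (ω d : ℕ) : List ℕ :=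
  (List.range' 1 (2 * size ω + 1)).filter (fun i => (extended ω)[i - 1]? = some d)

/-- The bitonic permutation `P_b = Z₀ || Z₁ᴿ`. -/
def bitonic (ω : ℕ) : List ℕ := indexes ω 0 ++ (indexes ω 1).reverse

/-- The element of `P_b` at the same distance from the end of `P_b` as `u` is from its start:
if `u = b_i` this is `b_{n* - i + 1}`, where `n* = 2n + 1`. -/
def partner (ω u : ℕ) : ℕ := (bitonic ω).getD (2 * size ω - (bitonic ω).idxOf u) 0

/-- The self-inverting permutation `P_s`, as the sequence of its elements. -/
def selfInverting (ω : ℕ) : List ℕ := (List.range' 1 (2 * size ω + 1)).map (partner ω)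

/-- The head `q(u)` of the tree edge that leaves `u`: among the elements to the left of `u` in
`P_s`, the rightmost one that exceeds `u` if there is one, and `2n + 2` otherwise. -/
def treeTarget (ω u : ℕ) : ℕ :=
  ((((selfInverting ω).take ((selfInverting ω).idxOf u)).reverse).find?
    (fun v => decide (u < v))).getD (2 * size ω + 2)

/-- The path edges `(u, u - 1)`, `u = 1, …, 2n + 2`. -/
def pathEdges (ω : ℕ) : Finset (ℕ × ℕ) :=
  (Finset.Icc 1 (2 * size ω + 2)).image (fun u => (u, u - 1))

/-- The tree edges `(u, q(u))`, `u = 1, …, 2n + 1`. -/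
def treeEdges (ω : ℕ) : Finset (ℕ × ℕ) :=
  (Finset.Icc 1 (2 * size ω + 1)).image (fun u => (u, treeTarget ω u))

/-- The edge set of the watermark of the key `ω`; its vertex set is `{0, …, 2n + 2}`. -/
def watermark (ω : ℕ) : Finset (ℕ × ℕ) := pathEdges ω ∪ treeEdges ω

/-- `L` is a listing, in some order and without repetitions, of the edges of an isomorphic copy of
the digraph with vertex set `{0, …, N - 1}` and edge set `E`: the vertices have been given
arbitrary new names in `{0, …, N - 1}`. -/
def IsListing (N : ℕ) (E : Finset (ℕ × ℕ)) (L : List (ℕ × ℕ)) : Prop :=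
  L.Nodup ∧ ∃ σ : ℕ → ℕ, Set.BijOn σ (Set.Iio N) (Set.Iio N) ∧
    L.toFinset = E.image (fun e => (σ e.1, σ e.2))

/-! ### The machine: a structured random access machine with unit-cost instructions

The memory has finitely many registers and finitely many arrays of natural numbers.  The only
arithmetic is the successor and truncated subtraction, so a number in memory never exceeds the
largest input or literal by more than the number of steps made so far. -/

/-- The registers. -/
inductive Reg
  | N | M | n | k | two | s | a | b | d | cur | cnt | go | c | e | w | x | i | j | h | u | v
  | good | done | t | f | tries | r | iso | loose | pos
  deriving DecidableEq

/-- The arrays. -/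
inductive Arr
  | src | dst | deg | ind | head | nxt | cand | mark | lab | par | cc | mc | rm | ro | de
  | asc | ps | q | key
  deriving DecidableEq

/-- A state of the memory. -/
structure Store where
  reg : Reg → ℕ
  arr : Arr → ℕ → ℕ

def Store.setReg (s : Store) (y : Reg) (m : ℕ) : Store :=
  { s with reg := Function.update s.reg y m }

def Store.setArr (s : Store) (z : Arr) (p m : ℕ) : Store :=
  { s with arr := Function.update s.arr z (Function.update (s.arr z) p m) }

/-- Expressions: literals, registers, array cells, successor, truncated subtraction. -/
inductive Expr
  | lit (m : ℕ)
  | reg (y : Reg)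
  | get (z : Arr) (p : Expr)
  | succ (p : Expr)
  | sub (p p' : Expr)

def Expr.eval (s : Store) : Expr → ℕ
  | lit m => m
  | reg y => s.reg y
  | get z p => s.arr z (p.eval s)
  | succ p => p.eval s + 1
  | sub p p' => p.eval s - p'.eval s

/-- The number of steps of an evaluation. -/
def Expr.cost : Expr → ℕ
  | lit _ => 1
  | reg _ => 1
  | get _ p => p.cost + 1
  | succ p => p.cost + 1
  | sub p p' => p.cost + p'.cost + 1

instance (m : ℕ) : OfNat Expr m := ⟨Expr.lit m⟩
instance : Coe Reg Expr := ⟨Expr.reg⟩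
instance : Sub Expr := ⟨Expr.sub⟩
instance : CoeFun Arr (fun _ => Expr → Expr) := ⟨Expr.get⟩

/-- Tests. -/
inductive Test
  | lt (p p' : Expr)
  | eq (p p' : Expr)
  | not (T : Test)
  | and (T T' : Test)

def Test.eval (s : Store) : Test → Bool
  | lt p p' => decide (p.eval s < p'.eval s)
  | eq p p' => decide (p.eval s = p'.eval s)
  | not T => !T.eval s
  | and T T' => T.eval s && T'.eval s

def Test.cost : Test → ℕ
  | lt p p' => p.cost + p'.cost + 1
  | eq p p' => p.cost + p'.cost + 1
  | not T => T.cost + 1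
  | and T T' => T.cost + T'.cost + 1

/-- Programs.  `forTo y p C` evaluates `p` once and then runs `C` with `y` set to
`0, 1, …, p - 1` in turn. -/
inductive Cmd
  | skip
  | assign (y : Reg) (p : Expr)
  | put (z : Arr) (p p' : Expr)
  | seq (C C' : Cmd)
  | ite (T : Test) (C C' : Cmd)
  | forTo (y : Reg) (p : Expr) (C : Cmd)

/-- `iter g m s` is `g (m - 1) (⋯ (g 1 (g 0 s)))`. -/
def iter (g : ℕ → Store → Store) : ℕ → Store → Store
  | 0, s => s
  | m + 1, s => g m (iter g m s)

/-- The memory after the run of a program. -/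
def Cmd.exec : Cmd → Store → Store
  | skip, s => s
  | assign y p, s => s.setReg y (p.eval s)
  | put z p p', s => s.setArr z (p.eval s) (p'.eval s)
  | seq C C', s => C'.exec (C.exec s)
  | ite T C C', s => if T.eval s then C.exec s else C'.exec s
  | forTo y p C, s => iter (fun m s' => C.exec (s'.setReg y m)) (p.eval s) s

/-- The number of steps of the run of a program. -/
def Cmd.time : Cmd → Store → ℕ
  | skip, _ => 1
  | assign _ p, _ => p.cost + 1
  | put _ p p', _ => p.cost + p'.cost + 1
  | seq C C', s => C.time s + C'.time (C.exec s)
  | ite T C C', s => T.cost + 1 + if T.eval s then C.time s else C'.time s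
  | forTo y p C, s => p.cost + 1 + ∑ m ∈ Finset.range (p.eval s),
      (1 + C.time ((iter (fun m' s' => C.exec (s'.setReg y m')) m s).setReg y m))

infixr:30 " ;; " => Cmd.seq
infix:40 " ::= " => Cmd.assign
infix:50 " ≐ " => Test.eq
infix:50 " ≺ " => Test.lt

def Cmd.ifThen (T : Test) (C : Cmd) : Cmd := Cmd.ite T C Cmd.skip

def Cmd.inc (y : Reg) : Cmd := y ::= Expr.succ y

/-- The initial memory: the number `N` of vertices, the number `M` of edges, and the list of the
edges as the two arrays `src` (tails) and `dst` (heads); everything else is `0`. -/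
def input (N : ℕ) (L : List (ℕ × ℕ)) : Store where
  reg y := if y = Reg.N then N else if y = Reg.M then L.length else 0
  arr z p := if z = Arr.src then (L.getD p (0, 0)).1
    else if z = Arr.dst then (L.getD p (0, 0)).2 else 0

/-! ### The decoding algorithm -/

section Program

open Reg Arr Cmd Test

/-- The numbers `n = (N - 3) / 2` and `k = 4n + 3 - M = 2N - 3 - M`. -/
def countEdges : Cmd :=
  two ::= N ;; forTo i N (inc two) ;;
  n ::= 0 ;; t ::= 0 ;;
  forTo i (N - 3) (ite (t ≐ 0) (t ::= 1) (t ::= 0 ;; inc n)) ;;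
  k ::= two - 3 - M

/-- Out-degrees `deg`, in-degrees `ind`, and the linked lists `head`, `nxt` of the edges into each
vertex; then the list `cand`, of length `s`, of the vertices of out-degree `0` or `1`
(the sets `V₀` and `V₁`). -/
def readGraph : Cmd :=
  forTo j M (
    put deg (src j) (Expr.succ (deg (src j))) ;;
    put ind (dst j) (Expr.succ (ind (dst j))) ;;
    put nxt j (head (dst j)) ;;
    put head (dst j) (Expr.succ j)) ;;
  s ::= 0 ;;
  forTo v N (ifThen (deg v ≺ 2) (put cand s v ;; inc s))

/-- The directed path `H(cur)` that ends at `cur`, traced backwards: as long as the current vertex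
has exactly one in-neighbour that is not marked yet, move there.  The vertices receive
consecutive labels `cnt, cnt + 1, …`. -/
def climb : Cmd :=
  ifThen (mark cur ≐ 0) (
    go ::= 1 ;;
    forTo i N (ifThen (go ≐ 1) (
      put lab cur cnt ;; put mark cur 1 ;; inc cnt ;;
      c ::= 0 ;; e ::= head cur ;;
      forTo j (ind cur) (
        w ::= src (e - 1) ;;
        ifThen (mark w ≐ 0) (inc c ;; x ::= w) ;;
        e ::= nxt (e - 1)) ;;
      ite (c ≐ 1) (cur ::= x) (go ::= 0))))

/-- Reconstruction of the Hamiltonian path, for one choice of the ends `v₀ = cand a` (of out-degree `0`),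
`v₁ = cand b` and `v₁' = cand d`: sew `H(v₁') || H(v₁) || H(v₀)`.  The Hamiltonian path is complete when
`cnt = N`; the labels along it are `N - 1, …, 0`. -/
def sewPaths : Cmd :=
  forTo v N (put mark v 0) ;;
  cnt ::= 0 ;;
  ifThen (deg (cand a) ≐ 0) (
    cur ::= cand a ;; climb ;;
    cur ::= cand b ;; climb ;;
    cur ::= cand d ;; climb)

/-- The damaged representative tree `F` in terms of the labels: `par u` is the parent of `u`, or
`0` when the tree edge that leaves `u` is missing.  Every edge that does not ascend has to be an
edge of the Hamiltonian path, and at most one edge ascends from each vertex.  Then, for each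
vertex, the number `cc` of its children, its greatest child `mc`, the rightmost vertex `rm` of
the subtree rooted at it, and the root `ro` of its tree. -/
def readForest : Cmd :=
  good ::= 1 ;;
  forTo v N (put par v 0 ;; put cc v 0 ;; put mc v 0) ;;
  forTo j M (
    u ::= lab (src j) ;; v ::= lab (dst j) ;;
    ite (u ≺ v)
      (ite (par u ≐ 0) (put par u v) (good ::= 0))
      (ifThen (Test.not (Expr.succ v ≐ u)) (good ::= 0))) ;;
  forTo i (N - 2) (
    u ::= Expr.succ i ;;
    ifThen (Test.not (par u ≐ 0)) (
      put cc (par u) (Expr.succ (cc (par u))) ;; put mc (par u) u)) ;;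
  forTo i (N - 1) (
    v ::= Expr.succ i ;;
    ite (cc v ≐ 0) (put rm v v) (put rm v (rm (mc v)))) ;;
  forTo i (N - 1) (
    v ::= N - 1 - i ;;
    ite (par v ≐ 0) (put ro v v) (put ro v (ro (par v))))

/-- Mark in `de` the proper descendants of `x` in `F`. -/
def markDescendants : Cmd :=
  forTo i (N - 1) (
    v ::= N - 1 - i ;;
    ite (par v ≐ 0) (put de v 0) (
      ite (par v ≐ x) (put de v 1) (put de v (de (par v)))))

/-- A vertex is small if it is at most `n`, and large if it lies in `{n + 1, …, 2n + 1}`.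
Set `t` to `1` if `f = 2n + 1`, that is, if `2n + 1` is a leaf of `F` and all small vertices
are children of `2n`, except at most two, which are isolated; otherwise set `t` to `0`. -/
def testLastFixed : Cmd :=
  t ::= 1 ;; c ::= 0 ;;
  ifThen (Test.not (cc (N - 2) ≐ 0)) (t ::= 0) ;;
  forTo i n (
    u ::= Expr.succ i ;;
    ifThen (Test.not (par u ≐ N - 3)) (
      ite (Test.and (par u ≐ 0) (cc u ≐ 0)) (inc c) (t ::= 0))) ;;
  ifThen (2 ≺ c) (t ::= 0)

/-- First rule for the fixed vertex: if a large vertex `x ≤ 2n` that is not a child of the root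
has a sibling, then `f` is the greatest of these siblings. -/
def findFixed1 : Cmd :=
  forTo i n (
    x ::= N - 3 - i ;;
    ifThen (Test.and (Test.not (par x ≐ 0)) (Test.not (par x ≐ N - 1))) (
      ifThen (1 ≺ cc (par x)) (f ::= mc (par x))))

/-- Second rule for the fixed vertex: for the (at most two) large vertices `x ≤ 2n`
that have children, all of them small, let `Y' = {x - n, …, n}`.  If the set of the proper descendants of `x` is `Y'`, or if
it is contained in `Y'` and its complement in `Y'` is the vertex set of a tree of `F`, then
`f = x`.  (Here `r` is the greatest element of the complement, or `0` if the complement is empty;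
no tree has the root `0`.) -/
def findFixed2 : Cmd :=
  tries ::= 0 ;;
  forTo h n (
    x ::= N - 3 - h ;;
    ifThen (Test.and (f ≐ 0) (tries ≺ 2)) (
      ifThen (Test.and (Test.not (cc x ≐ 0)) (Test.not (n ≺ mc x))) (
        inc tries ;;
        markDescendants ;;
        t ::= 1 ;; r ::= 0 ;;
        forTo i (N - 2) (
          v ::= Expr.succ i ;;
          ite (Test.and (Test.not (n ≺ v)) (Test.not (v ≺ x - n)))
            (ifThen (de v ≐ 0) (r ::= v))
            (ifThen (de v ≐ 1) (t ::= 0))) ;;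
        forTo i (N - 2) (
          v ::= Expr.succ i ;;
          ite (Test.and (Test.and (Test.not (n ≺ v)) (Test.not (v ≺ x - n))) (de v ≐ 0))
            (ifThen (Test.not (ro v ≐ r)) (t ::= 0))
            (ifThen (ro v ≐ r) (t ::= 0))) ;;
        ifThen (t ≐ 1) (f ::= x))))

/-- Third rule for the fixed vertex: `f` is the large vertex that is the rightmost
vertex of a tree of `F`. -/
def findFixed3 : Cmd :=
  forTo i (N - 1) (
    v ::= Expr.succ i ;;
    ifThen (Test.and (par v ≐ 0) (Test.and (n ≺ rm v) (rm v ≺ N - 1))) (f ::= rm v))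

/-- The fixed vertex `f`: the test for `f = 2n + 1`, and then the three rules in turn. -/
def findFixed : Cmd :=
  testLastFixed ;;
  ite (t ≐ 1) (f ::= N - 2) (
    f ::= 0 ;; findFixed1 ;;
    ifThen (f ≐ 0) findFixed2 ;;
    ifThen (f ≐ 0) findFixed3)

/-- The set `A` of the ascending vertices, as the characteristic array `asc`.  If
`f = 2n + 1` then `A = {n + 1, …, 2n}`.  Otherwise let `X_c` be the set of the large vertices
other than `f`, let `loose` be the number of the vertices of `X_c` whose parent in `F` is missing
or outside `X_c ∪ {2n + 2}` (it is `0` exactly when `F[X_c ∪ {2n + 2}]` is connected), and let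
`iso` be the number of the vertices of `X_c` that are isolated in `F`. -/
def findAscending : Cmd :=
  ite (f ≐ N - 2)
    (forTo i (Expr.succ n) (
      x ::= N - 2 - i ;;
      ite (x ≐ f) (put asc x 0) (put asc x 1)))
    (loose ::= 0 ;; iso ::= 0 ;;
     forTo i (Expr.succ n) (
      x ::= N - 2 - i ;;
      put asc x 0 ;;
      ifThen (Test.not (x ≐ f)) (
        ifThen (par x ≐ N - 1) (put asc x 1) ;;
        ifThen (par x ≐ f) (inc loose) ;;
        ifThen (par x ≐ 0) (
          inc loose ;;
          ifThen (cc x ≐ 0) (inc iso)))) ;;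
     ifThen (Test.not (loose ≐ 0)) (
      ite (iso ≐ 0) (put asc (N - 2) 1) (
        x ::= f ;; markDescendants ;;
        c ::= 0 ;; forTo i (N - 2) (ifThen (de (Expr.succ i) ≐ 1) (inc c)) ;;
        t ::= 1 ;;
        ifThen (Test.and (iso ≐ 1) (c ≐ N - 2 - f)) (
          ite (cc (N - 1) ≺ rm f) (put asc (N - 2) 1) (t ::= 0)) ;;
        ifThen (t ≐ 1) (
          forTo i (Expr.succ n) (
            x ::= N - 2 - i ;;
            ifThen (Test.not (x ≐ f)) (
              ifThen (Test.and (par x ≐ 0) (cc x ≐ 0)) (put asc x 1)))))))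

/-- Append `p` to the sequence `ps`, whose indexes start at `1`. -/
def append (p : Expr) : Cmd := inc pos ;; put ps pos p

/-- The root-free preorder traversal `ps` of the representative tree, namely `A` in
ascending order, `D = X_c \ A` in descending order, then `1, …, f - n - 1`, then `f`; and each
small `y ≥ f - n` at the position given by the element that has index `y`. -/
def findPreorder : Cmd :=
  pos ::= 0 ;;
  forTo i (Expr.succ n) (
    x ::= N - 2 - (n - i) ;; ifThen (asc x ≐ 1) (append x)) ;;
  forTo i (Expr.succ n) (
    x ::= N - 2 - i ;;
    ifThen (Test.and (asc x ≐ 0) (Test.not (x ≐ f))) (append x)) ;;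
  forTo i (f - n - 1) (append (Expr.succ i)) ;;
  append f ;;
  forTo i (N - 2 - f) (
    u ::= n - i ;;
    put ps (ps u) u)

/-- The tree edges of the restored watermark: `q u` is the rightmost element that exceeds `u` to
the left of `u` in `ps`, or `2n + 2`. -/
def restoreTree : Cmd :=
  pos ::= 1 ;; c ::= N - 1 ;;
  forTo i two (
    ifThen (pos ≺ N - 1) (
      u ::= ps pos ;;
      ite (u ≺ c) (put q u c ;; c ::= u ;; inc pos) (c ::= q c)))

/-- Keep `good = 1` only if `A` contains `n + 1, …, f - 1` and, unless it is `f`, also `2n + 1`,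
and if the restored tree contains `F`. -/
def checkRestored : Cmd :=
  ifThen (Test.not (Expr.succ n ≺ f)) (good ::= 0) ;;
  ifThen (Test.not (f ≐ N - 2)) (ifThen (asc (N - 2) ≐ 0) (good ::= 0)) ;;
  forTo i n (
    x ::= N - 3 - i ;;
    ifThen (Test.and (x ≺ f) (asc x ≐ 0)) (good ::= 0)) ;;
  forTo i (N - 2) (
    u ::= Expr.succ i ;;
    ifThen (Test.not (par u ≐ 0)) (ifThen (Test.not (par u ≐ q u)) (good ::= 0)))

/-- The key `ω = ∑ 2 ^ (2n - x)`, the sum over the `x ∈ A` with `x ≠ 2n + 1`: `key p` is the digit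
of `2 ^ p` in the binary representation of `ω`. -/
def writeKey : Cmd :=
  forTo i n (put key i (asc (N - 3 - i)))

/-- The decoding algorithm.  If more than two edges are missing then `k` is left as the report;
otherwise the watermark is restored and its key is written.  The choices of the ends in `sewPaths`
are tried in turn until one of them leads to a restored watermark that contains the input. -/
def decode : Cmd :=
  countEdges ;;
  ite (2 ≺ k) skip (
    readGraph ;;
    done ::= 0 ;;
    forTo a s (forTo b s (forTo d s (
      ifThen (done ≐ 0) (
        sewPaths ;;
        ifThen (cnt ≐ N) (
          readForest ;; findFixed ;; findAscending ;; findPreorder ;;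
          restoreTree ;; checkRestored ;;
          ifThen (good ≐ 1) (done ::= 1 ;; writeKey)))))))

end Program

end Watermark

/-! Three facts together give the theorem: the tree can be recovered from a damaged copy once the
Hamiltonian path is known; no wrong labelling can pass for the right one; and the right labelling is
among the boundedly many that are tried.

Structure. The permutation `P_s`, and with it the tree, is determined by the fixed element `f` and
the set `A` of ascending large elements (`Layout.unique`, `IsTarget.unique`). For `f ≤ 2n` the tree
looks as follows (`Layout.shape`). The ascending vertices are children of the root. The other large
vertices form a chain from `f` up to `2n + 1`. The vertices `1, …, f - n - 1` are siblings of `f`.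
The vertices `f - n, …, n` are the proper descendants of `f`; those from `a = |A|` on form the chain
`a, a + 1, …, n, f`. For `f = 2n + 1` the large vertices are all children of the root and the small
ones are children of `2n`.

Recovery. This structure is so redundant that two missing edges cannot hide `f` or `A`. Each rule of
the decoder fails only if particular edges are missing, and a third missing edge is then excluded by
counting (`Forest.not_test_last`, `Forest.rule_one`, `Forest.rule_two_pass`, `Forest.rule_three` for
`f`; `Forest.asc_of_connected`, `Forest.asc_of_no_isolated`, `Forest.asc_of_one_isolated`,
`Forest.asc_of_missing` for `A`).

Rigidity. A bijection between the vertices of two watermarks of the same size that loses at most two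
edges in either direction is the identity (`Near.eq_id`). The decoder accepts a labelling only if
the given edges then lie in some watermark of the right size (`restore_sound`). As at least `4n + 1`
of the `4n + 3` edges are given, that labelling is the true one (`Copy.label_eq`), and the key that
is written is `ω` (`restore_complete`). Rejected trials write nothing.

Search. A missing path edge leaves its tail with out-degree at most `1`, so the pieces of the path
end at candidates and the true labelling does arise (`exists_choice`). At most four vertices are
candidates (`Copy.ends_le`), hence there are at most `64` trials. Each trial is linear: nearly all
loops are simple, tracing a path costs the in-degrees of the vertices it visits, and the second rule
for `f` makes at most two expensive attempts. -/

namespace Watermark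

/-! ### The combinatorial structure of a watermark -/

/-- `P` is the self-inverting permutation whose fixed element is `f` and whose ascending elements
are the large elements satisfying `A`. -/
structure Layout (n f : ℕ) (A : ℕ → Prop) (P : ℕ → ℕ) : Prop where
  three_le : 3 ≤ n
  le_fixed : n + 2 ≤ f
  fixed_le : f ≤ 2 * n + 1
  asc_of_lt : ∀ x, n < x → x < f → A x
  not_asc_fixed : ¬ A f
  asc_last : f ≤ 2 * n → A (2 * n + 1)
  pos : ∀ x, 1 ≤ x → x ≤ 2 * n + 1 → 1 ≤ P x
  le : ∀ x, 1 ≤ x → x ≤ 2 * n + 1 → P x ≤ 2 * n + 1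
  invol : ∀ x, 1 ≤ x → x ≤ 2 * n + 1 → P (P x) = x
  fix : P f = f
  large : ∀ x, n < x → x ≤ 2 * n + 1 → x ≠ f → P x ≤ n
  small : ∀ x, 1 ≤ x → x ≤ n → n < P x
  asc_desc : ∀ x y, n < x → x ≤ 2 * n + 1 → n < y → y ≤ 2 * n + 1 → y ≠ f → A x → ¬ A y → P x < P y
  asc_mono : ∀ x y, n < x → x < y → y ≤ 2 * n + 1 → A x → A y → P x < P y
  desc_anti : ∀ x y, n < x → x < y → y ≤ 2 * n + 1 → x ≠ f → y ≠ f → ¬ A x → ¬ A y → P y < P x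

/-- `q u` is the rightmost element of `P` to the left of `u` that exceeds `u`, or `2n + 2`. -/
def IsTarget (n : ℕ) (P q : ℕ → ℕ) : Prop :=
  ∀ u, 1 ≤ u → u ≤ 2 * n + 1 →
    (q u = 2 * n + 2 ∧ ∀ w, u < w → w ≤ 2 * n + 1 → ¬ P w < P u) ∨
    (u < q u ∧ q u ≤ 2 * n + 1 ∧ P (q u) < P u ∧
      ∀ w, u < w → w ≤ 2 * n + 1 → P w < P u → P w ≤ P (q u))

/-- The description of the representative tree by the heads of its edges; `a` is the number of
ascending vertices. -/
structure Shape (n f a : ℕ) (A : ℕ → Prop) (q : ℕ → ℕ) : Prop where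
  three_le : 3 ≤ n
  le_fixed : n + 2 ≤ f
  fixed_le : f ≤ 2 * n + 1
  asc_of_lt : ∀ x, n < x → x < f → A x
  not_asc_fixed : ¬ A f
  asc_last : f ≤ 2 * n → A (2 * n + 1)
  lt : ∀ u, 1 ≤ u → u ≤ 2 * n + 1 → u < q u
  le : ∀ u, 1 ≤ u → u ≤ 2 * n + 1 → q u ≤ 2 * n + 2
  asc : ∀ x, n < x → x ≤ 2 * n + 1 → A x → q x = 2 * n + 2
  last : f = 2 * n + 1 → (∀ i, 1 ≤ i → i ≤ n → q i = 2 * n) ∧ q f = 2 * n + 2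
  desc : ∀ x, f ≤ x → x ≤ 2 * n → ¬ A x →
    q x ≤ 2 * n + 1 ∧ (q x ≤ 2 * n → ¬ A (q x)) ∧ ∀ y, x < y → y < q x → A y
  first : f ≤ 2 * n → ∀ i, 1 ≤ i → i + n < f → q i = q f
  le_count : f ≤ 2 * n → f ≤ n + a
  count_le : f ≤ 2 * n → a ≤ n
  top : f ≤ 2 * n → q n = f
  chain : f ≤ 2 * n → ∀ y, a < y → y < n → q y = y + 1
  hang : f ≤ 2 * n → ∀ y, f ≤ y + n → y ≤ a → q y = f ∨ (a < q y ∧ q y ≤ n)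
  count : f ≤ 2 * n → a < n → q a = a + 1
  card : f ≤ 2 * n → {x | n < x ∧ x ≤ 2 * n + 1 ∧ A x}.ncard = a

/-! ### A self-inverting permutation is determined by its fixed and its ascending elements. -/

namespace Layout

variable {n f : ℕ} {A : ℕ → Prop} {P q : ℕ → ℕ}

theorem inj (h : Layout n f A P) {x y : ℕ} (hx : 1 ≤ x) (hx' : x ≤ 2 * n + 1) (hy : 1 ≤ y)
    (hy' : y ≤ 2 * n + 1) (e : P x = P y) : x = y := by
  rw [← h.invol x hx hx', e, h.invol y hy hy']

theorem ne_fixed (h : Layout n f A P) {i : ℕ} (hi : 1 ≤ i) (hi' : i ≤ n) : P i ≠ f := by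
  intro e
  have h1 := h.invol i hi (by omega)
  rw [e, h.fix] at h1
  have := h.le_fixed
  omega

/-- All large elements below `f` are ascending, so they open the sequence in their natural order. If
`n + j` came after position `j`, the element at position `j` would precede it, hence be ascending
and smaller, and by induction it would already occupy an earlier position. -/
theorem initial (h : Layout n f A P) : ∀ j, 1 ≤ j → j + n < f → P (n + j) = j := by
  intro j
  induction j using Nat.strong_induction_on with
  | _ j ih =>
    intro hj hjf
    have hf := h.fixed_le
    by_contra hne
    have hpj : P (n + j) ≤ n := h.large _ (by omega) (by omega) (by omega)
    have hp1 := h.pos (n + j) (by omega) (by omega)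
    have hgt : j < P (n + j) := by
      by_contra hle
      have hlt : P (n + j) < j := by omega
      have h2 := ih _ hlt hp1 (by omega)
      have := h.inj (by omega) (by omega) (by omega) (by omega) h2
      omega
    have hx1 := h.small j hj (by omega)
    have hx2 := h.le j hj (by omega)
    have hx3 : P j ≠ f := h.ne_fixed hj (by omega)
    have hx4 : P (P j) = j := h.invol j hj (by omega)
    have hAj : A (n + j) := h.asc_of_lt _ (by omega) (by omega)
    by_cases hA : A (P j)
    · rcases lt_trichotomy (P j) (n + j) with hlt | heq | hlt
      · obtain ⟨i, hi⟩ : ∃ i, P j = n + i := ⟨P j - n, by omega⟩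
        have := ih i (by omega) (by omega) (by omega)
        rw [← hi, hx4] at this
        omega
      · rw [heq] at hx4; omega
      · have := h.asc_mono _ _ (by omega) hlt hx2 hAj hA
        omega
    · have := h.asc_desc (n + j) (P j) (by omega) (by omega) hx1 hx2 hx3 hAj hA
      omega

theorem initial' (h : Layout n f A P) (j : ℕ) (hj : 1 ≤ j) (hjf : j + n < f) : P j = n + j := by
  have := h.invol (n + j) (by omega) (by have := h.fixed_le; omega)
  rwa [h.initial j hj hjf] at this

/-- The order of the elements at the first `n` positions. -/
theorem lt_iff_of_lt (h : Layout n f A P) {P' : ℕ → ℕ} (h' : Layout n f A P') {x y : ℕ}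
    (hx : n < x) (hx' : x ≤ 2 * n + 1) (hxf : x ≠ f)
    (hy : n < y) (hy' : y ≤ 2 * n + 1) (hyf : y ≠ f) (hlt : P x < P y) : P' x < P' y := by
  rcases lt_trichotomy x y with hxy | hxy | hxy
  · by_cases hAx : A x <;> by_cases hAy : A y
    · exact h'.asc_mono _ _ hx hxy hy' hAx hAy
    · exact h'.asc_desc _ _ hx hx' hy hy' hyf hAx hAy
    · have := h.asc_desc _ _ hy hy' hx hx' hxf hAy hAx
      omega
    · have := h.desc_anti _ _ hx hxy hy' hxf hyf hAx hAy
      omega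
  · subst hxy; omega
  · by_cases hAx : A x <;> by_cases hAy : A y
    · have := h.asc_mono _ _ hy hxy hx' hAy hAx
      omega
    · exact h'.asc_desc _ _ hx hx' hy hy' hyf hAx hAy
    · have := h.asc_desc _ _ hy hy' hx hx' hxf hAy hAx
      omega
    · exact h'.desc_anti _ _ hy hxy hx' hyf hxf hAy hAx

/-- At the first position where the two sequences differ, the entry of each occurs later in the
other, against the common order of `lt_iff_of_lt`. -/
theorem unique_small (h : Layout n f A P) {P' : ℕ → ℕ} (h' : Layout n f A P') :
    ∀ i, 1 ≤ i → i ≤ n → P i = P' i := by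
  intro i
  induction i using Nat.strong_induction_on with
  | _ i ih =>
    intro hi hin
    by_contra hne
    have a1 := h.small i hi hin
    have a2 := h.le i hi (by omega)
    have a3 := h.ne_fixed hi hin
    have a4 := h.invol i hi (by omega)
    have b1 := h'.small i hi hin
    have b2 := h'.le i hi (by omega)
    have b3 := h'.ne_fixed hi hin
    have b4 := h'.invol i hi (by omega)
    have c1 := h'.large (P i) a1 a2 a3
    have c2 := h'.pos (P i) (by omega) a2
    have d1 := h.large (P' i) b1 b2 b3
    have d2 := h.pos (P' i) (by omega) b2
    have e1 : i < P' (P i) := by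
      rcases lt_trichotomy (P' (P i)) i with hlt | heq | hlt
      · have := ih _ hlt c2 c1
        rw [h'.invol (P i) (by omega) a2] at this
        rw [← this] at a4
        have := h.invol (P' (P i)) c2 (by omega)
        omega
      · have := h'.invol (P i) (by omega) a2
        rw [heq] at this; omega
      · exact hlt
    have e2 : i < P (P' i) := by
      rcases lt_trichotomy (P (P' i)) i with hlt | heq | hlt
      · have := ih _ hlt d2 d1
        rw [h.invol (P' i) (by omega) b2] at this
        rw [this] at b4
        have := h'.invol (P (P' i)) d2 (by omega)
        omega
      · have := h.invol (P' i) (by omega) b2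
        rw [heq] at this; omega
      · exact hlt
    have := h.lt_iff_of_lt h' a1 a2 a3 b1 b2 b3 (by omega)
    omega

/-- A layout is determined by its fixed element and its ascending elements. -/
theorem unique (h : Layout n f A P) {P' : ℕ → ℕ} (h' : Layout n f A P') (x : ℕ) (hx : 1 ≤ x)
    (hx' : x ≤ 2 * n + 1) : P x = P' x := by
  by_cases hxn : x ≤ n
  · exact h.unique_small h' x hx hxn
  · by_cases hxf : x = f
    · rw [hxf, h.fix, h'.fix]
    · have a1 := h.large x (by omega) hx' hxf
      have a2 := h.pos x hx hx'
      have := h.unique_small h' (P x) a2 a1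
      rw [h.invol x hx hx'] at this
      have a3 := h'.invol (P x) a2 (by omega)
      rw [← this] at a3
      exact a3.symm

end Layout

theorem IsTarget.unique {n f : ℕ} {A : ℕ → Prop} {P P' q q' : ℕ → ℕ} (h : Layout n f A P)
    (hP : ∀ x, 1 ≤ x → x ≤ 2 * n + 1 → P x = P' x) (t : IsTarget n P q) (t' : IsTarget n P' q')
    (u : ℕ) (hu : 1 ≤ u) (hu' : u ≤ 2 * n + 1) : q u = q' u := by
  rcases t u hu hu' with ⟨a1, a2⟩ | ⟨a1, a2, a3, a4⟩ <;>
    rcases t' u hu hu' with ⟨b1, b2⟩ | ⟨b1, b2, b3, b4⟩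
  · rw [a1, b1]
  · rw [← hP _ (by omega) b2, ← hP u hu hu'] at b3
    exact absurd b3 (a2 _ b1 b2)
  · rw [hP _ (by omega) a2, hP u hu hu'] at a3
    exact absurd a3 (b2 _ a1 a2)
  · rw [← hP _ (by omega) b2, ← hP u hu hu'] at b3
    have c1 := a4 _ b1 b2 b3
    rw [hP _ (by omega) a2, hP u hu hu'] at a3
    have c2 := b4 _ a1 a2 a3
    rw [← hP _ (by omega) b2, ← hP _ (by omega) a2] at c2
    exact h.inj (by omega) a2 (by omega) b2 (by omega)

/-- `P` gives the positions of the elements, so a candidate whose position is maximal is the head,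
by injectivity of `P`. -/
theorem IsTarget.eq_of {n f : ℕ} {A : ℕ → Prop} {P q : ℕ → ℕ} (h : Layout n f A P)
    (t : IsTarget n P q) {u v : ℕ} (hu : 1 ≤ u) (hu' : u ≤ 2 * n + 1) (h1 : u < v)
    (h2 : v ≤ 2 * n + 1) (h3 : P v < P u)
    (h4 : ∀ w, u < w → w ≤ 2 * n + 1 → P w < P u → P w ≤ P v) : q u = v := by
  rcases t u hu hu' with ⟨a1, a2⟩ | ⟨a1, a2, a3, a4⟩
  · exact absurd h3 (a2 _ h1 h2)
  · have c1 := a4 _ h1 h2 h3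
    have c2 := h4 _ a1 a2 a3
    exact h.inj (by omega) a2 (by omega) h2 (by omega)

/-! ### The heads of the tree edges, for each kind of element. -/

namespace Layout

variable {n f : ℕ} {A : ℕ → Prop} {P q : ℕ → ℕ}

/-- In front of an ascending element there are only smaller ascending ones; the fixed element is no
candidate because its position `f` exceeds `n`. -/
theorem target_asc (h : Layout n f A P) (t : IsTarget n P q) (x : ℕ) (hx : n < x)
    (hx' : x ≤ 2 * n + 1) (hA : A x) : q x = 2 * n + 2 := by
  have hxf : x ≠ f := fun e => h.not_asc_fixed (e ▸ hA)
  rcases t x (by omega) hx' with ⟨a1, a2⟩ | ⟨a1, a2, a3, a4⟩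
  · exact a1
  · have hxn := h.large x hx hx' hxf
    by_cases hA' : A (q x)
    · have := h.asc_mono _ _ hx a1 a2 hA hA'
      omega
    · by_cases hqf : q x = f
      · have := h.le_fixed
        rw [hqf, h.fix] at a3
        omega
      · have := h.asc_desc _ _ hx hx' (by omega) a2 hqf hA hA'
        omega

/-- To the left of `x` come the larger non-ascending elements, the smallest of them nearest, and
before them `2n + 1`, which ends the ascending elements. So the head is the next non-ascending
element above `x`, or `2n + 1` if there is none; these edges form a chain from `f` to `2n + 1`. -/
theorem target_desc (h : Layout n f A P) (t : IsTarget n P q) (x : ℕ) (hx : f ≤ x)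
    (hx' : x ≤ 2 * n) (hA : ¬ A x) :
    q x ≤ 2 * n + 1 ∧ (q x ≤ 2 * n → ¬ A (q x)) ∧ ∀ y, x < y → y < q x → A y := by
  have hf := h.le_fixed
  have hL := h.asc_last (by omega)
  have hlt : P (2 * n + 1) < P x := by
    by_cases hxf : x = f
    · have := h.large (2 * n + 1) (by omega) (by omega) (by omega)
      rw [hxf, h.fix]
      omega
    · exact h.asc_desc _ _ (by omega) (by omega) (by omega) (by omega) hxf hL hA
  have key : ∀ y, x < y → y ≤ 2 * n → ¬ A y → P y < P x := by
    intro y hy hy' hAy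
    by_cases hxf : x = f
    · have := h.large y (by omega) (by omega) (by omega)
      rw [hxf, h.fix]
      omega
    · exact h.desc_anti _ _ (by omega) hy (by omega) hxf (by omega) hA hAy
  rcases t x (by omega) (by omega) with ⟨a1, a2⟩ | ⟨a1, a2, a3, a4⟩
  · exact absurd hlt (a2 _ (by omega) (by omega))
  · refine ⟨a2, fun hq hAq => ?_, fun y hy hy' => ?_⟩
    · have := h.asc_mono (q x) (2 * n + 1) (by omega) (by omega) (by omega) hAq hL
      have := a4 _ (by omega) (by omega) hlt
      omega
    · by_contra hAy
      have c1 := a4 _ hy (by omega) (key y hy (by omega) hAy)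
      by_cases hAq : A (q x)
      · have := h.asc_desc (q x) y (by omega) a2 (by omega) (by omega) (by omega) hAq hAy
        omega
      · have := h.desc_anti y (q x) (by omega) hy' a2 (by omega) (by omega) hAy hAq
        omega

/-- Between the first `n` positions and the position of `f` there are only `1, …, f - n - 1`, in
ascending order. Neither `i` nor `f` meets anything larger there, so both have their head among the
first `n` entries, and it is the same one. -/
theorem target_first (h : Layout n f A P) (t : IsTarget n P q) (hf : f ≤ 2 * n) (i : ℕ)
    (hi : 1 ≤ i) (hi' : i + n < f) : q i = q f := by
  have hf' := h.le_fixed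
  have hPi := h.initial' i hi hi'
  have d := h.target_desc t f le_rfl hf h.not_asc_fixed
  have df : f < q f := by
    rcases t f (by omega) (by omega) with ⟨a1, a2⟩ | ⟨a1, a2, a3, a4⟩
    · omega
    · exact a1
  have hq := h.large (q f) (by omega) d.1 (by omega)
  refine t.eq_of h hi (by omega) (by omega) d.1 (by omega) ?_
  intro w hw hw' hlt
  by_cases hwf : f < w
  · rcases t f (by omega) (by omega) with ⟨a1, a2⟩ | ⟨a1, a2, a3, a4⟩
    · omega
    · refine a4 w hwf hw' ?_
      rw [h.fix]
      have := h.large w (by omega) hw' (by omega)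
      omega
  · by_cases hwf' : w = f
    · rw [hwf', h.fix] at hlt
      omega
    · by_cases hwn : n < w
      · have hAw := h.asc_of_lt w hwn (by omega)
        by_cases hAq : A (q f)
        · exact (h.asc_mono _ _ hwn (by omega) d.1 hAw hAq).le
        · exact (h.asc_desc _ _ hwn hw' (by omega) d.1 (by omega) hAw hAq).le
      · have h1 := h.small w (by omega) (by omega)
        have h2 := h.initial (P w - n) (by omega) (by omega)
        rw [show n + (P w - n) = P w by omega, h.invol w (by omega) hw'] at h2
        omega

/-- For `i` at most the number `P (2n + 1)` of ascending elements, position `i` is ascending. -/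
theorem asc_iff (h : Layout n f A P) (hf : f ≤ 2 * n) (i : ℕ) (hi : 1 ≤ i) (hin : i ≤ n) :
    A (P i) ↔ i ≤ P (2 * n + 1) := by
  have hL := h.asc_last hf
  have h1 := h.small i hi hin
  have h2 := h.le i hi (by omega)
  have h3 := h.ne_fixed hi hin
  have h4 := h.invol i hi (by omega)
  constructor
  · intro hA
    rcases h2.eq_or_lt with he | hl
    · rw [he] at h4; omega
    · have := h.asc_mono _ _ h1 hl le_rfl hA hL
      omega
  · intro hle
    by_contra hA
    have := h.asc_desc _ _ (by omega) le_rfl h1 h2 h3 hL hA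
    omega

/-- `2n + 1` is the last of the ascending elements, so its position counts them, and `P` itself is
the bijection. -/
theorem ncard_asc (h : Layout n f A P) (hf : f ≤ 2 * n) :
    {x | n < x ∧ x ≤ 2 * n + 1 ∧ A x}.ncard = P (2 * n + 1) := by
  have hf' := h.le_fixed
  have hcn := h.large (2 * n + 1) (by omega) le_rfl (by omega)
  have e : {x | n < x ∧ x ≤ 2 * n + 1 ∧ A x} = P '' (Finset.Icc 1 (P (2 * n + 1)) : Finset ℕ) := by
    ext x
    simp only [Set.mem_ofPred_eq, Finset.coe_Icc, Set.mem_image, Set.mem_Icc]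
    constructor
    · rintro ⟨h1, h2, h3⟩
      have h4 : x ≠ f := fun e => h.not_asc_fixed (e ▸ h3)
      have h5 := h.large x h1 h2 h4
      have h6 := h.pos x (by omega) h2
      have h7 := h.invol x (by omega) h2
      exact ⟨P x, ⟨h6, (h.asc_iff hf _ h6 h5).1 (h7.symm ▸ h3)⟩, h7⟩
    · rintro ⟨i, ⟨h1, h2⟩, rfl⟩
      exact ⟨h.small i h1 (by omega), h.le i h1 (by omega), (h.asc_iff hf i h1 (by omega)).2 h2⟩
  rw [e, Set.InjOn.ncard_image, Set.ncard_coe_finset, Nat.card_Icc]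
  · omega
  · intro x hx y hy hxy
    simp only [Finset.coe_Icc, Set.mem_Icc] at hx hy
    exact h.inj hx.1 (by omega) hy.1 (by omega) hxy

theorem le_small (h : Layout n f A P) (y : ℕ) (hy : f ≤ y + n) (hyn : y ≤ n) :
    f < P y := by
  have hf' := h.le_fixed
  have h1 := h.small y (by omega) hyn
  have h2 := h.le y (by omega) (by omega)
  have h3 := h.ne_fixed (i := y) (by omega) hyn
  by_contra hle
  have h4 := h.initial (P y - n) (by omega) (by omega)
  rw [show n + (P y - n) = P y by omega, h.invol y (by omega) (by omega)] at h4
  omega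

/-- Already `n + 1, …, f - 1` and `2n + 1` are `f - n` ascending elements. -/
theorem fixed_le_count (h : Layout n f A P) (hf : f ≤ 2 * n) : f ≤ n + P (2 * n + 1) := by
  have hf' := h.le_fixed
  have h1 := h.large (2 * n + 1) (by omega) le_rfl (by omega)
  have h2 := h.initial (f - 1 - n) (by omega) (by omega)
  have h3 := h.asc_of_lt (n + (f - 1 - n)) (by omega) (by omega)
  have := h.asc_mono _ _ (by omega) (by omega) le_rfl h3 (h.asc_last hf)
  omega

/-- A bound for the candidates for the head of the edge that leaves a small element. -/
theorem small_cases (h : Layout n f A P) {y w : ℕ} (hy : f ≤ y + n)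
    (hw : y < w) (hw' : w ≤ 2 * n + 1) :
    P w ≤ f ∨ (w ≤ n ∧ f < P w ∧ P w ≤ 2 * n + 1) := by
  by_cases hwn : w ≤ n
  · exact Or.inr ⟨hwn, h.le_small w (by omega) hwn, h.le w (by omega) hw'⟩
  · left
    by_cases hwf : w = f
    · rw [hwf, h.fix]
    · have := h.large w (by omega) hw' hwf
      have := h.le_fixed
      omega

/-- `f` stands to the left of `y` and exceeds it, and only small elements stand further right than
`f`; hence only these could come between. -/
theorem target_small_eq_fixed (h : Layout n f A P) (t : IsTarget n P q) (hf : f ≤ 2 * n) {y : ℕ}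
    (hy : f ≤ y + n) (hyn : y ≤ n)
    (hno : ∀ w, y < w → w ≤ n → ¬ P w < P y) : q y = f := by
  have hf' := h.le_fixed
  have h1 := h.le_small y hy hyn
  refine t.eq_of h (by omega) (by omega) (by omega) (by omega) (by rw [h.fix]; omega) ?_
  intro w hw hw' hlt
  rw [h.fix]
  rcases h.small_cases hy hw hw' with h2 | ⟨h2, -, -⟩
  · exact h2
  · exact absurd hlt (hno w hw h2)

/-- From position `P (2n + 1)` on, the entries of the first half decrease, beginning with `2n + 1`.
By the involution, the small elements from there on appear in reverse order, so that `y + 1` is the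
nearest small element above `y` on its left. -/
theorem target_chain (h : Layout n f A P) (t : IsTarget n P q) (hf : f ≤ 2 * n) (y : ℕ)
    (hy : P (2 * n + 1) ≤ y) (hyn : y < n) : q y = y + 1 := by
  have hf' := h.le_fixed
  have hc := h.fixed_le_count hf
  have hfy : f ≤ y + n := by omega
  have a1 := h.le_small (y + 1) (by omega) (by omega)
  have a2 := h.le (y + 1) (by omega) (by omega)
  have a3 := h.invol (y + 1) (by omega) (by omega)
  have a4 : ¬ A (P (y + 1)) := by
    rw [h.asc_iff hf _ (by omega) (by omega)]; omega
  have b1 := h.le_small y (by omega) (by omega)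
  have b2 := h.le y (by omega) (by omega)
  have b3 := h.invol y (by omega) (by omega)
  have c : ∀ w, y + 1 ≤ w → w ≤ n → P w < P y → P w ≤ P (y + 1) := by
    intro w hw hwn hlt
    rcases hw.eq_or_lt with e | hw
    · rw [e]
    have a1' := h.le_small w (by omega) (by omega)
    have a2' := h.le w (by omega) (by omega)
    have a3' := h.invol w (by omega) (by omega)
    have a4' : ¬ A (P w) := by
      rw [h.asc_iff hf _ (by omega) (by omega)]; omega
    by_contra hgt
    have := h.desc_anti _ _ (by omega) (lt_of_not_ge hgt) a2' (by omega) (by omega) a4 a4'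
    omega
  have hlt : P (y + 1) < P y := by
    by_cases hA : A (P y)
    · have := (h.asc_iff hf y (by omega) (by omega)).1 hA
      have e : y = P (2 * n + 1) := by omega
      have e' : P y = 2 * n + 1 := by rw [e, h.invol _ (by omega) le_rfl]
      rcases a2.eq_or_lt with e2 | hl
      · have := h.inj (by omega) (by omega) (by omega) (by omega) (e2.trans e'.symm)
        omega
      · omega
    · by_contra hge
      rcases (not_lt.1 hge).eq_or_lt with e2 | hl
      · have := h.inj (by omega) (by omega) (by omega) (by omega) e2
        omega
      · have := h.desc_anti _ _ (by omega) hl a2 (by omega) (by omega) hA a4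
        omega
  refine t.eq_of h (by omega) (by omega) (by omega) (by omega) hlt ?_
  intro w hw hw' hlt'
  rcases h.small_cases hfy hw hw' with h2 | ⟨h2, -, -⟩
  · omega
  · exact c w (by omega) h2 hlt'

/-- On the ascending positions the entries increase, so the elements above `y` up to `P (2n + 1)`
stand to the right of `y` and cannot be its head. -/
theorem target_hang (h : Layout n f A P) (t : IsTarget n P q) (hf : f ≤ 2 * n) (y : ℕ)
    (hy : f ≤ y + n) (hyn : y ≤ P (2 * n + 1)) :
    q y = f ∨ (P (2 * n + 1) < q y ∧ q y ≤ n) := by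
  have hf' := h.le_fixed
  have hcn := h.large (2 * n + 1) (by omega) le_rfl (by omega)
  have b1 := h.le_small y (by omega) (by omega)
  have hA : A (P y) := (h.asc_iff hf y (by omega) (by omega)).2 hyn
  by_cases hno : ∀ w, y < w → w ≤ n → ¬ P w < P y
  · exact Or.inl (h.target_small_eq_fixed t hf hy (by omega) hno)
  · right
    push Not at hno
    obtain ⟨w, hw, hwn, hlt⟩ := hno
    rcases t y (by omega) (by omega) with ⟨a1, a2⟩ | ⟨a1, a2, a3, a4⟩
    · exact absurd hlt (a2 w hw (by omega))
    · have hle := a4 w hw (by omega) hlt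
      have hw1 := h.le_small w (by omega) hwn
      rcases h.small_cases hy a1 a2 with h2 | ⟨h2, h3, h4⟩
      · omega
      · refine ⟨?_, h2⟩
        by_contra hq
        have hA' : A (P (q y)) := (h.asc_iff hf _ (by omega) h2).2 (by omega)
        have := h.asc_mono _ _ (by omega) a3 (h.le y (by omega) (by omega)) hA' hA
        rw [h.invol _ (by omega) (by omega), h.invol _ (by omega) (by omega)] at this
        omega

theorem target_last (h : Layout n f A P) (t : IsTarget n P q) (hf : f = 2 * n + 1) :
    (∀ i, 1 ≤ i → i ≤ n → q i = 2 * n) ∧ q f = 2 * n + 2 := by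
  subst hf
  have hn := h.three_le
  constructor
  · intro i hi hin
    have h1 := h.initial' i hi (by omega)
    have h2 := h.initial n (by omega) (by omega)
    rw [← two_mul] at h2
    refine t.eq_of h hi (by omega) (by omega) (by omega) (by omega) ?_
    intro w hw hw' hlt
    rw [h2]
    by_cases hwn : w ≤ n
    · have := h.initial' w (by omega) (by omega)
      omega
    · by_cases hwf : w = 2 * n + 1
      · have := h.fix
        rw [hwf] at hlt
        omega
      · exact h.large w (by omega) hw' hwf
  · rcases t (2 * n + 1) (by omega) le_rfl with ⟨a1, a2⟩ | ⟨a1, a2, a3, a4⟩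
    · exact a1
    · omega

theorem shape (h : Layout n f A P) (t : IsTarget n P q) : Shape n f (P (2 * n + 1)) A q where
  three_le := h.three_le
  le_fixed := h.le_fixed
  fixed_le := h.fixed_le
  asc_of_lt := h.asc_of_lt
  not_asc_fixed := h.not_asc_fixed
  asc_last := h.asc_last
  lt u hu hu' := by rcases t u hu hu' with ⟨a1, a2⟩ | ⟨a1, a2, a3, a4⟩ <;> omega
  le u hu hu' := by rcases t u hu hu' with ⟨a1, a2⟩ | ⟨a1, a2, a3, a4⟩ <;> omega
  asc := h.target_asc t
  last := h.target_last t
  desc := h.target_desc t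
  first := h.target_first t
  le_count := h.fixed_le_count
  count_le hf := h.large _ (by omega) le_rfl (by omega)
  top hf := by
    have hn := h.three_le
    exact h.target_small_eq_fixed t hf (by omega) le_rfl (fun w hw hw' => by omega)
  chain hf y hy hy' := h.target_chain t hf y hy.le hy'
  hang hf := h.target_hang t hf
  count hf := h.target_chain t hf _ le_rfl
  card := h.ncard_asc

end Layout

end Watermark

namespace Watermark

/-! ### Consequences of the shape of a representative tree -/

namespace Shape

variable {n f a : ℕ} {A : ℕ → Prop} {q : ℕ → ℕ}

theorem succ_asc (S : Shape n f a A q) : A (n + 1) := by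
  have := S.le_fixed
  exact S.asc_of_lt _ (by omega) (by omega)

theorem head_succ (S : Shape n f a A q) : q (n + 1) = 2 * n + 2 := by
  have := S.le_fixed
  exact S.asc _ (by omega) (by omega) S.succ_asc

theorem head_last (S : Shape n f a A q) : q (2 * n + 1) = 2 * n + 2 := by
  have := S.fixed_le
  by_cases h : f = 2 * n + 1
  · rw [← h]
    exact (S.last h).2
  · exact S.asc _ (by omega) (by omega) (S.asc_last (by omega))

theorem fixed_le_of_not_asc (S : Shape n f a A q) {x : ℕ} (hx : n < x) (hA : ¬ A x) : f ≤ x := by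
  by_contra h
  exact hA (S.asc_of_lt x hx (by omega))

theorem asc_of_head_eq (S : Shape n f a A q) {x : ℕ} (hx : n < x) (hx' : x ≤ 2 * n)
    (h : q x = 2 * n + 2) : A x := by
  by_contra hA
  have := (S.desc x (S.fixed_le_of_not_asc hx hA) hx' hA).1
  omega

/-- `n + 1` is a leaf. -/
theorem ne_succ (S : Shape n f a A q) {u : ℕ} (hu : 1 ≤ u) (hu' : u ≤ 2 * n + 1) :
    q u ≠ n + 1 := by
  intro e
  have hn := S.three_le
  have hf := S.le_fixed
  have hf' := S.fixed_le
  have hlt := S.lt u hu hu'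
  have hA := S.succ_asc
  by_cases hl : f = 2 * n + 1
  · have := (S.last hl).1 u hu (by omega)
    omega
  · have hun : u ≤ n := by omega
    by_cases h1 : u + n < f
    · have h2 := S.first (by omega) u hu h1
      have := S.lt f (by omega) (by omega)
      omega
    · by_cases h3 : u ≤ a
      · rcases S.hang (by omega) u (by omega) h3 with h | h <;> omega
      · by_cases h4 : u = n
        · have := S.top (by omega)
          rw [h4] at e
          omega
        · have := S.chain (by omega) u (by omega) (by omega)
          omega

/-- Either `1` is a sibling of `f`, or `f = 2n + 1` and the head is `2n`. -/
theorem le_head_one (S : Shape n f a A q) : n + 2 ≤ q 1 ∧ q 1 ≤ 2 * n + 1 := by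
  have hn := S.three_le
  have hf := S.le_fixed
  have hf' := S.fixed_le
  by_cases hl : f = 2 * n + 1
  · have := (S.last hl).1 1 (by omega) (by omega)
    omega
  · have h1 := S.first (by omega) 1 (by omega) (by omega)
    have h2 := S.lt f (by omega) (by omega)
    have h3 := (S.desc f le_rfl (by omega) S.not_asc_fixed).1
    omega

/-- The tree with exactly two ascending vertices. -/
theorem of_two (S : Shape n f a A q)
    (h : ∀ c, n < c → c ≤ 2 * n + 1 → q c = 2 * n + 2 → c = n + 1 ∨ c = 2 * n + 1) :
    q 1 = n + 3 ∧ (∀ i, 2 ≤ i → i < n → q i = i + 1) ∧ q n = n + 2 ∧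
      ∀ i, n + 2 ≤ i → i ≤ 2 * n → q i = i + 1 := by
  have hn := S.three_le
  have hf := S.le_fixed
  have hf' := S.fixed_le
  have hl : f ≤ 2 * n := by
    by_contra hl
    have h1 := S.asc (n + 2) (by omega) (by omega) (S.asc_of_lt _ (by omega) (by omega))
    have := h (n + 2) (by omega) (by omega) h1
    omega
  have hA : ∀ c, n + 2 ≤ c → c ≤ 2 * n → ¬ A c := by
    intro c hc hc' hA
    have h1 := S.asc c (by omega) (by omega) hA
    have := h c (by omega) (by omega) h1
    omega
  -- All large elements below `f` are ascending, so with only two ascending elements `f` is as small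
  -- as possible.
  have hf2 : f = n + 2 := by
    by_contra hne
    exact hA (n + 2) le_rfl (by omega) (S.asc_of_lt _ (by omega) (by omega))
  subst hf2
  have hstep : ∀ i, n + 2 ≤ i → i ≤ 2 * n → q i = i + 1 := by
    intro i hi hi'
    obtain ⟨h1, h2, h3⟩ := S.desc i hi hi' (hA i hi hi')
    have h4 := S.lt i (by omega) (by omega)
    by_contra hne
    exact hA (i + 1) (by omega) (by omega) (h3 (i + 1) (by omega) (by omega))
  have ha : a = 2 := by
    have e : {x | n < x ∧ x ≤ 2 * n + 1 ∧ A x} = {n + 1, 2 * n + 1} := by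
      ext x
      simp only [Set.mem_ofPred_eq, Set.mem_insert_iff, Set.mem_singleton_iff]
      constructor
      · rintro ⟨h1, h2, h3⟩
        by_contra hne
        exact hA x (by omega) (by omega) h3
      · rintro (rfl | rfl)
        · exact ⟨by omega, by omega, S.succ_asc⟩
        · exact ⟨by omega, by omega, S.asc_last hl⟩
    have := S.card hl
    rw [e, Set.ncard_pair (by omega)] at this
    exact this.symm
  subst ha
  refine ⟨?_, ?_, S.top hl, hstep⟩
  · rw [S.first hl 1 (by omega) (by omega), hstep _ le_rfl hl]
  · intro i hi hi'
    rcases hi.eq_or_lt with e | hi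
    · rw [← e]
      exact S.count hl (by omega)
    · exact S.chain hl i hi hi'

/-- If `f > n + 2` then `2` is one of the initial small vertices, whose head is large. -/
theorem head_two (S : Shape n f a A q) (h : q 2 = 3) : f = n + 2 := by
  have hn := S.three_le
  have hf := S.le_fixed
  have hf' := S.fixed_le
  by_contra hne
  by_cases hl : f = 2 * n + 1
  · have := (S.last hl).1 2 (by omega) (by omega)
    omega
  · have h1 := S.first (by omega) 2 (by omega) (by omega)
    have h2 := S.lt f (by omega) (by omega)
    omega

end Shape

/-! ### Rigidity of watermarks -/

/-- The edges of the watermark whose representative tree is given by `q`. -/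
def Edge (n : ℕ) (q : ℕ → ℕ) (u v : ℕ) : Prop :=
  (1 ≤ u ∧ u ≤ 2 * n + 2 ∧ v + 1 = u) ∨ (1 ≤ u ∧ u ≤ 2 * n + 1 ∧ v = q u)

/-- The edges that `lam` does not map to edges. -/
def Bad (n : ℕ) (q q' lam : ℕ → ℕ) (u v : ℕ) : Prop :=
  Edge n q u v ∧ ¬ Edge n q' (lam u) (lam v)

/-- At most two pairs satisfy `B`. -/
def AtMostTwo (B : ℕ → ℕ → Prop) : Prop :=
  ∀ u₁ v₁ u₂ v₂ u₃ v₃, B u₁ v₁ → B u₂ v₂ → B u₃ v₃ →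
    (u₁ = u₂ ∧ v₁ = v₂) ∨ (u₁ = u₃ ∧ v₁ = v₃) ∨ (u₂ = u₃ ∧ v₂ = v₃)

/-- `lam`, with inverse `mu`, is an isomorphism of the two watermarks up to two edges. -/
structure Near (n : ℕ) (q q' lam mu : ℕ → ℕ) : Prop where
  lam_le : ∀ u, u ≤ 2 * n + 2 → lam u ≤ 2 * n + 2
  mu_le : ∀ u, u ≤ 2 * n + 2 → mu u ≤ 2 * n + 2
  left : ∀ u, u ≤ 2 * n + 2 → mu (lam u) = u
  right : ∀ u, u ≤ 2 * n + 2 → lam (mu u) = u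
  bad : AtMostTwo (Bad n q q' lam)
  bad' : AtMostTwo (Bad n q' q mu)

theorem edge_path {n : ℕ} {q : ℕ → ℕ} {u : ℕ} (h : 1 ≤ u) (h' : u ≤ 2 * n + 2) :
    Edge n q u (u - 1) := Or.inl ⟨h, h', by omega⟩

theorem edge_tree {n : ℕ} {q : ℕ → ℕ} {u v : ℕ} (h : 1 ≤ u) (h' : u ≤ 2 * n + 1) (e : q u = v) :
    Edge n q u v := Or.inr ⟨h, h', e.symm⟩

theorem not_edge_zero {n : ℕ} {q : ℕ → ℕ} {v : ℕ} : ¬ Edge n q 0 v := by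
  rintro (⟨h, -⟩ | ⟨h, -⟩) <;> omega

theorem edge_root {n : ℕ} {q : ℕ → ℕ} {v : ℕ} (h : Edge n q (2 * n + 2) v) : v = 2 * n + 1 := by
  rcases h with ⟨h1, h2, h3⟩ | ⟨h1, h2, h3⟩ <;> omega

namespace Near

variable {n f a f' a' : ℕ} {A A' : ℕ → Prop} {q q' lam mu : ℕ → ℕ}

theorem symm (N : Near n q q' lam mu) : Near n q' q mu lam :=
  ⟨N.mu_le, N.lam_le, N.right, N.left, N.bad', N.bad⟩

theorem inj (N : Near n q q' lam mu) {u v : ℕ} (hu : u ≤ 2 * n + 2) (hv : v ≤ 2 * n + 2)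
    (e : lam u = lam v) : u = v := by rw [← N.left u hu, e, N.left v hv]

theorem good (N : Near n q q' lam mu) {u₁ v₁ u₂ v₂ u v : ℕ} (h1 : Bad n q q' lam u₁ v₁)
    (h2 : Bad n q q' lam u₂ v₂) (h12 : ¬ (u₁ = u₂ ∧ v₁ = v₂)) (h : Edge n q u v)
    (h13 : ¬ (u₁ = u ∧ v₁ = v)) (h23 : ¬ (u₂ = u ∧ v₂ = v)) : Edge n q' (lam u) (lam v) := by
  by_contra hb
  rcases N.bad _ _ _ _ _ _ h1 h2 ⟨h, hb⟩ with h | h | h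
  · exact h12 h
  · exact h13 h
  · exact h23 h

/-- An initial segment of fixed vertices can only end at a bad edge. -/
theorem bad_of_initial (S' : Shape n f' a' A' q') (N : Near n q q' lam mu) {l : ℕ}
    (hl : l < 2 * n + 2) (hfix : ∀ u, u ≤ l → lam u = u) (hne : lam (l + 1) ≠ l + 1) :
    Bad n q q' lam (l + 1) l := by
  refine ⟨Or.inl ⟨by omega, by omega, rfl⟩, ?_⟩
  rw [hfix l le_rfl]
  rintro (⟨h1, h2, h3⟩ | ⟨h1, h2, h3⟩)
  · omega
  · have h4 := S'.lt _ h1 h2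
    have h5 := hfix (lam (l + 1)) (by omega)
    have := N.inj (by omega) (by omega) h5
    omega

/-- If `0` is fixed, the edge from the first moved vertex to its fixed predecessor is lost. Together
with `exists_final` this accounts for both bad edges when the two ends of the path are fixed. -/
theorem exists_initial (S' : Shape n f' a' A' q') (N : Near n q q' lam mu) (h0 : lam 0 = 0)
    (hne : ¬ ∀ u, u ≤ 2 * n + 2 → lam u = u) :
    ∃ l, l < 2 * n + 2 ∧ (∀ u, u ≤ l → lam u = u) ∧ lam (l + 1) ≠ l + 1 ∧
      Bad n q q' lam (l + 1) l := by
  classical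
  push Not at hne
  have hs := Nat.find_spec hne
  have hm : ∀ u, u < Nat.find hne → lam u = u := by
    intro u hu
    by_contra hc
    exact Nat.find_min hne hu ⟨by omega, hc⟩
  obtain ⟨l, hl⟩ : ∃ l, Nat.find hne = l + 1 := by
    refine ⟨Nat.find hne - 1, ?_⟩
    have : Nat.find hne ≠ 0 := by
      intro e
      rw [e] at hs
      exact hs.2 h0
    omega
  rw [hl] at hs hm
  have hfix : ∀ u, u ≤ l → lam u = u := fun u hu => hm u (by omega)
  exact ⟨l, by omega, hfix, hs.2, N.bad_of_initial S' (by omega) hfix hs.2⟩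

theorem exists_final (S' : Shape n f' a' A' q') (N : Near n q q' lam mu)
    (hr : lam (2 * n + 2) = 2 * n + 2) (hne : ¬ ∀ u, u ≤ 2 * n + 2 → lam u = u) :
    ∃ m, 1 ≤ m ∧ m ≤ 2 * n + 2 ∧ (∀ u, m ≤ u → u ≤ 2 * n + 2 → lam u = u) ∧ lam (m - 1) ≠ m - 1 ∧
      Bad n q q' lam m (m - 1) := by
  classical
  push Not at hne
  -- The greatest moved vertex is obtained as the one at the least distance `k` from the root.
  have hne' : ∃ k, k ≤ 2 * n + 2 ∧ lam (2 * n + 2 - k) ≠ 2 * n + 2 - k := by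
    obtain ⟨u, hu, h⟩ := hne
    exact ⟨2 * n + 2 - u, by omega, by rwa [Nat.sub_sub_self hu]⟩
  have hs := Nat.find_spec hne'
  set k := Nat.find hne' with hk
  have hk0 : k ≠ 0 := by
    intro e
    rw [e] at hs
    exact hs.2 hr
  have hfix : ∀ u, 2 * n + 2 - (k - 1) ≤ u → u ≤ 2 * n + 2 → lam u = u := by
    intro u hu hu'
    by_contra hc
    refine Nat.find_min hne' (m := 2 * n + 2 - u) (by omega) ⟨by omega, ?_⟩
    rwa [Nat.sub_sub_self hu']
  have e : 2 * n + 2 - k = 2 * n + 2 - (k - 1) - 1 := by omega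
  rw [e] at hs
  have hm1 : 1 ≤ 2 * n + 2 - (k - 1) := by omega
  have hm2 : 2 * n + 2 - (k - 1) ≤ 2 * n + 2 := by omega
  generalize 2 * n + 2 - (k - 1) = m at *
  refine ⟨m, hm1, hm2, hfix, hs.2, edge_path hm1 hm2, ?_⟩
  rw [hfix m le_rfl hm2]
  rintro (⟨h1, h2, h3⟩ | ⟨h1, h2, h3⟩)
  · exact hs.2 (by omega)
  · have h4 := S'.lt m h1 h2
    have h5 := S'.le m h1 h2
    have h6 := hfix (lam (m - 1)) (by omega) (by omega)
    have := N.inj (by omega) (by omega) h6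
    omega

/-- The preimage of the first vertex after a fixed one has a bad edge. -/
theorem eq_of_good (S : Shape n f a A q) (N : Near n q q' lam mu) {l w : ℕ} (hl : lam l = l)
    (hw : lam w = l + 1) (hlw : l < w) (hw' : w ≤ 2 * n + 1) (hl' : l ≤ 2 * n)
    (h1 : Edge n q' (lam w) (lam (w - 1))) (h2 : Edge n q' (lam w) (lam (q w))) : w = l + 1 := by
  have hq := S.lt w (by omega) hw'
  have hq' := S.le w (by omega) hw'
  rw [hw] at h1 h2
  -- The only heads of `l + 1` are `l` and `q' (l + 1)`. As `l` is the image of `l`, neither `w - 1`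
  -- nor `q w` goes to `l` unless `w = l + 1`; so both would go to `q' (l + 1)`, against
  -- injectivity.
  rcases h1 with ⟨a1, a2, a3⟩ | ⟨a1, a2, a3⟩
  · have := N.inj (u := w - 1) (v := l) (by omega) (by omega) (by omega)
    omega
  · rcases h2 with ⟨b1, b2, b3⟩ | ⟨b1, b2, b3⟩
    · have := N.inj (u := q w) (v := l) (by omega) (by omega) (by omega)
      omega
    · have := N.inj (u := q w) (v := w - 1) (by omega) (by omega) (by omega)
      omega

theorem bad_of_lam_zero {z v : ℕ} (h : lam z = 0) (he : Edge n q z v) :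
    Bad n q q' lam z v := ⟨he, by rw [h]; exact not_edge_zero⟩

/-- The preimage of the root has a bad edge. -/
theorem exists_bad_of_lam_root (S : Shape n f a A q) (N : Near n q q' lam mu) {x : ℕ}
    (h : lam x = 2 * n + 2) (hx : 1 ≤ x) (hx' : x ≤ 2 * n + 1) :
    Bad n q q' lam x (x - 1) ∨ Bad n q q' lam x (q x) := by
  by_contra hb
  push Not at hb
  have h1 : Edge n q' (lam x) (lam (x - 1)) := by
    by_contra hc
    exact hb.1 ⟨edge_path hx (by omega), hc⟩
  have h2 : Edge n q' (lam x) (lam (q x)) := by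
    by_contra hc
    exact hb.2 ⟨edge_tree hx hx' rfl, hc⟩
  rw [h] at h1 h2
  have hq := S.lt x hx hx'
  have hq' := S.le x hx hx'
  have := N.inj (by omega) (by omega) ((edge_root h1).trans (edge_root h2).symm)
  omega

/-- A non-identity has a bad edge at the top, below the fixed final segment. If `0` moves, the
vertex sent to `0` loses both its edges, three in all. If `0` is fixed, there is a second bad edge
at the bottom, and then the vertex sent to the first moved place has two good edges, which
`eq_of_good` forbids. -/
theorem eq_of_root_fixed (S : Shape n f a A q) (S' : Shape n f' a' A' q')
    (N : Near n q q' lam mu) (hr : lam (2 * n + 2) = 2 * n + 2) :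
    ∀ u, u ≤ 2 * n + 2 → lam u = u := by
  by_contra hne
  obtain ⟨m, hm1, hm2, hfix, hm, hbad⟩ := N.exists_final S' hr hne
  have h0 : lam 0 = 0 := by
    by_contra h0
    have hz := N.right 0 (by omega)
    have hz' := N.mu_le 0 (by omega)
    set z := mu 0 with hzd
    have hz0 : z ≠ 0 := by
      intro e
      rw [e] at hz
      exact h0 hz
    have hzm : z < m := by
      by_contra hge
      have := hfix z (by omega) hz'
      omega
    have b1 : Bad n q q' lam z (z - 1) := bad_of_lam_zero hz (edge_path (by omega) (by omega))
    have b2 : Bad n q q' lam z (q z) := bad_of_lam_zero hz (edge_tree (by omega) (by omega) rfl)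
    have := S.lt z (by omega) (by omega)
    rcases N.bad _ _ _ _ _ _ b1 b2 hbad with h | h | h <;> omega
  obtain ⟨l, hl, hfixl, hnel, hbadl⟩ := N.exists_initial S' h0 hne
  have hlm : l + 1 ≤ m - 1 := by
    by_contra hge
    exact hnel (hfix _ (by omega) (by omega))
  have hw := N.right (l + 1) (by omega)
  have hw' := N.mu_le (l + 1) (by omega)
  set w := mu (l + 1) with hwd
  have hwl : l < w := by
    by_contra hge
    have := hfixl w (by omega)
    omega
  have hwm : w < m := by
    by_contra hge
    have := hfix w (by omega) hw'
    omega
  have hwne : w ≠ l + 1 := by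
    intro e
    rw [e] at hw
    exact hnel hw
  have hlt := S.lt w (by omega) (by omega)
  exact hwne (N.eq_of_good S (hfixl l le_rfl) hw hwl (by omega) (by omega)
    (N.good hbad hbadl (by omega) (edge_path (by omega) (by omega)) (by omega) (by omega))
    (N.good hbad hbadl (by omega) (edge_tree (by omega) (by omega) rfl) (by omega) (by omega)))

/-- The edges into the root from `n + 1` and `2 n + 1` cannot both become edges into `0`. -/
theorem bad_of_root_zero (h : lam (2 * n + 2) = 0) {c : ℕ} (hc : q c = 2 * n + 2) (hc1 : 1 ≤ c)
    (hc2 : c ≤ 2 * n + 1) (hne : lam c ≠ 1) (S' : Shape n f' a' A' q') :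
    Bad n q q' lam c (2 * n + 2) := by
  refine ⟨edge_tree hc1 hc2 hc, ?_⟩
  rw [h]
  rintro (⟨h1, h2, h3⟩ | ⟨h1, h2, h3⟩)
  · omega
  · have := S'.lt _ h1 h2
    omega

/-- Both bad edges start at the vertex sent to `0`, so the vertex sent to the root can only be `0`,
which has no edges to lose. The inverse map then sends the root to `0` and loses `(2n + 2, 2n + 1)`,
an edge at the vertex `y` that it sends to the root, and every edge into the root except possibly
the one from its preimage of `1`. The count leaves two possibilities for the edges from `n + 1` and
`2n + 1`, and both fail. -/
theorem not_of_source (S : Shape n f a A q) (S' : Shape n f' a' A' q')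
    (N : Near n q q' lam mu) {z : ℕ} (hz : lam z = 0) (hz1 : 1 ≤ z) (hz2 : z ≤ 2 * n + 1)
    (hr : lam (2 * n + 2) ≠ 2 * n + 2) : False := by
  have hn := S.three_le
  have b1 : Bad n q q' lam z (z - 1) := bad_of_lam_zero hz (edge_path hz1 (by omega))
  have b2 : Bad n q q' lam z (q z) := bad_of_lam_zero hz (edge_tree hz1 hz2 rfl)
  have hzq := S.lt z hz1 hz2
  have good : ∀ u v, u ≠ z → Edge n q u v → Edge n q' (lam u) (lam v) := fun u v hu he =>
    N.good b1 b2 (by omega) he (by omega) (by omega)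
  have h0 : lam 0 = 2 * n + 2 := by
    have hx := N.right (2 * n + 2) le_rfl
    have hx' := N.mu_le (2 * n + 2) le_rfl
    set x := mu (2 * n + 2) with hxd
    have hxr : x ≠ 2 * n + 2 := by
      intro e
      rw [e] at hx
      exact hr hx
    by_cases hx0 : x = 0
    · rwa [hx0] at hx
    · have hxz : x ≠ z := by
        intro e
        rw [e, hz] at hx
        omega
      rcases N.exists_bad_of_lam_root S hx (by omega) (by omega) with h | h
      · exact absurd (good _ _ hxz h.1) h.2
      · exact absurd (good _ _ hxz h.1) h.2
  have m0 : mu (2 * n + 2) = 0 := by rw [← h0, N.left 0 (by omega)]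
  obtain ⟨y, hy⟩ : ∃ y, lam (2 * n + 2) = y := ⟨_, rfl⟩
  have hyr : y ≤ 2 * n + 2 := hy ▸ N.lam_le _ le_rfl
  have hy0 : y ≠ 0 := by
    intro e
    have := N.inj (u := 2 * n + 2) (v := z) le_rfl (by omega) (by omega)
    omega
  have my : mu y = 2 * n + 2 := by rw [← hy, N.left _ le_rfl]
  have c1 : Bad n q' q mu (2 * n + 2) (2 * n + 1) :=
    bad_of_lam_zero m0 (Or.inl ⟨by omega, le_rfl, by omega⟩)
  have hyr' : y ≠ 2 * n + 2 := by rw [← hy]; exact hr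
  have cy := N.symm.exists_bad_of_lam_root S' my (by omega) (by omega)
  have hrest : ∀ c, c = n + 1 ∨ c = 2 * n + 1 → mu c ≠ 1 → c = y := by
    intro c hc hm
    have hc' : q' c = 2 * n + 2 := by
      rcases hc with rfl | rfl
      · exact S'.head_succ
      · exact S'.head_last
    have c2 := bad_of_root_zero m0 hc' (by omega) (by omega) hm S
    rcases cy with cy | cy
    · rcases N.bad' _ _ _ _ _ _ c1 c2 cy with h | h | h <;> omega
    · rcases N.bad' _ _ _ _ _ _ c1 c2 cy with h | h | h <;> omega
  have hdist : ∀ d, d ≤ 2 * n + 2 → mu d = 1 → lam 1 = d := fun d hd h => by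
    rw [← h, N.right d hd]
  have hcase : (y = 2 * n + 1 ∧ lam 1 = n + 1) ∨ (y = n + 1 ∧ lam 1 = 2 * n + 1) := by
    by_cases e1 : mu (n + 1) = 1
    · have := hdist _ (by omega) e1
      by_cases e2 : mu (2 * n + 1) = 1
      · have := hdist _ (by omega) e2
        omega
      · exact Or.inl ⟨(hrest _ (Or.inr rfl) e2).symm, this⟩
    · have h1 := hrest _ (Or.inl rfl) e1
      by_cases e2 : mu (2 * n + 1) = 1
      · exact Or.inr ⟨h1.symm, hdist _ (by omega) e2⟩
      · have h2 := hrest _ (Or.inr rfl) e2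
        omega
  have hzr : 2 * n + 2 ≠ z := by omega
  rcases hcase with ⟨ey, e1⟩ | ⟨ey, e1⟩
  -- The root moves down by one, and the surviving path edges pass this shift on from vertex to
  -- vertex, until `1` would have to go to `0`.
  · have key : ∀ k, k ≤ 2 * n + 1 → lam (2 * n + 2 - k) = 2 * n + 1 - k := by
      intro k
      induction k using Nat.strong_induction_on with
      | _ k ih =>
        intro hk
        rcases Nat.eq_zero_or_pos k with rfl | hk0
        · rw [Nat.sub_zero, hy, ey]; rfl
        · have hu := ih (k - 1) (by omega) (by omega)
          obtain ⟨u, hud⟩ : ∃ u, 2 * n + 2 - (k - 1) = u := ⟨_, rfl⟩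
          rw [hud, show 2 * n + 1 - (k - 1) = u - 1 by omega] at hu
          rw [show 2 * n + 2 - k = u - 1 by omega, show 2 * n + 1 - k = u - 2 by omega]
          have huz : u ≠ z := by
            intro e
            rw [e, hz] at hu
            omega
          have he := good u (u - 1) huz (edge_path (by omega) (by omega))
          rw [hu] at he
          rcases he with ⟨h1, h2, h3⟩ | ⟨h1, h2, h3⟩
          · omega
          · have h4 := S'.lt _ h1 h2
            have h5 := S'.le _ h1 h2
            exfalso
            by_cases h6 : q' (u - 1) = 2 * n + 2
            · have := N.inj (u := u - 1) (v := 0) (by omega) (by omega) (by omega)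
              omega
            · have h7 := ih (2 * n + 1 - q' (u - 1)) (by omega) (by omega)
              rw [show 2 * n + 2 - (2 * n + 1 - q' (u - 1)) = q' (u - 1) + 1 by omega,
                show 2 * n + 1 - (2 * n + 1 - q' (u - 1)) = q' (u - 1) by omega, ← h3] at h7
              have := N.inj (by omega) (by omega) h7
              omega
    have := key (2 * n + 1) le_rfl
    rw [show 2 * n + 2 - (2 * n + 1) = 1 by omega, e1] at this
    omega
  -- Here `2n + 1` is sent to `n`, and its edge into the root would become an edge from `n` to the
  -- leaf `n + 1`.
  · have he := good (2 * n + 2) (2 * n + 1) hzr (Or.inl ⟨by omega, le_rfl, by omega⟩)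
    rw [hy, ey] at he
    have hl : lam (2 * n + 1) = n := by
      rcases he with ⟨h1, h2, h3⟩ | ⟨h1, h2, h3⟩
      · omega
      · rw [S'.head_succ] at h3
        have := N.inj (u := 2 * n + 1) (v := 0) (by omega) (by omega) (by omega)
        omega
    have hlz : 2 * n + 1 ≠ z := by
      intro e
      rw [e, hz] at hl
      omega
    have he' := good (2 * n + 1) (2 * n + 2) hlz (edge_tree (by omega) le_rfl S.head_last)
    rw [hl, hy, ey] at he'
    rcases he' with ⟨h1, h2, h3⟩ | ⟨h1, h2, h3⟩
    · omega
    · exact S'.ne_succ h1 h2 h3.symm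

end Near

end Watermark

/-! ### Rigidity: the root is not sent to `0`, nor to a vertex `s ≤ n + 1` below which everything is
fixed. -/

namespace Watermark
namespace Near

variable {n f a f' a' : ℕ} {A A' : ℕ → Prop} {q q' lam mu : ℕ → ℕ}

/-- If the root becomes `0`, then the tree has two ascending vertices. -/
theorem root_zero (S : Shape n f a A q) (S' : Shape n f' a' A' q') (N : Near n q q' lam mu)
    (h : lam (2 * n + 2) = 0) :
    Bad n q q' lam (2 * n + 2) (2 * n + 1) ∧ Bad n q q' lam (2 * n + 1) (2 * n + 2) ∧
      lam (n + 1) = 1 ∧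
      ∀ c, n < c → c ≤ 2 * n + 1 → q c = 2 * n + 2 → c = n + 1 ∨ c = 2 * n + 1 := by
  have hn := S.three_le
  have b0 : Bad n q q' lam (2 * n + 2) (2 * n + 1) :=
    bad_of_lam_zero h (Or.inl ⟨by omega, le_rfl, by omega⟩)
  have hb : ∀ c, q c = 2 * n + 2 → n < c → c ≤ 2 * n + 1 → lam c ≠ 1 →
      Bad n q q' lam c (2 * n + 2) := fun c hc h1 h2 h3 =>
    bad_of_root_zero h hc (by omega) h2 h3 S'
  -- Only `1` has an edge into `0`. Of two edges into the root, one must therefore start at the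
  -- vertex sent to `1`, since otherwise they and the edge leaving the root are three bad edges.
  have two : ∀ c d, q c = 2 * n + 2 → n < c → c ≤ 2 * n + 1 → q d = 2 * n + 2 → n < d →
      d ≤ 2 * n + 1 → c ≠ d → lam c ≠ 1 → lam d = 1 := by
    intro c d h1 h2 h3 h4 h5 h6 h7 h8
    by_contra h9
    rcases N.bad _ _ _ _ _ _ b0 (hb c h1 h2 h3 h8) (hb d h4 h5 h6 h9) with h | h | h <;> omega
  have hk := S.head_succ
  have hL := S.head_last
  have hex : ∀ c, n < c → c ≤ 2 * n + 1 → q c = 2 * n + 2 → c = n + 1 ∨ c = 2 * n + 1 := by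
    intro c h1 h2 h3
    by_contra hc
    have inj := fun u v (hu : u ≤ 2 * n + 2) (hv : v ≤ 2 * n + 2) => N.inj (u := u) (v := v) hu hv
    have t1 := two c (n + 1) h3 h1 h2 hk (by omega) (by omega) (by omega)
    have t2 := two c (2 * n + 1) h3 h1 h2 hL (by omega) (by omega) (by omega)
    have t3 := two (n + 1) (2 * n + 1) hk (by omega) (by omega) hL (by omega) (by omega) (by omega)
    have t4 := two (n + 1) c hk (by omega) (by omega) h3 h1 h2 (by omega)
    have i1 := inj c (n + 1) (by omega) (by omega)
    have i2 := inj c (2 * n + 1) (by omega) (by omega)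
    have i3 := inj (n + 1) (2 * n + 1) (by omega) (by omega)
    omega
  obtain ⟨e1, e2, e3, e4⟩ := S.of_two hex
  -- Otherwise the edges between `2n` and `2n + 1` survive in both directions: `2n` goes to `q' 1`,
  -- and `q' 1` would have an edge to `1` although it is at least `n + 2`.
  have hne : lam (2 * n + 1) ≠ 1 := by
    intro e
    have hne : lam (n + 1) ≠ 1 := by
      intro e'
      have := N.inj (u := 2 * n + 1) (v := n + 1) (by omega) (by omega) (by omega)
      omega
    have b1 := hb _ hk (by omega) (by omega) hne
    have g1 := N.good b0 b1 (by omega) (edge_path (u := 2 * n + 1) (by omega) (by omega))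
      (by omega) (by omega)
    have g2 := N.good b0 b1 (by omega) (edge_tree (u := 2 * n) (by omega) (by omega)
      (e4 _ (by omega) (by omega))) (by omega) (by omega)
    rw [show 2 * n + 1 - 1 = 2 * n by omega, e] at g1
    rw [e] at g2
    have hq1 := S'.le_head_one
    rcases g1 with ⟨h1, h2, h3⟩ | ⟨h1, h2, h3⟩
    · have := N.inj (u := 2 * n) (v := 2 * n + 2) (by omega) (by omega) (by omega)
      omega
    · rw [h3] at g2
      rcases g2 with ⟨h4, h5, h6⟩ | ⟨h4, h5, h6⟩
      · omega
      · have := S'.lt _ h4 h5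
        omega
  exact ⟨b0, hb _ hL (by omega) (by omega) hne,
    two _ _ hL (by omega) (by omega) hk (by omega) (by omega) (by omega) hne, hex⟩

/-- With only two ascending vertices the tree is known explicitly, and so are the two bad edges. The
vertex sent to the root is `0` or `2n + 1`. In the first case the inverse map satisfies the same
hypotheses, and following a few edges from `n + 1` and `1` leads to `n = 3` and then to a
contradiction. -/
theorem not_root_zero (S : Shape n f a A q) (S' : Shape n f' a' A' q') (N : Near n q q' lam mu)
    (h : lam (2 * n + 2) = 0) : False := by
  have hn := S.three_le
  obtain ⟨b0, b1, hl, hex⟩ := N.root_zero S S' h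
  obtain ⟨e1, e2, e3, e4⟩ := S.of_two hex
  have good : ∀ u v, Edge n q u v → ¬ (2 * n + 2 = u ∧ 2 * n + 1 = v) →
      ¬ (2 * n + 1 = u ∧ 2 * n + 2 = v) → Edge n q' (lam u) (lam v) := fun u v he =>
    N.good b0 b1 (by omega) he
  have hx := N.right (2 * n + 2) le_rfl
  have hx' := N.mu_le (2 * n + 2) le_rfl
  obtain ⟨x, hxd⟩ : ∃ x, mu (2 * n + 2) = x := ⟨_, rfl⟩
  rw [hxd] at hx hx'
  by_cases hx0 : x = 0
  · rw [hx0] at hx hxd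
    obtain ⟨-, -, hm, hex'⟩ := N.symm.root_zero S' S hxd
    have hl1 : lam 1 = n + 1 := by
      have := N.right (n + 1) (by omega)
      rwa [hm] at this
    obtain ⟨-, c2, -, -⟩ := S'.of_two hex'
    have c2 := c2 2 le_rfl (by omega)
    have l2 : lam (n + 2) = 2 := by
      have g := good (n + 2) (n + 1) (edge_path (by omega) (by omega)) (by omega) (by omega)
      rw [hl] at g
      rcases g with ⟨h1, h2, h3⟩ | ⟨h1, h2, h3⟩
      · omega
      · have := S'.lt _ h1 h2
        omega
    have l3 : lam (n + 3) = 3 := by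
      have g := good (n + 2) (n + 3) (edge_tree (by omega) (by omega) (e4 _ le_rfl (by omega)))
        (by omega) (by omega)
      rw [l2] at g
      rcases g with ⟨h1, h2, h3⟩ | ⟨h1, h2, h3⟩
      · have := N.inj (u := n + 3) (v := n + 1) (by omega) (by omega) (by omega)
        omega
      · omega
    have h3n : n = 3 := by
      have g := good 1 (n + 3) (edge_tree (by omega) (by omega) e1) (by omega) (by omega)
      rw [hl1, l3] at g
      rcases g with ⟨h1, h2, h3⟩ | ⟨h1, h2, h3⟩
      · omega
      · rw [S'.head_succ] at h3
        omega
    have g := good (n + 4) (n + 3) (edge_path (by omega) (by omega)) (by omega) (by omega)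
    rw [l3] at g
    rcases g with ⟨h1, h2, h3⟩ | ⟨h1, h2, h3⟩
    · have := N.inj (u := n + 4) (v := 1) (by omega) (by omega) (by omega)
      omega
    · have := S'.lt _ h1 h2
      have hc : lam (n + 4) = 1 ∨ lam (n + 4) = 2 := by omega
      rcases hc with hc | hc
      · have := N.inj (u := n + 4) (v := n + 1) (by omega) (by omega) (by omega)
        omega
      · have := N.inj (u := n + 4) (v := n + 2) (by omega) (by omega) (by omega)
        omega
  · have hxr : x ≠ 2 * n + 2 := by
      intro e
      rw [e, h] at hx
      omega
    have hxL : x = 2 * n + 1 := by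
      by_contra hne
      rcases N.exists_bad_of_lam_root S hx (by omega) (by omega) with hb | hb
      · exact hb.2 (good _ _ hb.1 (by omega) (by omega))
      · exact hb.2 (good _ _ hb.1 (by omega) (by omega))
    rw [hxL] at hx
    -- `2n + 1` has taken the place of the root, and the path carries the upward shift down to `n +
    -- 1`, which is however sent to `1`.
    have key : ∀ k, k ≤ 2 * n → lam (2 * n + 1 - k) = 2 * n + 2 - k := by
      intro k
      induction k using Nat.strong_induction_on with
      | _ k ih =>
        intro hk
        rcases Nat.eq_zero_or_pos k with rfl | hk0
        · simpa using hx
        · have hu := ih (k - 1) (by omega) (by omega)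
          obtain ⟨u, hud⟩ : ∃ u, 2 * n + 1 - (k - 1) = u := ⟨_, rfl⟩
          rw [hud, show 2 * n + 2 - (k - 1) = u + 1 by omega] at hu
          rw [show 2 * n + 1 - k = u - 1 by omega, show 2 * n + 2 - k = u by omega]
          have he := good u (u - 1) (edge_path (by omega) (by omega)) (by omega) (by omega)
          rw [hu] at he
          rcases he with ⟨h1, h2, h3⟩ | ⟨h1, h2, h3⟩
          · omega
          · have h4 := S'.lt _ h1 h2
            have h5 := S'.le _ h1 h2
            exfalso
            have h7 := ih (2 * n + 2 - q' (u + 1)) (by omega) (by omega)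
            rw [show 2 * n + 1 - (2 * n + 2 - q' (u + 1)) = q' (u + 1) - 1 by omega,
              show 2 * n + 2 - (2 * n + 2 - q' (u + 1)) = q' (u + 1) by omega, ← h3] at h7
            have := N.inj (by omega) (by omega) h7
            omega
    have := key n (by omega)
    rw [show 2 * n + 1 - n = n + 1 by omega, hl] at this
    omega

/-- The bad edges when the root is sent to the first vertex that is not fixed. -/
theorem root_first (S : Shape n f a A q) (S' : Shape n f' a' A' q') (N : Near n q q' lam mu)
    {s : ℕ} (hs : 1 ≤ s) (hs' : s ≤ 2 * n + 1) (hfix : ∀ u, u < s → lam u = u)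
    (hr : lam (2 * n + 2) = s) :
    Bad n q q' lam s (s - 1) ∧ (∃ c, (c = n + 1 ∨ c = 2 * n + 1 ∧ s ≤ n + 1) ∧
      Bad n q q' lam c (2 * n + 2)) ∧
    ∀ c, s ≤ c → c ≤ 2 * n + 1 → q c = 2 * n + 2 → ¬ Bad n q q' lam c (2 * n + 2) →
      lam c = s + 1 := by
  have hn := S.three_le
  have hne : lam s ≠ s := by
    intro e
    have := N.inj (u := s) (v := 2 * n + 2) (by omega) (by omega) (by omega)
    omega
  have b0 : Bad n q q' lam s (s - 1) := by
    have := N.bad_of_initial S' (l := s - 1) (by omega) (fun u hu => hfix u (by omega))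
      (by rwa [Nat.sub_add_cancel hs])
    rwa [Nat.sub_add_cancel hs] at this
  -- An edge into `s` comes from `s + 1` or ascends from a vertex below `s`; the latter are all
  -- fixed, so they are not images of `c`.
  have hin : ∀ c, s ≤ c → c ≤ 2 * n + 1 → q c = 2 * n + 2 → ¬ Bad n q q' lam c (2 * n + 2) →
      lam c = s + 1 := by
    intro c hc hc' hq hb
    have he : Edge n q' (lam c) (lam (2 * n + 2)) := by
      by_contra h
      exact hb ⟨edge_tree (by omega) hc' hq, h⟩
    rw [hr] at he
    rcases he with ⟨h1, h2, h3⟩ | ⟨h1, h2, h3⟩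
    · omega
    · have h4 := S'.lt _ h1 h2
      have h5 := hfix (lam c) (by omega)
      have := N.inj (by omega) (by omega) h5
      omega
  refine ⟨b0, ?_, hin⟩
  by_cases hsn : n + 1 < s
  · refine ⟨n + 1, Or.inl rfl, edge_tree (by omega) (by omega) S.head_succ, ?_⟩
    rw [hr, hfix _ hsn]
    rintro (⟨h1, h2, h3⟩ | ⟨h1, h2, h3⟩)
    · omega
    · rw [S'.head_succ] at h3
      omega
  · by_contra hc
    push Not at hc
    have h1 := hin (n + 1) (by omega) (by omega) S.head_succ (hc _ (Or.inl rfl))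
    have h2 := hin (2 * n + 1) (by omega) (by omega) S.head_last (hc _ (Or.inr ⟨rfl, by omega⟩))
    have := N.inj (u := n + 1) (v := 2 * n + 1) (by omega) (by omega) (by omega)
    omega

/-- The head of the tree edge of `s` when the root is sent to `s`. -/
theorem lam_last (N : Near n q q' lam mu)
    {s : ℕ} (hs' : s ≤ 2 * n + 1) (hfix : ∀ u, u < s → lam u = u)
    (hr : lam (2 * n + 2) = s) (hg : Edge n q' (lam (2 * n + 2)) (lam (2 * n + 1))) :
    lam (2 * n + 1) = q' s := by
  rw [hr] at hg
  rcases hg with ⟨h1, h2, h3⟩ | ⟨h1, h2, h3⟩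
  · have h5 := hfix (lam (2 * n + 1)) (by omega)
    have := N.inj (by omega) (by omega) h5
    omega
  · exact h3

/-- The good edge `(2n + 1, 2n + 2)` sends `2n + 1` to `s + 1`, and no third vertex is ascending.
From there the edges in both directions between neighbours in the chain `n + 2, …, 2n + 1` force a
reflected copy of it: `2n + 1 - i` goes to `s + 1 + i` and `q' (s + i) = s + i + 1`. For `s > 1`
this runs into `n + 1`, whose head is the root; for `s = 1` already the head of `1` is too small. -/
theorem not_low_first (S : Shape n f a A q) (S' : Shape n f' a' A' q') (N : Near n q q' lam mu)
    {s : ℕ} (hs : 1 ≤ s) (hs' : s ≤ n + 1) (hfix : ∀ u, u < s → lam u = u)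
    (hr : lam (2 * n + 2) = s) (hc : Bad n q q' lam (n + 1) (2 * n + 2)) : False := by
  have hn := S.three_le
  obtain ⟨b0, -, hin⟩ := N.root_first S S' hs (by omega) hfix hr
  have good : ∀ u v, Edge n q u v → ¬ (s = u ∧ s - 1 = v) →
      ¬ (n + 1 = u ∧ 2 * n + 2 = v) → Edge n q' (lam u) (lam v) := fun u v he =>
    N.good b0 hc (by omega) he
  have l0 : lam (2 * n + 1) = s + 1 := by
    refine hin _ (by omega) le_rfl S.head_last (fun hb => hb.2 ?_)
    exact good _ _ hb.1 (by omega) (by omega)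
  have hq := N.lam_last (by omega) hfix hr (good _ _ (Or.inl ⟨by omega, le_rfl, by omega⟩) (by omega)
    (by omega))
  rw [l0] at hq
  have hex : ∀ c, n < c → c ≤ 2 * n + 1 → q c = 2 * n + 2 → c = n + 1 ∨ c = 2 * n + 1 := by
    intro c h1 h2 h3
    by_contra hne
    have := hin c (by omega) h2 h3 (fun hb => hb.2 (good _ _ hb.1 (by omega) (by omega)))
    have := N.inj (u := c) (v := 2 * n + 1) (by omega) (by omega) (by omega)
    omega
  obtain ⟨e1, e2, e3, e4⟩ := S.of_two hex
  have key : ∀ i, i ≤ n - 1 → lam (2 * n + 1 - i) = s + 1 + i ∧ q' (s + i) = s + i + 1 := by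
    intro i
    induction i using Nat.strong_induction_on with
    | _ i ih =>
      intro hi
      rcases Nat.eq_zero_or_pos i with rfl | hi0
      · exact ⟨by simpa using l0, by simpa using hq.symm⟩
      · obtain ⟨k1, k2⟩ := ih (i - 1) (by omega) (by omega)
        obtain ⟨u, hud⟩ : ∃ u, 2 * n + 1 - (i - 1) = u := ⟨_, rfl⟩
        rw [hud, show s + 1 + (i - 1) = s + i by omega] at k1
        have hu : 2 * n + 1 - i = u - 1 := by omega
        rw [hu]
        have g1 := good u (u - 1) (edge_path (by omega) (by omega)) (by omega) (by omega)
        rw [k1] at g1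
        have l1 : lam (u - 1) = q' (s + i) := by
          rcases g1 with ⟨h1, h2, h3⟩ | ⟨h1, h2, h3⟩
          · by_cases hi1 : i = 1
            · have := N.inj (u := u - 1) (v := 2 * n + 2) (by omega) (by omega) (by omega)
              omega
            · obtain ⟨k3, -⟩ := ih (i - 2) (by omega) (by omega)
              have := N.inj (u := u - 1) (v := 2 * n + 1 - (i - 2)) (by omega) (by omega) (by omega)
              omega
          · exact h3
        have g2 := good (u - 1) u (edge_tree (by omega) (by omega)
          ((e4 (u - 1) (by omega) (by omega)).trans (by omega))) (by omega) (by omega)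
        rw [k1] at g2
        have l2 : lam (u - 1) = s + i + 1 := by
          rcases g2 with ⟨h1, h2, h3⟩ | ⟨h1, h2, h3⟩
          · omega
          · have := S'.lt _ h1 h2
            have := N.lam_le (u - 1) (by omega)
            have h8 : s + i ≤ 2 * n + 1 := by omega
            have := S'.lt (s + i) (by omega) h8
            omega
        exact ⟨by omega, by omega⟩
  by_cases hs1 : s = 1
  · subst hs1
    have := S'.le_head_one
    omega
  · obtain ⟨-, k⟩ := key (n + 1 - s) (by omega)
    rw [show s + (n + 1 - s) = n + 1 by omega, S'.head_succ] at k
    omega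

/-- Now `n + 1, n + 2, n + 3` go to `s + 1, s + 2, s + 3`. If `s ≤ n`, no place is left for `n`,
which has an edge to `n + 2`. If `s = n + 1`, the edges of `1` and `2` give `f' = n + 2` with head
`n + 4`, so that `n + 3` is ascending in the second tree; but the image of `(n + 2, n + 3)` gives it
the head `n + 4`. -/
theorem not_low_last (S : Shape n f a A q) (S' : Shape n f' a' A' q') (N : Near n q q' lam mu)
    {s : ℕ} (hs : 1 ≤ s) (hs' : s ≤ n + 1) (hfix : ∀ u, u < s → lam u = u)
    (hr : lam (2 * n + 2) = s) (hc : Bad n q q' lam (2 * n + 1) (2 * n + 2)) : False := by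
  have hn := S.three_le
  obtain ⟨b0, -, hin⟩ := N.root_first S S' hs (by omega) hfix hr
  have good : ∀ u v, Edge n q u v → ¬ (s = u ∧ s - 1 = v) →
      ¬ (2 * n + 1 = u ∧ 2 * n + 2 = v) → Edge n q' (lam u) (lam v) := fun u v he =>
    N.good b0 hc (by omega) he
  have l1 : lam (n + 1) = s + 1 := by
    refine hin _ (by omega) (by omega) S.head_succ (fun hb => hb.2 ?_)
    exact good _ _ hb.1 (by omega) (by omega)
  have hex : ∀ c, n < c → c ≤ 2 * n + 1 → q c = 2 * n + 2 → c = n + 1 ∨ c = 2 * n + 1 := by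
    intro c h1 h2 h3
    by_contra hne
    have := hin c (by omega) h2 h3 (fun hb => hb.2 (good _ _ hb.1 (by omega) (by omega)))
    have := N.inj (u := c) (v := n + 1) (by omega) (by omega) (by omega)
    omega
  obtain ⟨e1, e2, e3, e4⟩ := S.of_two hex
  have ge : ∀ u, s ≤ u → u ≤ 2 * n + 2 → s ≤ lam u := by
    intro u hu hu'
    by_contra hlt
    have := N.inj (by omega) hu' (hfix (lam u) (by omega))
    omega
  have l2 : lam (n + 2) = s + 2 := by
    have g := good (n + 2) (n + 1) (edge_path (by omega) (by omega)) (by omega) (by omega)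
    rw [l1] at g
    rcases g with ⟨h1, h2, h3⟩ | ⟨h1, h2, h3⟩
    · omega
    · have h4 := S'.lt _ h1 h2
      have := ge (n + 2) (by omega) (by omega)
      have := N.inj (u := n + 2) (v := 2 * n + 2) (by omega) (by omega) (by omega)
      omega
  have l3 : lam (n + 3) = s + 3 := by
    have g1 := good (n + 2) (n + 3) (edge_tree (by omega) (by omega) (e4 _ le_rfl (by omega)))
      (by omega) (by omega)
    have g2 := good (n + 3) (n + 2) (edge_path (by omega) (by omega)) (by omega) (by omega)
    rw [l2] at g1 g2
    rcases g1 with ⟨h1, h2, h3⟩ | ⟨h1, h2, h3⟩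
    · have := N.inj (u := n + 3) (v := n + 1) (by omega) (by omega) (by omega)
      omega
    · rcases g2 with ⟨h4, h5, h6⟩ | ⟨h4, h5, h6⟩
      · omega
      · have := S'.lt _ h4 h5
        have := S'.lt _ h1 h2
        omega
  by_cases hsn : s ≤ n
  · have g := good n (n + 2) (edge_tree (by omega) (by omega) e3) (by omega) (by omega)
    rw [l2] at g
    rcases g with ⟨h1, h2, h3⟩ | ⟨h1, h2, h3⟩
    · have := N.inj (u := n) (v := n + 3) (by omega) (by omega) (by omega)
      omega
    · have := S'.lt _ h1 h2
      have := ge n hsn (by omega)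
      have i1 := N.inj (u := n) (v := 2 * n + 2) (by omega) (by omega)
      have i2 := N.inj (u := n) (v := n + 1) (by omega) (by omega)
      omega
  · have es : s = n + 1 := by omega
    subst es
    have f2 : q' 2 = 3 := by
      have g := good 2 3 (edge_tree (by omega) (by omega) (e2 2 le_rfl (by omega))) (by omega)
        (by omega)
      rw [hfix 2 (by omega), hfix 3 (by omega)] at g
      rcases g with ⟨h1, h2, h3⟩ | ⟨h1, h2, h3⟩ <;> omega
    have f1 : q' 1 = n + 4 := by
      have g := good 1 (n + 3) (edge_tree (by omega) (by omega) e1) (by omega) (by omega)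
      rw [hfix 1 (by omega), l3] at g
      rcases g with ⟨h1, h2, h3⟩ | ⟨h1, h2, h3⟩ <;> omega
    have hf' := S'.head_two f2
    subst hf'
    have g := good (n + 2) (n + 3) (edge_tree (by omega) (by omega) (e4 _ le_rfl (by omega)))
      (by omega) (by omega)
    rw [l2, l3] at g
    have hq1 := S'.first (by omega) 1 le_rfl (by omega)
    have hA := (S'.desc (n + 2) le_rfl (by omega) S'.not_asc_fixed).2.2 (n + 3) (by omega)
      (by omega)
    have := S'.asc (n + 3) (by omega) (by omega) hA
    rcases g with ⟨h1, h2, h3⟩ | ⟨h1, h2, h3⟩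
    · omega
    · rw [show n + 1 + 2 = n + 3 by omega] at h3
      omega

end Near
end Watermark

/-! ### Rigidity: the root is not exchanged with a large vertex; conclusion. -/

namespace Watermark
namespace Near

variable {n f a f' a' : ℕ} {A A' : ℕ → Prop} {q q' lam mu : ℕ → ℕ}

/-- The situation in which the root is exchanged with a large vertex `s` below which every vertex
is fixed. -/
structure Swap (n : ℕ) (q q' lam mu : ℕ → ℕ) (s : ℕ) : Prop where
  near : Near n q q' lam mu
  le_s : n + 2 ≤ s
  s_le : s ≤ 2 * n + 1
  fix : ∀ u, u < s → lam u = u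
  root : lam (2 * n + 2) = s
  good : ∀ u v, Edge n q u v → ¬ (s = u ∧ s - 1 = v) → ¬ (n + 1 = u ∧ 2 * n + 2 = v) →
    Edge n q' (lam u) (lam v)
  lam_s : lam s = 2 * n + 2
  lam_last : lam (2 * n + 1) = s + 1
  head_s : q' s = s + 1
  ne_root : ∀ c, s ≤ c → c ≤ 2 * n → q c ≠ 2 * n + 2
  eq_s : ∀ c, n + 1 < c → c < s → q c = 2 * n + 2 → q' c = s

/-- `n + 1` is fixed and has no edge to `s`, so its edge into the root is bad and, with `(s, s -
1)`, the bad edges are known. The vertex sent to the root has a bad edge and is not below `s`, hence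
it is `s`. No ascending vertex from `s` on other than `2n + 1` is possible, as all would have to go
to `s + 1`. -/
theorem swap (S : Shape n f a A q) (S' : Shape n f' a' A' q') (N : Near n q q' lam mu)
    {s : ℕ} (hs : n + 2 ≤ s) (hs' : s ≤ 2 * n + 1) (hfix : ∀ u, u < s → lam u = u)
    (hr : lam (2 * n + 2) = s) : Swap n q q' lam mu s := by
  have hn := S.three_le
  obtain ⟨b0, ⟨c, hc, bc⟩, hin⟩ := N.root_first S S' (by omega) hs' hfix hr
  obtain rfl : c = n + 1 := by omega
  have good : ∀ u v, Edge n q u v → ¬ (s = u ∧ s - 1 = v) → ¬ (n + 1 = u ∧ 2 * n + 2 = v) →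
      Edge n q' (lam u) (lam v) := fun u v he => N.good b0 bc (by omega) he
  have l0 : lam (2 * n + 1) = s + 1 := by
    refine hin _ (by omega) le_rfl S.head_last (fun hb => hb.2 ?_)
    exact good _ _ hb.1 (by omega) (by omega)
  have hq := N.lam_last (by omega) hfix hr
    (good _ _ (Or.inl ⟨by omega, le_rfl, by omega⟩) (by omega) (by omega))
  refine ⟨N, hs, hs', hfix, hr, good, ?_, l0, by omega, ?_, ?_⟩
  · have hx := N.right (2 * n + 2) le_rfl
    have hx' := N.mu_le (2 * n + 2) le_rfl
    set x := mu (2 * n + 2) with hxd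
    have hx0 : s ≤ x := by
      by_contra hlt
      have := hfix x (by omega)
      omega
    have hxr : x ≠ 2 * n + 2 := by
      intro e
      rw [e, hr] at hx
      omega
    by_contra hne
    have hxs : x ≠ s := by
      intro e
      rw [e] at hx
      exact hne hx
    rcases N.exists_bad_of_lam_root S hx (by omega) (by omega) with hb | hb
    · exact hb.2 (good _ _ hb.1 (by omega) (by omega))
    · exact hb.2 (good _ _ hb.1 (by omega) (by omega))
  · intro c hc hc' hq
    have := hin c hc (by omega) hq (fun hb => hb.2 (good _ _ hb.1 (by omega) (by omega)))
    have := N.inj (u := c) (v := 2 * n + 1) (by omega) (by omega) (by omega)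
    omega
  · intro c hc hc' hq
    have g := good c (2 * n + 2) (edge_tree (by omega) (by omega) hq) (by omega) (by omega)
    rw [hfix c hc', hr] at g
    rcases g with ⟨h1, h2, h3⟩ | ⟨h1, h2, h3⟩
    · omega
    · exact h3.symm

namespace Swap

variable {s : ℕ}

theorem symm (S : Shape n f a A q) (S' : Shape n f' a' A' q') (W : Swap n q q' lam mu s) :
    Swap n q' q mu lam s := by
  have hs := W.le_s
  have hs' := W.s_le
  refine W.near.symm.swap S' S W.le_s W.s_le (fun u hu => ?_) ?_
  · have := W.near.left u (by omega)
    rwa [W.fix u hu] at this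
  · have := W.near.left s (by omega)
    rwa [W.lam_s] at this

theorem not_asc (S : Shape n f a A q) (W : Swap n q q' lam mu s) {c : ℕ} (hc : s ≤ c)
    (hc' : c ≤ 2 * n) : ¬ A c := by
  have hs := W.le_s
  exact fun hA => W.ne_root c hc hc' (S.asc c (by omega) (by omega) hA)

/-- If `f = 2n + 1` then `n + 1, …, 2n` are ascending, which forces `s = 2n + 1`; in the second tree
`n + 2, …, 2n` would then share the head `2n + 1`. But non-ascending vertices form a chain, and `n ≥
3` provides two of them. -/
theorem fixed_ne_last (S : Shape n f a A q) (S' : Shape n f' a' A' q')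
    (W : Swap n q q' lam mu s) : f ≤ 2 * n := by
  by_contra hl
  have hn := S.three_le
  have hs := W.le_s
  have hs' := W.s_le
  have hf := S.fixed_le
  have hs1 : s = 2 * n + 1 := by
    by_contra hne
    exact W.not_asc S (c := 2 * n) (by omega) le_rfl (S.asc_of_lt _ (by omega) (by omega))
  have h1 : ∀ c, n + 1 < c → c ≤ 2 * n → q' c = 2 * n + 1 := by
    intro c hc hc'
    rw [W.eq_s c hc (by omega) (S.asc c (by omega) (by omega) (S.asc_of_lt _ (by omega) (by omega)))]
    exact hs1
  have h2 : ∀ c, n + 1 < c → c ≤ 2 * n → ¬ A' c := by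
    intro c hc hc' hA
    have := S'.asc c (by omega) (by omega) hA
    have := h1 c hc hc'
    omega
  have h3 := S'.fixed_le_of_not_asc (by omega) (h2 (2 * n - 1) (by omega) (by omega))
  refine h2 (2 * n) (by omega) le_rfl
    ((S'.desc (2 * n - 1) h3 (by omega) (h2 _ (by omega) (by omega))).2.2 (2 * n) (by omega) ?_)
  rw [h1 (2 * n - 1) (by omega) (by omega)]
  omega

/-- The greatest element that is not ascending in an interval that starts at the fixed vertex. -/
theorem _root_.Watermark.Shape.exists_pred (S : Shape n f a A q) {x : ℕ} (hx : f < x)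
    (hx' : x ≤ 2 * n + 1) (hA : x ≤ 2 * n → ¬ A x) :
    ∃ p, f ≤ p ∧ p < x ∧ ¬ A p ∧ q p = x := by
  classical
  obtain ⟨p, hp, hmax⟩ : ∃ p, (f ≤ p ∧ p < x ∧ ¬ A p) ∧ ∀ y, p < y → y < x → A y := by
    have h0 : f ≤ x - 1 := by omega
    have := Nat.findGreatest_spec (P := fun p => f ≤ p ∧ ¬ A p) h0 ⟨le_rfl, S.not_asc_fixed⟩
    refine ⟨Nat.findGreatest (fun p => f ≤ p ∧ ¬ A p) (x - 1), ⟨this.1, ?_, this.2⟩, ?_⟩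
    · have := Nat.findGreatest_le (P := fun p => f ≤ p ∧ ¬ A p) (x - 1)
      omega
    · intro y hy hy'
      have := Nat.findGreatest_is_greatest (P := fun p => f ≤ p ∧ ¬ A p) hy (by omega)
      by_contra hc
      exact this ⟨by omega, hc⟩
  obtain ⟨d1, d2, d3⟩ := S.desc p hp.1 (by omega) hp.2.2
  have hf := S.le_fixed
  have hlt := S.lt p (by omega) (by omega)
  refine ⟨p, hp.1, hp.2.1, hp.2.2, ?_⟩
  rcases lt_trichotomy (q p) x with h | h | h
  · exact absurd (hmax _ hlt h) (d2 (by omega))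
  · exact h
  · exact absurd (d3 x hp.2.1 h) (hA (by omega))

/-- If `f < s`, climb the chain of non-ascending vertices from `f` to `s`. Below `s` all vertices
and their heads are fixed, so by induction the chain members above `f` are non-ascending in the
second tree too. The last one before `s` then acquires the root as its head, which is impossible.
The vertex `1`, which has the head of `f`, stands in for `f`, of which nothing is known in the
second tree. -/
theorem s_le_fixed (S : Shape n f a A q) (S' : Shape n f' a' A' q')
    (W : Swap n q q' lam mu s) : s ≤ f := by
  by_contra hfs
  have hn := S.three_le
  have hs := W.le_s
  have hs' := W.s_le
  have hf := W.fixed_ne_last S S'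
  have hf' := (W.symm S S').fixed_ne_last S' S
  have hflo := S.le_fixed
  have hflo' := S'.le_fixed
  have fixed : ∀ u v, n + 1 ≠ u → u < s → v < s → 1 ≤ u → q u = v → q' u = v := by
    intro u v hne hu hv hu1 hq
    have hlt := S.lt u hu1 (by omega)
    have g := W.good u v (edge_tree hu1 (by omega) hq) (by omega) (by omega)
    rw [W.fix u hu, W.fix v hv] at g
    rcases g with ⟨h1, h2, h3⟩ | ⟨h1, h2, h3⟩
    · omega
    · exact h3.symm
  have q1 := S.first hf 1 le_rfl (by omega)
  have q1' := S'.first hf' 1 le_rfl (by omega)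
  have dF' := S'.desc f' le_rfl hf' S'.not_asc_fixed
  have key : ∀ x, f < x → x < s → ¬ A x → ¬ A' x := by
    intro x
    induction x using Nat.strong_induction_on with
    | _ x ih =>
      intro hx hxs hA
      obtain ⟨p, h1, h2, h3, h4⟩ := S.exists_pred hx (by omega) (fun _ => hA)
      rcases h1.eq_or_lt with e | h1
      · have h5 := fixed 1 x (by omega) (by omega) hxs le_rfl (by rw [q1, e, h4])
        have h6 := dF'.2.1
        rw [← q1', h5] at h6
        exact h6 (by omega)
      · have h5 := ih p h2 h1 (by omega) h3
        have h6 := fixed p x (by omega) (by omega) hxs (by omega) h4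
        have h7 := (S'.desc p (S'.fixed_le_of_not_asc (by omega) h5) (by omega) h5).2.1
        rw [h6] at h7
        exact h7 (by omega)
  obtain ⟨p, h1, h2, h3, h4⟩ := S.exists_pred (x := s) (by omega) hs'
    (fun h => W.not_asc S le_rfl h)
  have toroot : ∀ u, n + 1 ≠ u → u < s → 1 ≤ u → q u = s → q' u = 2 * n + 2 := by
    intro u hne hu hu1 hq
    have hlt := S.lt u hu1 (by omega)
    have g := W.good u s (edge_tree hu1 (by omega) hq) (by omega) (by omega)
    rw [W.fix u hu, W.lam_s] at g
    rcases g with ⟨h1, h2, h3⟩ | ⟨h1, h2, h3⟩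
    · omega
    · exact h3.symm
  rcases h1.eq_or_lt with e | h1
  · have := toroot 1 (by omega) (by omega) le_rfl (by rw [q1, e, h4])
    rw [q1'] at this
    omega
  · have h5 := key p h1 h2 h3
    have h6 := toroot p (by omega) h2 (by omega) h4
    have h7 := (S'.desc p (S'.fixed_le_of_not_asc (by omega) h5) (by omega) h5).1
    omega

theorem fixed_eq (S : Shape n f a A q) (S' : Shape n f' a' A' q')
    (W : Swap n q q' lam mu s) : f = s := by
  have h1 := W.s_le_fixed S S'
  have h2 := W.fixed_ne_last S S'
  have h3 := W.le_s
  by_contra hne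
  exact W.not_asc S le_rfl (by omega) (S.asc_of_lt s (by omega) (by omega))

/-- By symmetry `f = f' = s`. If `s > n + 2`, then `n + 2` is ascending in both trees, against
`eq_s`. So `s = n + 2`, and the edge from `1` to `q 1 = s + 1` goes to an edge from `1` to `2n + 1`,
while `q' 1 = s + 1 = n + 3 < 2n + 1`. -/
theorem false (S : Shape n f a A q) (S' : Shape n f' a' A' q')
    (W : Swap n q q' lam mu s) : False := by
  have hn := S.three_le
  have W' := W.symm S S'
  have hf := W.fixed_ne_last S S'
  obtain rfl := W.fixed_eq S S'
  obtain rfl := W'.fixed_eq S' S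
  have hs := W.le_s
  have h2 : f' = n + 2 := by
    by_contra hne
    have h1 := S.asc (n + 2) (by omega) (by omega) (S.asc_of_lt _ (by omega) (by omega))
    have h2 := S'.asc (n + 2) (by omega) (by omega) (S'.asc_of_lt _ (by omega) (by omega))
    have := W.eq_s (n + 2) (by omega) (by omega) h1
    omega
  have q1 := S.first hf 1 le_rfl (by omega)
  have q1' := S'.first hf 1 le_rfl (by omega)
  rw [W'.head_s] at q1
  rw [W.head_s] at q1'
  have g := W.good 1 (f' + 1) (edge_tree le_rfl (by omega) q1) (by omega) (by omega)
  have hl : lam (f' + 1) = 2 * n + 1 := by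
    rw [← W'.lam_last, W.near.right _ (by omega)]
  rw [W.fix 1 (by omega), hl] at g
  rcases g with ⟨h1, h2, h3⟩ | ⟨h1, h2, h3⟩ <;> omega

end Swap

theorem not_root_first (S : Shape n f a A q) (S' : Shape n f' a' A' q') (N : Near n q q' lam mu)
    {s : ℕ} (hs : 1 ≤ s) (hs' : s ≤ 2 * n + 1) (hfix : ∀ u, u < s → lam u = u)
    (hr : lam (2 * n + 2) = s) : False := by
  by_cases hsn : s ≤ n + 1
  · obtain ⟨b0, ⟨c, hc, bc⟩, hin⟩ := N.root_first S S' hs hs' hfix hr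
    rcases hc with rfl | ⟨rfl, -⟩
    · exact N.not_low_first S S' hs hsn hfix hr bc
    · exact N.not_low_last S S' hs hsn hfix hr bc
  · exact (N.swap S S' (by omega) hs' hfix hr).false S S'

/-- Watermarks are rigid: a bijection that maps all but two edges to edges is the identity. -/
theorem eq_id (S : Shape n f a A q) (S' : Shape n f' a' A' q') (N : Near n q q' lam mu) :
    ∀ u, u ≤ 2 * n + 2 → lam u = u := by
  by_cases hr : lam (2 * n + 2) = 2 * n + 2
  · exact N.eq_of_root_fixed S S' hr
  exfalso
  by_cases h0 : lam 0 = 0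
  · obtain ⟨l, hl, hfix, hne, hb⟩ := N.exists_initial S' h0 (fun h => hr (h _ le_rfl))
    have hfix' : ∀ u, u < l + 1 → lam u = u := fun u hu => hfix u (by omega)
    have hls : l + 1 ≤ 2 * n + 1 := by
      by_contra hgt
      have h1 := N.lam_le (2 * n + 2) le_rfl
      have := N.inj (by omega) le_rfl (hfix (lam (2 * n + 2)) (by omega))
      omega
    have hx := N.right (2 * n + 2) le_rfl
    have hx' := N.mu_le (2 * n + 2) le_rfl
    have hw := N.right (l + 1) (by omega)
    have hw' := N.mu_le (l + 1) (by omega)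
    obtain ⟨x, hxd⟩ : ∃ x, mu (2 * n + 2) = x := ⟨_, rfl⟩
    obtain ⟨w, hwd⟩ : ∃ w, mu (l + 1) = w := ⟨_, rfl⟩
    rw [hxd] at hx hx'
    rw [hwd] at hw hw'
    by_cases hwr : w = 2 * n + 2
    · rw [hwr] at hw
      exact N.not_root_first S S' (by omega) hls hfix' hw
    by_cases hxs : x = l + 1
    · refine N.symm.not_root_first S' S (s := l + 1) (by omega) hls (fun u hu => ?_) (by omega)
      have := N.left u (by omega)
      rwa [hfix' u hu] at this
    have hx0 : x ≠ 0 := by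
      intro e
      rw [e] at hx
      omega
    have hxr : x ≠ 2 * n + 2 := by
      intro e
      rw [e] at hx
      exact hr hx
    have hwl : l < w := by
      by_contra hge
      have := hfix w (by omega)
      omega
    have hwx : w ≠ x := by
      intro e
      rw [e] at hw
      omega
    have hws : w ≠ l + 1 := by
      intro e
      rw [e] at hw
      exact hne hw
    -- The bad edges are `(l + 1, l)` and one at the vertex `x` sent to the root, so both edges of
    -- the vertex `w` sent to `l + 1` survive.
    have fin : ∀ v, Bad n q q' lam x v → False := by
      intro v bx
      exact hws (N.eq_of_good S (hfix l le_rfl) hw hwl (by omega) (by omega)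
        (N.good hb bx (by omega) (edge_path (by omega) (by omega)) (by omega) (by omega))
        (N.good hb bx (by omega) (edge_tree (by omega) (by omega) rfl) (by omega) (by omega)))
    rcases N.exists_bad_of_lam_root S hx (by omega) (by omega) with h | h
    · exact fin _ h
    · exact fin _ h
  · have hz := N.right 0 (by omega)
    have hz' := N.mu_le 0 (by omega)
    obtain ⟨z, hzd⟩ : ∃ z, mu 0 = z := ⟨_, rfl⟩
    rw [hzd] at hz hz'
    have hz0 : z ≠ 0 := by
      intro e
      rw [e] at hz
      exact h0 hz
    by_cases hzr : z = 2 * n + 2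
    · rw [hzr] at hz
      exact N.not_root_zero S S' hz
    · exact N.not_of_source S S' hz (by omega) (by omega) hr

end Near
end Watermark

namespace Watermark

/-! ### Restoring a tree from which at most two edges are missing -/

/-- `par` is the parent function of the tree given by `q` with at most two edges missing. -/
structure Forest (n : ℕ) (q par : ℕ → ℕ) : Prop where
  eq : ∀ u, 1 ≤ u → u ≤ 2 * n + 1 → par u = 0 ∨ par u = q u
  root : par (2 * n + 2) = 0
  two : ∀ u v w, 1 ≤ u → u ≤ 2 * n + 1 → 1 ≤ v → v ≤ 2 * n + 1 → 1 ≤ w → w ≤ 2 * n + 1 →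
    par u = 0 → par v = 0 → par w = 0 → u = v ∨ u = w ∨ v = w

/-- The number `cc` of the children, the greatest child `mc`, the rightmost vertex `rm` of the
subtree and the root `ro` of the tree of each vertex. -/
structure Tables (n : ℕ) (par cc mc rm ro : ℕ → ℕ) : Prop where
  cc_eq : ∀ v, 1 ≤ v → v ≤ 2 * n + 2 →
    cc v = ((Finset.Icc 1 (2 * n + 1)).filter (fun u => par u = v)).card
  mc_spec : ∀ v, 1 ≤ v → v ≤ 2 * n + 2 → cc v ≠ 0 →
    1 ≤ mc v ∧ mc v ≤ 2 * n + 1 ∧ par (mc v) = v ∧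
      ∀ u, 1 ≤ u → u ≤ 2 * n + 1 → par u = v → u ≤ mc v
  rm_leaf : ∀ v, 1 ≤ v → v ≤ 2 * n + 2 → cc v = 0 → rm v = v
  rm_node : ∀ v, 1 ≤ v → v ≤ 2 * n + 2 → cc v ≠ 0 → rm v = rm (mc v)
  ro_root : ∀ v, 1 ≤ v → v ≤ 2 * n + 2 → par v = 0 → ro v = v
  ro_node : ∀ v, 1 ≤ v → v ≤ 2 * n + 2 → par v ≠ 0 → ro v = ro (par v)

/-- `de` marks the proper descendants of `x`. -/
structure Marks (n : ℕ) (par : ℕ → ℕ) (x : ℕ) (de : ℕ → ℕ) : Prop where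
  root : ∀ v, 1 ≤ v → v ≤ 2 * n + 2 → par v = 0 → de v = 0
  child : ∀ v, 1 ≤ v → v ≤ 2 * n + 2 → par v ≠ 0 → par v = x → de v = 1
  node : ∀ v, 1 ≤ v → v ≤ 2 * n + 2 → par v ≠ 0 → par v ≠ x → de v = de (par v)

/-- The test of the second rule for the fixed vertex. -/
def Pass (n : ℕ) (ro de : ℕ → ℕ) (x r : ℕ) : Prop :=
  (∀ v, 1 ≤ v → v ≤ 2 * n + 1 → ¬ (x ≤ v + n ∧ v ≤ n) → de v ≠ 1) ∧
  (∀ v, 1 ≤ v → v ≤ 2 * n + 1 → (x ≤ v + n ∧ v ≤ n) → de v = 0 → ro v = r) ∧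
  ∀ v, 1 ≤ v → v ≤ 2 * n + 1 → ¬ ((x ≤ v + n ∧ v ≤ n) ∧ de v = 0) → ro v ≠ r

/-- `r` is the greatest unmarked vertex of `{x - n, …, n}`, or `0` if there is none. -/
def IsTop (n : ℕ) (de : ℕ → ℕ) (x r : ℕ) : Prop :=
  (∀ v, 1 ≤ v → x ≤ v + n → v ≤ n → de v = 0 → v ≤ r) ∧
    (r = 0 ∨ (1 ≤ r ∧ x ≤ r + n ∧ r ≤ n ∧ de r = 0))

namespace Shape

variable {n f a : ℕ} {A : ℕ → Prop} {q : ℕ → ℕ}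

/-- The children of a vertex `x`, seen from below. -/
theorem child_cases (S : Shape n f a A q) (hf : f ≤ 2 * n) {u : ℕ} (hu : 1 ≤ u)
    (hu' : u ≤ 2 * n + 1) :
    (u + n < f ∧ q u = q f) ∨ (f ≤ u + n ∧ u ≤ n ∧ (q u = f ∨ (u < q u ∧ q u ≤ n ∧ a < q u))) ∨
    (n < u ∧ A u ∧ q u = 2 * n + 2) ∨
    (f ≤ u ∧ u ≤ 2 * n ∧ ¬ A u ∧ u < q u ∧ q u ≤ 2 * n + 1 ∧ (q u ≤ 2 * n → ¬ A (q u))) := by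
  have hlo := S.le_fixed
  have hlt := S.lt u hu hu'
  by_cases h1 : u + n < f
  · exact Or.inl ⟨h1, S.first hf u hu h1⟩
  right
  by_cases h2 : u ≤ n
  · left
    refine ⟨by omega, h2, ?_⟩
    by_cases h3 : u ≤ a
    · rcases S.hang hf u (by omega) h3 with h | h
      · exact Or.inl h
      · exact Or.inr ⟨hlt, h.2, h.1⟩
    · by_cases h4 : u = n
      · left
        rw [h4]
        exact S.top hf
      · have := S.chain hf u (by omega) (by omega)
        right
        omega
  right
  by_cases hA : A u
  · exact Or.inl ⟨by omega, hA, S.asc u (by omega) hu' hA⟩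
  · right
    have h3 := S.fixed_le_of_not_asc (by omega) hA
    have h4 : u ≤ 2 * n := by
      by_contra h
      obtain rfl : u = 2 * n + 1 := by omega
      exact hA (S.asc_last hf)
    have h5 := S.desc u h3 h4 hA
    exact ⟨h3, h4, hA, hlt, h5.1, h5.2.1⟩

theorem fixed_lt_head (S : Shape n f a A q) (hf : f ≤ 2 * n) : f < q f ∧ q f ≤ 2 * n + 1 := by
  have := S.le_fixed
  exact ⟨S.lt f (by omega) (by omega), (S.desc f le_rfl hf S.not_asc_fixed).1⟩

theorem first_one (S : Shape n f a A q) (hf : f ≤ 2 * n) : q 1 = q f :=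
  S.first hf 1 le_rfl (by have := S.le_fixed; omega)

theorem asc_iff (S : Shape n f a A q) (hf : f ≤ 2 * n) {x : ℕ} (hx : n < x)
    (hx' : x ≤ 2 * n + 1) : A x ↔ q x = 2 * n + 2 := by
  refine ⟨S.asc x hx hx', fun h => ?_⟩
  rcases hx'.eq_or_lt with e | h'
  · rw [e]
    exact S.asc_last hf
  · exact S.asc_of_head_eq hx (by omega) h

end Shape

namespace Tables

variable {n : ℕ} {par cc mc rm ro : ℕ → ℕ}

theorem cc_ne_zero (T : Tables n par cc mc rm ro) {u v : ℕ} (hu : 1 ≤ u) (hu' : u ≤ 2 * n + 1)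
    (hv : 1 ≤ v) (hv' : v ≤ 2 * n + 2) (h : par u = v) : cc v ≠ 0 := by
  rw [T.cc_eq v hv hv']
  exact Finset.card_ne_zero_of_mem (a := u) (by simp [hu, hu', h])

theorem cc_eq_zero (T : Tables n par cc mc rm ro) {v : ℕ}
    (hv : 1 ≤ v) (hv' : v ≤ 2 * n + 2) (h : ∀ u, 1 ≤ u → u ≤ 2 * n + 1 → par u ≠ v) :
    cc v = 0 := by
  by_contra hc
  obtain ⟨h1, h2, h3, -⟩ := T.mc_spec v hv hv' hc
  exact h _ h1 h2 h3

theorem one_lt_cc (T : Tables n par cc mc rm ro) {u u' v : ℕ} (hu : 1 ≤ u) (hu' : u ≤ 2 * n + 1)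
    (hw : 1 ≤ u') (hw' : u' ≤ 2 * n + 1) (hne : u ≠ u')
    (hv : 1 ≤ v) (hv' : v ≤ 2 * n + 2) (h : par u = v) (h' : par u' = v) : 1 < cc v := by
  rw [T.cc_eq v hv hv', Finset.one_lt_card]
  exact ⟨u, by simp [hu, hu', h], u', by simp [hw, hw', h'], hne⟩

theorem exists_sibling (T : Tables n par cc mc rm ro) {u v : ℕ} (hv : 1 ≤ v)
    (hv' : v ≤ 2 * n + 2) (h : 1 < cc v) :
    ∃ u', 1 ≤ u' ∧ u' ≤ 2 * n + 1 ∧ u' ≠ u ∧ par u' = v := by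
  rw [T.cc_eq v hv hv'] at h
  obtain ⟨u', hu', hne⟩ := Finset.exists_mem_ne h u
  simp only [Finset.mem_filter, Finset.mem_Icc] at hu'
  exact ⟨u', hu'.1.1, hu'.1.2, hne, hu'.2⟩

theorem mc_eq (T : Tables n par cc mc rm ro) {u v : ℕ} (hu : 1 ≤ u) (hu' : u ≤ 2 * n + 1)
    (hv : 1 ≤ v) (hv' : v ≤ 2 * n + 2) (h : par u = v)
    (hmax : ∀ w, 1 ≤ w → w ≤ 2 * n + 1 → par w = v → w ≤ u) : cc v ≠ 0 ∧ mc v = u := by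
  have hc := T.cc_ne_zero hu hu' hv hv' h
  obtain ⟨h1, h2, h3, h4⟩ := T.mc_spec v hv hv' hc
  exact ⟨hc, le_antisymm (hmax _ h1 h2 h3) (h4 u hu hu' h)⟩

theorem rm_eq (T : Tables n par cc mc rm ro) {u v : ℕ} (hu : 1 ≤ u) (hu' : u ≤ 2 * n + 1)
    (hv : 1 ≤ v) (hv' : v ≤ 2 * n + 2) (h : par u = v)
    (hmax : ∀ w, 1 ≤ w → w ≤ 2 * n + 1 → par w = v → w ≤ u) : rm v = rm u := by
  obtain ⟨h1, h2⟩ := T.mc_eq hu hu' hv hv' h hmax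
  rw [T.rm_node v hv hv' h1, h2]

end Tables

namespace Forest

variable {n f a : ℕ} {A : ℕ → Prop} {q par cc mc rm ro de : ℕ → ℕ}

theorem head_eq (F : Forest n q par) {u v : ℕ} (hu : 1 ≤ u) (hu' : u ≤ 2 * n + 1)
    (h : par u = v) (hv : 1 ≤ v) : q u = v := by
  rcases F.eq u hu hu' with h1 | h1 <;> omega

theorem par_eq (F : Forest n q par) {u : ℕ} (hu : 1 ≤ u) (hu' : u ≤ 2 * n + 1)
    (h : par u ≠ 0) : par u = q u := by
  rcases F.eq u hu hu' with h1 | h1 <;> omega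

theorem le_head (F : Forest n q par) (S : Shape n f a A q) {u : ℕ} (hu : 1 ≤ u)
    (hu' : u ≤ 2 * n + 1) (h : par u ≠ 0) : u < par u ∧ par u ≤ 2 * n + 2 := by
  rw [F.par_eq hu hu' h]
  exact ⟨S.lt u hu hu', S.le u hu hu'⟩

theorem rm_le (F : Forest n q par) (S : Shape n f a A q) (T : Tables n par cc mc rm ro) :
    ∀ v, 1 ≤ v → v ≤ 2 * n + 2 → rm v ≤ v := by
  intro v
  induction v using Nat.strong_induction_on with
  | _ v ih =>
    intro hv hv'
    by_cases hc : cc v = 0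
    · exact (T.rm_leaf v hv hv' hc).le
    · obtain ⟨h1, h2, h3, -⟩ := T.mc_spec v hv hv' hc
      have := F.le_head S h1 h2 (by omega)
      rw [T.rm_node v hv hv' hc]
      have := ih (mc v) (by omega) h1 (by omega)
      omega

theorem le_ro (F : Forest n q par) (S : Shape n f a A q) (T : Tables n par cc mc rm ro) :
    ∀ k v, 2 * n + 2 - v = k → 1 ≤ v → v ≤ 2 * n + 2 → v ≤ ro v := by
  intro k
  induction k using Nat.strong_induction_on with
  | _ k ih =>
    intro v hk hv hv'
    by_cases hc : par v = 0
    · exact (T.ro_root v hv hv' hc).ge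
    · have hv2 : v ≤ 2 * n + 1 := by
        by_contra h
        obtain rfl : v = 2 * n + 2 := by omega
        exact hc F.root
      have := F.le_head S hv hv2 hc
      rw [T.ro_node v hv hv' hc]
      have := ih (2 * n + 2 - par v) (by omega) (par v) rfl (by omega) (by omega)
      omega

/-! #### The fixed vertex -/

theorem test_last (F : Forest n q par) (S : Shape n f a A q) (T : Tables n par cc mc rm ro)
    (hf : f = 2 * n + 1) : cc (2 * n + 1) = 0 ∧
      (∀ u, 1 ≤ u → u ≤ n → par u ≠ 2 * n → par u = 0 ∧ cc u = 0) ∧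
      ((Finset.Icc 1 n).filter (fun u => par u ≠ 2 * n)).card ≤ 2 := by
  have hn := S.three_le
  have hq := S.last hf
  have hqL : ∀ u, n < u → u ≤ 2 * n + 1 → q u = 2 * n + 2 := by
    intro u hu hu'
    rcases hu'.eq_or_lt with rfl | h
    · rw [← hf]; exact hq.2
    · exact S.asc u hu hu' (S.asc_of_lt u hu (by omega))
  have hval : ∀ u, 1 ≤ u → u ≤ 2 * n + 1 → q u = 2 * n ∨ q u = 2 * n + 2 := by
    intro u hu hu'
    by_cases h : u ≤ n
    · exact Or.inl (hq.1 u hu h)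
    · exact Or.inr (hqL u (by omega) hu')
  have hleaf : ∀ v, 1 ≤ v → v ≤ 2 * n + 2 → v ≠ 2 * n → v ≠ 2 * n + 2 → cc v = 0 := by
    intro v hv hv' h1 h2
    refine T.cc_eq_zero hv hv' (fun u hu hu' e => ?_)
    have := F.head_eq hu hu' e hv
    rcases hval u hu hu' with h | h <;> omega
  have hzero : ∀ u, 1 ≤ u → u ≤ n → par u ≠ 2 * n → par u = 0 := by
    intro u hu hun h
    rcases F.eq u hu (by omega) with h1 | h1
    · exact h1
    · exact absurd (h1.trans (hq.1 u hu hun)) h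
  refine ⟨hleaf _ (by omega) (by omega) (by omega) (by omega),
    fun u hu hun h => ⟨hzero u hu hun h, hleaf u hu (by omega) (by omega) (by omega)⟩, ?_⟩
  by_contra hc
  obtain ⟨x, hx, y, hy, z, hz, h1, h2, h3⟩ := Finset.two_lt_card.1 (not_le.1 hc)
  simp only [Finset.mem_filter, Finset.mem_Icc] at hx hy hz
  rcases F.two x y z hx.1.1 (by omega) hy.1.1 (by omega) hz.1.1 (by omega)
    (hzero x hx.1.1 hx.1.2 hx.2) (hzero y hy.1.1 hy.1.2 hy.2) (hzero z hz.1.1 hz.1.2 hz.2) with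
    h | h | h <;> contradiction

/-- A small vertex with head `2n` means that `2n` is `f` or the head of `f`. If `f = 2n`, the edges
of `f`, `1` and `2` all lead to `2n + 1`, a leaf, and are missing. Otherwise the edge of `2n` is
missing for the same reason, and so are those of `n` and `n - 1`, which lie below `f` and do not
hang from `2n`. Three missing edges are too many. -/
theorem not_test_last (F : Forest n q par) (S : Shape n f a A q) (T : Tables n par cc mc rm ro)
    (hf : f ≤ 2 * n) (h1 : cc (2 * n + 1) = 0)
    (h2 : ∀ u, 1 ≤ u → u ≤ n → par u ≠ 2 * n → par u = 0 ∧ cc u = 0)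
    (h3 : ((Finset.Icc 1 n).filter (fun u => par u ≠ 2 * n)).card ≤ 2) : False := by
  have hn := S.three_le
  have hlo := S.le_fixed
  have hq := S.fixed_lt_head hf
  obtain ⟨u, hu, hun, hpu⟩ : ∃ u, 1 ≤ u ∧ u ≤ n ∧ par u = 2 * n := by
    by_contra hc
    push Not at hc
    rw [Finset.filter_true_of_mem (fun u hu => by
      simp only [Finset.mem_Icc] at hu; exact hc u hu.1 hu.2)] at h3
    simp at h3
    omega
  have hqu := F.head_eq hu (by omega) hpu (by omega)
  have miss : ∀ u, 1 ≤ u → u ≤ 2 * n + 1 → q u = 2 * n + 1 → par u = 0 := by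
    intro u hu hu' e
    rcases F.eq u hu hu' with h | h
    · exact h
    · exact absurd h1 (T.cc_ne_zero hu hu' (by omega) (by omega) (h.trans e))
  have hcase : 2 * n = f ∨ q f = 2 * n := by
    rcases S.child_cases hf hu (by omega) with h | h | h | h <;> omega
  have q1 := S.first_one hf
  rcases hcase with e | e
  · have m1 := miss f (by omega) (by omega) (by omega)
    have m2 := miss 1 (by omega) (by omega) (by omega)
    have m3 := miss 2 (by omega) (by omega) (by rw [S.first hf 2 (by omega) (by omega)]; omega)
    have := F.two f 1 2 (by omega) (by omega) (by omega) (by omega) (by omega) (by omega) m1 m2 m3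
    omega
  · have hA : ¬ A (2 * n) := by
      have := (S.desc f le_rfl hf S.not_asc_fixed).2.1
      rw [e] at this
      exact this le_rfl
    have hq2 := S.desc (2 * n) (by omega) le_rfl hA
    have hlt := S.lt (2 * n) (by omega) (by omega)
    have m1 := miss (2 * n) (by omega) (by omega) (by omega)
    have miss' : ∀ y, f ≤ y + n → 1 ≤ y → y ≤ n → par y = 0 := by
      intro y hy hy1 hyn
      refine (h2 y hy1 hyn (fun hp => ?_)).1
      have h := F.head_eq hy1 (by omega) hp (by omega)
      rcases S.child_cases hf hy1 (by omega) with h | h | h | h <;> omega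
    have m2 := miss' n (by omega) (by omega) le_rfl
    have m3 := miss' (n - 1) (by omega) (by omega) (by omega)
    have := F.two (2 * n) n (n - 1) (by omega) (by omega) (by omega) (by omega) (by omega)
      (by omega) m1 m2 m3
    omega

/-- Distinct non-ascending large vertices have distinct heads. A large vertex with a sibling under a
parent other than the root is therefore `f`, and its siblings are initial small vertices. -/
theorem rule_one (F : Forest n q par) (S : Shape n f a A q) (T : Tables n par cc mc rm ro)
    (hf : f ≤ 2 * n) {x : ℕ} (hx : n < x) (hx' : x ≤ 2 * n) (h0 : par x ≠ 0)
    (h1 : par x ≠ 2 * n + 2) (h2 : 1 < cc (par x)) : mc (par x) = f := by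
  have hlo := S.le_fixed
  have hq := S.fixed_lt_head hf
  have hp := F.le_head S (by omega) (by omega) h0
  have hpx := F.par_eq (by omega) (by omega) h0
  have hxA : ¬ A x := by
    intro hA
    exact h1 (hpx.trans (S.asc x hx (by omega) hA))
  have hfx := S.fixed_le_of_not_asc hx hxA
  obtain ⟨y, hy1, hy2, hyx, hy⟩ := T.exists_sibling (u := x) (by omega) hp.2 h2
  have hqy := F.head_eq hy1 hy2 hy (by omega)
  have hd := S.desc x hfx hx' hxA
  have large_eq : ∀ z, f ≤ z → z ≤ 2 * n → ¬ A z → q z = q x → z = x := by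
    intro z hz hz' hzA he
    rcases lt_trichotomy z x with h | h | h
    · exact absurd ((S.desc z hz hz' hzA).2.2 x h (by omega)) hxA
    · exact h
    · have := S.lt z (by omega) (by omega)
      exact absurd (hd.2.2 z h (by omega)) hzA
  have hxf : x = f := by
    rcases S.child_cases hf hy1 hy2 with h | h | h | h
    · exact (large_eq f le_rfl hf S.not_asc_fixed (by omega)).symm
    · omega
    · omega
    · exact absurd (large_eq y h.1 h.2.1 h.2.2.1 (by omega)) hyx
  subst hxf
  refine (T.mc_eq (by omega) (by omega) (by omega) hp.2 rfl ?_).2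
  intro w hw1 hw2 hw
  by_contra hgt
  have hqw := F.head_eq hw1 hw2 hw (by omega)
  rcases S.child_cases hf hw1 hw2 with h | h | h | h
  · omega
  · omega
  · omega
  · have := large_eq w h.1 h.2.1 h.2.2.1 (by omega)
    omega

/-- What is missing if the first rule does not apply. -/
theorem missing_of_not_rule_one (F : Forest n q par) (S : Shape n f a A q)
    (T : Tables n par cc mc rm ro) (hf : f ≤ 2 * n)
    (h : ¬ (par f ≠ 0 ∧ par f ≠ 2 * n + 2 ∧ 1 < cc (par f))) :
    par f = 0 ∨ ∀ i, 1 ≤ i → i + n < f → par i = 0 := by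
  by_contra hc
  push Not at hc
  obtain ⟨h0, i, hi, hif, hpi⟩ := hc
  have hlo := S.le_fixed
  have hq := S.fixed_lt_head hf
  have e1 := F.par_eq (by omega) (by omega) h0
  have e2 := F.par_eq hi (by omega) hpi
  have e3 := S.first hf i hi hif
  exact h ⟨h0, by omega, T.one_lt_cc (u := i) (u' := f) hi (by omega) (by omega) (by omega)
    (by omega) (by omega) (by omega) (by omega) rfl⟩

/-- Only `f` and the head of `f` can have small children, so two attempts suffice. -/
theorem rule_two_cases (F : Forest n q par) (S : Shape n f a A q)
    (T : Tables n par cc mc rm ro) (hf : f ≤ 2 * n) {x : ℕ} (hx : n < x) (hx' : x ≤ 2 * n)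
    (hc : cc x ≠ 0) (hm : mc x ≤ n) : x = f ∨ (x = q f ∧ mc x + n < f) := by
  have hlo := S.le_fixed
  obtain ⟨h1, h2, h3, -⟩ := T.mc_spec x (by omega) (by omega) hc
  have h4 := F.head_eq h1 h2 h3 (by omega)
  rcases S.child_cases hf h1 h2 with h | h | h | h <;> omega

/-- The other candidate is the head of `f`. Its small children are among `1, …, f - n - 1`, outside
the set `{x - n, …, n}` to which the test confines the descendants. -/
theorem rule_two_fail (F : Forest n q par) (S : Shape n f a A q)
    (T : Tables n par cc mc rm ro) (hf : f ≤ 2 * n) {x r : ℕ} (hx : n < x) (hx' : x ≤ 2 * n)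
    (hxf : x ≠ f) (hc : cc x ≠ 0) (hm : mc x ≤ n) (D : Marks n par x de) :
    ¬ Pass n ro de x r := by
  intro hp
  obtain ⟨h1, h2, h3, -⟩ := T.mc_spec x (by omega) (by omega) hc
  have hq := S.fixed_lt_head hf
  have := F.rule_two_cases S T hf hx hx' hc hm
  exact hp.1 (mc x) h1 h2 (by omega) (D.child (mc x) h1 (by omega) (by omega) h3)

/-- The marked vertices are those that are not separated from `f` by the missing edge. -/
theorem marks_cases (F : Forest n q par) (S : Shape n f a A q)
    (T : Tables n par cc mc rm ro) (hf : f ≤ 2 * n) (D : Marks n par f de) {y : ℕ}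
    (hy : ∀ v, f ≤ v + n → v ≤ n → par v = 0 → v = y) :
    ∀ k v, n - v = k → f ≤ v + n → v ≤ n →
      (de v = 0 ∧ ro v = y) ∨ (de v = 1 ∧ ro v = ro f) := by
  have hlo := S.le_fixed
  intro k
  induction k using Nat.strong_induction_on with
  | _ k ih =>
    intro v hk hv hvn
    by_cases h0 : par v = 0
    · left
      have := hy v hv hvn h0
      exact ⟨D.root v (by omega) (by omega) h0, by rw [T.ro_root v (by omega) (by omega) h0, this]⟩
    · have hp := F.par_eq (by omega) (by omega) h0
      by_cases h1 : par v = f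
      · right
        refine ⟨D.child v (by omega) (by omega) h0 h1, ?_⟩
        rw [T.ro_node v (by omega) (by omega) h0, h1]
      · rw [D.node v (by omega) (by omega) h0 h1, T.ro_node v (by omega) (by omega) h0]
        rcases S.child_cases hf (u := v) (by omega) (by omega) with h | h | h | h
        · omega
        · exact ih (n - par v) (by omega) (par v) rfl (by omega) (by omega)
        · omega
        · omega

/-- Outside `{f - n, …, n}` there are no proper descendants of `f`. -/
theorem not_marked (F : Forest n q par) (S : Shape n f a A q) (hf : f ≤ 2 * n)
    (D : Marks n par f de) :
    ∀ k v, 2 * n + 2 - v = k → 1 ≤ v → v ≤ 2 * n + 2 → ¬ (f ≤ v + n ∧ v ≤ n) → de v = 0 := by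
  have hlo := S.le_fixed
  have hq := S.fixed_lt_head hf
  intro k
  induction k using Nat.strong_induction_on with
  | _ k ih =>
    intro v hk hv hv' hout
    by_cases h0 : par v = 0
    · exact D.root v hv hv' h0
    · have hv2 : v ≤ 2 * n + 1 := by
        by_contra h
        obtain rfl : v = 2 * n + 2 := by omega
        exact h0 F.root
      have hp := F.par_eq hv hv2 h0
      have hlt := F.le_head S hv hv2 h0
      rcases S.child_cases hf hv hv2 with h | h | h | h
      all_goals
        first
        | omega
        | rw [D.node v hv hv' h0 (by omega)]
          exact ih (2 * n + 2 - par v) (by omega) (par v) rfl (by omega) hlt.2 (by omega)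

/-- No edge leads from outside `{f - n, …, n}` into it: the edges ascend, and the initial small
vertices have a large head. -/
theorem ro_outside (F : Forest n q par) (S : Shape n f a A q) (T : Tables n par cc mc rm ro)
    (hf : f ≤ 2 * n) {v : ℕ} (hv : 1 ≤ v) (hv' : v ≤ 2 * n + 1) (hout : ¬ (f ≤ v + n ∧ v ≤ n)) :
    ro v + n < f ∧ 1 ≤ ro v ∨ n < ro v := by
  have hlo := S.le_fixed
  have hq := S.fixed_lt_head hf
  have h1 := F.le_ro S T _ v rfl hv (by omega)
  by_cases hvn : n < v
  · right; omega
  · by_cases h0 : par v = 0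
    · left
      have := T.ro_root v hv (by omega) h0
      omega
    · right
      have h2 := F.par_eq hv hv' h0
      have h3 := S.first hf v hv (by omega)
      rw [T.ro_node v hv (by omega) h0, h2, h3]
      have := F.le_ro S T _ (q f) rfl (by omega) (by omega)
      omega

/-- When the first rule fails, an edge outside `{f - n, …, n}` is missing, so at most one is missing
inside. If `y` is its tail, the unmarked vertices are those of the tree with root `y`. Since edges
ascend, `y` is the greatest of them and thus the `r` of the test; if there is no such `y`, both are
`0`. -/
theorem rule_two_pass (F : Forest n q par) (S : Shape n f a A q)
    (T : Tables n par cc mc rm ro) (hf : f ≤ 2 * n) (D : Marks n par f de) {r : ℕ}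
    (h1 : ¬ (par f ≠ 0 ∧ par f ≠ 2 * n + 2 ∧ 1 < cc (par f))) (hr : IsTop n de f r) :
    Pass n ro de f r := by
  have hlo := S.le_fixed
  have hq := S.fixed_lt_head hf
  have hmiss : ∃ e, 1 ≤ e ∧ e ≤ 2 * n + 1 ∧ par e = 0 ∧ ¬ (f ≤ e + n ∧ e ≤ n) := by
    rcases F.missing_of_not_rule_one S T hf h1 with h | h
    · exact ⟨f, by omega, by omega, h, by omega⟩
    · exact ⟨1, le_rfl, by omega, h 1 le_rfl (by omega), by omega⟩
  obtain ⟨e, he1, he2, he, heo⟩ := hmiss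
  obtain ⟨y, hy, hy'⟩ : ∃ y, (∀ v, f ≤ v + n → v ≤ n → par v = 0 → v = y) ∧
      (y = 0 ∨ (f ≤ y + n ∧ y ≤ n ∧ par y = 0)) := by
    by_cases hex : ∃ y, f ≤ y + n ∧ y ≤ n ∧ par y = 0
    · obtain ⟨y, hy⟩ := hex
      refine ⟨y, fun v hv hv' hv0 => ?_, Or.inr hy⟩
      have := F.two e v y he1 he2 (by omega) (by omega) (by omega) (by omega) he hv0 hy.2.2
      by_contra hne
      rcases this with h | h | h
      · subst h; exact heo ⟨hv, hv'⟩
      · subst h; exact heo ⟨hy.1, hy.2.1⟩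
      · exact hne h
    · refine ⟨0, fun v hv hv' hv0 => absurd ⟨v, hv, hv', hv0⟩ hex, Or.inl rfl⟩
  have hcases := F.marks_cases S T hf D hy
  have hfro := F.ro_outside S T hf (v := f) (by omega) (by omega) (by omega)
  have hfro' := F.le_ro S T _ f rfl (by omega) (by omega)
  have hry : r = y := by
    rcases hr.2 with h | h
    · rcases hy' with h' | h'
      · omega
      · have := hr.1 y (by omega) h'.1 h'.2.1 (D.root y (by omega) (by omega) h'.2.2)
        omega
    · rcases hcases _ r rfl h.2.1 h.2.2.1 with hc | hc
      · have h2 := F.le_ro S T _ r rfl h.1 (by omega)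
        rcases hy' with h' | h'
        · omega
        · have := hr.1 y (by omega) h'.1 h'.2.1 (D.root y (by omega) (by omega) h'.2.2)
          omega
      · omega
  refine ⟨fun v hv hv' hout => ?_, fun v hv hv' hin h0 => ?_, fun v hv hv' hout e => ?_⟩
  · rw [F.not_marked S hf D _ v rfl hv (by omega) hout]
    omega
  · rcases hcases _ v rfl hin.1 hin.2 with hc | hc <;> omega
  · by_cases hin : f ≤ v + n ∧ v ≤ n
    · rcases hcases _ v rfl hin.1 hin.2 with hc | hc
      · exact hout ⟨hin, hc.1⟩
      · omega
    · have h2 := F.ro_outside S T hf hv hv' hin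
      omega

/-- The descent along the greatest children to the fixed vertex. -/
theorem mc_pred (F : Forest n q par) (S : Shape n f a A q) (T : Tables n par cc mc rm ro)
    (hf : f ≤ 2 * n) {p x : ℕ} (hp : f ≤ p) (hpx : p < x) (hx : x ≤ 2 * n + 1) (hA : ¬ A p)
    (hq : q p = x) (h0 : par p ≠ 0) : rm x = rm p := by
  have hlo := S.le_fixed
  refine T.rm_eq (by omega) (by omega) (by omega) (by omega)
    ((F.par_eq (by omega) (by omega) h0).trans hq) ?_
  intro w hw hw' hwx
  by_contra hgt
  have := F.head_eq hw hw' hwx (by omega)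
  rcases S.child_cases hf hw hw' with h | h | h | h
  · omega
  · omega
  · omega
  · exact h.2.2.1 ((S.desc p hp (by omega) hA).2.2 w (by omega) (by omega))

/-- If `f` has no child, the edge of its child `n` is missing, and the failure of the first rule
costs the edge of `f` or that of `1`. All other edges are present, which determines the rightmost
vertices of all trees. -/
theorem rule_three (F : Forest n q par) (S : Shape n f a A q)
    (T : Tables n par cc mc rm ro) (hf : f ≤ 2 * n)
    (h1 : ¬ (par f ≠ 0 ∧ par f ≠ 2 * n + 2 ∧ 1 < cc (par f))) (hc : cc f = 0) :
    (∃ v, 1 ≤ v ∧ v ≤ 2 * n + 2 ∧ par v = 0 ∧ rm v = f) ∧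
      ∀ v, 1 ≤ v → v ≤ 2 * n + 2 → par v = 0 → n < rm v → rm v < 2 * n + 2 → rm v = f := by
  have hn := S.three_le
  have hlo := S.le_fixed
  have hq := S.fixed_lt_head hf
  have hq1 := S.first_one hf
  have hpn : par n = 0 := by
    rcases F.eq n (by omega) (by omega) with h | h
    · exact h
    · exact absurd hc (T.cc_ne_zero (by omega) (by omega) (by omega) (by omega) (h.trans (S.top hf)))
  have hrf : rm f = f := T.rm_leaf f (by omega) (by omega) hc
  -- With the edges of `n` and `e` the missing ones are exhausted, and `2n + 1` is the greatest
  -- child of the root.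
  have hroot : ∀ e, 1 ≤ e → e ≤ 2 * n + 1 → e ≠ n → e ≠ 2 * n + 1 → par e = 0 →
      (∀ u, 1 ≤ u → u ≤ 2 * n + 1 → u ≠ n → u ≠ e → par u = q u) ∧
      rm (2 * n + 2) = rm (2 * n + 1) := by
    intro e he he' hen heL hpe
    have hall : ∀ u, 1 ≤ u → u ≤ 2 * n + 1 → u ≠ n → u ≠ e → par u = q u := by
      intro u hu hu' h1 h2
      rcases F.eq u hu hu' with h | h
      · have := F.two u n e hu hu' (by omega) (by omega) he he' h hpn hpe
        omega
      · exact h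
    refine ⟨hall, T.rm_eq (by omega) le_rfl (by omega) le_rfl ?_ (fun w _ h _ => h)⟩
    rw [hall _ (by omega) le_rfl (by omega) (by omega), S.head_last]
  by_cases hpf : par f = 0
  · obtain ⟨hall, hrr⟩ := hroot f (by omega) (by omega) (by omega) (by omega) hpf
    -- Without the edge of `f`, the descent from `2n + 1` along greatest children ends among the
    -- small children of the head of `f`; the tree of `f` consists of `f` alone.
    have key : ∀ x, f < x → x ≤ 2 * n + 1 → (x ≤ 2 * n → ¬ A x) → rm x ≤ n := by
      intro x
      induction x using Nat.strong_induction_on with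
      | _ x ih =>
        intro hx hx' hA
        obtain ⟨p, hp1, hp2, hp3, hp4⟩ := S.exists_pred hx hx' hA
        rcases hp1.eq_or_lt with e | hlt
        · subst e
          have hcx := T.cc_ne_zero (u := 1) (v := x) le_rfl (by omega) (by omega) (by omega)
            (by rw [hall 1 le_rfl (by omega) (by omega) (by omega), hq1, hp4])
          obtain ⟨c1, c2, c3, -⟩ := T.mc_spec x (by omega) (by omega) hcx
          rw [T.rm_node x (by omega) (by omega) hcx]
          have hmn : mc x ≤ n := by
            have hqc := F.head_eq c1 c2 c3 (by omega)
            rcases S.child_cases hf c1 c2 with h | h | h | h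
            · omega
            · omega
            · omega
            · by_cases hmf : mc x = f
              · rw [hmf, hpf] at c3
                omega
              · exact absurd ((S.desc f le_rfl hf hp3).2.2 (mc x) (by omega) (by omega)) h.2.2.1
          exact (F.rm_le S T (mc x) c1 (by omega)).trans hmn
        · have h2 := hall p (by omega) (by omega) (by omega) (by omega)
          rw [F.mc_pred S T hf hp1 hp2 hx' hp3 hp4 (by omega)]
          exact ih p hp2 hlt (by omega) (fun _ => hp3)
    refine ⟨⟨f, by omega, by omega, hpf, hrf⟩, fun v hv hv' hpv hlt hlt' => ?_⟩
    by_cases hvr : v = 2 * n + 2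
    · have := key (2 * n + 1) (by omega) le_rfl (by omega)
      rw [hvr, hrr] at hlt
      omega
    · by_cases hvf : v = f
      · rw [hvf, hrf]
      · have := F.two v n f hv (by omega) (by omega) (by omega) (by omega) (by omega) hpv hpn hpf
        have h3 := F.rm_le S T v hv hv'
        omega
  · have hp1 : par 1 = 0 := by
      rcases F.missing_of_not_rule_one S T hf h1 with h | h
      · exact absurd h hpf
      · exact h 1 le_rfl (by omega)
    obtain ⟨hall, hrr⟩ := hroot 1 le_rfl (by omega) (by omega) (by omega) hp1
    -- Here the edge of `1` is missing and the chain is intact, so the descent along it reaches `f`.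
    have key : ∀ x, f < x → x ≤ 2 * n + 1 → (x ≤ 2 * n → ¬ A x) → rm x = f := by
      intro x
      induction x using Nat.strong_induction_on with
      | _ x ih =>
        intro hx hx' hA
        obtain ⟨p, hp1, hp2, hp3, hp4⟩ := S.exists_pred hx hx' hA
        have h2 := hall p (by omega) (by omega) (by omega) (by omega)
        rw [F.mc_pred S T hf hp1 hp2 hx' hp3 hp4 (by omega)]
        rcases hp1.eq_or_lt with e | hlt
        · rw [← e, hrf]
        · exact ih p hp2 hlt (by omega) (fun _ => hp3)
    refine ⟨⟨2 * n + 2, by omega, le_rfl, F.root, ?_⟩, fun v hv hv' hpv hlt hlt' => ?_⟩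
    · rw [hrr]
      exact key _ (by omega) le_rfl (by omega)
    · by_cases hvr : v = 2 * n + 2
      · rw [hvr, hrr]
        exact key _ (by omega) le_rfl (by omega)
      · have := F.two v n 1 hv (by omega) (by omega) (by omega) (by omega) (by omega) hpv hpn hp1
        have h3 := F.rm_le S T v hv hv'
        omega

/-! #### The ascending vertices -/

/-- The edges that are missing at an isolated vertex that is not a leaf. -/
theorem isolated_cases (F : Forest n q par) (S : Shape n f a A q) (T : Tables n par cc mc rm ro)
    (hf : f ≤ 2 * n) {x : ℕ} (hx : n < x) (hx' : x ≤ 2 * n + 1) (hxf : x ≠ f) (h0 : par x = 0)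
    (hc : cc x = 0) : (A x ∧ x ≤ 2 * n) ∨
      ∃ p, f < p ∧ p < x ∧ ¬ A p ∧ par p = 0 ∧ ∀ u, 1 ≤ u → u ≤ 2 * n + 1 → par u = 0 →
        u = x ∨ u = p := by
  have hlo := S.le_fixed
  by_cases hA : A x ∧ x ≤ 2 * n
  · exact Or.inl hA
  right
  have hfx : f < x := by
    by_contra h
    exact hA ⟨S.asc_of_lt x hx (by omega), by omega⟩
  obtain ⟨p, h1, h2, h3, h4⟩ := S.exists_pred hfx hx' (fun h hA' => hA ⟨hA', h⟩)
  have miss : ∀ u, 1 ≤ u → u ≤ 2 * n + 1 → q u = x → par u = 0 := by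
    intro u hu hu' e
    rcases F.eq u hu hu' with h | h
    · exact h
    · exact absurd hc (T.cc_ne_zero hu hu' (by omega) (by omega) (h.trans e))
  have hp := miss p (by omega) (by omega) h4
  have hall : ∀ u, 1 ≤ u → u ≤ 2 * n + 1 → par u = 0 → u = x ∨ u = p := by
    intro u hu hu' hu0
    have := F.two u x p hu hu' (by omega) hx' (by omega) (by omega) hu0 h0 hp
    omega
  refine ⟨p, ?_, h2, h3, hp, hall⟩
  -- If `p = f`, the edge from `1` into the same `x` would be a third missing one.
  rcases h1.eq_or_lt with e | h
  · have := hall 1 le_rfl (by omega)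
      (miss 1 le_rfl (by omega) (by rw [S.first_one hf, e, h4]))
    omega
  · exact h

theorem asc_of_par (F : Forest n q par) (S : Shape n f a A q) (hf : f ≤ 2 * n) {x : ℕ}
    (hx : n < x) (hx' : x ≤ 2 * n + 1) (h : par x = 2 * n + 2) : A x :=
  (S.asc_iff hf hx hx').2 (F.head_eq (by omega) hx' h (by omega))

theorem par_of_asc (F : Forest n q par) (S : Shape n f a A q) {x : ℕ}
    (hx : n < x) (hx' : x ≤ 2 * n + 1) (hA : A x) (h : par x ≠ 0) : par x = 2 * n + 2 :=
  (F.par_eq (by omega) hx' h).trans (S.asc x hx hx' hA)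

/-- Every head is small, non-ascending, `2n + 1` or the root, so an ascending vertex below `2n + 1`
is a leaf even of the undamaged tree. -/
theorem isolated_of_asc (F : Forest n q par) (S : Shape n f a A q) (T : Tables n par cc mc rm ro)
    (hf : f ≤ 2 * n) {x : ℕ} (hx : n < x) (hx' : x ≤ 2 * n) (hA : A x) : cc x = 0 := by
  have hlo := S.le_fixed
  have hq := S.fixed_lt_head hf
  have hxf : x ≠ f := fun e => S.not_asc_fixed (e ▸ hA)
  refine T.cc_eq_zero (by omega) (by omega) (fun u hu hu' e => ?_)
  have h := F.head_eq hu hu' e (by omega)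
  rcases S.child_cases hf hu hu' with h1 | h1 | h1 | h1
  · have := (S.desc f le_rfl hf S.not_asc_fixed).2.1
    rw [← h1.2, h] at this
    exact this hx' hA
  · omega
  · omega
  · rw [h] at h1
    exact h1.2.2.2.2.2 hx' hA

/-- No large vertex but `f` is isolated. -/
theorem asc_of_no_isolated (F : Forest n q par) (S : Shape n f a A q)
    (T : Tables n par cc mc rm ro) (hf : f ≤ 2 * n)
    (h : ∀ x, n < x → x ≤ 2 * n + 1 → x ≠ f → ¬ (par x = 0 ∧ cc x = 0))
    {x : ℕ} (hx : n < x) (hx' : x ≤ 2 * n + 1) : A x ↔ par x = 2 * n + 2 ∨ x = 2 * n + 1 := by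
  constructor
  · intro hA
    by_cases hL : x = 2 * n + 1
    · exact Or.inr hL
    · have hxf : x ≠ f := fun e => S.not_asc_fixed (e ▸ hA)
      left
      refine F.par_of_asc S hx hx' hA (fun h0 => h x hx hx' hxf ⟨h0, ?_⟩)
      exact F.isolated_of_asc S T hf hx (by omega) hA
  · rintro (h1 | rfl)
    · exact F.asc_of_par S hf hx hx' h1
    · exact S.asc_last hf

theorem asc_of_connected (F : Forest n q par) (S : Shape n f a A q)
    (hf : f ≤ 2 * n) {x : ℕ} (h : par x ≠ 0) (hx : n < x) (hx' : x ≤ 2 * n + 1) :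
    A x ↔ par x = 2 * n + 2 :=
  ⟨fun hA => F.par_of_asc S hx hx' hA h, F.asc_of_par S hf hx hx'⟩

/-- Two large vertices are isolated, or one is and another edge is missing below `f`. -/
theorem asc_of_missing (F : Forest n q par) (S : Shape n f a A q)
    (T : Tables n par cc mc rm ro) (hf : f ≤ 2 * n) {y z : ℕ} (hy : n < y) (hy' : y ≤ 2 * n + 1)
    (hyf : y ≠ f) (hy0 : par y = 0) (hyc : cc y = 0) (hzy : z ≠ y) (hz : 1 ≤ z) (hz' : z ≤ 2 * n + 1)
    (hz0 : par z = 0) (hzc : z ≤ n ∨ (z ≠ f ∧ cc z = 0))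
    {x : ℕ} (hx : n < x) (hx' : x ≤ 2 * n + 1) (hxf : x ≠ f) :
    A x ↔ par x = 2 * n + 2 ∨ (par x = 0 ∧ cc x = 0) := by
  have hlo := S.le_fixed
  -- If `y` were not an ascending vertex below `2n + 1`, the second missing edge would start at a
  -- non-ascending `z` between `f` and `y`. This `z` is not small, so it is isolated as well, and
  -- that requires a third missing edge at a still smaller vertex.
  have aux : ∀ y z, n < y → y ≤ 2 * n + 1 → y ≠ f → par y = 0 → cc y = 0 → z ≠ y → 1 ≤ z →
      z ≤ 2 * n + 1 → par z = 0 → (z ≤ n ∨ (z ≠ f ∧ cc z = 0)) → A y ∧ y ≤ 2 * n := by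
    intro y z hy hy' hyf hy0 hyc hzy hz hz' hz0 hzc
    rcases F.isolated_cases S T hf hy hy' hyf hy0 hyc with h | ⟨p, h1, h2, h3, h4, h5⟩
    · exact h
    · exfalso
      obtain rfl : z = p := by
        have := h5 z hz hz' hz0
        omega
      rcases F.isolated_cases S T hf (by omega) hz' (by omega) hz0 (by omega) with
        h | ⟨p', h1', h2', h3', h4', h5'⟩
      · exact h3 h.1
      · have := h5 p' (by omega) (by omega) h4'
        omega
  have hyA := aux y z hy hy' hyf hy0 hyc hzy hz hz' hz0 hzc
  constructor
  · intro hA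
    by_cases h0 : par x = 0
    · right
      refine ⟨h0, ?_⟩
      have := F.two x y z (by omega) hx' (by omega) hy' hz hz' h0 hy0 hz0
      rcases this with h | h | h
      · rw [h]; exact hyc
      · rw [h]
        exact (hzc.resolve_left (by omega)).2
      · omega
    · exact Or.inl (F.par_of_asc S hx hx' hA h0)
  · rintro (h | ⟨h0, hc⟩)
    · exact F.asc_of_par S hf hx hx' h
    · by_cases hxy : x = y
      · rw [hxy]
        exact hyA.1
      · exact (aux x y hx hx' hxf h0 hc (Ne.symm hxy) (by omega) hy' hy0 (Or.inr ⟨hyf, hyc⟩)).1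

/-- If no edge is missing below `f` then the rightmost vertex below `f` is the number of the
ascending vertices. -/
theorem rm_fixed (F : Forest n q par) (S : Shape n f a A q)
    (T : Tables n par cc mc rm ro) (hf : f ≤ 2 * n)
    (h : ∀ v, f ≤ v + n → v ≤ n → par v ≠ 0) : rm f = a := by
  have hlo := S.le_fixed
  have ha := S.le_count hf
  have ha' := S.count_le hf
  have hq := S.fixed_lt_head hf
  have hp : ∀ v, f ≤ v + n → v ≤ n → par v = q v := fun v hv hv' =>
    F.par_eq (by omega) (by omega) (h v hv hv')
  have below : ∀ w v, 1 ≤ w → w ≤ 2 * n + 1 → par w = v → 1 ≤ v → v ≤ n →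
      f ≤ w + n ∧ w < v ∧ a < v := by
    intro w v hw hw' hv hv1 hvn
    have := F.head_eq hw hw' hv hv1
    rcases S.child_cases hf hw hw' with h | h | h | h <;> omega
  have hleaf : rm a = a := T.rm_leaf a (by omega) (by omega)
    (T.cc_eq_zero (by omega) (by omega) (fun u hu hu' e => by
      have := below u a hu hu' e (by omega) ha'
      omega))
  -- On the chain `a, a + 1, …, n` each vertex is the greatest child of the next, since children are
  -- smaller than their parent; and `a` is a leaf.
  have key : ∀ y, a ≤ y → y ≤ n → rm y = a := by
    intro y hy
    induction y, hy using Nat.le_induction with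
    | base => exact fun _ => hleaf
    | succ y hy ih =>
      intro hyn
      rw [← ih (by omega)]
      refine T.rm_eq (by omega) (by omega) (by omega) (by omega) ?_ ?_
      · rw [hp y (by omega) (by omega)]
        rcases hy.eq_or_lt with e | hlt
        · rw [← e]
          exact S.count hf (by omega)
        · exact S.chain hf y hlt (by omega)
      · intro w hw hw' hwy
        have := below w _ hw hw' hwy (by omega) hyn
        omega
  rw [← key n ha' le_rfl]
  refine T.rm_eq (by omega) (by omega) (by omega) (by omega)
    ((hp n (by omega) le_rfl).trans (S.top hf)) ?_
  intro w hw hw' hwf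
  have := F.head_eq hw hw' hwf (by omega)
  rcases S.child_cases hf hw hw' with h | h | h | h <;> omega

theorem cc_root (F : Forest n q par) (S : Shape n f a A q) (T : Tables n par cc mc rm ro)
    (hf : f ≤ 2 * n) :
    cc (2 * n + 2) = {x | (n < x ∧ x ≤ 2 * n + 1 ∧ A x) ∧ par x ≠ 0}.ncard := by
  have hlo := S.le_fixed
  have hq := S.fixed_lt_head hf
  rw [T.cc_eq _ (by omega) le_rfl, ← Set.ncard_coe_finset]
  congr 1
  ext x
  simp only [Finset.coe_filter, Finset.mem_Icc, Set.mem_ofPred_eq]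
  constructor
  · rintro ⟨⟨h1, h2⟩, h3⟩
    have h4 := F.head_eq h1 h2 h3 (by omega)
    have hx : n < x := by
      rcases S.child_cases hf h1 h2 with h | h | h | h <;> omega
    exact ⟨⟨hx, h2, F.asc_of_par S hf hx h2 h3⟩, by omega⟩
  · rintro ⟨⟨h1, h2, h3⟩, h4⟩
    exact ⟨⟨by omega, h2⟩, F.par_of_asc S h1 h2 h3 h4⟩

/-- Exactly one large vertex but `f` is isolated, and no edge is missing below `f`. -/
theorem asc_of_one_isolated (F : Forest n q par) (S : Shape n f a A q)
    (T : Tables n par cc mc rm ro) (hf : f ≤ 2 * n)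
    (h : ∀ v, f ≤ v + n → v ≤ n → par v ≠ 0) {y : ℕ} (hy : n < y) (hy' : y ≤ 2 * n + 1)
    (hyf : y ≠ f) (hy0 : par y = 0) (hyc : cc y = 0)
    (hone : ∀ x, n < x → x ≤ 2 * n + 1 → x ≠ f → par x = 0 → cc x = 0 → x = y)
    {x : ℕ} (hx : n < x) (hx' : x ≤ 2 * n + 1) :
    A x ↔ par x = 2 * n + 2 ∨ (cc (2 * n + 2) < rm f ∧ (x = 2 * n + 1 ∨ x = y)) := by
  have hlo := S.le_fixed
  rw [F.rm_fixed S T hf h, F.cc_root S T hf]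
  have hfin : {x | n < x ∧ x ≤ 2 * n + 1 ∧ A x}.Finite :=
    (Set.finite_Icc 0 (2 * n + 1)).subset (fun x hx => by simp [hx.2.1])
  have hcard := S.card hf
  -- If `y` is ascending, its missing edge leaves the root with fewer than `a` children. Otherwise
  -- both missing edges start at non-ascending vertices, and the root keeps all its `a` children.
  by_cases hAy : A y
  · have hlt : {x | (n < x ∧ x ≤ 2 * n + 1 ∧ A x) ∧ par x ≠ 0}.ncard < a := by
      rw [← hcard]
      refine Set.ncard_lt_ncard ⟨fun x hx => hx.1, fun hsub => ?_⟩ hfin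
      exact (hsub (a := y) ⟨hy, hy', hAy⟩).2 hy0
    constructor
    · intro hA
      by_cases h0 : par x = 0
      · right
        refine ⟨hlt, ?_⟩
        rcases hx'.eq_or_lt with e | hl
        · exact Or.inl e
        · right
          exact hone x hx hx' (fun e => S.not_asc_fixed (e ▸ hA)) h0
            (F.isolated_of_asc S T hf hx (by omega) hA)
      · exact Or.inl (F.par_of_asc S hx hx' hA h0)
    · rintro (h1 | ⟨-, rfl | rfl⟩)
      · exact F.asc_of_par S hf hx hx' h1
      · exact S.asc_last hf
      · exact hAy
  · rcases F.isolated_cases S T hf hy hy' hyf hy0 hyc with h1 | ⟨p, h1, h2, h3, h4, h5⟩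
    · exact absurd h1.1 hAy
    · have hall : ∀ x, n < x → x ≤ 2 * n + 1 → A x → par x ≠ 0 := by
        intro x hx hx' hA h0
        rcases h5 x (by omega) hx' h0 with rfl | rfl
        · exact hAy hA
        · exact h3 hA
      have e : {x | (n < x ∧ x ≤ 2 * n + 1 ∧ A x) ∧ par x ≠ 0} =
          {x | n < x ∧ x ≤ 2 * n + 1 ∧ A x} := by
        ext x
        exact ⟨fun h => h.1, fun h => ⟨h, hall x h.1 h.2.1 h.2.2⟩⟩
      rw [e, hcard]
      simp only [lt_irrefl, false_and, or_false]
      exact ⟨fun hA => F.par_of_asc S hx hx' hA (hall x hx hx' hA), F.asc_of_par S hf hx hx'⟩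

/-- The number of the proper descendants of `f`. -/
theorem card_marks (F : Forest n q par) (S : Shape n f a A q) (T : Tables n par cc mc rm ro)
    (hf : f ≤ 2 * n) (D : Marks n par f de) :
    ((Finset.Icc 1 (2 * n + 1)).filter (fun v => de v = 1)).card = 2 * n + 1 - f ↔
      ∀ v, f ≤ v + n → v ≤ n → par v ≠ 0 := by
  have hlo := S.le_fixed
  have hsub : (Finset.Icc 1 (2 * n + 1)).filter (fun v => de v = 1) ⊆ Finset.Icc (f - n) n := by
    intro v hv
    simp only [Finset.mem_filter, Finset.mem_Icc] at hv ⊢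
    by_contra hout
    have := F.not_marked S hf D _ v rfl hv.1.1 (by omega) (by omega)
    omega
  have hc : (Finset.Icc (f - n) n).card = 2 * n + 1 - f := by
    rw [Nat.card_Icc]
    omega
  rw [← hc]
  constructor
  · intro h v hv hv' h0
    have := Finset.eq_of_subset_of_card_le hsub h.ge
    have hm : v ∈ Finset.Icc (f - n) n := by
      simp only [Finset.mem_Icc]; omega
    rw [← this] at hm
    simp only [Finset.mem_filter, Finset.mem_Icc] at hm
    have := D.root v (by omega) (by omega) h0
    omega
  · intro h
    congr 1
    refine le_antisymm hsub (fun v hv => ?_)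
    simp only [Finset.mem_filter, Finset.mem_Icc] at hv ⊢
    refine ⟨by omega, ?_⟩
    rcases F.marks_cases S T hf D (y := 0) (fun v hv hv' h0 => absurd h0 (h v hv hv')) _ v rfl
      (by omega) (by omega) with h1 | h1
    · have := F.le_ro S T _ v rfl (by omega) (by omega)
      omega
    · exact h1.1

end Forest
end Watermark

namespace Watermark

/-! ### The permutation and the tree of a key -/

/-- The digit `0` of the extended binary has the index `x`. -/
def IsZero (ω x : ℕ) : Prop :=
  size ω < x ∧ x ≤ 2 * size ω + 1 ∧ (x ≤ 2 * size ω → ω / 2 ^ (2 * size ω - x) % 2 = 1)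

theorem size_eq (ω : ℕ) : size ω = (Nat.digits 2 ω).length := by simp [size, bits]

theorem extended_get {ω x : ℕ} (hx : 1 ≤ x) (hx' : x ≤ 2 * size ω + 1) :
    (extended ω)[x - 1]? = some (if x ≤ size ω then 1 else if x = 2 * size ω + 1 then 0 else
      1 - ω / 2 ^ (2 * size ω - x) % 2) := by
  have hs : (bits ω).length = size ω := rfl
  have hd : (Nat.digits 2 ω).length = size ω := (size_eq ω).symm
  unfold extended
  by_cases h1 : x ≤ size ω
  · rw [List.append_assoc, List.getElem?_append_left (by simp; omega), if_pos h1,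
      List.getElem?_replicate_of_lt (by omega)]
  · rw [if_neg h1]
    by_cases h2 : x = 2 * size ω + 1
    · have hl : x - 1 - (List.replicate (size ω) 1 ++ (bits ω).map (fun d => 1 - d)).length = 0 := by
        simp [hs]; omega
      rw [if_pos h2, List.getElem?_append_right (by simp [hs]; omega), hl]
      rfl
    · rw [if_neg h2, List.append_assoc, List.getElem?_append_right (by simp; omega),
        List.getElem?_append_left (by simp [hs]; omega), List.getElem?_map, List.length_replicate,
        bits, List.getElem?_reverse (by omega)]
      have : (Nat.digits 2 ω)[(Nat.digits 2 ω).length - 1 - (x - 1 - size ω)]? =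
          some (ω / 2 ^ (2 * size ω - x) % 2) := by
        rw [← Nat.getD_digits ω (2 * size ω - x) le_rfl, hd,
          show size ω - 1 - (x - 1 - size ω) = 2 * size ω - x by omega,
          List.getD_eq_getElem _ _ (by omega), List.getElem?_eq_getElem (by omega)]
      rw [this]
      rfl

theorem mem_indexes_zero {ω x : ℕ} : x ∈ indexes ω 0 ↔ IsZero ω x := by
  simp only [indexes, List.mem_filter, List.mem_range'_1, decide_eq_true_eq, IsZero]
  constructor
  · rintro ⟨⟨h1, h2⟩, h3⟩
    rw [extended_get h1 (by omega)] at h3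
    split_ifs at h3 with h4 h5
    · simp at h3
    · omega
    · refine ⟨by omega, by omega, fun _ => ?_⟩
      have := Nat.mod_lt (ω / 2 ^ (2 * size ω - x)) (show 0 < 2 by norm_num)
      simp only [Option.some.injEq] at h3
      omega
  · rintro ⟨h1, h2, h3⟩
    refine ⟨⟨by omega, by omega⟩, ?_⟩
    rw [extended_get (by omega) h2, if_neg (by omega)]
    split_ifs with h5
    · rfl
    · rw [h3 (by omega)]

theorem mem_indexes_one {ω x : ℕ} :
    x ∈ indexes ω 1 ↔ 1 ≤ x ∧ x ≤ 2 * size ω + 1 ∧ ¬ IsZero ω x := by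
  simp only [indexes, List.mem_filter, List.mem_range'_1, decide_eq_true_eq, IsZero]
  constructor
  · rintro ⟨⟨h1, h2⟩, h3⟩
    rw [extended_get h1 (by omega)] at h3
    refine ⟨h1, by omega, ?_⟩
    rintro ⟨a1, a2, a3⟩
    rw [if_neg (by omega)] at h3
    split_ifs at h3 with h5
    · simp at h3
    · rw [a3 (by omega)] at h3
      simp at h3
  · rintro ⟨h1, h2, h3⟩
    refine ⟨⟨h1, by omega⟩, ?_⟩
    rw [extended_get h1 h2]
    split_ifs with h4 h5
    · rfl
    · exact absurd ⟨by omega, h2, fun h => absurd h (by omega)⟩ h3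
    · have := Nat.mod_lt (ω / 2 ^ (2 * size ω - x)) (show 0 < 2 by norm_num)
      have h6 : ω / 2 ^ (2 * size ω - x) % 2 ≠ 1 := fun h => h3 ⟨by omega, h2, fun _ => h⟩
      rw [show ω / 2 ^ (2 * size ω - x) % 2 = 0 by omega]

theorem pairwise_indexes (ω d : ℕ) : (indexes ω d).Pairwise (· < ·) :=
  List.Pairwise.filter _ List.pairwise_lt_range'

theorem nodup_bitonic (ω : ℕ) : (bitonic ω).Nodup := by
  unfold bitonic
  rw [List.nodup_append]
  refine ⟨(pairwise_indexes ω 0).imp (fun h => h.ne),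
    List.nodup_reverse.2 ((pairwise_indexes ω 1).imp (fun h => h.ne)), ?_⟩
  intro x hx y hy e
  rw [List.mem_reverse, mem_indexes_one] at hy
  rw [mem_indexes_zero, e] at hx
  exact hy.2.2 hx

theorem mem_bitonic {ω x : ℕ} : x ∈ bitonic ω ↔ 1 ≤ x ∧ x ≤ 2 * size ω + 1 := by
  unfold bitonic
  rw [List.mem_append, List.mem_reverse, mem_indexes_zero, mem_indexes_one]
  constructor
  · rintro (h | h)
    · exact ⟨by have := h.1; omega, h.2.1⟩
    · exact ⟨h.1, h.2.1⟩
  · rintro ⟨h1, h2⟩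
    by_cases h : IsZero ω x
    · exact Or.inl h
    · exact Or.inr ⟨h1, h2, h⟩

theorem length_bitonic (ω : ℕ) : (bitonic ω).length = 2 * size ω + 1 := by
  have h : (bitonic ω).Perm (List.range' 1 (2 * size ω + 1)) := by
    rw [List.perm_ext_iff_of_nodup (nodup_bitonic ω) List.nodup_range']
    intro x
    rw [mem_bitonic, List.mem_range'_1]
    omega
  rw [h.length_eq, List.length_range']

/-- The element of the bitonic permutation at a position counted from `0`. -/
def bit (ω i : ℕ) : ℕ := (bitonic ω).getD i 0

theorem bit_mem {ω i : ℕ} (hi : i ≤ 2 * size ω) : 1 ≤ bit ω i ∧ bit ω i ≤ 2 * size ω + 1 := by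
  rw [← mem_bitonic, bit, List.getD_eq_getElem _ _ (by rw [length_bitonic]; omega)]
  exact List.getElem_mem _

theorem bit_inj {ω i j : ℕ} (hi : i ≤ 2 * size ω) (hj : j ≤ 2 * size ω) (h : bit ω i = bit ω j) :
    i = j := by
  have hl := length_bitonic ω
  rw [bit, bit, List.getD_eq_getElem _ _ (by omega), List.getD_eq_getElem _ _ (by omega)] at h
  exact (List.Nodup.getElem_inj_iff (nodup_bitonic ω)).1 h

theorem exists_bit {ω x : ℕ} (hx : 1 ≤ x) (hx' : x ≤ 2 * size ω + 1) :
    ∃ i, i ≤ 2 * size ω ∧ bit ω i = x := by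
  obtain ⟨i, hi, h⟩ := List.getElem_of_mem (mem_bitonic.2 ⟨hx, hx'⟩)
  rw [length_bitonic] at hi
  exact ⟨i, by omega, by
    rw [bit, List.getD_eq_getElem _ _ (by rw [length_bitonic]; omega), h]⟩

theorem partner_bit {ω i : ℕ} (hi : i ≤ 2 * size ω) :
    partner ω (bit ω i) = bit ω (2 * size ω - i) := by
  have hl := length_bitonic ω
  have h : (bitonic ω).idxOf (bit ω i) = i := by
    rw [bit, List.getD_eq_getElem _ _ (by omega), List.Nodup.idxOf_getElem (nodup_bitonic ω)]
  rw [partner, h, bit]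

/-- The number of the zeros of the extended binary. -/
def zeros (ω : ℕ) : ℕ := (indexes ω 0).length

theorem isZero_bit {ω i : ℕ} (hi : i ≤ 2 * size ω) : IsZero ω (bit ω i) ↔ i < zeros ω := by
  have hl := length_bitonic ω
  rw [bit, List.getD_eq_getElem _ _ (by omega)]
  unfold bitonic zeros at *
  by_cases h : i < (indexes ω 0).length
  · rw [List.getElem_append_left h, ← mem_indexes_zero]
    exact ⟨fun _ => h, fun _ => List.getElem_mem _⟩
  · rw [List.getElem_append_right (by omega)]
    refine ⟨fun h' => ?_, fun h' => absurd h' h⟩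
    have hm : (indexes ω 1).reverse[i - (indexes ω 0).length]'(by
      rw [List.length_append] at hl; omega) ∈ (indexes ω 1).reverse := List.getElem_mem _
    rw [List.mem_reverse, mem_indexes_one] at hm
    exact absurd h' hm.2.2

theorem bit_lt {ω i j : ℕ} (hij : i < j) (hj : j < zeros ω) (hj' : j ≤ 2 * size ω) :
    bit ω i < bit ω j := by
  have hl := length_bitonic ω
  rw [bit, bit, List.getD_eq_getElem _ _ (by omega), List.getD_eq_getElem _ _ (by omega)]
  unfold bitonic zeros at *
  rw [List.getElem_append_left (by omega), List.getElem_append_left (by omega)]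
  exact List.pairwise_iff_getElem.1 (pairwise_indexes ω 0) _ _ _ _ hij

theorem bit_gt {ω i j : ℕ} (hij : i < j) (hi : zeros ω ≤ i) (hj : j ≤ 2 * size ω) :
    bit ω j < bit ω i := by
  have hl := length_bitonic ω
  rw [bit, bit, List.getD_eq_getElem _ _ (by omega), List.getD_eq_getElem _ _ (by omega)]
  unfold bitonic zeros at *
  rw [List.getElem_append_right (by omega), List.getElem_append_right (by omega)]
  have h := List.pairwise_reverse.2 (pairwise_indexes ω 1)
  exact List.pairwise_iff_getElem.1 h _ _ _ _ (by omega)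

/-- The last `n` elements of the bitonic permutation are `n, …, 1`. -/
theorem bit_small {ω : ℕ} : ∀ j, j < size ω → bit ω (2 * size ω - j) = j + 1 := by
  intro j
  induction j using Nat.strong_induction_on with
  | _ j ih =>
    intro hj
    obtain ⟨i, hi, h⟩ := exists_bit (ω := ω) (x := j + 1) (by omega) (by omega)
    have hz : zeros ω ≤ i := by
      by_contra hlt
      have := (isZero_bit hi).2 (by omega)
      rw [h] at this
      have := this.1
      omega
    have h1 : i ≤ 2 * size ω - j := by
      by_contra hlt
      have := ih (2 * size ω - i) (by omega) (by omega)
      rw [Nat.sub_sub_self hi] at this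
      omega
    rcases h1.eq_or_lt with e | hlt
    · rw [← e, h]
    · exfalso
      have h2 := bit_gt hlt hz (by omega)
      have h3 := bit_mem (ω := ω) (i := 2 * size ω - j) (by omega)
      have h4 := ih (bit ω (2 * size ω - j) - 1) (by omega) (by omega)
      have := bit_inj (by omega) (by omega) (h4.trans (Nat.sub_add_cancel h3.1))
      omega

theorem lt_bit {ω i : ℕ} (hi : i ≤ size ω) : size ω < bit ω i := by
  by_contra h
  have h1 := bit_mem (ω := ω) (i := i) (by omega)
  have h2 := bit_small (ω := ω) (bit ω i - 1) (by omega)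
  have := bit_inj (by omega) (by omega) (h2.trans (Nat.sub_add_cancel h1.1))
  omega

theorem exists_bit_large {ω x : ℕ} (hx : size ω < x) (hx' : x ≤ 2 * size ω + 1) :
    ∃ i, i ≤ size ω ∧ bit ω i = x := by
  obtain ⟨i, hi, h⟩ := exists_bit (ω := ω) (by omega) hx'
  refine ⟨i, ?_, h⟩
  by_contra hlt
  have := bit_small (ω := ω) (2 * size ω - i) (by omega)
  rw [Nat.sub_sub_self hi] at this
  omega

theorem partner_large {ω i : ℕ} (hi : i < size ω) : partner ω (bit ω i) = i + 1 := by
  rw [partner_bit (by omega), bit_small i hi]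

/-- The fixed element of the self-inverting permutation. -/
def fixedElt (ω : ℕ) : ℕ := bit ω (size ω)

/-- The ascending elements. -/
def Asc (ω x : ℕ) : Prop := IsZero ω x ∧ x ≠ fixedElt ω

theorem size_pos_digit {ω : ℕ} (h : 0 < size ω) : ω / 2 ^ (size ω - 1) % 2 = 1 := by
  have hs := size_eq ω
  have h0 : ω ≠ 0 := by
    rintro rfl
    simp [size, bits] at h
  have h1 := Nat.getLast_digit_ne_zero 2 h0
  rw [List.getLast_eq_getElem] at h1
  have h2 := Nat.getD_digits ω (size ω - 1) (b := 2) le_rfl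
  rw [List.getD_eq_getElem _ _ (by omega)] at h2
  simp only [hs] at h2 ⊢
  rw [← h2]
  have := Nat.digits_lt_base (b := 2) (m := ω) one_lt_two
    (List.getElem_mem (show (Nat.digits 2 ω).length - 1 < (Nat.digits 2 ω).length by omega))
  omega

/-- The bitonic permutation ends with `n, …, 1`, so its first `n + 1` entries are the large
elements, zeros ascending and then ones descending; its middle entry is paired with itself and is
`fixedElt ω`. The entry with index `i < n`, counted from `0`, is paired with `i + 1`. The leading
digit `1` of the key makes `n + 1` a zero, whence `f ≥ n + 2`. -/
theorem layout {ω : ℕ} (h3 : 2 < size ω) :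
    Layout (size ω) (fixedElt ω) (Asc ω) (partner ω) := by
  have hlast : IsZero ω (2 * size ω + 1) := ⟨by omega, le_rfl, fun h => absurd h (by omega)⟩
  have hfmem := bit_mem (ω := ω) (i := size ω) (by omega)
  have hflarge := lt_bit (ω := ω) (i := size ω) le_rfl
  -- If the middle entry is a zero, the entries before it are smaller zeros, and `2n + 1`, which is
  -- among the first `n + 1` entries, has to be the middle one.
  have hfz : IsZero ω (fixedElt ω) → fixedElt ω = 2 * size ω + 1 := by
    intro hz
    obtain ⟨i, hi, h⟩ := exists_bit_large (ω := ω) (x := 2 * size ω + 1) (by omega) le_rfl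
    have h1 := (isZero_bit (by omega)).1 hz
    rcases hi.eq_or_lt with e | hlt
    · rw [← h, e]; rfl
    · have := bit_lt hlt h1 (by omega)
      omega
  have large : ∀ x, size ω < x → x ≤ 2 * size ω + 1 → x ≠ fixedElt ω →
      ∃ i, i < size ω ∧ bit ω i = x ∧ partner ω x = i + 1 ∧ (Asc ω x ↔ i < zeros ω) := by
    intro x hx hx' hxf
    obtain ⟨i, hi, rfl⟩ := exists_bit_large hx hx'
    have hlt : i < size ω := by
      rcases hi.eq_or_lt with e | h
      · rw [e] at hxf
        exact absurd rfl hxf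
      · exact h
    exact ⟨i, hlt, rfl, partner_large hlt, ⟨fun h => (isZero_bit (by omega)).1 h.1,
      fun h => ⟨(isZero_bit (by omega)).2 h, hxf⟩⟩⟩
  refine ⟨h3, ?_, hfmem.2, ?_, fun h => h.2 rfl, ?_, ?_, ?_, ?_, ?_, ?_, ?_, ?_, ?_, ?_⟩
  · by_contra hlt
    have h0 := size_pos_digit (ω := ω) (by omega)
    have e : fixedElt ω = size ω + 1 := by
      unfold fixedElt at hlt ⊢
      omega
    have := hfz (e ▸ ⟨by omega, by omega, fun _ => by
      rw [show 2 * size ω - (size ω + 1) = size ω - 1 by omega]; exact h0⟩)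
    omega
  · intro x hx hxf
    obtain ⟨i, h1, h2, -, h4⟩ := large x hx (by unfold fixedElt at hxf; omega) hxf.ne
    rw [h4]
    -- A large element below `f` that is not a zero would belong to the descending part in front of
    -- the middle entry, and then exceed it.
    by_contra hz
    have := bit_gt (ω := ω) h1 (by omega) (by omega)
    unfold fixedElt at hxf
    omega
  · intro hf
    exact ⟨hlast, by omega⟩
  · intro x hx hx'
    obtain ⟨i, hi, rfl⟩ := exists_bit hx hx'
    rw [partner_bit hi]
    exact (bit_mem (by omega)).1
  · intro x hx hx'
    obtain ⟨i, hi, rfl⟩ := exists_bit hx hx'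
    rw [partner_bit hi]
    exact (bit_mem (by omega)).2
  · intro x hx hx'
    obtain ⟨i, hi, rfl⟩ := exists_bit hx hx'
    rw [partner_bit hi, partner_bit (by omega), Nat.sub_sub_self hi]
  · rw [fixedElt, partner_bit (by omega)]
    congr 1
    omega
  · intro x hx hx' hxf
    obtain ⟨i, h1, -, h2, -⟩ := large x hx hx' hxf
    omega
  · intro x hx hx'
    have h := bit_small (ω := ω) (x - 1) (by omega)
    rw [Nat.sub_add_cancel hx] at h
    rw [← h, partner_bit (by omega)]
    exact lt_bit (by omega)
  · intro x y hx hx' hy hy' hyf hA hA'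
    obtain ⟨i, h1, -, h2, h4⟩ := large x hx hx' hA.2
    obtain ⟨j, g1, -, g2, g4⟩ := large y hy hy' hyf
    rw [h4] at hA
    rw [g4] at hA'
    omega
  · intro x y hx hxy hy hA hA'
    obtain ⟨i, h1, h2, h3, h4⟩ := large x hx (by omega) hA.2
    obtain ⟨j, g1, g2, g3, g4⟩ := large y (by omega) hy hA'.2
    rw [h4] at hA
    by_contra hle
    rcases (show j ≤ i by omega).eq_or_lt with e | hlt
    · rw [e] at g2
      omega
    · have := bit_lt hlt hA (by omega)
      omega
  · intro x y hx hxy hy hxf hyf hA hA'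
    obtain ⟨i, h1, h2, h3, h4⟩ := large x hx (by omega) hxf
    obtain ⟨j, g1, g2, g3, g4⟩ := large y (by omega) hy hyf
    rw [h4] at hA
    by_contra hle
    rcases (show i ≤ j by omega).eq_or_lt with e | hlt
    · rw [e] at h2
      omega
    · have := bit_gt hlt (by omega) (by omega : j ≤ 2 * size ω)
      omega

/-- The ascending elements are given by the digits of the key. -/
theorem asc_iff_digit {ω x : ℕ} (hx : size ω < x) (hx' : x ≤ 2 * size ω) (h3 : 2 < size ω) :
    Asc ω x ↔ ω / 2 ^ (2 * size ω - x) % 2 = 1 := by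
  constructor
  · exact fun h => h.1.2.2 hx'
  · intro h
    by_cases hxf : x = fixedElt ω
    · have L := layout h3
      exfalso
      have h1 : IsZero ω (fixedElt ω) := hxf ▸ ⟨hx, by omega, fun _ => h⟩
      have h2 := (isZero_bit (ω := ω) (by omega)).1 h1
      obtain ⟨i, hi, h4⟩ := exists_bit_large (ω := ω) (x := 2 * size ω + 1) (by omega) le_rfl
      rcases hi.eq_or_lt with e | hlt
      · rw [e] at h4
        unfold fixedElt at hxf
        omega
      · have := bit_lt hlt h2 (by omega)
        unfold fixedElt at hxf
        omega
    · exact ⟨⟨hx, by omega, fun _ => h⟩, hxf⟩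

/-- `treeTarget` searches the elements to the left of `u` from right to left; this is the
corresponding description of the search. -/
theorem find_reverse (P : ℕ → ℕ) (p : ℕ → Bool) : ∀ k,
    (((List.range' 1 k).map P).reverse.find? p = none ∧ ∀ i, 1 ≤ i → i ≤ k → p (P i) = false) ∨
    ∃ j, 1 ≤ j ∧ j ≤ k ∧ ((List.range' 1 k).map P).reverse.find? p = some (P j) ∧
      p (P j) = true ∧ ∀ i, j < i → i ≤ k → p (P i) = false := by
  intro k
  induction k with
  | zero => left; exact ⟨rfl, fun i h h' => by omega⟩
  | succ k ih =>
    rw [List.range'_1_concat, List.map_append, List.map_singleton, List.reverse_append,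
      List.reverse_singleton, List.singleton_append, List.find?_cons, add_comm 1 k]
    cases hp : p (P (k + 1)) with
    | true =>
      right
      exact ⟨k + 1, by omega, le_rfl, rfl, hp, fun i h h' => by omega⟩
    | false =>
      rcases ih with ⟨h1, h2⟩ | ⟨j, h1, h2, h3, h4, h5⟩
      · left
        refine ⟨h1, fun i hi hi' => ?_⟩
        rcases hi'.eq_or_lt with e | h
        · rw [e]; exact hp
        · exact h2 i hi (by omega)
      · right
        refine ⟨j, h1, by omega, h3, h4, fun i hi hi' => ?_⟩
        rcases hi'.eq_or_lt with e | h
        · rw [e]; exact hp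
        · exact h5 i hi (by omega)

/-- The permutation is its own inverse, so `partner ω u` is also the position of `u`; list indexes
start at `0`. -/
theorem idxOf_selfInverting {ω u : ℕ} (h3 : 2 < size ω) (hu : 1 ≤ u)
    (hu' : u ≤ 2 * size ω + 1) : (selfInverting ω).idxOf u = partner ω u - 1 := by
  have L := layout h3
  have hp := L.pos u hu hu'
  have hp' := L.le u hu hu'
  have hnd : (selfInverting ω).Nodup := by
    unfold selfInverting
    rw [List.nodup_map_iff_inj_on List.nodup_range']
    intro x hx y hy e
    rw [List.mem_range'_1] at hx hy
    exact L.inj hx.1 (by omega) hy.1 (by omega) e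
  have hlen : (selfInverting ω).length = 2 * size ω + 1 := by simp [selfInverting]
  have hget : (selfInverting ω)[partner ω u - 1]'(by omega) = u := by
    simp only [selfInverting, List.getElem_map, List.getElem_range']
    rw [show 1 + 1 * (partner ω u - 1) = partner ω u by omega, L.invol u hu hu']
  conv_lhs => rw [← hget]
  exact hnd.idxOf_getElem _ _

theorem isTarget {ω : ℕ} (h3 : 2 < size ω) : IsTarget (size ω) (partner ω) (treeTarget ω) := by
  intro u hu hu'
  have L := layout h3
  have hp := L.pos u hu hu'
  have hp' := L.le u hu hu'
  have htake : (selfInverting ω).take (partner ω u - 1) =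
      (List.range' 1 (partner ω u - 1)).map (partner ω) := by
    unfold selfInverting
    rw [← List.map_take, List.take_range'_of_length_ge (by omega)]
  rw [treeTarget, idxOf_selfInverting h3 hu hu', htake]
  rcases find_reverse (partner ω) (fun v => decide (u < v)) (partner ω u - 1) with
    ⟨h1, h2⟩ | ⟨j, h1, h2, h4, h5, h6⟩
  · left
    rw [h1]
    refine ⟨rfl, fun w hw hw' hlt => ?_⟩
    have h4 := L.pos w (by omega) hw'
    have := h2 (partner ω w) h4 (by omega)
    rw [L.invol w (by omega) hw'] at this
    simp at this
    omega
  · right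
    rw [h4]
    simp only [Option.getD_some]
    rw [L.invol j h1 (by omega)]
    refine ⟨by simpa using h5, L.le j h1 (by omega), by omega, fun w hw hw' hlt => ?_⟩
    by_contra hgt
    have := h6 (partner ω w) (by omega) (by omega)
    rw [L.invol w (by omega) hw'] at this
    simp at this
    omega

theorem treeShape {ω : ℕ} (h3 : 2 < size ω) :
    Shape (size ω) (fixedElt ω) (partner ω (2 * size ω + 1)) (Asc ω) (treeTarget ω) :=
  (layout h3).shape (isTarget h3)

/-- The edges of the watermark whose representative tree is given by `q`. -/
def edgeFinset (n : ℕ) (q : ℕ → ℕ) : Finset (ℕ × ℕ) :=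
  (Finset.Icc 1 (2 * n + 2)).image (fun u => (u, u - 1)) ∪
    (Finset.Icc 1 (2 * n + 1)).image (fun u => (u, q u))

theorem watermark_eq (ω : ℕ) : watermark ω = edgeFinset (size ω) (treeTarget ω) := rfl

theorem mem_edgeFinset {n : ℕ} {q : ℕ → ℕ} {u v : ℕ} :
    (u, v) ∈ edgeFinset n q ↔ Edge n q u v := by
  simp only [edgeFinset, Finset.mem_union, Finset.mem_image, Finset.mem_Icc,
    Prod.mk.injEq, Edge]
  constructor
  · rintro (⟨x, h1, rfl, rfl⟩ | ⟨x, h1, rfl, rfl⟩)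
    · left; omega
    · right; exact ⟨h1.1, h1.2, rfl⟩
  · rintro (⟨h1, h2, h3⟩ | ⟨h1, h2, h3⟩)
    · left; exact ⟨u, ⟨h1, h2⟩, rfl, by omega⟩
    · right; exact ⟨u, ⟨h1, h2⟩, rfl, h3.symm⟩

/-- Path edges descend and tree edges ascend, so no edge is counted twice. -/
theorem card_edgeFinset {n : ℕ} {q : ℕ → ℕ} (hq : ∀ u, 1 ≤ u → u ≤ 2 * n + 1 → u < q u) :
    (edgeFinset n q).card = 4 * n + 3 := by
  rw [edgeFinset, Finset.card_union_of_disjoint, Finset.card_image_of_injOn,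
    Finset.card_image_of_injOn, Nat.card_Icc, Nat.card_Icc]
  · omega
  · intro x _ y _ e
    exact (Prod.mk.inj e).1
  · intro x _ y _ e
    exact (Prod.mk.inj e).1
  · rw [Finset.disjoint_left]
    intro e he he'
    simp only [Finset.mem_image, Finset.mem_Icc] at he he'
    obtain ⟨x, hx, rfl⟩ := he
    obtain ⟨y, hy, e⟩ := he'
    simp only [Prod.mk.injEq] at e
    have := hq y hy.1 hy.2
    omega

end Watermark

namespace Watermark

/-! ### Reasoning about programs -/

@[simp] theorem Store.setReg_reg (s : Store) (y z : Reg) (m : ℕ) :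
    (s.setReg y m).reg z = if z = y then m else s.reg z := by
  simp [Store.setReg, Function.update_apply]

@[simp] theorem Store.setReg_arr (s : Store) (y : Reg) (m : ℕ) : (s.setReg y m).arr = s.arr := rfl

@[simp] theorem Store.setArr_reg (s : Store) (z : Arr) (p m : ℕ) :
    (s.setArr z p m).reg = s.reg := rfl

@[simp] theorem Store.setArr_arr (s : Store) (z z' : Arr) (p p' m : ℕ) :
    (s.setArr z p m).arr z' p' = if z' = z ∧ p' = p then m else s.arr z' p' := by
  by_cases h : z' = z
  · subst h
    simp [Store.setArr, Function.update_apply]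
  · simp [Store.setArr, h]

@[simp] theorem Expr.eval_lit (s : Store) (m : ℕ) : (Expr.lit m).eval s = m := rfl
@[simp] theorem Expr.eval_zero (s : Store) : (0 : Expr).eval s = 0 := rfl
@[simp] theorem Expr.eval_one (s : Store) : (1 : Expr).eval s = 1 := rfl
@[simp] theorem Expr.eval_two (s : Store) : (2 : Expr).eval s = 2 := rfl
@[simp] theorem Expr.eval_three (s : Store) : (3 : Expr).eval s = 3 := rfl
@[simp] theorem Expr.eval_reg (s : Store) (y : Reg) : (Expr.reg y).eval s = s.reg y := rfl
@[simp] theorem Expr.eval_get (s : Store) (z : Arr) (p : Expr) :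
    (Expr.get z p).eval s = s.arr z (p.eval s) := rfl
@[simp] theorem Expr.eval_succ (s : Store) (p : Expr) : (Expr.succ p).eval s = p.eval s + 1 := rfl
@[simp] theorem Expr.eval_sub (s : Store) (p p' : Expr) :
    (p - p').eval s = p.eval s - p'.eval s := rfl

@[simp] theorem Test.eval_lt (s : Store) (p p' : Expr) :
    (Test.lt p p').eval s = decide (p.eval s < p'.eval s) := rfl
@[simp] theorem Test.eval_eq (s : Store) (p p' : Expr) :
    (Test.eq p p').eval s = decide (p.eval s = p'.eval s) := rfl
@[simp] theorem Test.eval_not (s : Store) (T : Test) : (Test.not T).eval s = !T.eval s := rfl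
@[simp] theorem Test.eval_and (s : Store) (T T' : Test) :
    (Test.and T T').eval s = (T.eval s && T'.eval s) := rfl

@[simp] theorem Cmd.exec_skip (s : Store) : Cmd.skip.exec s = s := rfl
@[simp] theorem Cmd.exec_assign (s : Store) (y : Reg) (p : Expr) :
    (Cmd.assign y p).exec s = s.setReg y (p.eval s) := rfl
@[simp] theorem Cmd.exec_put (s : Store) (z : Arr) (p p' : Expr) :
    (Cmd.put z p p').exec s = s.setArr z (p.eval s) (p'.eval s) := rfl
@[simp] theorem Cmd.exec_seq (s : Store) (C C' : Cmd) :
    (Cmd.seq C C').exec s = C'.exec (C.exec s) := rfl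
@[simp] theorem Cmd.exec_ite (s : Store) (T : Test) (C C' : Cmd) :
    (Cmd.ite T C C').exec s = if T.eval s then C.exec s else C'.exec s := rfl
@[simp] theorem Cmd.exec_ifThen (s : Store) (T : Test) (C : Cmd) :
    (Cmd.ifThen T C).exec s = if T.eval s then C.exec s else s := rfl
@[simp] theorem Cmd.exec_inc (s : Store) (y : Reg) :
    (Cmd.inc y).exec s = s.setReg y (s.reg y + 1) := rfl

/-- The registers that a program may change. -/
def Cmd.setsReg : Cmd → Reg → Bool
  | skip, _ => false
  | assign y _, z => decide (y = z)
  | put _ _ _, _ => false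
  | seq C C', z => C.setsReg z || C'.setsReg z
  | ite _ C C', z => C.setsReg z || C'.setsReg z
  | forTo y _ C, z => decide (y = z) || C.setsReg z

/-- The arrays that a program may change. -/
def Cmd.setsArr : Cmd → Arr → Bool
  | skip, _ => false
  | assign _ _, _ => false
  | put y _ _, z => decide (y = z)
  | seq C C', z => C.setsArr z || C'.setsArr z
  | ite _ C C', z => C.setsArr z || C'.setsArr z
  | forTo _ _ C, z => C.setsArr z

/-- `t` agrees with `s` on everything that `C` does not change. -/
structure Same (C : Cmd) (s t : Store) : Prop where
  reg : ∀ y, C.setsReg y = false → t.reg y = s.reg y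
  arr : ∀ z, C.setsArr z = false → t.arr z = s.arr z

theorem iter_induction {g : ℕ → Store → Store} {s : Store} (I : ℕ → Store → Prop) {k : ℕ}
    (h0 : I 0 s) (hs : ∀ m, m < k → ∀ t, I m t → I (m + 1) (g m t)) : I k (iter g k s) := by
  induction k with
  | zero => exact h0
  | succ k ih => exact hs k (by omega) _ (ih (fun m hm => hs m (by omega)))

/-- The frame rule. For a concrete program `setsReg` and `setsArr` evaluate, so that what is
preserved is read off by `rfl`. -/
theorem Cmd.exec_same (C : Cmd) : ∀ s, Same C s (C.exec s) := by
  induction C with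
  | skip => exact fun s => ⟨fun _ _ => rfl, fun _ _ => rfl⟩
  | assign y p =>
    intro s
    refine ⟨fun z hz => ?_, fun _ _ => rfl⟩
    have : ¬ z = y := fun h => by simp [Cmd.setsReg, h] at hz
    simp [this]
  | put y p p' =>
    intro s
    refine ⟨fun _ _ => rfl, fun z hz => ?_⟩
    have : ¬ z = y := fun h => by simp [Cmd.setsArr, h] at hz
    funext x
    simp [this]
  | seq C C' ih ih' =>
    intro s
    refine ⟨fun z hz => ?_, fun z hz => ?_⟩
    · simp only [Cmd.setsReg, Bool.or_eq_false_iff] at hz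
      rw [Cmd.exec_seq, (ih' _).reg z hz.2, (ih s).reg z hz.1]
    · simp only [Cmd.setsArr, Bool.or_eq_false_iff] at hz
      rw [Cmd.exec_seq, (ih' _).arr z hz.2, (ih s).arr z hz.1]
  | ite T C C' ih ih' =>
    intro s
    refine ⟨fun z hz => ?_, fun z hz => ?_⟩
    · simp only [Cmd.setsReg, Bool.or_eq_false_iff] at hz
      rw [Cmd.exec_ite]
      split
      · exact (ih s).reg z hz.1
      · exact (ih' s).reg z hz.2
    · simp only [Cmd.setsArr, Bool.or_eq_false_iff] at hz
      rw [Cmd.exec_ite]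
      split
      · exact (ih s).arr z hz.1
      · exact (ih' s).arr z hz.2
  | forTo y p C ih =>
    intro s
    refine iter_induction (I := fun _ t => Same (Cmd.forTo y p C) s t)
      ⟨fun _ _ => rfl, fun _ _ => rfl⟩ (fun m _ t ht => ⟨fun z hz => ?_, fun z hz => ?_⟩)
    · have hz' := hz
      simp only [Cmd.setsReg, Bool.or_eq_false_iff, decide_eq_false_iff_not] at hz'
      rw [(ih _).reg z hz'.2, Store.setReg_reg, if_neg (Ne.symm hz'.1), ht.reg z hz]
    · rw [(ih _).arr z hz, Store.setReg_arr, ht.arr z hz]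

/-- The rule for loops. -/
theorem Cmd.forTo_induction {y : Reg} {p : Expr} {C : Cmd} {s : Store} (I : ℕ → Store → Prop)
    {k : ℕ} (hk : p.eval s = k) (h0 : I 0 s)
    (hs : ∀ m, m < k → ∀ t, Same (Cmd.forTo y p C) s t → I m t →
      I (m + 1) (C.exec (t.setReg y m))) :
    I k ((Cmd.forTo y p C).exec s) := by
  subst hk
  refine (iter_induction (I := fun m t => Same (Cmd.forTo y p C) s t ∧ I m t)
    (k := p.eval s) ⟨⟨fun _ _ => rfl, fun _ _ => rfl⟩, h0⟩
    (fun m hm t ht => ⟨⟨fun z hz => ?_, fun z hz => ?_⟩, hs m hm t ht.1 ht.2⟩)).2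
  · have hz' := hz
    simp only [Cmd.setsReg, Bool.or_eq_false_iff, decide_eq_false_iff_not] at hz'
    rw [(C.exec_same _).reg z hz'.2, Store.setReg_reg, if_neg (Ne.symm hz'.1), ht.1.reg z hz]
  · rw [(C.exec_same _).arr z hz, Store.setReg_arr, ht.1.arr z hz]

/-! ### The input and its adjacency lists -/

open Reg Arr Cmd Test

/-- The machine neither adds nor halves. The value `2N` arises by `N` increments, and halving is
done by a flag `t` that lets every second iteration count. -/
theorem exec_countEdges {n : ℕ} {s : Store} (hN : s.reg Reg.N = 2 * n + 3) :
    (countEdges.exec s).reg two = 2 * (2 * n + 3) ∧ (countEdges.exec s).reg Reg.n = n ∧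
    (countEdges.exec s).reg k = 4 * n + 3 - s.reg Reg.M := by
  unfold countEdges
  rw [exec_seq, exec_seq]
  generalize hs1 : (Cmd.forTo i N (inc two)).exec ((two ::= N).exec s) = s1
  have h1 : s1.reg two = 2 * (2 * n + 3) := by
    have := Cmd.forTo_induction (y := i) (p := N) (C := inc two) (s := (two ::= N).exec s)
      (I := fun m t => t.reg two = 2 * n + 3 + m) (k := 2 * n + 3) (by simp [hN]) (by simp [hN])
      (fun m _ t _ ht => by simp [ht]; ring)
    rw [hs1] at this
    omega
  have f1 : s1.reg N = 2 * n + 3 ∧ s1.reg M = s.reg M := by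
    subst hs1
    constructor
    · rw [(Cmd.exec_same _ _).reg N rfl]; simp [hN]
    · rw [(Cmd.exec_same _ _).reg M rfl]; simp
  rw [exec_seq, exec_seq, exec_seq]
  generalize hs2 : (Cmd.forTo i (N - 3) _).exec _ = s2
  have h2 : s2.reg Reg.n = n := by
    have := Cmd.forTo_induction (y := i) (p := N - 3)
      (C := ite (t ≐ 0) (t ::= 1) (t ::= 0 ;; inc Reg.n))
      (s := (t ::= 0).exec ((Reg.n ::= 0).exec s1))
      (I := fun m u => u.reg t = m % 2 ∧ u.reg Reg.n = m / 2) (k := 2 * n) (by simp [f1.1])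
      (by simp)
      (fun m _ u _ hu => by
        by_cases h : m % 2 = 0
        · simp [hu, h]; omega
        · simp [hu, h]; omega)
    rw [hs2] at this
    omega
  have f2 : s2.reg two = 2 * (2 * n + 3) ∧ s2.reg M = s.reg M := by
    subst hs2
    constructor
    · rw [(Cmd.exec_same _ _).reg two rfl]; simp [h1]
    · rw [(Cmd.exec_same _ _).reg M rfl]; simp [f1.2]
  simp [f2, h2]
  omega

end Watermark

namespace Watermark

open Reg Arr Cmd Test

/-! ### Reading the forest -/

theorem card_filter_Icc_succ (p : ℕ → Prop) [DecidablePred p] (m : ℕ) :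
    ((Finset.Icc 1 (m + 1)).filter p).card =
      ((Finset.Icc 1 m).filter p).card + if p (m + 1) then 1 else 0 := by
  rw [← Finset.insert_Icc_right_eq_Icc_add_one (by omega), Finset.filter_insert]
  split
  · rw [Finset.card_insert_of_notMem (by simp)]
  · rfl

/-- The first loop of `readForest`. -/
def clearForest : Cmd :=
  forTo v N (put par v 0 ;; put cc v 0 ;; put mc v 0)

/-- The second loop of `readForest`. -/
def readParents : Cmd :=
  forTo j M (
    u ::= lab (src j) ;; v ::= lab (dst j) ;;
    ite (u ≺ v)
      (ite (par u ≐ 0) (put par u v) (good ::= 0))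
      (ifThen (Test.not (Expr.succ v ≐ u)) (good ::= 0)))

/-- The third loop of `readForest`. -/
def countChildren : Cmd :=
  forTo i (N - 2) (
    u ::= Expr.succ i ;;
    ifThen (Test.not (par u ≐ 0)) (
      put cc (par u) (Expr.succ (cc (par u))) ;; put mc (par u) u))

/-- The fourth loop of `readForest`. -/
def findRightmost : Cmd :=
  forTo i (N - 1) (
    v ::= Expr.succ i ;;
    ite (cc v ≐ 0) (put rm v v) (put rm v (rm (mc v))))

/-- The last loop of `readForest`. -/
def findRoots : Cmd :=
  forTo i (N - 1) (
    v ::= N - 1 - i ;;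
    ite (par v ≐ 0) (put ro v v) (put ro v (ro (par v))))

theorem readForest_eq : readForest =
    (good ::= 1 ;; clearForest ;; readParents ;; countChildren ;; findRightmost ;; findRoots) := rfl

theorem clearForest_spec {n : ℕ} {s : Store} (hN : s.reg N = 2 * n + 3) :
    ∀ v, v < 2 * n + 3 → (clearForest.exec s).arr par v = 0 ∧ (clearForest.exec s).arr cc v = 0 ∧
      (clearForest.exec s).arr mc v = 0 :=
  Cmd.forTo_induction (I := fun m t => ∀ v, v < m → t.arr par v = 0 ∧ t.arr cc v = 0 ∧
    t.arr mc v = 0) (by simpa using hN) (by simp) (fun m _ t _ ht v hv => by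
      by_cases h : v = m
      · simp [h]
      · simp [h, ht v (by omega)])

/-- The effect of `readParents`, if the edges have the labels `U j` and `V j`. -/
structure ParentSpec (n m : ℕ) (U V par : ℕ → ℕ) (good : ℕ) : Prop where
  good_le : good ≤ 1
  par_eq : ∀ v, v < 2 * n + 3 → par v = 0 ∨ ∃ j, j < m ∧ U j = v ∧ V j = par v ∧ v < par v
  edge : good = 1 → ∀ j, j < m → (U j < V j ∧ par (U j) = V j) ∨ U j = V j + 1
  bad : good = 0 → (∃ j, j < m ∧ ¬ U j < V j ∧ U j ≠ V j + 1) ∨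
    ∃ j j', j < j' ∧ j' < m ∧ U j < V j ∧ U j' < V j' ∧ U j = U j'

theorem readParents_spec {n m : ℕ} {s : Store} {U V : ℕ → ℕ} (hM : s.reg M = m)
    (hU : ∀ j, j < m → s.arr lab (s.arr src j) = U j)
    (hV : ∀ j, j < m → s.arr lab (s.arr dst j) = V j)
    (hUN : ∀ j, j < m → U j < 2 * n + 3)
    (h0 : ∀ v, v < 2 * n + 3 → s.arr par v = 0) (hg : s.reg good = 1) :
    ParentSpec n m U V ((readParents.exec s).arr par) ((readParents.exec s).reg good) := by
  refine Cmd.forTo_induction (I := fun k t => ParentSpec n k U V (t.arr par) (t.reg good))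
    (by simpa using hM) ⟨by omega, fun v hv => Or.inl (h0 v hv), by simp, by omega⟩
    (fun k hk t hs ht => ?_)
  have e1 : t.arr lab (t.arr src k) = U k := by
    rw [hs.arr lab rfl, hs.arr src rfl, hU k hk]
  have e2 : t.arr lab (t.arr dst k) = V k := by
    rw [hs.arr lab rfl, hs.arr dst rfl, hV k hk]
  have hp := ht.par_eq (U k) (hUN k hk)
  have hgl := ht.good_le
  by_cases h1 : U k < V k
  · by_cases h2 : t.arr par (U k) = 0
    · simp only [exec_seq, exec_assign, exec_ite, exec_put, Test.eval_lt, Test.eval_eq, Expr.eval_get,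
        Expr.eval_reg, Expr.eval_zero, Store.setReg_reg, Store.setReg_arr]
      simp only [reduceCtorEq, if_true, if_false, decide_true, e1, e2, h1, h2]
      refine ⟨by simpa using hgl, fun v hv => ?_, fun hg j hj => ?_, fun hg => ?_⟩
      · by_cases hv' : v = U k
        · right
          exact ⟨k, by omega, by simp [hv', h1]⟩
        · simp only [Store.setArr_arr, hv', Store.setReg_arr]
          rcases ht.par_eq v hv with h | ⟨j, hj, h⟩
          · simp [h]
          · right
            exact ⟨j, by omega, by simpa using h⟩
      · simp at hg
        by_cases hjk : j = k
        · left
          simp [hjk, h1]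
        · rcases ht.edge hg j (by omega) with h | h
          · left
            have : U j ≠ U k := fun e => by
              rw [e, h2] at h
              omega
            simp [this, h]
          · exact Or.inr h
      · simp at hg
        rcases ht.bad hg with ⟨j, hj, h⟩ | ⟨j, j', h, h', h''⟩
        · exact Or.inl ⟨j, by omega, h⟩
        · exact Or.inr ⟨j, j', h, by omega, h''⟩
    · simp only [exec_seq, exec_assign, exec_ite, exec_put, Test.eval_lt, Test.eval_eq, Expr.eval_get,
        Expr.eval_reg, Expr.eval_zero, Store.setReg_reg, Store.setReg_arr]
      simp only [reduceCtorEq, if_true, if_false, decide_true, decide_false, e1, e2, h1, h2]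
      refine ⟨by simp, fun v hv => ?_, by simp, fun _ => Or.inr ?_⟩
      · rcases ht.par_eq v hv with h | ⟨j, hj, h⟩
        · exact Or.inl h
        · exact Or.inr ⟨j, by omega, h⟩
      · rcases hp with h | ⟨j, hj, h, h', h''⟩
        · exact absurd h h2
        · exact ⟨j, k, hj, by omega, by omega, h1, h⟩
  · by_cases h2 : V k + 1 = U k
    · simp only [exec_seq, exec_assign, exec_ite, exec_ifThen, Test.eval_lt, Test.eval_eq,
        Test.eval_not, Expr.eval_get, Expr.eval_succ, Expr.eval_reg, Store.setReg_reg,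
        Store.setReg_arr]
      simp only [reduceCtorEq, if_true, if_false, decide_true, decide_false, e1, e2, h1, h2,
        Bool.not_true, Bool.false_eq_true]
      refine ⟨by simpa using hgl, fun v hv => ?_, fun hg j hj => ?_, fun hg => ?_⟩
      · rcases ht.par_eq v hv with h | ⟨j, hj, h⟩
        · exact Or.inl h
        · exact Or.inr ⟨j, by omega, h⟩
      · simp at hg
        by_cases hjk : j = k
        · right
          rw [hjk, h2]
        · exact ht.edge hg j (by omega)
      · simp at hg
        rcases ht.bad hg with ⟨j, hj, h⟩ | ⟨j, j', h, h', h''⟩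
        · exact Or.inl ⟨j, by omega, h⟩
        · exact Or.inr ⟨j, j', h, by omega, h''⟩
    · simp only [exec_seq, exec_assign, exec_ite, exec_ifThen, Test.eval_lt, Test.eval_eq,
        Test.eval_not, Expr.eval_get, Expr.eval_succ, Expr.eval_reg, Expr.eval_zero,
        Store.setReg_reg, Store.setReg_arr]
      simp only [reduceCtorEq, if_true, if_false, decide_false, e1, e2, h1, h2,
        Bool.not_false, Bool.false_eq_true]
      refine ⟨by simp, fun v hv => ?_, by simp, fun _ => Or.inl ⟨k, by omega, h1, by omega⟩⟩
      rcases ht.par_eq v hv with h | ⟨j, hj, h⟩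
      · exact Or.inl h
      · exact Or.inr ⟨j, by omega, h⟩

/-- The parents of the vertices `1, …, 2n + 1` are greater, and the root has none. -/
structure Ascending (n : ℕ) (par : ℕ → ℕ) : Prop where
  par_eq : ∀ v, 1 ≤ v → v ≤ 2 * n + 1 → par v = 0 ∨ (v < par v ∧ par v ≤ 2 * n + 2)
  root : par (2 * n + 2) = 0

/-- The vertices are scanned in ascending order, so the last child recorded is the greatest. -/
theorem countChildren_spec {n : ℕ} {s : Store} (hN : s.reg N = 2 * n + 3)
    (hc : ∀ v, v < 2 * n + 3 → s.arr cc v = 0) :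
    let t := countChildren.exec s
    ∀ v, 1 ≤ v → v ≤ 2 * n + 2 →
      t.arr cc v = ((Finset.Icc 1 (2 * n + 1)).filter (fun u => s.arr par u = v)).card ∧
      (t.arr cc v ≠ 0 → 1 ≤ t.arr mc v ∧ t.arr mc v ≤ 2 * n + 1 ∧ s.arr par (t.arr mc v) = v ∧
        ∀ u, 1 ≤ u → u ≤ 2 * n + 1 → s.arr par u = v → u ≤ t.arr mc v) := by
  refine Cmd.forTo_induction (I := fun m t => ∀ v, 1 ≤ v → v ≤ 2 * n + 2 →
      t.arr cc v = ((Finset.Icc 1 m).filter (fun u => s.arr par u = v)).card ∧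
      (t.arr cc v ≠ 0 → 1 ≤ t.arr mc v ∧ t.arr mc v ≤ m ∧ s.arr par (t.arr mc v) = v ∧
        ∀ u, 1 ≤ u → u ≤ m → s.arr par u = v → u ≤ t.arr mc v)) (k := 2 * n + 1)
    (by simp [hN]) (fun v hv hv' => ?_) (fun m hm t hs ht v hv hv' => ?_)
  · have := hc v (by omega)
    simp [this]
  have e := congrFun (hs.arr par rfl)
  obtain ⟨h1, h2⟩ := ht v hv hv'
  rw [card_filter_Icc_succ, ← h1]
  by_cases h0 : s.arr par (m + 1) = 0
  · have hne : ¬ (0 = v) := by omega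
    simp [e, h0, hne]
    intro hcc
    obtain ⟨a1, a2, a3, a4⟩ := h2 hcc
    refine ⟨a1, by omega, a3, fun u hu hu' hp => ?_⟩
    by_cases hum : u = m + 1
    · rw [hum, h0] at hp
      omega
    · exact a4 u hu (by omega) hp
  · by_cases hv0 : v = s.arr par (m + 1)
    · simp [e, h0, hv0]
      omega
    · have hv1 : ¬ (s.arr par (m + 1) = v) := fun h => hv0 h.symm
      simp [e, h0, hv0, hv1]
      intro hcc
      obtain ⟨a1, a2, a3, a4⟩ := h2 hcc
      refine ⟨a1, by omega, a3, fun u hu hu' hp => ?_⟩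
      by_cases hum : u = m + 1
      · rw [hum] at hp
        omega
      · exact a4 u hu (by omega) hp

/-- The greatest child of `v` is smaller than `v`, so its entry is final when `v` is treated. For
the roots the order is reversed, because parents are greater. -/
theorem findRightmost_spec {n : ℕ} {s : Store} (hN : s.reg N = 2 * n + 3)
    (hm : ∀ v, 1 ≤ v → v ≤ 2 * n + 2 → s.arr cc v ≠ 0 → 1 ≤ s.arr mc v ∧ s.arr mc v < v) :
    let t := findRightmost.exec s
    ∀ v, 1 ≤ v → v ≤ 2 * n + 2 →
      (s.arr cc v = 0 → t.arr rm v = v) ∧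
      (s.arr cc v ≠ 0 → t.arr rm v = t.arr rm (s.arr mc v)) := by
  refine Cmd.forTo_induction (I := fun m t => ∀ v, 1 ≤ v → v ≤ m →
      (s.arr cc v = 0 → t.arr rm v = v) ∧
      (s.arr cc v ≠ 0 → t.arr rm v = t.arr rm (s.arr mc v))) (k := 2 * n + 2)
    (by simp [hN]) (fun v hv hv' => by omega) (fun m hmn t hs ht v hv hv' => ?_)
  have e := congrFun (hs.arr cc rfl)
  have e' := congrFun (hs.arr mc rfl)
  by_cases hv0 : v = m + 1
  · subst hv0
    by_cases h0 : s.arr cc (m + 1) = 0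
    · simp [e, h0]
    · have := hm _ hv (by omega) h0
      have hne : ¬ (s.arr mc (m + 1) = m + 1) := by omega
      simp [e, e', h0, hne]
  · obtain ⟨h1, h2⟩ := ht v hv (by omega)
    have hne : s.arr cc v ≠ 0 → ¬ (s.arr mc v = m + 1) := fun h => by
      have := hm v hv (by omega) h
      omega
    by_cases h0 : s.arr cc (m + 1) = 0
    · simp [e, h0, hv0]
      exact ⟨h1, fun h => by rw [if_neg (hne h)]; exact h2 h⟩
    · simp [e, e', h0, hv0]
      exact ⟨h1, fun h => by rw [if_neg (hne h)]; exact h2 h⟩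

theorem findRoots_spec {n : ℕ} {s : Store} (hN : s.reg N = 2 * n + 3)
    (ha : Ascending n (s.arr par)) :
    let t := findRoots.exec s
    ∀ v, 1 ≤ v → v ≤ 2 * n + 2 →
      (s.arr par v = 0 → t.arr ro v = v) ∧
      (s.arr par v ≠ 0 → t.arr ro v = t.arr ro (s.arr par v)) := by
  have key : ∀ v, 0 + v < 2 * n + 3 → 0 < v → v ≤ 2 * n + 2 := by omega
  have := Cmd.forTo_induction (y := i) (p := N - 1)
    (C := v ::= N - 1 - i ;; ite (par v ≐ 0) (put ro v v) (put ro v (ro (par v)))) (s := s)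
    (I := fun m t => ∀ v, 2 * n + 3 ≤ m + v → v ≤ 2 * n + 2 →
      (s.arr par v = 0 → t.arr ro v = v) ∧
      (s.arr par v ≠ 0 → t.arr ro v = t.arr ro (s.arr par v))) (k := 2 * n + 2)
    (by simp [hN]) (fun v hv hv' => by omega) (fun m hmn t hs ht v hv hv' => ?_)
  · exact fun v hv hv' => this v (by omega) hv'
  have e := congrFun (hs.arr par rfl)
  have eN : t.reg N = 2 * n + 3 := (hs.reg N rfl).trans hN
  have hp : s.arr par v ≠ 0 → v < s.arr par v := fun h => by
    by_cases hr : v = 2 * n + 2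
    · rw [hr, ha.root] at h
      omega
    · rcases ha.par_eq v (by omega) (by omega) with h | h <;> omega
  by_cases hv0 : v = 2 * n + 2 - m
  · subst hv0
    by_cases h0 : s.arr par (2 * n + 2 - m) = 0
    · simp [e, eN, h0]
    · have hne : ¬ (s.arr par (2 * n + 2 - m) = 2 * n + 2 - m) := by
        have := hp h0
        omega
      simp [e, eN, h0, hne]
  · obtain ⟨h1, h2⟩ := ht v (by omega) (by omega)
    have hne : s.arr par v ≠ 0 → ¬ (s.arr par v = 2 * n + 2 - m) := fun h => by
      have := hp h
      omega
    by_cases h0 : s.arr par (2 * n + 2 - m) = 0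
    · simp [e, eN, h0, hv0]
      exact ⟨h1, fun h => by rw [if_neg (hne h)]; exact h2 h⟩
    · simp [e, eN, h0, hv0]
      exact ⟨h1, fun h => by rw [if_neg (hne h)]; exact h2 h⟩

/-- The memory holds a forest with its tables. -/
structure HasForest (n : ℕ) (t : Store) : Prop where
  N_eq : t.reg N = 2 * n + 3
  n_eq : t.reg Reg.n = n
  asc : Ascending n (t.arr par)
  tables : Tables n (t.arr par) (t.arr cc) (t.arr mc) (t.arr rm) (t.arr ro)

theorem HasForest.of_same {n : ℕ} {C : Cmd} {s t : Store} (h : HasForest n s) (e : Same C s t)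
    (h1 : C.setsReg N = false := by rfl) (h2 : C.setsReg Reg.n = false := by rfl)
    (h3 : C.setsArr par = false := by rfl) (h4 : C.setsArr cc = false := by rfl)
    (h5 : C.setsArr mc = false := by rfl) (h6 : C.setsArr rm = false := by rfl)
    (h7 : C.setsArr ro = false := by rfl) : HasForest n t := by
  refine ⟨(e.reg N h1).trans h.N_eq, (e.reg Reg.n h2).trans h.n_eq, ?_, ?_⟩
  · rw [e.arr par h3]
    exact h.asc
  · rw [e.arr par h3, e.arr cc h4, e.arr mc h5, e.arr rm h6, e.arr ro h7]
    exact h.tables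

theorem readForest_spec {n m : ℕ} {s : Store} {U V : ℕ → ℕ} (hN : s.reg N = 2 * n + 3)
    (hn : s.reg Reg.n = n) (hM : s.reg M = m)
    (hU : ∀ j, j < m → s.arr lab (s.arr src j) = U j)
    (hV : ∀ j, j < m → s.arr lab (s.arr dst j) = V j)
    (hUN : ∀ j, j < m → U j < 2 * n + 3) (hVN : ∀ j, j < m → V j < 2 * n + 3) :
    ParentSpec n m U V ((readForest.exec s).arr par) ((readForest.exec s).reg good) ∧
      HasForest n (readForest.exec s) := by
  rw [readForest_eq]
  simp only [exec_seq]
  generalize e1 : (good ::= (1 : Expr)).exec s = s1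
  have b1 : s1.reg N = 2 * n + 3 ∧ s1.reg Reg.n = n ∧ s1.reg good = 1 ∧ s1.reg M = m ∧
    s1.arr = s.arr := by
    subst e1
    simp [hN, hn, hM]
  have c2 := clearForest_spec b1.1
  have f2 := clearForest.exec_same s1
  generalize clearForest.exec s1 = s2 at c2 f2
  have c3 := readParents_spec (n := n) (s := s2) (m := m) (U := U) (V := V)
    ((f2.reg M rfl).trans b1.2.2.2.1)
    (by rw [f2.arr lab rfl, f2.arr src rfl, b1.2.2.2.2]; exact hU)
    (by rw [f2.arr lab rfl, f2.arr dst rfl, b1.2.2.2.2]; exact hV) hUN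
    (fun v hv => (c2 v hv).1) ((f2.reg good rfl).trans b1.2.2.1)
  have f3 := readParents.exec_same s2
  generalize readParents.exec s2 = s3 at c3 f3
  have hN3 : s3.reg N = 2 * n + 3 := by rw [f3.reg N rfl, f2.reg N rfl, b1.1]
  have hasc : Ascending n (s3.arr par) := by
    refine ⟨fun v hv hv' => ?_, ?_⟩
    · rcases c3.par_eq v (by omega) with h | ⟨j, hj, -, h1, h2⟩
      · exact Or.inl h
      · have := hVN j hj
        omega
    · rcases c3.par_eq (2 * n + 2) (by omega) with h | ⟨j, hj, -, h1, h2⟩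
      · exact h
      · have := hVN j hj
        omega
  have c4 := countChildren_spec hN3 (fun v hv => by rw [f3.arr cc rfl]; exact (c2 v hv).2.1)
  have f4 := countChildren.exec_same s3
  generalize countChildren.exec s3 = s4 at c4 f4
  have hN4 : s4.reg N = 2 * n + 3 := by rw [f4.reg N rfl, hN3]
  have c5 := findRightmost_spec hN4 (fun v hv hv' h => by
    obtain ⟨a1, a2, a3, -⟩ := (c4 v hv hv').2 h
    refine ⟨a1, ?_⟩
    rcases hasc.par_eq _ a1 a2 with h | h <;> omega)
  have f5 := findRightmost.exec_same s4
  generalize findRightmost.exec s4 = s5 at c5 f5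
  have hp : s5.arr par = s3.arr par := by rw [f5.arr par rfl, f4.arr par rfl]
  have c6 := findRoots_spec (n := n) (s := s5) (by rw [f5.reg N rfl, hN4]) (by rw [hp]; exact hasc)
  have f6 := findRoots.exec_same s5
  generalize findRoots.exec s5 = s6 at c6 f6
  have hp' : s6.arr par = s3.arr par := by rw [f6.arr par rfl, hp]
  refine ⟨?_, ?_, ?_, ?_, ?_⟩
  · rw [hp', f6.reg good rfl, f5.reg good rfl, f4.reg good rfl]
    exact c3
  · rw [f6.reg N rfl, f5.reg N rfl, hN4]
  · rw [f6.reg Reg.n rfl, f5.reg Reg.n rfl, f4.reg Reg.n rfl, f3.reg Reg.n rfl, f2.reg Reg.n rfl,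
      b1.2.1]
  · rw [hp']
    exact hasc
  · rw [hp', f6.arr cc rfl, f5.arr cc rfl, f6.arr mc rfl, f5.arr mc rfl, f6.arr rm rfl]
    rw [hp] at c6
    exact ⟨fun v hv hv' => (c4 v hv hv').1, fun v hv hv' => (c4 v hv hv').2,
      fun v hv hv' => (c5 v hv hv').1, fun v hv hv' => (c5 v hv hv').2,
      fun v hv hv' => (c6 v hv hv').1, fun v hv hv' => (c6 v hv hv').2⟩

/-- The marks of the proper descendants of `x`. -/
theorem markDescendants_spec {n : ℕ} {s : Store} (h : HasForest n s) :
    Marks n (s.arr par) (s.reg x) ((markDescendants.exec s).arr de) := by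
  have := Cmd.forTo_induction (y := i) (p := N - 1)
    (C := v ::= N - 1 - i ;; ite (par v ≐ 0) (put de v 0) (
      ite (par v ≐ x) (put de v 1) (put de v (de (par v))))) (s := s)
    (I := fun m t => ∀ v, 2 * n + 3 ≤ m + v → v ≤ 2 * n + 2 →
      (s.arr par v = 0 → t.arr de v = 0) ∧
      (s.arr par v ≠ 0 → s.arr par v = s.reg x → t.arr de v = 1) ∧
      (s.arr par v ≠ 0 → s.arr par v ≠ s.reg x → t.arr de v = t.arr de (s.arr par v)))
    (k := 2 * n + 2) (by simp [h.N_eq]) (fun v hv hv' => by omega)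
    (fun m hmn t hs ht v hv hv' => ?_)
  · exact ⟨fun v hv hv' => (this v (by omega) hv').1, fun v hv hv' => (this v (by omega) hv').2.1,
      fun v hv hv' => (this v (by omega) hv').2.2⟩
  have e := congrFun (hs.arr par rfl)
  have ex := hs.reg x rfl
  have eN : t.reg N = 2 * n + 3 := (hs.reg N rfl).trans h.N_eq
  have hp : s.arr par v ≠ 0 → v < s.arr par v := fun h' => by
    by_cases hr : v = 2 * n + 2
    · rw [hr, h.asc.root] at h'
      omega
    · rcases h.asc.par_eq v (by omega) (by omega) with h | h <;> omega
  by_cases hv0 : v = 2 * n + 2 - m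
  · subst hv0
    by_cases h0 : s.arr par (2 * n + 2 - m) = 0
    · simp [e, eN, h0]
    · have hne : ¬ (s.arr par (2 * n + 2 - m) = 2 * n + 2 - m) := by
        have := hp h0
        omega
      by_cases h1 : s.arr par (2 * n + 2 - m) = s.reg x
      · rw [h1] at h0
        simp [e, eN, ex, h0, h1]
      · simp [e, eN, ex, h0, h1, hne]
  · obtain ⟨h1, h2, h3⟩ := ht v (by omega) (by omega)
    have hne : s.arr par v ≠ 0 → ¬ (s.arr par v = 2 * n + 2 - m) := fun h => by
      have := hp h
      omega
    by_cases h0 : s.arr par (2 * n + 2 - m) = 0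
    · simp [e, eN, h0, hv0]
      exact ⟨h1, h2, fun h h' => by rw [if_neg (hne h)]; exact h3 h h'⟩
    · by_cases h4 : s.arr par (2 * n + 2 - m) = s.reg x
      · simp [e, eN, ex, h4 ▸ h0, h4, hv0]
        exact ⟨h1, h2, fun h h' => by rw [if_neg (hne h)]; exact h3 h h'⟩
      · simp [e, eN, ex, h0, h4, hv0]
        exact ⟨h1, h2, fun h h' => by rw [if_neg (hne h)]; exact h3 h h'⟩

end Watermark

namespace Watermark

open Reg Arr Cmd Test

/-! ### Finding the fixed vertex -/

theorem testLastFixed_spec {n : ℕ} {s : Store} (h : HasForest n s) :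
    (testLastFixed.exec s).reg t = 1 ↔ s.arr cc (2 * n + 1) = 0 ∧
      (∀ u, 1 ≤ u → u ≤ n → s.arr par u ≠ 2 * n → s.arr par u = 0 ∧ s.arr cc u = 0) ∧
      ((Finset.Icc 1 n).filter (fun u => s.arr par u ≠ 2 * n)).card ≤ 2 := by
  unfold testLastFixed
  simp only [exec_seq]
  generalize e1 : (ifThen (Test.not (cc (N - 2) ≐ 0)) (t ::= 0)).exec
    ((c ::= 0).exec ((t ::= 1).exec s)) = s1
  have b1 : s1.reg t ≤ 1 ∧ (s1.reg t = 1 ↔ s.arr cc (2 * n + 1) = 0) ∧ s1.reg c = 0 ∧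
      s1.arr = s.arr ∧ s1.reg N = 2 * n + 3 ∧ s1.reg Reg.n = n := by
    subst e1
    by_cases hc : s.arr cc (2 * n + 1) = 0 <;> simp [hc, h.N_eq, h.n_eq]
  have c2 := Cmd.forTo_induction (y := i) (p := Reg.n) (C := u ::= Expr.succ i ;;
    ifThen (Test.not (par u ≐ N - 3)) (
      ite (Test.and (par u ≐ 0) (cc u ≐ 0)) (inc c) (t ::= 0))) (s := s1)
    (I := fun m z => z.reg t ≤ 1 ∧ (z.reg t = 1 ↔ s.arr cc (2 * n + 1) = 0 ∧
      (∀ u, 1 ≤ u → u ≤ m → s.arr par u ≠ 2 * n → s.arr par u = 0 ∧ s.arr cc u = 0)) ∧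
      (z.reg t = 1 → z.reg c = ((Finset.Icc 1 m).filter (fun u => s.arr par u ≠ 2 * n)).card))
    (k := n) (by simp [b1]) ?_ ?_
  · generalize (Cmd.forTo i Reg.n _).exec s1 = s2 at c2 ⊢
    obtain ⟨a1, a2, a3⟩ := c2
    by_cases hc : 2 < s2.reg c
    · simp only [exec_ifThen, Test.eval_lt, Expr.eval_two, Expr.eval_reg, hc, decide_true,
        if_true, exec_assign, Store.setReg_reg, Expr.eval_zero, zero_ne_one, false_iff]
      rintro ⟨x1, x2, x3⟩
      have := a3 (a2.2 ⟨x1, x2⟩)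
      omega
    · simp only [exec_ifThen, Test.eval_lt, Expr.eval_two, Expr.eval_reg, hc, decide_false,
        Bool.false_eq_true, if_false, a2]
      constructor
      · rintro ⟨x1, x2⟩
        have := a3 (a2.2 ⟨x1, x2⟩)
        exact ⟨x1, x2, by omega⟩
      · rintro ⟨x1, x2, -⟩
        exact ⟨x1, x2⟩
  · refine ⟨b1.1, ?_, by simp [b1]⟩
    rw [b1.2.1]
    exact ⟨fun h => ⟨h, fun u hu hu' => by omega⟩, fun h => h.1⟩
  · rintro m hm z hs ⟨a1, a2, a3⟩
    have ep : z.arr = s.arr := by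
      funext w
      rw [hs.arr w (by cases w <;> rfl), b1.2.2.2.1]
    have eN : z.reg N = 2 * n + 3 := (hs.reg N rfl).trans b1.2.2.2.2.1
    rw [card_filter_Icc_succ]
    have hall : (∀ u, 1 ≤ u → u ≤ m + 1 → s.arr par u ≠ 2 * n → s.arr par u = 0 ∧ s.arr cc u = 0) ↔
        (∀ u, 1 ≤ u → u ≤ m → s.arr par u ≠ 2 * n → s.arr par u = 0 ∧ s.arr cc u = 0) ∧
        (s.arr par (m + 1) ≠ 2 * n → s.arr par (m + 1) = 0 ∧ s.arr cc (m + 1) = 0) := by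
      refine ⟨fun h => ⟨fun u hu hu' => h u hu (by omega), h _ (by omega) le_rfl⟩,
        fun h u hu hu' => ?_⟩
      by_cases hum : u = m + 1
      · exact hum ▸ h.2
      · exact h.1 u hu (by omega)
    rw [hall]
    by_cases h1 : s.arr par (m + 1) = 2 * n
    · simp [ep, eN, h1]
      exact ⟨a1, a2, a3⟩
    · by_cases h2 : s.arr par (m + 1) = 0 ∧ s.arr cc (m + 1) = 0
      · have h3 : ¬ (0 = 2 * n) := fun h => h1 (h2.1.trans h)
        simp [ep, eN, h2, h3]
        exact ⟨a1, a2, a3⟩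
      · simp only [exec_seq, exec_assign, exec_ite, exec_ifThen, Test.eval_eq, Test.eval_not,
          Test.eval_and, Expr.eval_get, Expr.eval_reg, Expr.eval_succ, Expr.eval_zero,
          Expr.eval_sub, Expr.eval_three, Store.setReg_reg, Store.setReg_arr]
        simp only [ep, eN, reduceCtorEq, if_true, if_false, Nat.add_sub_cancel, h1, decide_false,
          Bool.not_false, ← Bool.decide_and, h2, Bool.false_eq_true]
        simp [h1]

/-- The first rule applies to `x`. -/
def RuleOne (n : ℕ) (par cc : ℕ → ℕ) (x : ℕ) : Prop :=
  par x ≠ 0 ∧ par x ≠ 2 * n + 2 ∧ 1 < cc (par x)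

theorem findFixed1_spec {n : ℕ} {s : Store} (h : HasForest n s) (hf : s.reg f = 0) :
    let w := (findFixed1.exec s).reg f
    (w = 0 ∨ ∃ x, n < x ∧ x ≤ 2 * n ∧ RuleOne n (s.arr par) (s.arr cc) x ∧
      w = s.arr mc (s.arr par x)) ∧ w ≤ 2 * n + 1 ∧
    (w = 0 → ∀ x, n < x → x ≤ 2 * n → ¬ RuleOne n (s.arr par) (s.arr cc) x) := by
  have := Cmd.forTo_induction (y := i) (p := Reg.n) (C := x ::= N - 3 - i ;;
    ifThen (Test.and (Test.not (par x ≐ 0)) (Test.not (par x ≐ N - 1))) (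
      ifThen (1 ≺ cc (par x)) (f ::= mc (par x)))) (s := s)
    (I := fun m z => (z.reg f = 0 ∨ ∃ x, n < x ∧ x ≤ 2 * n ∧ RuleOne n (s.arr par) (s.arr cc) x ∧
      z.reg f = s.arr mc (s.arr par x)) ∧ z.reg f ≤ 2 * n + 1 ∧
    (z.reg f = 0 → ∀ x, 2 * n < x + m → x ≤ 2 * n → ¬ RuleOne n (s.arr par) (s.arr cc) x))
    (k := n) (by simp [h.n_eq]) ⟨Or.inl hf, by omega, fun _ x hx hx' => by omega⟩ ?_
  · exact ⟨this.1, this.2.1, fun hw x hx hx' => this.2.2 hw x (by omega) hx'⟩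
  rintro m hm z hs ⟨a1, a2, a3⟩
  have ep : z.arr = s.arr := by
    funext w
    rw [hs.arr w (by cases w <;> rfl)]
  have eN : z.reg N = 2 * n + 3 := (hs.reg N rfl).trans h.N_eq
  by_cases h1 : RuleOne n (s.arr par) (s.arr cc) (2 * n - m)
  · obtain ⟨x1, x2, x3⟩ := h1
    have hpar : s.arr par (2 * n - m) ≤ 2 * n + 2 := by
      rcases h.asc.par_eq (2 * n - m) (by omega) (by omega) with h | h <;> omega
    have hmc := h.tables.mc_spec (s.arr par (2 * n - m)) (by omega) hpar (by omega)
    simp [ep, eN, x1, x2, x3]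
    exact ⟨Or.inr ⟨_, by omega, by omega, ⟨x1, x2, x3⟩, rfl⟩, hmc.2.1, fun h => by omega⟩
  · have : (Cmd.exec (x ::= N - 3 - i ;;
        ifThen (Test.and (Test.not (par x ≐ 0)) (Test.not (par x ≐ N - 1))) (
        ifThen (1 ≺ cc (par x)) (f ::= mc (par x)))) (z.setReg i m)).reg f = z.reg f := by
      by_cases h2 : s.arr par (2 * n - m) ≠ 0 ∧ s.arr par (2 * n - m) ≠ 2 * n + 2
      · have h3 : ¬ 1 < s.arr cc (s.arr par (2 * n - m)) := fun h => h1 ⟨h2.1, h2.2, h⟩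
        simp [ep, eN, h2, h3]
      · by_cases h3 : s.arr par (2 * n - m) = 0
        · simp [ep, eN, h3]
        · have h4 : s.arr par (2 * n - m) = 2 * n + 2 := by
            by_contra h4
            exact h2 ⟨h3, h4⟩
          simp [ep, eN, h4]
    rw [this]
    refine ⟨a1, a2, fun hf0 x hx hx' => ?_⟩
    by_cases hxm : x = 2 * n - m
    · rw [hxm]
      exact h1
    · exact a3 hf0 x (by omega) hx'

/-- The trial of one vertex in the second rule. -/
def tryFixed : Cmd :=
  markDescendants ;;
  t ::= 1 ;; r ::= 0 ;;
  forTo i (N - 2) (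
    v ::= Expr.succ i ;;
    ite (Test.and (Test.not (n ≺ v)) (Test.not (v ≺ x - n)))
      (ifThen (de v ≐ 0) (r ::= v))
      (ifThen (de v ≐ 1) (t ::= 0))) ;;
  forTo i (N - 2) (
    v ::= Expr.succ i ;;
    ite (Test.and (Test.and (Test.not (n ≺ v)) (Test.not (v ≺ x - n))) (de v ≐ 0))
      (ifThen (Test.not (ro v ≐ r)) (t ::= 0))
      (ifThen (ro v ≐ r) (t ::= 0))) ;;
  ifThen (t ≐ 1) (f ::= x)

theorem findFixed2_eq : findFixed2 = (tries ::= 0 ;;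
    forTo h n (x ::= N - 3 - h ;;
      ifThen (Test.and (f ≐ 0) (tries ≺ 2)) (
        ifThen (Test.and (Test.not (cc x ≐ 0)) (Test.not (n ≺ mc x))) (
          inc tries ;; tryFixed)))) := rfl

theorem tryFixed_spec {n : ℕ} {s : Store} (h : HasForest n s) :
    ∃ de r, Marks n (s.arr par) (s.reg x) de ∧ IsTop n de (s.reg x) r ∧
      (Pass n (s.arr ro) de (s.reg x) r → (tryFixed.exec s).reg f = s.reg x) ∧
      (¬ Pass n (s.arr ro) de (s.reg x) r → (tryFixed.exec s).reg f = s.reg f) := by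
  unfold tryFixed
  simp only [exec_seq]
  have d1 := markDescendants_spec h
  have f1 := markDescendants.exec_same s
  generalize markDescendants.exec s = s1 at d1 f1
  refine ⟨s1.arr de, ?_⟩
  generalize e2 : (r ::= 0).exec ((t ::= 1).exec s1) = s2
  have b2 : s2.arr = s1.arr ∧ s2.reg N = 2 * n + 3 ∧ s2.reg Reg.n = n ∧ s2.reg x = s.reg x ∧
      s2.reg f = s.reg f ∧ s2.reg t = 1 ∧ s2.reg r = 0 ∧ s1.arr ro = s.arr ro := by
    subst e2
    simp [f1.reg N rfl, h.N_eq, f1.reg Reg.n rfl, h.n_eq, f1.reg x rfl, f1.reg f rfl, f1.arr ro rfl]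
  -- The first loop keeps the greatest unmarked vertex of the interval in `r` and clears `t` at a
  -- marked vertex outside of the interval.
  have c3 := Cmd.forTo_induction (y := i) (p := N - 2) (C := v ::= Expr.succ i ;;
      ite (Test.and (Test.not (Reg.n ≺ v)) (Test.not (v ≺ x - Reg.n)))
      (ifThen (de v ≐ 0) (r ::= v))
      (ifThen (de v ≐ 1) (t ::= 0))) (s := s2)
    (I := fun m z => z.reg t ≤ 1 ∧
      (z.reg t = 1 ↔ ∀ v, 1 ≤ v → v ≤ m → ¬ (s.reg x ≤ v + n ∧ v ≤ n) → s1.arr de v ≠ 1) ∧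
      (∀ v, 1 ≤ v → v ≤ m → s.reg x ≤ v + n → v ≤ n → s1.arr de v = 0 → v ≤ z.reg r) ∧
      z.reg r ≤ m ∧ (z.reg r = 0 ∨ (1 ≤ z.reg r ∧ s.reg x ≤ z.reg r + n ∧ z.reg r ≤ n ∧
        s1.arr de (z.reg r) = 0)))
    (k := 2 * n + 1) (by simp [b2]) ?_ ?_
  rotate_left
  · refine ⟨by omega, ?_, fun v hv hv' => by omega, by omega, by omega⟩
    simp only [b2, true_iff]
    intro v hv hv'
    omega
  · rintro m hm z hs ⟨a1, a2, a3, a4, a5⟩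
    have ep : z.arr = s1.arr := by
      funext w
      rw [hs.arr w (by cases w <;> rfl), b2.1]
    have en : z.reg Reg.n = n := (hs.reg Reg.n rfl).trans b2.2.2.1
    have ex : z.reg x = s.reg x := (hs.reg x rfl).trans b2.2.2.2.1
    have hall : (∀ v, 1 ≤ v → v ≤ m + 1 → ¬ (s.reg x ≤ v + n ∧ v ≤ n) → s1.arr de v ≠ 1) ↔
        (∀ v, 1 ≤ v → v ≤ m → ¬ (s.reg x ≤ v + n ∧ v ≤ n) → s1.arr de v ≠ 1) ∧
        (¬ (s.reg x ≤ m + 1 + n ∧ m + 1 ≤ n) → s1.arr de (m + 1) ≠ 1) := by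
      refine ⟨fun h => ⟨fun u hu hu' => h u hu (by omega), h _ (by omega) le_rfl⟩,
        fun h u hu hu' => ?_⟩
      by_cases hum : u = m + 1
      · exact hum ▸ h.2
      · exact h.1 u hu (by omega)
    rw [hall]
    by_cases hY : s.reg x ≤ m + 1 + n ∧ m + 1 ≤ n
    · have y1 : ¬ (n < m + 1) := by omega
      have y2 : ¬ (m + 1 < s.reg x - n) := by omega
      by_cases hd : s1.arr de (m + 1) = 0
      · simp only [exec_seq, exec_assign, exec_ite, exec_ifThen, Test.eval_eq, Test.eval_not,
          Test.eval_and, Test.eval_lt, Expr.eval_get, Expr.eval_reg, Expr.eval_succ, Expr.eval_zero,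
          Expr.eval_sub, Store.setReg_reg, Store.setReg_arr]
        simp [ep, en, ex, y1, y2, hd]
        refine ⟨a1, ?_, fun v hv hv' _ _ _ => hv', by omega⟩
        rw [a2]
        exact ⟨fun h v hv hv' h' => h v hv hv' (by omega),
          fun h v hv hv' h' => h v hv hv' (by omega)⟩
      · simp [ep, en, ex, y1, y2, hd]
        refine ⟨a1, ?_, fun v hv hv' h1 h2 h3 => ?_, by omega, a5⟩
        · rw [a2]
          exact ⟨fun h => ⟨fun v hv hv' h' => h v hv hv' (fun hc => by omega), fun hc => by omega⟩,
            fun h v hv hv' h' => h.1 v hv hv' (fun hc => by omega)⟩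
        · by_cases hvm : v = m + 1
          · exact absurd (hvm ▸ h3) hd
          · exact a3 v hv (by omega) h1 h2 h3
    · have hrest : ∀ z' : Store, z'.reg r = z.reg r →
          (∀ v, 1 ≤ v → v ≤ m + 1 → s.reg x ≤ v + n → v ≤ n → s1.arr de v = 0 → v ≤ z'.reg r) ∧
          z'.reg r ≤ m + 1 ∧ (z'.reg r = 0 ∨ (1 ≤ z'.reg r ∧ s.reg x ≤ z'.reg r + n ∧
            z'.reg r ≤ n ∧ s1.arr de (z'.reg r) = 0)) := by
        intro z' hz'
        rw [hz']
        refine ⟨fun v hv hv' h1 h2 h3 => ?_, by omega, a5⟩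
        by_cases hvm : v = m + 1
        · subst hvm
          exact absurd ⟨h1, h2⟩ hY
        · exact a3 v hv (by omega) h1 h2 h3
      have y1 : ¬ (¬ n < m + 1 ∧ ¬ m + 1 < s.reg x - n) := by omega
      rw [← and_assoc]
      refine ⟨?_, hrest _ ?_⟩
      · by_cases hd : s1.arr de (m + 1) = 1
        · simp only [exec_seq, exec_assign, exec_ite, exec_ifThen, Test.eval_eq, Test.eval_not,
            Test.eval_and, Test.eval_lt, Expr.eval_get, Expr.eval_reg, Expr.eval_succ,
            Expr.eval_zero, Expr.eval_one, Expr.eval_sub, Store.setReg_reg, Store.setReg_arr]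
          simp only [ep, en, ex, reduceCtorEq, if_true, if_false, ← decide_not, ← Bool.decide_and,
            y1, decide_false, Bool.false_eq_true, hd, decide_true, Store.setReg_reg]
          refine ⟨by omega, fun h => by simp at h, fun h => absurd rfl (h.2 hY)⟩
        · simp only [exec_seq, exec_assign, exec_ite, exec_ifThen, Test.eval_eq, Test.eval_not,
            Test.eval_and, Test.eval_lt, Expr.eval_get, Expr.eval_reg, Expr.eval_succ,
            Expr.eval_zero, Expr.eval_one, Expr.eval_sub, Store.setReg_reg, Store.setReg_arr]
          simp only [ep, en, ex, reduceCtorEq, if_true, if_false, ← decide_not, ← Bool.decide_and,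
            y1, decide_false, Bool.false_eq_true, hd, Store.setReg_reg]
          exact ⟨a1, a2.trans ⟨fun h => ⟨h, fun _ => hd⟩, fun h => h.1⟩⟩
      · by_cases hd : s1.arr de (m + 1) = 1
        · simp only [exec_seq, exec_assign, exec_ite, exec_ifThen, Test.eval_eq, Test.eval_not,
            Test.eval_and, Test.eval_lt, Expr.eval_get, Expr.eval_reg, Expr.eval_succ,
            Expr.eval_zero, Expr.eval_one, Expr.eval_sub, Store.setReg_reg, Store.setReg_arr]
          simp only [ep, en, ex, reduceCtorEq, if_true, if_false, ← decide_not, ← Bool.decide_and,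
            y1, decide_false, Bool.false_eq_true, hd, decide_true, Store.setReg_reg]
        · simp only [exec_seq, exec_assign, exec_ite, exec_ifThen, Test.eval_eq, Test.eval_not,
            Test.eval_and, Test.eval_lt, Expr.eval_get, Expr.eval_reg, Expr.eval_succ,
            Expr.eval_zero, Expr.eval_one, Expr.eval_sub, Store.setReg_reg, Store.setReg_arr]
          simp only [ep, en, ex, reduceCtorEq, if_true, if_false, ← decide_not, ← Bool.decide_and,
            y1, decide_false, Bool.false_eq_true, hd, Store.setReg_reg]
  generalize e3 : (Cmd.forTo i (N - 2) _).exec s2 = s3 at c3 ⊢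
  have b3 : s3.arr = s1.arr ∧ s3.reg N = 2 * n + 3 ∧ s3.reg Reg.n = n ∧ s3.reg x = s.reg x ∧
      s3.reg f = s.reg f := by
    subst e3
    refine ⟨?_, ?_⟩
    · funext w
      rw [(Cmd.exec_same _ _).arr w (by cases w <;> rfl), b2.1]
    · rw [(Cmd.exec_same _ _).reg N rfl, (Cmd.exec_same _ _).reg Reg.n rfl,
        (Cmd.exec_same _ _).reg x rfl, (Cmd.exec_same _ _).reg f rfl]
      exact ⟨b2.2.1, b2.2.2.1, b2.2.2.2.1, b2.2.2.2.2.1⟩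
  -- The second loop clears `t` unless lying in the tree with root `r` is the same as being unmarked
  -- and in the interval.
  have c4 := Cmd.forTo_induction (y := i) (p := N - 2) (C := v ::= Expr.succ i ;;
      ite (Test.and (Test.and (Test.not (Reg.n ≺ v)) (Test.not (v ≺ x - Reg.n))) (de v ≐ 0))
      (ifThen (Test.not (ro v ≐ r)) (t ::= 0))
      (ifThen (ro v ≐ r) (t ::= 0))) (s := s3)
    (I := fun m z => z.reg t ≤ 1 ∧ (z.reg t = 1 ↔ s3.reg t = 1 ∧ ∀ v, 1 ≤ v → v ≤ m →
      ((s.reg x ≤ v + n ∧ v ≤ n) ∧ s1.arr de v = 0 ↔ s.arr ro v = s3.reg r)))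
    (k := 2 * n + 1) (by simp [b3]) ?_ ?_
  rotate_left
  · refine ⟨c3.1, ⟨fun h => ⟨h, fun v hv hv' => by omega⟩, fun h => h.1⟩⟩
  · rintro m hm z hs ⟨a1, a2⟩
    have ep : z.arr = s1.arr := by
      funext w
      rw [hs.arr w (by cases w <;> rfl), b3.1]
    have en : z.reg Reg.n = n := (hs.reg Reg.n rfl).trans b3.2.2.1
    have ex : z.reg x = s.reg x := (hs.reg x rfl).trans b3.2.2.2.1
    have er : z.reg r = s3.reg r := hs.reg r rfl
    have hall : (∀ v, 1 ≤ v → v ≤ m + 1 → ((s.reg x ≤ v + n ∧ v ≤ n) ∧ s1.arr de v = 0 ↔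
        s.arr ro v = s3.reg r)) ↔
        (∀ v, 1 ≤ v → v ≤ m → ((s.reg x ≤ v + n ∧ v ≤ n) ∧ s1.arr de v = 0 ↔
        s.arr ro v = s3.reg r)) ∧ ((s.reg x ≤ m + 1 + n ∧ m + 1 ≤ n) ∧ s1.arr de (m + 1) = 0 ↔
        s.arr ro (m + 1) = s3.reg r) := by
      refine ⟨fun h => ⟨fun u hu hu' => h u hu (by omega), h _ (by omega) le_rfl⟩,
        fun h u hu hu' => ?_⟩
      by_cases hum : u = m + 1
      · exact hum ▸ h.2
      · exact h.1 u hu (by omega)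
    rw [hall, ← and_assoc, ← a2]
    have hY : ((¬ n < m + 1 ∧ ¬ m + 1 < s.reg x - n) ∧ s1.arr de (m + 1) = 0) ↔
        (s.reg x ≤ m + 1 + n ∧ m + 1 ≤ n) ∧ s1.arr de (m + 1) = 0 := by
      refine and_congr_left fun _ => ?_
      omega
    simp only [exec_seq, exec_assign, exec_ite, exec_ifThen, Test.eval_eq, Test.eval_not,
      Test.eval_and, Test.eval_lt, Expr.eval_get, Expr.eval_reg, Expr.eval_succ,
      Expr.eval_zero, Expr.eval_sub, Store.setReg_reg, Store.setReg_arr]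
    simp only [ep, en, ex, er, reduceCtorEq, if_true, if_false, ← decide_not, ← Bool.decide_and,
      decide_eq_true_eq, hY, b2.2.2.2.2.2.2.2]
    by_cases h1 : (s.reg x ≤ m + 1 + n ∧ m + 1 ≤ n) ∧ s1.arr de (m + 1) = 0 <;>
      by_cases h2 : s.arr ro (m + 1) = s3.reg r
    · simp only [h1, h2, and_self, if_true, not_true_eq_false, if_false]
      simp [a1]
    · simp only [h1, h2, and_self, if_true, not_false_eq_true]
      simp
    · simp only [h1, h2, if_true, if_false]
      simp
    · simp only [h1, h2, if_false]
      simp [a1]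
  generalize e4 : (Cmd.forTo i (N - 2) _).exec s3 = s4 at c4 ⊢
  have b4 : s4.reg x = s.reg x ∧ s4.reg f = s.reg f := by
    subst e4
    rw [(Cmd.exec_same _ _).reg x rfl, (Cmd.exec_same _ _).reg f rfl]
    exact b3.2.2.2
  have hpass : s4.reg t = 1 ↔ Pass n (s.arr ro) (s1.arr de) (s.reg x) (s3.reg r) := by
    rw [c4.2, c3.2.1]
    refine and_congr_right fun _ => ⟨fun h => ⟨fun v hv hv' h1 h2 => (h v hv hv').1 ⟨h1, h2⟩,
      fun v hv hv' h1 h2 => h1 ((h v hv hv').2 h2)⟩, fun h v hv hv' => ?_⟩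
    exact ⟨fun h1 => h.1 v hv hv' h1.1 h1.2, fun h1 => by
      by_contra h2
      exact h.2 v hv hv' h2 h1⟩
  refine ⟨s3.reg r, d1, ⟨fun v hv h1 h2 h3 => c3.2.2.1 v hv (by omega) h1 h2 h3, c3.2.2.2.2⟩, ?_, ?_⟩
  · intro hp
    simp [hpass.2 hp, b4]
  · intro hp
    simp [hpass, hp, b4]

theorem mc_fixed {n f a : ℕ} {A : ℕ → Prop} {q par cc mc rm ro : ℕ → ℕ} (F : Forest n q par)
    (S : Shape n f a A q) (T : Tables n par cc mc rm ro) (hf : f ≤ 2 * n) (hc : cc f ≠ 0) :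
    mc f ≤ n := by
  have hlo := S.le_fixed
  obtain ⟨h1, h2, h3, -⟩ := T.mc_spec f (by omega) (by omega) hc
  have h4 := F.head_eq h1 h2 h3 (by omega)
  rcases S.child_cases hf h1 h2 with h | h | h | h
  · omega
  · exact h.2.1
  · omega
  · omega

/-- The descending scan meets the head of `f₀` before `f₀`. As these are the only candidates, the
limit of two attempts cannot be exhausted before `f₀` has had its turn. -/
theorem findFixed2_spec {n : ℕ} {s : Store} (h : HasForest n s) (hf : s.reg f = 0) :
    (findFixed2.exec s).reg f ≤ 2 * n ∧
    ∀ {f₀ a : ℕ} {A : ℕ → Prop} {q : ℕ → ℕ}, Forest n q (s.arr par) → Shape n f₀ a A q →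
      f₀ ≤ 2 * n → ¬ RuleOne n (s.arr par) (s.arr cc) f₀ →
      (findFixed2.exec s).reg f = f₀ ∨ ((findFixed2.exec s).reg f = 0 ∧ s.arr cc f₀ = 0) := by
  rw [findFixed2_eq, exec_seq]
  generalize e1 : (tries ::= 0).exec s = s1
  have b1 : s1.reg f = 0 ∧ s1.reg tries = 0 ∧ HasForest n s1 ∧ s1.arr = s.arr := by
    subst e1
    exact ⟨by simp [hf], by simp, h.of_same (Cmd.exec_same _ _), rfl⟩
  have := Cmd.forTo_induction (y := Reg.h) (p := Reg.n) (C := x ::= N - 3 - Reg.h ;;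
      ifThen (Test.and (f ≐ 0) (tries ≺ 2)) (
        ifThen (Test.and (Test.not (cc x ≐ 0)) (Test.not (Reg.n ≺ mc x))) (
          inc tries ;; tryFixed))) (s := s1)
    -- As long as nothing is found, `f₀` is still ahead or has no children, and an attempt already
    -- made was spent on `q f₀`.
    (I := fun m z => z.reg f ≤ 2 * n ∧
      ∀ {f₀ a : ℕ} {A : ℕ → Prop} {q : ℕ → ℕ}, Forest n q (s.arr par) → Shape n f₀ a A q →
        f₀ ≤ 2 * n → ¬ RuleOne n (s.arr par) (s.arr cc) f₀ →
        z.reg f = f₀ ∨ (z.reg f = 0 ∧ (f₀ + m ≤ 2 * n ∨ s.arr cc f₀ = 0) ∧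
          (z.reg tries = 0 ∨ (z.reg tries = 1 ∧ 2 * n < q f₀ + m))))
    (k := n) (by simp [b1.2.2.1.n_eq]) ?_ ?_
  · refine ⟨this.1, fun F S hf h1 => ?_⟩
    have hlo := S.le_fixed
    rcases this.2 F S hf h1 with h | ⟨h, h', -⟩
    · exact Or.inl h
    · exact Or.inr ⟨h, by omega⟩
  · exact ⟨by omega, fun F S hf h1 => Or.inr ⟨b1.1, by omega, by omega⟩⟩
  rintro m hm z hs ⟨a1, a2⟩
  have ep : z.arr par = s.arr par := by rw [hs.arr par rfl, b1.2.2.2]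
  have ecc : z.arr cc = s.arr cc := by rw [hs.arr cc rfl, b1.2.2.2]
  have emc : z.arr mc = s.arr mc := by rw [hs.arr mc rfl, b1.2.2.2]
  have ero : z.arr ro = s.arr ro := by rw [hs.arr ro rfl, b1.2.2.2]
  have hz : HasForest n z := b1.2.2.1.of_same hs
  simp only [exec_seq, exec_assign, exec_ifThen, Expr.eval_sub, Expr.eval_reg, Expr.eval_three,
    Store.setReg_reg, Test.eval_and, Test.eval_not, Test.eval_eq, Test.eval_lt, Expr.eval_get,
    Expr.eval_zero, Expr.eval_two, Store.setReg_arr, reduceCtorEq, if_true, if_false, exec_inc,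
    hz.N_eq, hz.n_eq, Nat.add_sub_cancel, ecc, emc, ← decide_not, ← Bool.decide_and,
    decide_eq_true_eq]
  generalize e2 : ((z.setReg Reg.h m).setReg x (2 * n - m)).setReg tries (z.reg tries + 1) = z2
  by_cases h1 : z.reg f = 0 ∧ z.reg tries < 2
  · rw [if_pos h1]
    by_cases h2 : ¬ s.arr cc (2 * n - m) = 0 ∧ ¬ n < s.arr mc (2 * n - m)
    · rw [if_pos h2]
      have b2 : z2.reg x = 2 * n - m ∧ z2.reg f = 0 ∧ z2.reg tries = z.reg tries + 1 ∧
          z2.arr = z.arr := by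
        subst e2
        simp [h1]
      have hz2 : HasForest n z2 := by
        subst e2
        exact hz.of_same ⟨fun y hy => by
          simp only [Cmd.setsReg, Bool.or_eq_false_iff, decide_eq_false_iff_not] at hy
          simp [Ne.symm hy.1, Ne.symm hy.2.1, Ne.symm hy.2.2], fun _ _ => rfl⟩
          (C := Reg.h ::= 0 ;; x ::= 0 ;; tries ::= 0)
      obtain ⟨de, r, hD, hr, hp, hp'⟩ := tryFixed_spec hz2
      have f2 := (tryFixed.exec_same z2).reg tries rfl
      generalize tryFixed.exec z2 = z3 at hp hp' f2
      rw [b2.1] at hD hr hp hp'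
      rw [b2.2.2.2, ep] at hD
      rw [b2.2.2.2, ero] at hp hp'
      rw [b2.2.1] at hp'
      rw [b2.2.2.1] at f2
      refine ⟨?_, ?_⟩
      · by_cases hP : Pass n (s.arr ro) de (2 * n - m) r
        · rw [hp hP]
          omega
        · rw [hp' hP]
          omega
      · intro f₀ a A q F S hf₀ hR
        have hlo := S.le_fixed
        rcases a2 F S hf₀ hR with h3 | ⟨h3, h4, h5⟩
        · omega
        have T := h.tables
        rcases F.rule_two_cases S T hf₀ (x := 2 * n - m) (by omega) (by omega) h2.1 (by omega)
          with h6 | h6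
        · left
          rw [← h6]
          refine hp ?_
          rw [h6] at hD hr ⊢
          exact F.rule_two_pass S T hf₀ hD hR hr
        · right
          have h7 := S.lt f₀ (by omega) (by omega)
          refine ⟨hp' (F.rule_two_fail S T hf₀ (by omega) (by omega) (by omega) h2.1 (by omega) hD),
            Or.inl (by omega), Or.inr (by omega)⟩
    · rw [if_neg h2]
      simp only [Store.setReg_reg, reduceCtorEq, if_false]
      refine ⟨a1, fun {f₀ a A q} F S hf₀ hR => ?_⟩
      rcases a2 F S hf₀ hR with h3 | ⟨h3, h4, h5⟩
      · exact Or.inl h3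
      · refine Or.inr ⟨h3, ?_, by omega⟩
        by_cases hc : s.arr cc f₀ = 0
        · exact Or.inr hc
        · have hmc := mc_fixed F S h.tables hf₀ hc
          left
          by_contra hlt
          have : f₀ = 2 * n - m := by omega
          exact h2 ⟨this ▸ hc, this ▸ (by omega)⟩
  · rw [if_neg h1]
    simp only [Store.setReg_reg, reduceCtorEq, if_false]
    refine ⟨a1, fun {f₀ a A q} F S hf₀ hR => ?_⟩
    rcases a2 F S hf₀ hR with h3 | ⟨h3, h4, h5⟩
    · exact Or.inl h3
    · exact absurd ⟨h3, by omega⟩ h1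

/-- Later iterations may overwrite the register. This is harmless for a damaged watermark, where all
qualifying rightmost vertices coincide. -/
theorem findFixed3_spec {n : ℕ} {s : Store} (h : HasForest n s) (hf : s.reg f = 0) :
    let w := (findFixed3.exec s).reg f
    w ≤ 2 * n + 1 ∧ ∀ f₀, (∃ v, 1 ≤ v ∧ v ≤ 2 * n + 2 ∧ s.arr par v = 0 ∧ s.arr rm v = f₀) →
      (∀ v, 1 ≤ v → v ≤ 2 * n + 2 → s.arr par v = 0 → n < s.arr rm v → s.arr rm v < 2 * n + 2 →
        s.arr rm v = f₀) → n < f₀ → f₀ < 2 * n + 2 → w = f₀ := by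
  have := Cmd.forTo_induction (y := i) (p := N - 1) (C := v ::= Expr.succ i ;;
    ifThen (Test.and (par v ≐ 0) (Test.and (Reg.n ≺ rm v) (rm v ≺ N - 1))) (f ::= rm v)) (s := s)
    (I := fun m z => z.reg f ≤ 2 * n + 1 ∧ ∀ f₀,
      (∀ v, 1 ≤ v → v ≤ 2 * n + 2 → s.arr par v = 0 → n < s.arr rm v → s.arr rm v < 2 * n + 2 →
        s.arr rm v = f₀) → n < f₀ → f₀ < 2 * n + 2 → (z.reg f = f₀ ∨
          ∀ v, 1 ≤ v → v ≤ m → s.arr par v = 0 → s.arr rm v ≠ f₀))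
    (k := 2 * n + 2) (by simp [h.N_eq]) ⟨by omega, fun f₀ _ _ _ => Or.inr fun v hv hv' => by omega⟩ ?_
  · refine ⟨this.1, fun f₀ h1 h2 h3 h4 => ?_⟩
    obtain ⟨v, hv, hv', hv0, hvr⟩ := h1
    rcases this.2 f₀ h2 h3 h4 with h5 | h5
    · exact h5
    · exact absurd hvr (h5 v hv hv' hv0)
  rintro m hm z hs ⟨a1, a2⟩
  have ep : z.arr = s.arr := by
    funext w
    rw [hs.arr w (by cases w <;> rfl)]
  have eN : z.reg N = 2 * n + 3 := (hs.reg N rfl).trans h.N_eq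
  have en : z.reg Reg.n = n := (hs.reg Reg.n rfl).trans h.n_eq
  simp only [exec_seq, exec_assign, exec_ifThen, Expr.eval_sub, Expr.eval_reg, Expr.eval_succ,
    Store.setReg_reg, Test.eval_and, Test.eval_eq, Test.eval_lt, Expr.eval_get, Expr.eval_zero,
    Expr.eval_one, Store.setReg_arr, reduceCtorEq, if_true, if_false, eN, en, ep,
    ← Bool.decide_and, decide_eq_true_eq]
  split
  next h1 =>
    simp only [Store.setReg_reg, if_true]
    refine ⟨by omega, fun f₀ h2 h3 h4 => Or.inl (h2 _ (by omega) (by omega) h1.1 h1.2.1 (by omega))⟩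
  next h1 =>
    simp only [Store.setReg_reg, reduceCtorEq, if_false]
    refine ⟨a1, fun f₀ h2 h3 h4 => ?_⟩
    rcases a2 f₀ h2 h3 h4 with h5 | h5
    · exact Or.inl h5
    · refine Or.inr fun v hv hv' hv0 hvr => ?_
      by_cases hvm : v = m + 1
      · subst hvm
        exact h1 ⟨hv0, by omega, by omega⟩
      · exact h5 v hv (by omega) hv0 hvr

/-- The decoder also runs on wrong labellings, so the bound is proved for every forest, and the
value only for a forest that comes from a watermark. The later specifications are divided in the
same way. -/
theorem findFixed_spec {n : ℕ} {s : Store} (h : HasForest n s) :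
    (findFixed.exec s).reg f ≤ 2 * n + 1 ∧
    ∀ {f₀ a : ℕ} {A : ℕ → Prop} {q : ℕ → ℕ}, Forest n q (s.arr par) → Shape n f₀ a A q →
      (findFixed.exec s).reg f = f₀ := by
  unfold findFixed
  rw [exec_seq]
  have c1 := testLastFixed_spec h
  have f1 := testLastFixed.exec_same s
  generalize testLastFixed.exec s = s1 at c1 f1
  have h1 : HasForest n s1 := h.of_same f1
  have e1 : s1.arr = s.arr := by
    funext w
    rw [f1.arr w (by cases w <;> rfl)]
  rw [exec_ite]
  by_cases ht : s1.reg t = 1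
  · simp only [Test.eval_eq, Expr.eval_reg, Expr.eval_one, ht, decide_true, if_true, exec_assign,
      Store.setReg_reg, Expr.eval_sub, Expr.eval_two, h1.N_eq]
    refine ⟨by omega, fun {f₀ a A q} F S => ?_⟩
    by_contra hf
    have := S.fixed_le
    obtain ⟨x1, x2, x3⟩ := c1.1 ht
    exact F.not_test_last S h.tables (by omega) x1 x2 x3
  simp only [Test.eval_eq, Expr.eval_reg, Expr.eval_one, ht, decide_false, Bool.false_eq_true,
    if_false, exec_seq]
  have hlast : ∀ {f₀ a : ℕ} {A : ℕ → Prop} {q : ℕ → ℕ}, Forest n q (s.arr par) →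
      Shape n f₀ a A q → f₀ ≤ 2 * n := fun F S => by
    by_contra hf
    have := S.fixed_le
    exact ht (c1.2 (F.test_last S h.tables (by omega)))
  generalize e2 : (f ::= 0).exec s1 = s2
  have b2 : HasForest n s2 ∧ s2.reg f = 0 ∧ s2.arr = s.arr := by
    subst e2
    exact ⟨h1.of_same (Cmd.exec_same _ _), by simp, e1⟩
  have c3 := findFixed1_spec b2.1 b2.2.1
  have f3 := findFixed1.exec_same s2
  generalize findFixed1.exec s2 = s3 at c3 f3
  have h3 : HasForest n s3 := b2.1.of_same f3
  have e3 : s3.arr = s.arr := by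
    funext w
    rw [f3.arr w (by cases w <;> rfl), b2.2.2]
  rw [b2.2.2] at c3
  have one : ∀ {f₀ a : ℕ} {A : ℕ → Prop} {q : ℕ → ℕ}, Forest n q (s.arr par) →
      Shape n f₀ a A q → s3.reg f ≠ 0 → s3.reg f = f₀ := fun F S h0 => by
    rcases c3.1 with h4 | ⟨x, hx, hx', hR, h4⟩
    · exact absurd h4 h0
    · rw [h4]
      exact F.rule_one S h.tables (hlast F S) hx hx' hR.1 hR.2.1 hR.2.2
  rw [exec_ifThen, exec_ifThen]
  by_cases h0 : s3.reg f = 0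
  · simp only [Test.eval_eq, Expr.eval_reg, Expr.eval_zero, h0, decide_true, if_true]
    have c4 := findFixed2_spec h3 h0
    have f4 := findFixed2.exec_same s3
    generalize findFixed2.exec s3 = s4 at c4 f4
    have h4 : HasForest n s4 := h3.of_same f4
    rw [e3] at c4
    by_cases h0' : s4.reg f = 0
    · simp only [h0', decide_true, if_true]
      have c5 := findFixed3_spec h4 h0'
      rw [f4.arr par rfl, f4.arr rm rfl, e3] at c5
      refine ⟨c5.1, fun {f₀ a A q} F S => ?_⟩
      have hlo := S.le_fixed
      have hf₀ := hlast F S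
      have hR := c3.2.2 h0 f₀ (by omega) hf₀
      rcases c4.2 F S hf₀ hR with h5 | h5
      · omega
      · have := F.rule_three S h.tables hf₀ hR h5.2
        exact c5.2 f₀ this.1 this.2 (by omega) (by omega)
    · simp only [h0', decide_false, Bool.false_eq_true, if_false]
      refine ⟨by omega, fun {f₀ a A q} F S => ?_⟩
      have hlo := S.le_fixed
      have hf₀ := hlast F S
      have hR := c3.2.2 h0 f₀ (by omega) hf₀
      rcases c4.2 F S hf₀ hR with h5 | h5
      · exact h5
      · exact absurd h5.1 h0'
  · simp only [Test.eval_eq, Expr.eval_reg, Expr.eval_zero, h0, decide_false, Bool.false_eq_true,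
      if_false]
    exact ⟨c3.2.1, fun F S => one F S h0⟩

end Watermark

namespace Watermark

open Reg Arr Cmd Test

/-! ### Finding the ascending vertices -/

theorem card_filter_range_succ (p : ℕ → Prop) [DecidablePred p] (m : ℕ) :
    ((Finset.range (m + 1)).filter p).card =
      ((Finset.range m).filter p).card + if p m then 1 else 0 := by
  rw [Finset.range_add_one, Finset.filter_insert]
  split
  · rw [Finset.card_insert_of_notMem (by simp)]
  · rfl

/-- The large vertices if the last one is the fixed vertex. -/
def ascendBelowLast : Cmd :=
  forTo i (Expr.succ n) (
    x ::= N - 2 - i ;;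
    ite (x ≐ f) (put asc x 0) (put asc x 1))

/-- The children of the root among the large vertices, and the numbers `loose` and `iso`. -/
def ascendChildren : Cmd :=
  forTo i (Expr.succ n) (
    x ::= N - 2 - i ;;
    put asc x 0 ;;
    ifThen (Test.not (x ≐ f)) (
      ifThen (par x ≐ N - 1) (put asc x 1) ;;
      ifThen (par x ≐ f) (inc loose) ;;
      ifThen (par x ≐ 0) (
        inc loose ;;
        ifThen (cc x ≐ 0) (inc iso))))

/-- The isolated large vertices become ascending. -/
def ascendIsolated : Cmd :=
  forTo i (Expr.succ n) (
    x ::= N - 2 - i ;;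
    ifThen (Test.not (x ≐ f)) (
      ifThen (Test.and (par x ≐ 0) (cc x ≐ 0)) (put asc x 1)))

theorem findAscending_eq : findAscending =
    ite (f ≐ N - 2) ascendBelowLast (loose ::= 0 ;; iso ::= 0 ;; ascendChildren ;;
      ifThen (Test.not (loose ≐ 0)) (
        ite (iso ≐ 0) (put asc (N - 2) 1) (
          x ::= f ;; markDescendants ;;
          c ::= 0 ;; forTo i (N - 2) (ifThen (de (Expr.succ i) ≐ 1) (inc c)) ;;
          t ::= 1 ;;
          ifThen (Test.and (iso ≐ 1) (c ≐ N - 2 - f)) (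
            ite (cc (N - 1) ≺ rm f) (put asc (N - 2) 1) (t ::= 0)) ;;
          ifThen (t ≐ 1) ascendIsolated))) := rfl

theorem ascendBelowLast_spec {n : ℕ} {s : Store} (h : HasForest n s) :
    ∀ x, n < x → x ≤ 2 * n + 1 →
      (ascendBelowLast.exec s).arr asc x = if x = s.reg f then 0 else 1 := by
  have := Cmd.forTo_induction (y := i) (p := Expr.succ Reg.n) (C := x ::= N - 2 - i ;;
    ite (x ≐ f) (put asc x 0) (put asc x 1)) (s := s)
    (I := fun m z => ∀ x, 2 * n + 1 < x + m → x ≤ 2 * n + 1 →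
      z.arr asc x = if x = s.reg f then 0 else 1)
    (k := n + 1) (by simp [h.n_eq]) (fun x hx hx' => by omega) (fun m hm z hs hz x hx hx' => ?_)
  · exact fun x hx hx' => this x (by omega) hx'
  have ef : z.reg f = s.reg f := hs.reg f rfl
  have eN : z.reg N = 2 * n + 3 := (hs.reg N rfl).trans h.N_eq
  by_cases hxm : x = 2 * n + 1 - m
  · by_cases hf : 2 * n + 1 - m = s.reg f
    · rw [hxm, if_pos hf]
      simp [eN, ef, ← hf]
    · rw [hxm, if_neg hf]
      simp [eN, ef, hf]
  · have hz := hz x (by omega) hx'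
    by_cases hf : 2 * n + 1 - m = s.reg f
    · have hxf : ¬ x = s.reg f := by omega
      simp only [hxf, if_false] at hz ⊢
      simp [eN, ef, hf, hxf, hz]
    · simp [eN, ef, hf, hxm, hz]

/-- The vertex `x` is isolated in the forest and is not the vertex `g`. -/
def Isolated (par cc : ℕ → ℕ) (g x : ℕ) : Prop := x ≠ g ∧ par x = 0 ∧ cc x = 0

instance (par cc : ℕ → ℕ) (g : ℕ) : DecidablePred (Isolated par cc g) := fun _ =>
  inferInstanceAs (Decidable (_ ∧ _ ∧ _))

theorem ascendChildren_spec {n : ℕ} {s : Store} (h : HasForest n s) (hle : s.reg f ≤ 2 * n + 1)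
    (hi : s.reg iso = 0) :
    let z := ascendChildren.exec s
    (∀ x, n < x → x ≤ 2 * n + 1 →
      z.arr asc x = if x ≠ s.reg f ∧ s.arr par x = 2 * n + 2 then 1 else 0) ∧
    (z.reg loose = 0 → ∀ x, n < x → x ≤ 2 * n + 1 → x ≠ s.reg f → s.arr par x ≠ 0) ∧
    z.reg iso = ((Finset.range (n + 1)).filter
      (fun i => Isolated (s.arr par) (s.arr cc) (s.reg f) (2 * n + 1 - i))).card := by
  have := Cmd.forTo_induction (y := i) (p := Expr.succ Reg.n) (C := x ::= N - 2 - i ;;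
    put asc x 0 ;;
    ifThen (Test.not (x ≐ f)) (
      ifThen (par x ≐ N - 1) (put asc x 1) ;;
      ifThen (par x ≐ f) (inc loose) ;;
      ifThen (par x ≐ 0) (
        inc loose ;;
        ifThen (cc x ≐ 0) (inc iso)))) (s := s)
    (I := fun m z => (∀ x, 2 * n + 1 < x + m → x ≤ 2 * n + 1 →
      z.arr asc x = if x ≠ s.reg f ∧ s.arr par x = 2 * n + 2 then 1 else 0) ∧
    (z.reg loose = 0 → ∀ x, 2 * n + 1 < x + m → x ≤ 2 * n + 1 → x ≠ s.reg f → s.arr par x ≠ 0) ∧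
    z.reg iso = ((Finset.range m).filter
      (fun i => Isolated (s.arr par) (s.arr cc) (s.reg f) (2 * n + 1 - i))).card)
    (k := n + 1) (by simp [h.n_eq]) ⟨fun x hx hx' => by omega, fun _ x hx hx' => by omega,
      by simp [hi]⟩ ?_
  · exact ⟨fun x hx hx' => this.1 x (by omega) hx', fun h0 x hx hx' => this.2.1 h0 x (by omega) hx',
      this.2.2⟩
  rintro m hm z hs ⟨a1, a2, a3⟩
  have ef : z.reg f = s.reg f := hs.reg f rfl
  have eN : z.reg N = 2 * n + 3 := (hs.reg N rfl).trans h.N_eq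
  have ep : z.arr par = s.arr par := hs.arr par rfl
  have ecc : z.arr cc = s.arr cc := hs.arr cc rfl
  have hxm : ∀ x, x ≠ 2 * n + 1 - m → 2 * n + 1 < x + (m + 1) → 2 * n + 1 < x + m := by omega
  rw [card_filter_range_succ, ← a3]
  by_cases hf : 2 * n + 1 - m = s.reg f
  · have hI : ¬ Isolated (s.arr par) (s.arr cc) (s.reg f) (2 * n + 1 - m) := fun h => h.1 hf
    rw [if_neg hI]
    simp only [exec_seq, exec_assign, exec_put, exec_ifThen, Expr.eval_sub, Expr.eval_reg,
      Expr.eval_two, Expr.eval_zero, Test.eval_not, Test.eval_eq, Store.setReg_reg,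
      Store.setArr_reg, reduceCtorEq, if_true, if_false, eN, ef]
    simp only [show 2 * n + 3 - 2 - m = 2 * n + 1 - m from by omega, hf, decide_true,
      Bool.not_true, Bool.false_eq_true, if_false, Store.setArr_arr, Store.setReg_arr,
      Store.setArr_reg, Store.setReg_reg, reduceCtorEq]
    refine ⟨fun x hx hx' => ?_, fun h0 x hx hx' hxf => ?_, by simp⟩
    · by_cases hx0 : x = s.reg f
      · simp [hx0]
      · simp only [hx0, and_false, if_false]
        exact a1 x (by omega) hx'
    · exact a2 h0 x (by omega) hx' hxf
  · by_cases h1 : s.arr par (2 * n + 1 - m) = 2 * n + 2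
    · have hI : ¬ Isolated (s.arr par) (s.arr cc) (s.reg f) (2 * n + 1 - m) := fun h => by
        have := h.2.1
        omega
      rw [if_neg hI]
      have h2 : ¬ (2 * n + 2 = s.reg f) := by omega
      refine ⟨fun x hx hx' => ?_, fun h0 x hx hx' hxf => ?_, ?_⟩
      · by_cases hx0 : x = 2 * n + 1 - m
        · simp [eN, ef, ep, hf, h1, h2, hx0]
        · rw [← a1 x (by omega) hx']
          simp [eN, ef, ep, hf, h1, h2, hx0]
      · by_cases hx0 : x = 2 * n + 1 - m
        · rw [hx0, h1]
          omega
        · refine a2 ?_ x (by omega) hx' hxf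
          simp [eN, ef, ep, hf, h1, h2] at h0
          exact h0
      · simp [eN, ef, ep, hf, h1, h2]
    · have hasc : ∀ y : ℕ → ℕ, (∀ x, x ≠ 2 * n + 1 - m → y x = z.arr asc x) →
          y (2 * n + 1 - m) = 0 → ∀ x, 2 * n + 1 < x + (m + 1) → x ≤ 2 * n + 1 →
          y x = if x ≠ s.reg f ∧ s.arr par x = 2 * n + 2 then 1 else 0 := by
        intro y hy hy' x hx hx'
        by_cases hx0 : x = 2 * n + 1 - m
        · rw [hx0, hy']
          simp [h1]
        · rw [hy x hx0]
          exact a1 x (by omega) hx'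
      by_cases h3 : s.arr par (2 * n + 1 - m) = 0
      -- On a wrong labelling the register `f` may be `0`. Then the tests `par x = f` and `par x =
      -- 0` both succeed and `loose` is increased twice; only whether it vanishes matters.
      · by_cases h5 : s.reg f = 0
        · have hf' : ¬ (2 * n + 1 - m = 0) := by omega
          refine ⟨hasc _ (fun x hx => ?_) ?_, fun h0 => ?_, ?_⟩
          · by_cases h4 : s.arr cc (2 * n + 1 - m) = 0 <;>
              simp [eN, ef, ep, ecc, hf', h3, hx, h4, h5]
          · by_cases h4 : s.arr cc (2 * n + 1 - m) = 0 <;>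
              simp [eN, ef, ep, ecc, hf', h3, h4, h5]
          · exfalso
            by_cases h4 : s.arr cc (2 * n + 1 - m) = 0 <;>
              simp [eN, ef, ep, ecc, hf', h3, h4, h5] at h0
          · by_cases h4 : s.arr cc (2 * n + 1 - m) = 0
            · rw [if_pos ⟨hf, h3, h4⟩]
              simp [eN, ef, ep, ecc, hf', h3, h4, h5]
            · rw [if_neg (fun h => h4 h.2.2)]
              simp [eN, ef, ep, ecc, hf', h3, h4, h5]
        · have h5' : ¬ (0 = s.reg f) := fun h => h5 h.symm
          refine ⟨hasc _ (fun x hx => ?_) ?_, fun h0 => ?_, ?_⟩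
          · by_cases h4 : s.arr cc (2 * n + 1 - m) = 0 <;>
              simp [eN, ef, ep, ecc, hf, h3, hx, h4, h5']
          · by_cases h4 : s.arr cc (2 * n + 1 - m) = 0 <;>
              simp [eN, ef, ep, ecc, hf, h3, h4, h5']
          · exfalso
            by_cases h4 : s.arr cc (2 * n + 1 - m) = 0 <;>
              simp [eN, ef, ep, ecc, hf, h3, h4, h5'] at h0
          · by_cases h4 : s.arr cc (2 * n + 1 - m) = 0
            · rw [if_pos ⟨hf, h3, h4⟩]
              simp [eN, ef, ep, ecc, hf, h3, h4, h5']
            · rw [if_neg (fun h => h4 h.2.2)]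
              simp [eN, ef, ep, ecc, hf, h3, h4, h5']
      · rw [if_neg (fun h => h3 h.2.1)]
        refine ⟨hasc _ (fun x hx => ?_) ?_, fun h0 x hx hx' hxf => ?_, ?_⟩
        · by_cases h5 : s.reg f = s.arr par (2 * n + 1 - m)
          · rw [h5] at ef hf
            simp [eN, ef, ep, hf, h1, h3, hx]
          · have h5' := Ne.symm h5
            simp [eN, ef, ep, hf, h1, h3, hx, h5']
        · by_cases h5 : s.reg f = s.arr par (2 * n + 1 - m)
          · rw [h5] at ef hf
            simp [eN, ef, ep, hf, h1, h3]
          · have h5' := Ne.symm h5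
            simp [eN, ef, ep, hf, h1, h3, h5']
        · by_cases hx0 : x = 2 * n + 1 - m
          · rw [hx0]
            exact h3
          · refine a2 ?_ x (by omega) hx' hxf
            by_cases h5 : s.reg f = s.arr par (2 * n + 1 - m)
            · rw [h5] at ef hf
              simp [eN, ef, ep, hf, h1, h3] at h0
            · have h5' := Ne.symm h5
              simp [eN, ef, ep, hf, h1, h3, h5'] at h0
              exact h0
        · by_cases h5 : s.reg f = s.arr par (2 * n + 1 - m)
          · rw [h5] at ef hf
            simp [eN, ef, ep, hf, h1, h3]
          · have h5' := Ne.symm h5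
            simp [eN, ef, ep, hf, h1, h3, h5']

theorem ascendIsolated_spec {n : ℕ} {s : Store} (h : HasForest n s) :
    ∀ x, n < x → x ≤ 2 * n + 1 → (ascendIsolated.exec s).arr asc x =
      if Isolated (s.arr par) (s.arr cc) (s.reg f) x then 1 else s.arr asc x := by
  have := Cmd.forTo_induction (y := i) (p := Expr.succ Reg.n) (C := x ::= N - 2 - i ;;
    ifThen (Test.not (x ≐ f)) (
      ifThen (Test.and (par x ≐ 0) (cc x ≐ 0)) (put asc x 1))) (s := s)
    (I := fun m z => ∀ x, z.arr asc x = if 2 * n + 1 < x + m ∧ x ≤ 2 * n + 1 ∧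
      Isolated (s.arr par) (s.arr cc) (s.reg f) x then 1 else s.arr asc x)
    (k := n + 1) (by simp [h.n_eq]) (fun x => by rw [if_neg (by omega)])
    (fun m hm z hs hz x => ?_)
  · intro x hx hx'
    have hx1 : 2 * n + 1 < x + (n + 1) := by omega
    have := this x
    simp only [hx1, hx', true_and] at this
    exact this
  have ef : z.reg f = s.reg f := hs.reg f rfl
  have eN : z.reg N = 2 * n + 3 := (hs.reg N rfl).trans h.N_eq
  have ep : z.arr par = s.arr par := hs.arr par rfl
  have ecc : z.arr cc = s.arr cc := hs.arr cc rfl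
  simp only [exec_seq, exec_assign, exec_put, exec_ifThen, Expr.eval_sub, Expr.eval_reg,
    Expr.eval_two, Expr.eval_one, Expr.eval_zero, Test.eval_not, Test.eval_eq, Test.eval_and,
    Expr.eval_get, Store.setReg_reg, Store.setReg_arr, reduceCtorEq, if_true, if_false, eN, ef, ep,
    ecc, show 2 * n + 3 - 2 - m = 2 * n + 1 - m from by omega, ← Bool.decide_and,
    ← decide_not, decide_eq_true_eq]
  have hiff : ∀ x, x ≠ 2 * n + 1 - m →
      ((2 * n + 1 < x + (m + 1) ∧ x ≤ 2 * n + 1 ∧ Isolated (s.arr par) (s.arr cc) (s.reg f) x) ↔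
      (2 * n + 1 < x + m ∧ x ≤ 2 * n + 1 ∧ Isolated (s.arr par) (s.arr cc) (s.reg f) x)) :=
    fun x hx => ⟨fun h => ⟨by omega, h.2⟩, fun h => ⟨by omega, h.2⟩⟩
  by_cases hI : Isolated (s.arr par) (s.arr cc) (s.reg f) (2 * n + 1 - m)
  · rw [if_pos hI.1, if_pos hI.2, Store.setArr_arr]
    by_cases hx : x = 2 * n + 1 - m
    · rw [if_pos ⟨rfl, hx⟩, if_pos ⟨by omega, by omega, hx ▸ hI⟩]
    · rw [if_neg (fun h => hx h.2), Store.setReg_arr, Store.setReg_arr, hz x]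
      simp only [hiff x hx]
  · have : ∀ w w' : Store, w.arr = z.arr → w'.arr = z.arr → (if ¬ 2 * n + 1 - m = s.reg f then
        (if s.arr par (2 * n + 1 - m) = 0 ∧ s.arr cc (2 * n + 1 - m) = 0 then
          w.setArr asc (2 * n + 1 - m) 1 else w) else w').arr asc x = z.arr asc x := by
      intro w w' hw hw'
      by_cases h1 : 2 * n + 1 - m = s.reg f
      · simp [h1, hw']
      · have h2 : ¬ (s.arr par (2 * n + 1 - m) = 0 ∧ s.arr cc (2 * n + 1 - m) = 0) :=
          fun h => hI ⟨h1, h⟩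
        simp only [h1, not_false_eq_true, if_true, h2, if_false, hw]
    rw [this ((z.setReg i m).setReg Reg.x (2 * n + 1 - m)) ((z.setReg i m).setReg Reg.x (2 * n + 1 - m)) rfl rfl, hz x]
    by_cases hx : x = 2 * n + 1 - m
    · rw [if_neg (by omega), if_neg (fun h => hI (hx ▸ h.2.2))]
    · simp only [hiff x hx]

/-- The effect of `findAscending` on any forest. -/
structure AscSpec (n f : ℕ) (asc : ℕ → ℕ) : Prop where
  le_one : ∀ x, n < x → x ≤ 2 * n + 1 → asc x ≤ 1
  fixed : n < f → asc f = 0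
  below_last : f = 2 * n + 1 → ∀ x, n < x → x ≤ 2 * n → asc x = 1

/-- Apart from `f = 2n + 1`, the branches of the program correspond to `Forest.asc_of_connected`,
`Forest.asc_of_no_isolated`, `Forest.asc_of_one_isolated` and `Forest.asc_of_missing`. -/
theorem findAscending_spec {n : ℕ} {s : Store} (h : HasForest n s) (hf : s.reg f ≤ 2 * n + 1) :
    AscSpec n (s.reg f) ((findAscending.exec s).arr asc) ∧
    ∀ {a : ℕ} {A : ℕ → Prop} {q : ℕ → ℕ}, Forest n q (s.arr par) → Shape n (s.reg f) a A q →
      ∀ x, n < x → x ≤ 2 * n + 1 → ((findAscending.exec s).arr asc x = 1 ↔ A x) := by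
  rw [findAscending_eq, exec_ite]
  simp only [Test.eval_eq, Expr.eval_reg, Expr.eval_sub, Expr.eval_two, h.N_eq, decide_eq_true_eq,
    show 2 * n + 3 - 2 = 2 * n + 1 from by omega]
  by_cases hlast : s.reg f = 2 * n + 1
  · rw [if_pos hlast]
    have c := ascendBelowLast_spec h
    rw [hlast] at c ⊢
    refine ⟨⟨fun x hx hx' => ?_, fun hn => ?_, fun _ x hx hx' => ?_⟩, fun {a A q} F S x hx hx' => ?_⟩
    · rw [c x hx hx']
      split <;> omega
    · rw [c _ hn le_rfl, if_pos rfl]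
    · rw [c x hx (by omega), if_neg (by omega)]
    · rw [c x hx hx']
      by_cases hxl : x = 2 * n + 1
      · rw [if_pos hxl, hxl]
        simpa using S.not_asc_fixed
      · rw [if_neg hxl]
        simpa using S.asc_of_lt x hx (by omega)
  rw [if_neg hlast]
  simp only [exec_seq]
  generalize e1 : (iso ::= 0).exec ((loose ::= 0).exec s) = s1
  have b1 : HasForest n s1 ∧ s1.reg f = s.reg f ∧ s1.arr = s.arr ∧ s1.reg iso = 0 := by
    subst e1
    exact ⟨(h.of_same (Cmd.exec_same _ _)).of_same (Cmd.exec_same _ _), by simp⟩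
  obtain ⟨c1, c2, c3⟩ := ascendChildren_spec b1.1 (by rw [b1.2.1]; exact hf) b1.2.2.2
  have f1 := ascendChildren.exec_same s1
  generalize ascendChildren.exec s1 = s2 at c1 c2 c3 f1
  have h2 : HasForest n s2 := b1.1.of_same f1
  have ef : s2.reg f = s.reg f := (f1.reg f rfl).trans b1.2.1
  have ep : s2.arr par = s.arr par := by rw [f1.arr par rfl, b1.2.2.1]
  have ecc : s2.arr cc = s.arr cc := by rw [f1.arr cc rfl, b1.2.2.1]
  have erm : s2.arr rm = s.arr rm := by rw [f1.arr rm rfl, b1.2.2.1]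
  rw [b1.2.1, b1.2.2.1] at c1 c2 c3
  have hle : ∀ x, n < x → x ≤ 2 * n + 1 → s2.arr asc x ≤ 1 := fun x hx hx' => by
    rw [c1 x hx hx']
    split <;> omega
  have hfix : n < s.reg f → s2.arr asc (s.reg f) = 0 := fun hn => by
    rw [c1 _ hn hf]
    simp
  have hone : ∀ x, n < x → x ≤ 2 * n + 1 → x ≠ s.reg f →
      (s2.arr asc x = 1 ↔ s.arr par x = 2 * n + 2) := fun x hx hx' hxf => by
    rw [c1 x hx hx']
    by_cases hp : s.arr par x = 2 * n + 2 <;> simp [hp, hxf]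
  -- `f` is not ascending and is never marked as such, so it can be set aside.
  have fixed : ∀ {a : ℕ} {A : ℕ → Prop} {q : ℕ → ℕ}, Shape n (s.reg f) a A q → ∀ y : ℕ → ℕ,
      y (s.reg f) = 0 → (∀ x, n < x → x ≤ 2 * n + 1 → x ≠ s.reg f → (y x = 1 ↔ A x)) →
      ∀ x, n < x → x ≤ 2 * n + 1 → (y x = 1 ↔ A x) := fun {a A q} S y hy hy' x hx hx' => by
    by_cases hxf : x = s.reg f
    · rw [hxf, hy]
      simpa using S.not_asc_fixed
    · exact hy' x hx hx' hxf
  rw [exec_ifThen]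
  by_cases hl : s2.reg loose = 0
  · simp only [Test.eval_not, Test.eval_eq, Expr.eval_reg, Expr.eval_zero, hl, decide_true,
      Bool.not_true, Bool.false_eq_true, if_false]
    refine ⟨⟨hle, hfix, fun h => absurd h hlast⟩, fun {a A q} F S => ?_⟩
    have hlo := S.le_fixed
    refine fixed S _ (hfix (by omega)) fun x hx hx' hxf => ?_
    rw [hone x hx hx' hxf, F.asc_of_connected S (by omega) (c2 hl x hx hx' hxf) hx hx']
  simp only [Test.eval_not, Test.eval_eq, Expr.eval_reg, Expr.eval_zero, hl, decide_false,
    Bool.not_false, if_true, exec_ite]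
  have hiso : ∀ x, n < x → x ≤ 2 * n + 1 → Isolated (s.arr par) (s.arr cc) (s.reg f) x →
      2 * n + 1 - x ∈ (Finset.range (n + 1)).filter
      (fun i => Isolated (s.arr par) (s.arr cc) (s.reg f) (2 * n + 1 - i)) := fun x hx hx' hI => by
    rw [Finset.mem_filter, Finset.mem_range, show 2 * n + 1 - (2 * n + 1 - x) = x from by omega]
    exact ⟨by omega, hI⟩
  by_cases hi : s2.reg iso = 0
  · simp only [hi, decide_true, if_true, exec_put, Expr.eval_sub, Expr.eval_reg, Expr.eval_two,
      Expr.eval_one, h2.N_eq, show 2 * n + 3 - 2 = 2 * n + 1 from by omega]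
    have ea : ∀ x, (s2.setArr asc (2 * n + 1) 1).arr asc x =
        if x = 2 * n + 1 then 1 else s2.arr asc x := by simp
    refine ⟨⟨fun x hx hx' => ?_, fun hn => ?_, fun h => absurd h hlast⟩, fun {a A q} F S => ?_⟩
    · rw [ea]
      split
      · exact le_rfl
      · exact hle x hx hx'
    · rw [ea, if_neg hlast]
      exact hfix hn
    · have hlo := S.le_fixed
      refine fixed S _ (by rw [ea, if_neg hlast]; exact hfix (by omega)) fun x hx hx' hxf => ?_
      rw [ea, F.asc_of_no_isolated S h.tables (by omega) (fun x hx hx' hxf hI => ?_) hx hx']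
      · by_cases hxl : x = 2 * n + 1
        · simp [hxl]
        · simp only [hxl, if_false, or_false]
          exact hone x hx hx' hxf
      · rw [hi] at c3
        have := hiso x hx hx' ⟨hxf, hI⟩
        rw [Finset.card_eq_zero.1 c3.symm] at this
        simp at this
  simp only [hi, decide_false, Bool.false_eq_true, if_false, exec_seq]
  generalize e3 : (x ::= f).exec s2 = s3
  have b3 : HasForest n s3 ∧ s3.reg x = s.reg f ∧ s3.reg f = s.reg f ∧ s3.arr = s2.arr ∧
      s3.reg iso = s2.reg iso := by
    subst e3
    exact ⟨h2.of_same (Cmd.exec_same _ _), by simp [ef]⟩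
  have d := markDescendants_spec b3.1
  have f4 := markDescendants.exec_same s3
  generalize markDescendants.exec s3 = s4 at d f4
  rw [b3.2.1, b3.2.2.2.1, ep] at d
  have h4 : HasForest n s4 := b3.1.of_same f4
  have c5 := Cmd.forTo_induction (y := i) (p := N - 2) (C := ifThen (de (Expr.succ i) ≐ 1) (inc c))
    (s := (c ::= 0).exec s4)
    (I := fun m z => z.reg c = ((Finset.Icc 1 m).filter (fun v => s4.arr de v = 1)).card)
    (k := 2 * n + 1) (by simp [h4.N_eq]) (by simp) (fun m hm z hs hz => by
      have ed : z.arr de = s4.arr de := by rw [hs.arr de rfl]; rfl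
      rw [card_filter_Icc_succ, ← hz]
      by_cases hd : s4.arr de (m + 1) = 1 <;> simp [ed, hd])
  have f5 := (Cmd.forTo i (N - 2) (ifThen (de (Expr.succ i) ≐ 1) (inc c))).exec_same
    ((c ::= 0).exec s4)
  generalize (Cmd.forTo i (N - 2) (ifThen (de (Expr.succ i) ≐ 1) (inc c))).exec
    ((c ::= 0).exec s4) = s5 at c5 f5
  have h5 : HasForest n s5 := (h4.of_same (Cmd.exec_same (c ::= 0) _)).of_same f5
  have b5 : s5.reg f = s.reg f ∧ s5.arr asc = s2.arr asc ∧ s5.arr par = s.arr par ∧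
      s5.arr cc = s.arr cc ∧ s5.arr rm = s.arr rm ∧ s5.reg iso = s2.reg iso := by
    rw [f5.reg f rfl, f5.arr asc rfl, f5.arr par rfl, f5.arr cc rfl, f5.arr rm rfl, f5.reg iso rfl]
    simp [f4.reg f rfl, f4.arr asc rfl, f4.arr par rfl, f4.arr cc rfl, f4.arr rm rfl, b3, ep, ecc,
      f4.reg iso rfl, erm]
  have hmarks : ∀ {a : ℕ} {A : ℕ → Prop} {q : ℕ → ℕ}, Forest n q (s.arr par) →
      Shape n (s.reg f) a A q → (s5.reg c = 2 * n + 1 - s.reg f ↔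
      ∀ v, s.reg f ≤ v + n → v ≤ n → s.arr par v ≠ 0) := fun F S => by
    rw [c5]
    exact F.card_marks S h.tables (by omega) d
  by_cases hcond : s2.reg iso = 1 ∧ s5.reg c = 2 * n + 1 - s.reg f
  · obtain ⟨j, hj⟩ := Finset.card_eq_one.1 (c3.symm.trans hcond.1)
    have hj' : j ∈ (Finset.range (n + 1)).filter
      (fun i => Isolated (s.arr par) (s.arr cc) (s.reg f) (2 * n + 1 - i)) := by rw [hj]; simp
    rw [Finset.mem_filter, Finset.mem_range] at hj'
    have huniq : ∀ x, n < x → x ≤ 2 * n + 1 → (Isolated (s.arr par) (s.arr cc) (s.reg f) x ↔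
        x = 2 * n + 1 - j) := fun x hx hx' => by
      refine ⟨fun hI => ?_, fun hx0 => hx0 ▸ hj'.2⟩
      have := hiso x hx hx' hI
      rw [hj, Finset.mem_singleton] at this
      omega
    have hA : ∀ {a : ℕ} {A : ℕ → Prop} {q : ℕ → ℕ}, Forest n q (s.arr par) →
      Shape n (s.reg f) a A q → ∀ x, n < x → x ≤ 2 * n + 1 → (A x ↔ s.arr par x = 2 * n + 2 ∨
        (s.arr cc (2 * n + 2) < s.arr rm (s.reg f) ∧ (x = 2 * n + 1 ∨ x = 2 * n + 1 - j))) :=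
      fun F S x hx hx' => F.asc_of_one_isolated S h.tables (by omega) ((hmarks F S).1 hcond.2)
        (by omega) (by omega) hj'.2.1 hj'.2.2.1 hj'.2.2.2
        (fun x hx hx' hxf hp hc => (huniq x hx hx').1 ⟨hxf, hp, hc⟩) hx hx'
    by_cases hlt : s.arr cc (2 * n + 2) < s.arr rm (s.reg f)
    · have e6 : (ifThen (Test.and (iso ≐ 1) (c ≐ N - 2 - f)) (
            ite (cc (N - 1) ≺ rm f) (put asc (N - 2) 1) (t ::= 0))).exec ((t ::= 1).exec s5) =
            ((t ::= 1).exec s5).setArr asc (2 * n + 1) 1 := by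
        simp [b5, h5.N_eq, hcond, hlt]
      rw [e6]
      simp only [exec_ifThen, Test.eval_eq, Expr.eval_reg, exec_assign, Expr.eval_one,
        Store.setArr_reg, Store.setReg_reg, if_true, decide_true]
      have h6 : HasForest n ((s5.setReg t 1).setArr asc (2 * n + 1) 1) :=
        h5.of_same (C := t ::= 0 ;; put asc 0 0)
          ⟨fun y hy => by
            simp only [Cmd.setsReg, Bool.or_false, decide_eq_false_iff_not] at hy
            simp [Ne.symm hy], fun y hy => by
            simp only [Cmd.setsArr, Bool.false_or, decide_eq_false_iff_not] at hy
            funext p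
            simp [Ne.symm hy]⟩
      have c6 := ascendIsolated_spec h6
      simp only [Store.setArr_arr, Store.setReg_arr, Store.setArr_reg, Store.setReg_reg,
        reduceCtorEq, if_false, b5, true_and] at c6
      have epar : ((s5.setReg t 1).setArr asc (2 * n + 1) 1).arr par = s.arr par := by
        funext p
        simp [b5]
      have ecc' : ((s5.setReg t 1).setArr asc (2 * n + 1) 1).arr cc = s.arr cc := by
        funext p
        simp [b5]
      rw [epar, ecc'] at c6
      refine ⟨⟨fun x hx hx' => ?_, fun hn => ?_, fun h => absurd h hlast⟩, fun {a A q} F S => ?_⟩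
      · rw [c6 x hx hx']
        have := hle x hx hx'
        split
        · exact le_rfl
        · split <;> omega
      · rw [c6 _ hn hf, if_neg (fun h => h.1 rfl), if_neg hlast, hfix hn]
      · have hlo := S.le_fixed
        refine fixed S _ ?_ fun x hx hx' hxf => ?_
        · rw [c6 _ (by omega) hf, if_neg (fun h => h.1 rfl), if_neg hlast, hfix (by omega)]
        · rw [hA F S x hx hx', c6 x hx hx']
          by_cases h7 : x = 2 * n + 1 - j
          · rw [if_pos ((huniq x hx hx').2 h7)]
            simp [h7, hlt]
          · rw [if_neg (fun h => h7 ((huniq x hx hx').1 h))]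
            by_cases h8 : x = 2 * n + 1
            · simp [h8, hlt]
            · rw [if_neg h8, hone x hx hx' hxf]
              simp [h7, h8]
    · have e6 : (ifThen (Test.and (iso ≐ 1) (c ≐ N - 2 - f)) (
            ite (cc (N - 1) ≺ rm f) (put asc (N - 2) 1) (t ::= 0))).exec ((t ::= 1).exec s5) =
            ((t ::= 1).exec s5).setReg t 0 := by
        simp [b5, h5.N_eq, hcond, hlt]
      rw [e6]
      simp only [exec_ifThen, Test.eval_eq, Expr.eval_reg, exec_assign, Expr.eval_one,
        Store.setReg_reg, if_true, zero_ne_one, decide_false, Bool.false_eq_true, if_false,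
        Store.setReg_arr, b5]
      refine ⟨⟨hle, hfix, fun h => absurd h hlast⟩, fun {a A q} F S => ?_⟩
      have hlo := S.le_fixed
      refine fixed S _ (hfix (by omega)) fun x hx hx' hxf => ?_
      rw [hone x hx hx' hxf, hA F S x hx hx']
      simp [hlt]
  · have e6 : (ifThen (Test.and (iso ≐ 1) (c ≐ N - 2 - f)) (
            ite (cc (N - 1) ≺ rm f) (put asc (N - 2) 1) (t ::= 0))).exec ((t ::= 1).exec s5) =
            (t ::= 1).exec s5 := by
      simp only [exec_ifThen, Test.eval_and, Test.eval_eq, Expr.eval_reg, Expr.eval_one,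
        Expr.eval_sub, Expr.eval_two, exec_assign, Store.setReg_reg, reduceCtorEq, if_false, b5,
        h5.N_eq, ← Bool.decide_and, decide_eq_true_eq]
      rw [if_neg (fun h => hcond ⟨h.1, by omega⟩)]
    rw [e6]
    simp only [exec_ifThen, Test.eval_eq, Expr.eval_reg, exec_assign, Expr.eval_one,
      Store.setReg_reg, if_true, decide_true]
    have c6 := ascendIsolated_spec (h5.of_same (Cmd.exec_same (t ::= 1) s5))
    simp only [exec_assign, Store.setReg_arr, Store.setReg_reg,
      reduceCtorEq, if_false, b5, Expr.eval_one] at c6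
    refine ⟨⟨fun x hx hx' => ?_, fun hn => ?_, fun h => absurd h hlast⟩, fun {a A q} F S => ?_⟩
    · rw [c6 x hx hx']
      have := hle x hx hx'
      split <;> omega
    · rw [c6 _ hn hf, if_neg (fun h => h.1 rfl), hfix hn]
    · have hlo := S.le_fixed
      refine fixed S _ ?_ fun x hx hx' hxf => ?_
      · rw [c6 _ (by omega) hf, if_neg (fun h => h.1 rfl), hfix (by omega)]
      · have hA : A x ↔ s.arr par x = 2 * n + 2 ∨ (s.arr par x = 0 ∧ s.arr cc x = 0) := by
          -- With one isolated vertex, the count of the descendants of `f` was not the full one, so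
          -- an edge below `f` is missing. Otherwise two large vertices are isolated.
          -- `Forest.asc_of_missing` covers both cases.
          by_cases hi1 : s2.reg iso = 1
          · obtain ⟨j, hj⟩ := Finset.card_pos.1 (by omega : 0 < ((Finset.range (n + 1)).filter
              (fun i => Isolated (s.arr par) (s.arr cc) (s.reg f) (2 * n + 1 - i))).card)
            rw [Finset.mem_filter, Finset.mem_range] at hj
            have hnot : ¬ ∀ v, s.reg f ≤ v + n → v ≤ n → s.arr par v ≠ 0 :=
              fun hv => hcond ⟨hi1, (hmarks F S).2 hv⟩
            push Not at hnot
            obtain ⟨z, hz, hz', hz0⟩ := hnot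
            exact F.asc_of_missing S h.tables (by omega) (y := 2 * n + 1 - j) (z := z) (by omega)
              (by omega) hj.2.1 hj.2.2.1 hj.2.2.2 (by omega) (by omega) (by omega) hz0
              (Or.inl hz') hx hx' hxf
          · obtain ⟨j, hj, j', hj', hne⟩ := Finset.one_lt_card.1
              (by omega : 1 < ((Finset.range (n + 1)).filter
              (fun i => Isolated (s.arr par) (s.arr cc) (s.reg f) (2 * n + 1 - i))).card)
            rw [Finset.mem_filter, Finset.mem_range] at hj hj'
            exact F.asc_of_missing S h.tables (by omega) (y := 2 * n + 1 - j)
              (z := 2 * n + 1 - j') (by omega) (by omega) hj.2.1 hj.2.2.1 hj.2.2.2 (by omega)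
              (by omega) (by omega) hj'.2.2.1 (Or.inr ⟨hj'.2.1, hj'.2.2.2⟩) hx hx' hxf
        rw [hA, c6 x hx hx']
        by_cases hI : Isolated (s.arr par) (s.arr cc) (s.reg f) x
        · rw [if_pos hI]
          simp [hI.2]
        · have : ¬ (s.arr par x = 0 ∧ s.arr cc x = 0) := fun h => hI ⟨hxf, h⟩
          rw [if_neg hI, hone x hx hx' hxf]
          simp [this]

end Watermark

namespace Watermark

open Reg Arr Cmd Test

/-! ### Restoring the permutation and the tree -/

/-- The vertex `x` is listed before `y`: the ascending vertices in ascending order, and then the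
other ones in descending order. -/
def Before (asc : ℕ → ℕ) (x y : ℕ) : Prop :=
  (asc x = 1 ∧ asc y = 1 ∧ x < y) ∨ (asc x = 1 ∧ asc y = 0) ∨ (asc x = 0 ∧ asc y = 0 ∧ y < x)

theorem Before.asymm {asc : ℕ → ℕ} {x y : ℕ} (h : Before asc x y) (h' : Before asc y x) :
    False := by
  unfold Before at h h'
  omega

/-- The first `p` elements of `ps` are the vertices in `S`. -/
structure Listed (asc : ℕ → ℕ) (S : ℕ → Prop) (ps : ℕ → ℕ) (p : ℕ) : Prop where
  mem : ∀ i, 1 ≤ i → i ≤ p → S (ps i)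
  exists_pos : ∀ x, S x → ∃ i, 1 ≤ i ∧ i ≤ p ∧ ps i = x
  before : ∀ i j, 1 ≤ i → i < j → j ≤ p → Before asc (ps i) (ps j)

namespace Listed

variable {asc : ℕ → ℕ} {S S' : ℕ → Prop} {ps ps' : ℕ → ℕ} {p x : ℕ}

theorem append (h : Listed asc S ps p) (hb : ∀ y, S y → Before asc y x)
    (hS : ∀ y, S' y ↔ S y ∨ y = x) (h1 : ps' (p + 1) = x) (h2 : ∀ i, i ≤ p → ps' i = ps i) :
    Listed asc S' ps' (p + 1) := by
  refine ⟨fun i hi hi' => ?_, fun y hy => ?_, fun i j hi hij hj => ?_⟩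
  · rw [hS]
    by_cases hp : i = p + 1
    · right
      rw [hp, h1]
    · left
      rw [h2 i (by omega)]
      exact h.mem i hi (by omega)
  · rcases (hS y).1 hy with hy | hy
    · obtain ⟨i, hi, hi', e⟩ := h.exists_pos y hy
      exact ⟨i, hi, by omega, by rw [h2 i hi', e]⟩
    · exact ⟨p + 1, by omega, le_rfl, by rw [h1, hy]⟩
  · rw [h2 i (by omega)]
    by_cases hp : j = p + 1
    · rw [hp, h1]
      exact hb _ (h.mem i hi (by omega))
    · rw [h2 j (by omega)]
      exact h.before i j hi hij (by omega)

theorem congr (h : Listed asc S ps p) (hS : ∀ y, S' y ↔ S y) : Listed asc S' ps p :=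
  ⟨fun i hi hi' => (hS _).2 (h.mem i hi hi'), fun x hx => h.exists_pos x ((hS x).1 hx), h.before⟩

theorem lt_of_before (h : Listed asc S ps p) {i j : ℕ} (hj : 1 ≤ j) (hi' : i ≤ p)
    (hb : Before asc (ps i) (ps j)) : i < j := by
  by_contra hlt
  by_cases he : i = j
  · rw [he] at hb
    exact hb.asymm hb
  · exact hb.asymm (h.before j i hj (by omega) hi')

theorem inj (h : Listed asc S ps p) {i j : ℕ} (hi : 1 ≤ i) (hi' : i ≤ p) (hj : 1 ≤ j) (hj' : j ≤ p)
    (e : ps i = ps j) : i = j := by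
  rcases lt_trichotomy i j with hij | hij | hij
  · have := h.before i j hi hij hj'
    rw [e] at this
    exact (this.asymm this).elim
  · exact hij
  · have := h.before j i hj hij hi'
    rw [e] at this
    exact (this.asymm this).elim

end Listed

/-- The large vertices other than `f`. -/
def Other (n f x : ℕ) : Prop := n < x ∧ x ≤ 2 * n + 1 ∧ x ≠ f

/-- `Before` is asymmetric, hence the entries are distinct, and there are `n` large vertices other
than `f`. -/
theorem Listed.length {n f p : ℕ} {asc ps : ℕ → ℕ} (h : Listed asc (Other n f) ps p) (hf : n < f)
    (hf' : f ≤ 2 * n + 1) : p = n := by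
  have e : (Finset.Icc 1 p).image ps = (Finset.Icc (n + 1) (2 * n + 1)).erase f := by
    ext x
    simp only [Finset.mem_image, Finset.mem_Icc, Finset.mem_erase]
    constructor
    · rintro ⟨i, hi, rfl⟩
      have := h.mem i hi.1 hi.2
      exact ⟨this.2.2, this.1, this.2.1⟩
    · rintro ⟨h1, h2, h3⟩
      obtain ⟨i, hi, hi', e⟩ := h.exists_pos x ⟨by omega, h3, h1⟩
      exact ⟨i, ⟨hi, hi'⟩, e⟩
  have := congrArg Finset.card e
  rw [Finset.card_image_of_injOn, Finset.card_erase_of_mem (by simp; omega), Nat.card_Icc,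
    Nat.card_Icc] at this
  · omega
  · intro i hi j hj e
    simp only [Finset.coe_Icc, Set.mem_Icc] at hi hj
    exact h.inj hi.1 hi.2 hj.1 hj.2 e

/-- All vertices below `f` are ascending, so the entries up to position `i` are exactly `n + 1, …,
ps i`, and counting them gives the value. -/
theorem Listed.initial {n f p : ℕ} {asc ps : ℕ → ℕ} (h : Listed asc (Other n f) ps p)
    (hlt : ∀ x, n < x → x < f → asc x = 1) (hf' : f ≤ 2 * n + 1) {i : ℕ} (hi : 1 ≤ i) (hi' : i ≤ p)
    (hx : ps i < f) : ps i = n + i := by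
  have hn := (h.mem i hi hi').1
  have ha := hlt _ hn hx
  have e : (Finset.Icc 1 i).image ps = Finset.Ioc n (ps i) := by
    ext x
    simp only [Finset.mem_image, Finset.mem_Icc, Finset.mem_Ioc]
    constructor
    · rintro ⟨j, hj, rfl⟩
      refine ⟨(h.mem j hj.1 (by omega)).1, ?_⟩
      by_cases hji : j = i
      · rw [hji]
      · have := h.before j i hj.1 (by omega) hi'
        unfold Before at this
        omega
    · rintro ⟨h1, h2⟩
      obtain ⟨j, hj, hj', e⟩ := h.exists_pos x ⟨h1, by omega, by omega⟩
      refine ⟨j, ⟨hj, ?_⟩, e⟩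
      by_cases hxi : x = ps i
      · rw [hxi] at e
        exact (h.inj hj hj' hi hi' e).le
      · refine (h.lt_of_before hi hj' ?_).le
        rw [e]
        exact Or.inl ⟨hlt x h1 (by omega), ha, by omega⟩
  have := congrArg Finset.card e
  rw [Finset.card_image_of_injOn, Nat.card_Icc, Nat.card_Ioc] at this
  · omega
  · intro j hj k hk e
    simp only [Finset.coe_Icc, Set.mem_Icc] at hj hk
    exact h.inj hj.1 (by omega) hk.1 (by omega) e

/-- The conditions on the fixed vertex and on the ascending vertices that the decoder checks. -/
structure Checked (n f : ℕ) (asc : ℕ → ℕ) : Prop where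
  le_fixed : n + 2 ≤ f
  last : f ≠ 2 * n + 1 → asc (2 * n + 1) ≠ 0
  lt : ∀ x, n < x → x ≤ 2 * n → x < f → asc x ≠ 0

/-- The first half is sorted by `Before` and the rest is its inverse, so each axiom about the order
is `Listed.lt_of_before` read at the positions of the two elements. -/
theorem Listed.layout {n f : ℕ} {asc ps : ℕ → ℕ} (h3 : 3 ≤ n) (h : Listed asc (Other n f) ps n)
    (C : Checked n f asc) (a : AscSpec n f asc) (hf' : f ≤ 2 * n + 1) (hfix : ps f = f)
    (hinv : ∀ i, 1 ≤ i → i ≤ n → ps (ps i) = i) : Layout n f (fun x => asc x = 1) ps := by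
  have hlo := C.le_fixed
  have hz : asc f = 0 := a.fixed (by omega)
  have hone : ∀ x, n < x → x ≤ 2 * n + 1 → asc x ≠ 0 → asc x = 1 := fun x hx hx' h0 => by
    have := a.le_one x hx hx'
    omega
  have key : ∀ x, 1 ≤ x → x ≤ 2 * n + 1 → x = f ∨ (x ≤ n ∧ Other n f (ps x) ∧ ps (ps x) = x) ∨
      (Other n f x ∧ ∃ i, 1 ≤ i ∧ i ≤ n ∧ ps i = x ∧ ps x = i) := fun x hx hx' => by
    by_cases hxf : x = f
    · exact Or.inl hxf
    · right
      by_cases hxn : x ≤ n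
      · exact Or.inl ⟨hxn, h.mem x hx hxn, hinv x hx hxn⟩
      · right
        have hO : Other n f x := ⟨by omega, hx', hxf⟩
        obtain ⟨i, hi, hi', e⟩ := h.exists_pos x hO
        exact ⟨hO, i, hi, hi', e, by rw [← e]; exact hinv i hi hi'⟩
  have pos : ∀ x, n < x → x ≤ 2 * n + 1 → x ≠ f → ∃ i, 1 ≤ i ∧ i ≤ n ∧ ps i = x ∧ ps x = i :=
    fun x hx hx' hxf => by
    rcases key x (by omega) hx' with h | h | h
    · exact absurd h hxf
    · omega
    · exact h.2
  have hb : ∀ x y, n < x → x ≤ 2 * n + 1 → x ≠ f → n < y → y ≤ 2 * n + 1 → y ≠ f →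
      Before asc x y → ps x < ps y := fun x y hx hx' hxf hy hy' hyf hxy => by
    obtain ⟨i, hi, hi', e, e'⟩ := pos x hx hx' hxf
    obtain ⟨j, hj, hj', e1, e1'⟩ := pos y hy hy' hyf
    rw [e', e1']
    refine h.lt_of_before hj hi' ?_
    rw [e, e1]
    exact hxy
  have hzero : ∀ x, n < x → x ≤ 2 * n + 1 → ¬ asc x = 1 → asc x = 0 := fun x hx hx' h1 => by
    have := a.le_one x hx hx'
    omega
  have hne : ∀ x, asc x = 1 → x ≠ f := fun x hx hxf => by
    rw [hxf, hz] at hx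
    omega
  refine ⟨h3, hlo, hf', fun x hx hxf => ?_, by simp [hz], fun hf => ?_, fun x hx hx' => ?_,
    fun x hx hx' => ?_, fun x hx hx' => ?_, hfix, fun x hx hx' hxf => ?_, fun x hx hx' => ?_,
    fun x y hx hx' hy hy' hyf hA hA' => ?_, fun x y hx hxy hy' hA hA' => ?_,
    fun x y hx hxy hy' hxf hyf hA hA' => ?_⟩
  · exact hone x hx (by omega) (C.lt x hx (by omega) hxf)
  · exact hone _ (by omega) le_rfl (C.last (by omega))
  · rcases key x hx hx' with h | h | ⟨h, i, h'⟩
    · rw [h, hfix]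
      omega
    · have := h.2.1.1
      omega
    · omega
  · rcases key x hx hx' with h | h | ⟨h, i, h'⟩
    · rw [h, hfix]
      omega
    · exact h.2.1.2.1
    · omega
  · rcases key x hx hx' with h | h | ⟨h, i, h'⟩
    · rw [h, hfix, hfix]
    · exact h.2.2
    · rw [h'.2.2.2, h'.2.2.1]
  · obtain ⟨i, hi, hi', e, e'⟩ := pos x hx hx' hxf
    omega
  · exact (h.mem x hx hx').1
  · exact hb x y hx hx' (hne x hA) hy hy' hyf (Or.inr (Or.inl ⟨hA, hzero y hy hy' hA'⟩))
  · exact hb x y hx (by omega) (hne x hA) (by omega) hy' (hne y hA') (Or.inl ⟨hA, hA', hxy⟩)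
  · exact hb y x (by omega) hy' hyf hx (by omega) hxf
      (Or.inr (Or.inr ⟨hzero y (by omega) hy' hA', hzero x hx (by omega) hA, hxy⟩))

/-- The ascending vertices in `findPreorder`. -/
def listAscending : Cmd :=
  forTo i (Expr.succ n) (x ::= N - 2 - (n - i) ;; ifThen (asc x ≐ 1) (append x))

/-- The descending vertices in `findPreorder`. -/
def listDescending : Cmd :=
  forTo i (Expr.succ n) (x ::= N - 2 - i ;;
    ifThen (Test.and (asc x ≐ 0) (Test.not (x ≐ f))) (append x))

/-- The initial small vertices in `findPreorder`. -/
def listInitial : Cmd := forTo i (f - n - 1) (append (Expr.succ i))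

/-- The remaining small vertices in `findPreorder`. -/
def listInverse : Cmd := forTo i (N - 2 - f) (u ::= n - i ;; put ps (ps u) u)

theorem findPreorder_eq : findPreorder =
    (pos ::= 0 ;; listAscending ;; listDescending ;; listInitial ;; append f ;; listInverse) := rfl

theorem exec_append (s : Store) (p : Expr) (h : p.eval (s.setReg pos (s.reg pos + 1)) = p.eval s) :
    (append p).exec s =
      (s.setReg pos (s.reg pos + 1)).setArr ps (s.reg pos + 1) (p.eval s) := by
  simp [append, h]

theorem listAscending_spec {n : ℕ} {s : Store} (hN : s.reg N = 2 * n + 3) (hn : s.reg Reg.n = n)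
    (hp : s.reg pos = 0) :
    Listed (s.arr asc) (fun x => n < x ∧ x ≤ 2 * n + 1 ∧ s.arr asc x = 1)
      ((listAscending.exec s).arr ps) ((listAscending.exec s).reg pos) := by
  have := Cmd.forTo_induction (y := i) (p := Expr.succ Reg.n)
    (C := x ::= N - 2 - (Reg.n - i) ;; ifThen (asc x ≐ 1) (append x)) (s := s)
    (I := fun m z => Listed (s.arr asc) (fun x => n < x ∧ x ≤ n + m ∧ s.arr asc x = 1)
      (z.arr ps) (z.reg pos)) (k := n + 1) (by simp [hn]) ?_ (fun m hm z hs hz => ?_)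
  · exact this.congr fun y => by rw [show n + (n + 1) = 2 * n + 1 from by omega]
  · rw [hp]
    exact ⟨fun i hi hi' => by omega, fun x hx => by omega, fun i j hi hij hj => by omega⟩
  have eN : z.reg N = 2 * n + 3 := (hs.reg N rfl).trans hN
  have en : z.reg Reg.n = n := (hs.reg Reg.n rfl).trans hn
  have ea : z.arr asc = s.arr asc := hs.arr asc rfl
  have ex : 2 * n + 3 - 2 - (n - m) = n + m + 1 := by omega
  by_cases h1 : s.arr asc (n + m + 1) = 1
  · simp only [exec_seq, exec_assign, exec_ifThen, Expr.eval_sub, Expr.eval_reg, Expr.eval_two,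
      Store.setReg_reg, reduceCtorEq, if_true, if_false, eN, en, ex, Test.eval_eq, Expr.eval_get,
      Store.setReg_arr, ea, h1, Expr.eval_one, decide_true]
    rw [exec_append _ _ (by simp)]
    simp only [Store.setArr_reg, Store.setReg_reg, reduceCtorEq, if_true, if_false, Expr.eval_reg]
    refine hz.append (x := n + m + 1) (fun y hy => Or.inl ⟨hy.2.2, h1, by omega⟩) (fun y => ?_)
      (by simp) (fun i hi => by
        have : ¬ i = z.reg pos + 1 := by omega
        simp [this])
    constructor
    · rintro ⟨a1, a2, a3⟩
      by_cases hy : y = n + m + 1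
      · exact Or.inr hy
      · exact Or.inl ⟨a1, by omega, a3⟩
    · rintro (h | h)
      · exact ⟨h.1, by omega, h.2.2⟩
      · rw [h]
        exact ⟨by omega, by omega, h1⟩
  · simp only [exec_seq, exec_assign, exec_ifThen, Expr.eval_sub, Expr.eval_reg, Expr.eval_two,
      Store.setReg_reg, reduceCtorEq, if_true, if_false, eN, en, ex, Test.eval_eq, Expr.eval_get,
      Store.setReg_arr, ea, h1, Expr.eval_one, decide_false, Bool.false_eq_true]
    refine hz.congr fun y => ⟨fun h => ⟨h.1, ?_, h.2.2⟩, fun h => ⟨h.1, by omega, h.2.2⟩⟩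
    by_contra hy
    exact h1 (by rw [← show y = n + m + 1 from by omega]; exact h.2.2)

theorem listDescending_spec {n : ℕ} {s : Store} (hN : s.reg N = 2 * n + 3) (hn : s.reg Reg.n = n)
    (ha : AscSpec n (s.reg f) (s.arr asc)) (hf : n < s.reg f)
    (h : Listed (s.arr asc) (fun x => n < x ∧ x ≤ 2 * n + 1 ∧ s.arr asc x = 1)
      (s.arr ps) (s.reg pos)) :
    Listed (s.arr asc) (Other n (s.reg f))
      ((listDescending.exec s).arr ps) ((listDescending.exec s).reg pos) := by
  have hz0 := ha.fixed hf
  have := Cmd.forTo_induction (y := i) (p := Expr.succ Reg.n)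
    (C := x ::= N - 2 - i ;;
      ifThen (Test.and (asc x ≐ 0) (Test.not (x ≐ f))) (append x)) (s := s)
    (I := fun m z => Listed (s.arr asc) (fun x => n < x ∧ x ≤ 2 * n + 1 ∧ x ≠ s.reg f ∧
      (s.arr asc x = 1 ∨ (s.arr asc x = 0 ∧ 2 * n + 1 < x + m)))
      (z.arr ps) (z.reg pos)) (k := n + 1) (by simp [hn]) ?_ (fun m hm z hs hz => ?_)
  · refine this.congr fun y => ⟨fun hy => ⟨hy.1, hy.2.1, hy.2.2, ?_⟩, fun hy => ⟨hy.1, hy.2.1, hy.2.2.1⟩⟩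
    have := ha.le_one y hy.1 hy.2.1
    have := hy.1
    omega
  · refine h.congr fun y => ⟨fun hy => ?_, fun hy => ⟨hy.1, hy.2.1, ?_, Or.inl hy.2.2⟩⟩
    · refine ⟨hy.1, hy.2.1, ?_⟩
      have := hy.2.1
      omega
    · rintro rfl
      omega
  have eN : z.reg N = 2 * n + 3 := (hs.reg N rfl).trans hN
  have ef : z.reg f = s.reg f := hs.reg f rfl
  have ea : z.arr asc = s.arr asc := hs.arr asc rfl
  have ex : 2 * n + 3 - 2 - m = 2 * n + 1 - m := by omega
  simp only [exec_seq, exec_assign, exec_ifThen, Expr.eval_sub, Expr.eval_reg, Expr.eval_two,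
    Store.setReg_reg, reduceCtorEq, if_true, if_false, eN, ef, ex, Test.eval_eq, Expr.eval_get,
    Store.setReg_arr, ea, Expr.eval_zero, Test.eval_and, Test.eval_not, ← decide_not,
    ← Bool.decide_and, decide_eq_true_eq]
  by_cases h1 : s.arr asc (2 * n + 1 - m) = 0 ∧ ¬ 2 * n + 1 - m = s.reg f
  · rw [if_pos h1, exec_append _ _ (by simp)]
    simp only [Store.setArr_reg, Store.setReg_reg, reduceCtorEq, if_true, if_false, Expr.eval_reg]
    refine hz.append (x := 2 * n + 1 - m) (fun y hy => ?_) (fun y => ?_)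
      (by simp) (fun i hi => by
        have : ¬ i = z.reg pos + 1 := by omega
        simp [this])
    · rcases hy.2.2.2 with h | h
      · exact Or.inr (Or.inl ⟨h, h1.1⟩)
      · exact Or.inr (Or.inr ⟨h.1, h1.1, by omega⟩)
    · constructor
      · rintro ⟨a1, a2, a3, a4⟩
        by_cases hy : y = 2 * n + 1 - m
        · exact Or.inr hy
        · exact Or.inl ⟨a1, a2, a3, by omega⟩
      · rintro (h | h)
        · exact ⟨h.1, h.2.1, h.2.2.1, by omega⟩
        · rw [h]
          exact ⟨by omega, by omega, h1.2, Or.inr ⟨h1.1, by omega⟩⟩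
  · rw [if_neg h1]
    refine hz.congr fun y => ⟨fun h => ⟨h.1, h.2.1, h.2.2.1, ?_⟩,
      fun h => ⟨h.1, h.2.1, h.2.2.1, by omega⟩⟩
    rcases h.2.2.2 with h2 | h2
    · exact Or.inl h2
    · refine Or.inr ⟨h2.1, ?_⟩
      by_contra hy
      have : y = 2 * n + 1 - m := by omega
      exact h1 ⟨this ▸ h2.1, this ▸ h.2.2.1⟩

theorem listInitial_spec {n : ℕ} {s : Store} (hn : s.reg Reg.n = n) (hp : s.reg pos = n) :
    let z := listInitial.exec s
    z.reg pos = n + (s.reg f - n - 1) ∧ (∀ j, j ≤ n → z.arr ps j = s.arr ps j) ∧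
      ∀ j, n < j → j ≤ n + (s.reg f - n - 1) → z.arr ps j = j - n := by
  refine Cmd.forTo_induction (I := fun m z => z.reg pos = n + m ∧
    (∀ j, j ≤ n → z.arr ps j = s.arr ps j) ∧ ∀ j, n < j → j ≤ n + m → z.arr ps j = j - n)
    (by simp [hn]) ⟨hp, fun _ _ => rfl, fun j hj hj' => by omega⟩ (fun m hm z hs hz => ?_)
  obtain ⟨a1, a2, a3⟩ := hz
  rw [exec_append _ _ (by simp)]
  simp only [Store.setReg_reg, reduceCtorEq, if_false, Expr.eval_succ, Expr.eval_reg, if_true,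
    Store.setArr_reg, a1]
  refine ⟨by omega, fun j hj => ?_, fun j hj hj' => ?_⟩
  · have : ¬ j = n + m + 1 := by omega
    simp [this, a2 j hj]
  · by_cases hj0 : j = n + m + 1
    · simp [hj0]
      omega
    · simp [hj0]
      exact a3 j hj (by omega)

/-- Writes go to positions beyond `f` and reads to positions up to `n`, so every read sees the
original entry. For `f ≤ 2n + 1` the condition `n < i + (2n + 1 - f)` says that `i ≥ f - n`. -/
theorem listInverse_spec {n : ℕ} {s : Store} (hN : s.reg N = 2 * n + 3) (hn : s.reg Reg.n = n)
    (hnf : n ≤ s.reg f)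
    (hlt : ∀ i, i ≤ n → n < i + (2 * n + 1 - s.reg f) → s.reg f < s.arr ps i)
    (hinj : ∀ i j, i ≤ n → n < i + (2 * n + 1 - s.reg f) → j ≤ n →
      n < j + (2 * n + 1 - s.reg f) → s.arr ps i = s.arr ps j → i = j) :
    let z := listInverse.exec s
    (∀ j, j ≤ s.reg f → z.arr ps j = s.arr ps j) ∧
      ∀ i, i ≤ n → n < i + (2 * n + 1 - s.reg f) → z.arr ps (s.arr ps i) = i := by
  refine Cmd.forTo_induction (I := fun m z => (∀ j, j ≤ s.reg f → z.arr ps j = s.arr ps j) ∧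
      ∀ i, i ≤ n → n < i + m → z.arr ps (s.arr ps i) = i)
    (by simp [hN]) ⟨fun _ _ => rfl, fun i hi hi' => by omega⟩ (fun m hm z hs hz => ?_)
  obtain ⟨a1, a2⟩ := hz
  have en : z.reg Reg.n = n := (hs.reg Reg.n rfl).trans hn
  have hu := hlt (n - m) (by omega) (by omega)
  have e0 := a1 (n - m) (by omega)
  refine ⟨fun j hj => ?_, fun i hi hi' => ?_⟩
  · have : ¬ j = s.arr ps (n - m) := by omega
    simp [en, e0, this, a1 j hj]
  · by_cases him : i = n - m
    · simp [en, e0, him]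
    · have : ¬ s.arr ps i = s.arr ps (n - m) := fun h =>
        him (hinj i (n - m) hi (by omega) (by omega) (by omega) h)
      simp [en, e0, this]
      exact a2 i hi (by omega)

theorem findPreorder_spec {n : ℕ} {s : Store} (h3 : 3 ≤ n) (hN : s.reg N = 2 * n + 3)
    (hn : s.reg Reg.n = n) (ha : AscSpec n (s.reg f) (s.arr asc)) (hf : s.reg f ≤ 2 * n + 1)
    (hC : Checked n (s.reg f) (s.arr asc)) :
    Layout n (s.reg f) (fun x => s.arr asc x = 1) ((findPreorder.exec s).arr ps) := by
  have hlo := hC.le_fixed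
  rw [findPreorder_eq]
  simp only [exec_seq]
  generalize e1 : (pos ::= 0).exec s = s1
  have b1 : s1.reg N = 2 * n + 3 ∧ s1.reg Reg.n = n ∧ s1.reg f = s.reg f ∧ s1.arr = s.arr ∧
      s1.reg pos = 0 := by
    subst e1
    simp [hN, hn]
  have c2 := listAscending_spec b1.1 b1.2.1 b1.2.2.2.2
  have f2 := listAscending.exec_same s1
  generalize listAscending.exec s1 = s2 at c2 f2
  have b2 : s2.reg N = 2 * n + 3 ∧ s2.reg Reg.n = n ∧ s2.reg f = s.reg f ∧
      s2.arr asc = s.arr asc := by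
    rw [f2.reg N rfl, f2.reg Reg.n rfl, f2.reg f rfl, f2.arr asc rfl]
    simp [b1]
  rw [b1.2.2.2.1] at c2
  have c3 := listDescending_spec b2.1 b2.2.1 (by rw [b2.2.2.1, b2.2.2.2]; exact ha)
    (by omega) (by rw [b2.2.2.2]; exact c2)
  have f3 := listDescending.exec_same s2
  generalize listDescending.exec s2 = s3 at c3 f3
  rw [b2.2.2.1, b2.2.2.2] at c3
  have hlen := c3.length (by omega) hf
  rw [hlen] at c3
  have b3 : s3.reg N = 2 * n + 3 ∧ s3.reg Reg.n = n ∧ s3.reg f = s.reg f ∧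
      s3.arr asc = s.arr asc := by
    rw [f3.reg N rfl, f3.reg Reg.n rfl, f3.reg f rfl, f3.arr asc rfl]
    exact b2
  have c4 := listInitial_spec b3.2.1 hlen
  rw [b3.2.2.1] at c4
  have f4 := listInitial.exec_same s3
  generalize listInitial.exec s3 = s4 at c4 f4
  have b4 : s4.reg N = 2 * n + 3 ∧ s4.reg Reg.n = n ∧ s4.reg f = s.reg f := by
    rw [f4.reg N rfl, f4.reg Reg.n rfl, f4.reg f rfl]
    exact ⟨b3.1, b3.2.1, b3.2.2.1⟩
  rw [exec_append _ _ (by simp)]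
  simp only [c4.1, Expr.eval_reg, b4.2.2, show n + (s.reg f - n - 1) + 1 = s.reg f from by omega]
  generalize e5 : (s4.setReg pos (s.reg f)).setArr ps (s.reg f) (s.reg f) = s5
  have b5 : s5.reg N = 2 * n + 3 ∧ s5.reg Reg.n = n ∧ s5.reg f = s.reg f ∧
      (∀ j, j ≤ n → s5.arr ps j = s3.arr ps j) ∧
      (∀ j, n < j → j < s.reg f → s5.arr ps j = j - n) ∧ s5.arr ps (s.reg f) = s.reg f := by
    subst e5
    simp only [Store.setArr_reg, Store.setReg_reg, reduceCtorEq, if_false, b4, Store.setArr_arr,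
      true_and, Store.setReg_arr, if_true]
    exact ⟨fun j hj => by rw [if_neg (by omega), c4.2.1 j hj], fun j hj hj' => by
      rw [if_neg (by omega), c4.2.2 j hj (by omega)], trivial⟩
  have c5 : Listed (s.arr asc) (Other n (s.reg f)) (s5.arr ps) n :=
    ⟨fun i hi hi' => by rw [b5.2.2.2.1 i hi']; exact c3.mem i hi hi', fun x hx => by
      obtain ⟨i, hi, hi', e⟩ := c3.exists_pos x hx
      exact ⟨i, hi, hi', by rw [b5.2.2.2.1 i hi', e]⟩, fun i j hi hij hj => by
      rw [b5.2.2.2.1 i (by omega), b5.2.2.2.1 j hj]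
      exact c3.before i j hi hij hj⟩
  have hlt : ∀ x, n < x → x < s.reg f → s.arr asc x = 1 := fun x hx hx' => by
    have := hC.lt x hx (by omega) hx'
    have := ha.le_one x hx (by omega)
    omega
  have hini : ∀ i, 1 ≤ i → i + n < s.reg f → s5.arr ps i = n + i := fun i hi hi' => by
    obtain ⟨j, hj, hj', e⟩ := c5.exists_pos (n + i) ⟨by omega, by omega, by omega⟩
    have := c5.initial hlt hf hj hj' (by omega)
    rw [← show j = i from by omega]
    omega
  -- An entry below `f` at such a position would contradict `Listed.initial`; hence the inverse is
  -- written into cells beyond `f` only.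
  have hrest : ∀ i, 1 ≤ i → i ≤ n → s.reg f ≤ i + n → s.reg f < s5.arr ps i := fun i hi hi' hi1 => by
    by_contra hle
    have := (c5.mem i hi hi').2.2
    have := c5.initial hlt hf hi hi' (by omega)
    omega
  have c6 := listInverse_spec b5.1 b5.2.1 (by omega) (fun i hi hi' => by
    rw [b5.2.2.1]
    exact hrest i (by omega) hi (by omega)) (fun i j hi hi' hj hj' e =>
      c5.inj (by omega) hi (by omega) hj e)
  rw [b5.2.2.1] at c6
  generalize listInverse.exec s5 = s6 at c6
  have c7 : Listed (s.arr asc) (Other n (s.reg f)) (s6.arr ps) n :=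
    ⟨fun i hi hi' => by rw [c6.1 i (by omega)]; exact c5.mem i hi hi', fun x hx => by
      obtain ⟨i, hi, hi', e⟩ := c5.exists_pos x hx
      exact ⟨i, hi, hi', by rw [c6.1 i (by omega), e]⟩, fun i j hi hij hj => by
      rw [c6.1 i (by omega), c6.1 j (by omega)]
      exact c5.before i j hi hij hj⟩
  refine c7.layout h3 hC ha hf ((c6.1 _ le_rfl).trans b5.2.2.2.2.2) fun i hi hi' => ?_
  rw [c6.1 i (by omega)]
  by_cases hif : i + n < s.reg f
  · rw [hini i hi hif, c6.1 _ (by omega), b5.2.2.2.2.1 _ (by omega) (by omega)]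
    omega
  · exact c6.2 i hi' (by omega)

end Watermark

/-! ### The stack that yields the tree edges, and the correctness of the restoration. -/

namespace Watermark

/-- `t` is the head of the tree edge that leaves `u`, for the sequence with the positions `P`. -/
def TargetAt (n : ℕ) (P : ℕ → ℕ) (u t : ℕ) : Prop :=
  (t = 2 * n + 2 ∧ ∀ w, u < w → w ≤ 2 * n + 1 → ¬ P w < P u) ∨
    (u < t ∧ t ≤ 2 * n + 1 ∧ P t < P u ∧
      ∀ w, u < w → w ≤ 2 * n + 1 → P w < P u → P w ≤ P t)

/-- The root is reached from `c` in `k` steps of `Q`, through elements at positions below `p`. -/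
def Depth (n : ℕ) (P Q : ℕ → ℕ) (p : ℕ) : ℕ → ℕ → Prop
  | 0, c => c = 2 * n + 2
  | k + 1, c => (1 ≤ c ∧ c ≤ 2 * n + 1) ∧ P c < p ∧ Depth n P Q p k (Q c)

theorem Depth.mono {n p p' : ℕ} {P Q Q' : ℕ → ℕ} (hp : p ≤ p')
    (hQ : ∀ x, 1 ≤ x → x ≤ 2 * n + 1 → P x < p → Q' x = Q x) :
    ∀ {k c : ℕ}, Depth n P Q p k c → Depth n P Q' p' k c
  | 0, _, h => h
  | k + 1, c, h => ⟨h.1, by have := h.2.1; omega, by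
      rw [hQ c h.1.1 h.1.2 h.2.1]
      exact Depth.mono hp hQ h.2.2⟩

/-- The invariant of the loop of `restoreTree`, after `m` iterations. -/
def Restoring (n : ℕ) (P : ℕ → ℕ) (m p c : ℕ) (Q : ℕ → ℕ) : Prop :=
  (∀ u, 1 ≤ u → u ≤ 2 * n + 1 → P u < p → TargetAt n P u (Q u)) ∧
    (p = 2 * n + 2 ∨ (1 ≤ p ∧ p ≤ 2 * n + 1 ∧ (∃ k, Depth n P Q p k c ∧ m + k = 2 * (p - 1)) ∧
      ∀ w, 1 ≤ w → w ≤ 2 * n + 1 → P w < p → (c = 2 * n + 2 ∨ P c < P w) → w < P p))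

/-- `c` runs down a stack of pending heads whose links are the values of `Q` already known.
Everything between `c` and position `p` is smaller than the new element `P p`, so `P p < c` makes
`c` its head, and `P p` becomes the top. The depth `k` grows by one with each push and shrinks by
one with each pop, which is the reason for `m + k = 2 * (p - 1)`. -/
theorem Restoring.push {n f m p c : ℕ} {A : ℕ → Prop} {P Q Q' : ℕ → ℕ} (L : Layout n f A P)
    (h : Restoring n P m p c Q) (hp : p < 2 * n + 2) (hc : P p < c) (h1 : Q' (P p) = c)
    (h2 : ∀ x, x ≠ P p → Q' x = Q x) : Restoring n P (m + 1) (p + 1) (P p) Q' := by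
  obtain ⟨ht, h | ⟨hp1, hp2, ⟨k, hk, hmk⟩, hw⟩⟩ := h
  · omega
  have hu := L.pos p hp1 hp2
  have hu' := L.le p hp1 hp2
  have hPu := L.invol p hp1 hp2
  have hne : ∀ x, 1 ≤ x → x ≤ 2 * n + 1 → P x < p → Q' x = Q x := fun x hx hx' hxp => by
    refine h2 x ?_
    rintro rfl
    omega
  have key : TargetAt n P (P p) c := by
    cases k with
    | zero =>
      have hc0 : c = 2 * n + 2 := hk
      refine Or.inl ⟨hc0, fun w hw1 hw2 hw3 => ?_⟩
      have := hw w (by omega) hw2 (by omega) (Or.inl hc0)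
      omega
    | succ k =>
      refine Or.inr ⟨hc, hk.1.2, by have := hk.2.1; omega, fun w hw1 hw2 hw3 => ?_⟩
      by_contra hlt
      have := hw w (by omega) hw2 (by omega) (Or.inr (by omega))
      omega
  have ht' : ∀ u, 1 ≤ u → u ≤ 2 * n + 1 → P u < p + 1 → TargetAt n P u (Q' u) :=
    fun u hu1 hu2 hup => by
    by_cases hup' : P u = p
    · have : u = P p := by rw [← hup', L.invol u hu1 hu2]
      rw [this, h1]
      exact key
    · rw [hne u hu1 hu2 (by omega)]
      exact ht u hu1 hu2 (by omega)
  refine ⟨ht', ?_⟩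
  by_cases hlast : p = 2 * n + 1
  · exact Or.inl (by omega)
  · refine Or.inr ⟨by omega, by omega, ⟨k + 1, ⟨⟨hu, hu'⟩, by omega, ?_⟩, by omega⟩,
      fun w hw1 hw2 hw3 hw4 => by omega⟩
    rw [h1]
    exact hk.mono (by omega) hne

/-- The elements between `Q c` and `c` are smaller than `c`, because `Q c` is the head of `c`; and
`c` is smaller than `P p`. So the search may continue at `Q c`. The root exceeds everything and is
never popped. -/
theorem Restoring.pop {n f m p c : ℕ} {A : ℕ → Prop} {P Q : ℕ → ℕ} (L : Layout n f A P)
    (h : Restoring n P m p c Q) (hp : p < 2 * n + 2) (hc : ¬ P p < c) :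
    Restoring n P (m + 1) p (Q c) Q := by
  obtain ⟨ht, h | ⟨hp1, hp2, ⟨k, hk, hmk⟩, hw⟩⟩ := h
  · omega
  have hu' := L.le p hp1 hp2
  refine ⟨ht, Or.inr ⟨hp1, hp2, ?_⟩⟩
  cases k with
  | zero =>
    have hc0 : c = 2 * n + 2 := hk
    omega
  | succ k =>
    have hPc := hk.2.1
    have hne : c ≠ P p := by
      intro h
      rw [h, L.invol p hp1 hp2] at hPc
      omega
    refine ⟨⟨k, hk.2.2, by omega⟩, fun w hw1 hw2 hw3 hw4 => ?_⟩
    by_cases hlt : P c < P w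
    · exact hw w hw1 hw2 hw3 (Or.inr hlt)
    by_cases hwc : w ≤ c
    · omega
    have hlt' : P w < P c := by
      have : P w ≠ P c := fun h => by
        have := L.inj hw1 hw2 hk.1.1 hk.1.2 h
        omega
      omega
    rcases ht c hk.1.1 hk.1.2 hPc with h | h
    · exact absurd hlt' (h.2 w (by omega) hw2)
    · have := h.2.2.2 w (by omega) hw2 hlt'
      omega

open Reg Arr Cmd Test

theorem restoreTree_spec {n f : ℕ} {A : ℕ → Prop} {s : Store} (hN : s.reg N = 2 * n + 3)
    (htwo : s.reg two = 2 * (2 * n + 3)) (L : Layout n f A (s.arr ps)) :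
    IsTarget n (s.arr ps) ((restoreTree.exec s).arr q) := by
  unfold restoreTree
  simp only [exec_seq]
  generalize e1 : (c ::= N - 1).exec ((pos ::= 1).exec s) = s1
  have b1 : s1.reg N = 2 * n + 3 ∧ s1.reg two = 2 * (2 * n + 3) ∧ s1.arr = s.arr ∧
      s1.reg pos = 1 ∧ s1.reg c = 2 * n + 2 := by
    subst e1
    simp [hN, htwo]
  have := Cmd.forTo_induction (y := i) (p := two) (C := ifThen (pos ≺ N - 1) (
      u ::= ps pos ;;
      ite (u ≺ c) (put q u c ;; c ::= u ;; inc pos) (c ::= q c))) (s := s1)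
    (I := fun m z => Restoring n (s.arr ps) m (z.reg pos) (z.reg c) (z.arr q))
    (k := 2 * (2 * n + 3)) (by simp [b1]) ?_ (fun m hm z hs hz => ?_)
  -- While an element is left, `m + k = 2 * (p - 1) ≤ 4n`; after `4n + 6` iterations all elements
  -- have therefore been placed.
  · obtain ⟨ht, h | ⟨hp1, hp2, ⟨k, hk, hmk⟩, hw⟩⟩ := this
    · intro u hu hu'
      have := L.le u hu hu'
      exact ht u hu hu' (by omega)
    · omega
  · rw [b1.2.2.2.1, b1.2.2.2.2]
    have hpos := fun u h h' => L.pos u h h'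
    refine ⟨fun u hu hu' hlt => ?_, Or.inr ⟨le_rfl, by omega, ⟨0, rfl, rfl⟩,
      fun w hw hw' hlt => ?_⟩⟩
    · have := L.pos u hu hu'
      omega
    · have := L.pos w hw hw'
      omega
  have eN : z.reg N = 2 * n + 3 := (hs.reg N rfl).trans b1.1
  have ep : z.arr ps = s.arr ps := by rw [hs.arr ps rfl, b1.2.2.1]
  simp only [exec_ifThen, Test.eval_lt, Expr.eval_reg, Store.setReg_reg, reduceCtorEq, if_false,
    Expr.eval_sub, Expr.eval_one, eN, decide_eq_true_eq, exec_seq, exec_assign, Expr.eval_get,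
    Store.setReg_arr, ep, exec_ite, if_true, exec_put, exec_inc, Store.setArr_reg]
  by_cases hp : z.reg pos < 2 * n + 2
  · rw [if_pos (by omega)]
    by_cases hc : s.arr ps (z.reg pos) < z.reg c
    · rw [if_pos hc]
      simp only [Store.setReg_reg, reduceCtorEq, if_true, if_false, Store.setReg_arr]
      exact hz.push L hp hc (by simp) (fun x hx => by simp [hx])
    · rw [if_neg hc]
      simp only [Store.setReg_reg, reduceCtorEq, if_true, if_false, Store.setReg_arr]
      exact hz.pop L hp hc
  · rw [if_neg (by omega)]
    simp only [Store.setReg_reg, reduceCtorEq, if_false, Store.setReg_arr]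
    obtain ⟨ht, h | h⟩ := hz
    · exact ⟨ht, Or.inl h⟩
    · omega

theorem checkRestored_spec {n : ℕ} {s : Store} (hN : s.reg N = 2 * n + 3) (hn : s.reg Reg.n = n) :
    (checkRestored.exec s).reg good = 1 ↔ s.reg good = 1 ∧ Checked n (s.reg f) (s.arr asc) ∧
      ∀ u, 1 ≤ u → u ≤ 2 * n + 1 → s.arr par u ≠ 0 → s.arr par u = s.arr q u := by
  unfold checkRestored
  simp only [exec_seq]
  generalize e0 : (ifThen (Test.not (Expr.succ Reg.n ≺ f)) (good ::= 0)).exec s = s0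
  have b0 : s0.reg N = 2 * n + 3 ∧ s0.reg Reg.n = n ∧ s0.reg f = s.reg f ∧ s0.arr = s.arr ∧
      (s0.reg good = 1 ↔ s.reg good = 1 ∧ n + 2 ≤ s.reg f) := by
    subst e0
    by_cases h1 : n + 1 < s.reg f
    · have h2 : n + 2 ≤ s.reg f := h1
      simp [hN, hn, h1, h2]
    · have h2 : ¬ n + 2 ≤ s.reg f := h1
      simp [hN, hn, h1, h2]
  generalize e1 : (ifThen (Test.not (f ≐ N - 2)) (ifThen (asc (N - 2) ≐ 0) (good ::= 0))).exec
    s0 = s1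
  have b1 : s1.reg N = 2 * n + 3 ∧ s1.reg Reg.n = n ∧ s1.reg f = s.reg f ∧ s1.arr = s.arr ∧
      (s1.reg good = 1 ↔ s.reg good = 1 ∧ n + 2 ≤ s.reg f ∧
        (s.reg f ≠ 2 * n + 1 → s.arr asc (2 * n + 1) ≠ 0)) := by
    rw [← and_assoc (a := s.reg good = 1), ← b0.2.2.2.2]
    subst e1
    by_cases h2 : s.reg f = 2 * n + 1
    · simp [b0, h2]
    · by_cases h3 : s.arr asc (2 * n + 1) = 0 <;> simp [b0, h2, h3]
  have c2 := Cmd.forTo_induction (y := i) (p := Reg.n) (C := x ::= N - 3 - i ;;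
    ifThen (Test.and (x ≺ f) (asc x ≐ 0)) (good ::= 0)) (s := s1)
    (I := fun m z => z.reg good = 1 ↔ s1.reg good = 1 ∧ ∀ x, 2 * n < x + m → x ≤ 2 * n →
      x < s.reg f → s.arr asc x ≠ 0) (k := n) (by simp [b1])
    ⟨fun h => ⟨h, fun x hx hx' => by omega⟩, fun h => h.1⟩ (fun m hm z hs hz => by
      have eN : z.reg N = 2 * n + 3 := (hs.reg N rfl).trans b1.1
      have ef : z.reg f = s.reg f := (hs.reg f rfl).trans b1.2.2.1
      have ea : z.arr asc = s.arr asc := by rw [hs.arr asc rfl, b1.2.2.2.1]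
      simp only [exec_seq, exec_assign, exec_ifThen, Test.eval_and, Test.eval_lt, Test.eval_eq,
        Expr.eval_sub, Expr.eval_reg, Expr.eval_three, Expr.eval_get, Expr.eval_zero,
        Store.setReg_reg, Store.setReg_arr, reduceCtorEq, if_true, if_false, eN, ef, ea,
        Nat.add_sub_cancel, ← Bool.decide_and, decide_eq_true_eq]
      by_cases h : 2 * n - m < s.reg f ∧ s.arr asc (2 * n - m) = 0
      · rw [if_pos h]
        simp only [Store.setReg_reg, if_true, zero_ne_one, false_iff]
        rintro ⟨-, h'⟩
        exact h' _ (by omega) (by omega) h.1 h.2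
      · rw [if_neg h]
        simp only [Store.setReg_reg, reduceCtorEq, if_false, hz]
        refine and_congr_right fun _ => ⟨fun h' x hx hx' hxf => ?_,
          fun h' x hx hx' hxf => h' x (by omega) hx' hxf⟩
        by_cases hxm : x = 2 * n - m
        · exact fun h0 => h ⟨hxm ▸ hxf, hxm ▸ h0⟩
        · exact h' x (by omega) hx' hxf)
  have f2 := (Cmd.forTo i Reg.n (x ::= N - 3 - i ;;
    ifThen (Test.and (x ≺ f) (asc x ≐ 0)) (good ::= 0))).exec_same s1
  generalize (Cmd.forTo i Reg.n (x ::= N - 3 - i ;;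
    ifThen (Test.and (x ≺ f) (asc x ≐ 0)) (good ::= 0))).exec s1 = s2 at c2 f2
  have b2 : s2.reg N = 2 * n + 3 ∧ s2.arr par = s.arr par ∧ s2.arr q = s.arr q := by
    rw [f2.reg N rfl, f2.arr par rfl, f2.arr q rfl, b1.2.2.2.1]
    exact ⟨b1.1, rfl, rfl⟩
  have c3 := Cmd.forTo_induction (y := i) (p := N - 2) (C := u ::= Expr.succ i ;;
    ifThen (Test.not (par u ≐ 0)) (ifThen (Test.not (par u ≐ q u)) (good ::= 0))) (s := s2)
    (I := fun m z => z.reg good = 1 ↔ s2.reg good = 1 ∧ ∀ u, 1 ≤ u → u ≤ m →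
      s.arr par u ≠ 0 → s.arr par u = s.arr q u) (k := 2 * n + 1) (by simp [b2])
    ⟨fun h => ⟨h, fun x hx hx' => by omega⟩, fun h => h.1⟩ (fun m hm z hs hz => by
      have ep : z.arr par = s.arr par := by rw [hs.arr par rfl, b2.2.1]
      have eq : z.arr q = s.arr q := by rw [hs.arr q rfl, b2.2.2]
      have hall : (∀ u, 1 ≤ u → u ≤ m + 1 → s.arr par u ≠ 0 → s.arr par u = s.arr q u) ↔
          (∀ u, 1 ≤ u → u ≤ m → s.arr par u ≠ 0 → s.arr par u = s.arr q u) ∧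
          (s.arr par (m + 1) ≠ 0 → s.arr par (m + 1) = s.arr q (m + 1)) := by
        refine ⟨fun h => ⟨fun u hu hu' => h u hu (by omega), h _ (by omega) le_rfl⟩,
          fun h u hu hu' => ?_⟩
        by_cases hum : u = m + 1
        · exact hum ▸ h.2
        · exact h.1 u hu (by omega)
      rw [hall, ← and_assoc, ← hz]
      by_cases h1 : s.arr par (m + 1) = 0
      · simp [ep, h1]
      · by_cases h2 : s.arr par (m + 1) = s.arr q (m + 1)
        · rw [h2] at h1
          simp [ep, eq, h1, h2]
        · simp [ep, eq, h1, h2])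
  rw [c3, c2, b1.2.2.2.2]
  constructor
  · rintro ⟨⟨⟨x1, x2, x3⟩, x4⟩, x5⟩
    exact ⟨x1, ⟨x2, x3, fun x hx hx' hxf => x4 x (by omega) hx' hxf⟩, x5⟩
  · rintro ⟨x1, x2, x3⟩
    exact ⟨⟨⟨x1, x2.le_fixed, x2.last⟩, fun x hx hx' hxf => x2.lt x (by omega) hx' hxf⟩, x3⟩

theorem writeKey_spec {n : ℕ} {s : Store} (hN : s.reg N = 2 * n + 3) (hn : s.reg Reg.n = n) :
    ∀ p, (writeKey.exec s).arr key p = if p < n then s.arr asc (2 * n - p) else s.arr key p := by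
  refine Cmd.forTo_induction (I := fun m z => ∀ p, z.arr key p =
    if p < m then s.arr asc (2 * n - p) else s.arr key p) (by simp [hn]) (by simp)
    (fun m hm z hs hz p => ?_)
  have eN : z.reg N = 2 * n + 3 := (hs.reg N rfl).trans hN
  have ea : z.arr asc = s.arr asc := hs.arr asc rfl
  by_cases hp : p = m
  · simp [eN, ea, hp]
  · have : p < m + 1 ↔ p < m := by omega
    simp [hp, this, hz p]

/-- Steps (1) to (4) of the decoder after the vertices have been labelled. -/
def restore : Cmd :=
  readForest ;; findFixed ;; findAscending ;; findPreorder ;; restoreTree ;; checkRestored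

/-- The labelled edges, in the order of the listing. -/
structure Labelled (n m : ℕ) (U V : ℕ → ℕ) (s : Store) : Prop where
  N_eq : s.reg N = 2 * n + 3
  n_eq : s.reg Reg.n = n
  M_eq : s.reg M = m
  two_eq : s.reg two = 2 * (2 * n + 3)
  src_eq : ∀ j, j < m → s.arr lab (s.arr src j) = U j
  dst_eq : ∀ j, j < m → s.arr lab (s.arr dst j) = V j
  src_lt : ∀ j, j < m → U j < 2 * n + 3
  dst_lt : ∀ j, j < m → V j < 2 * n + 3
  src_ne : ∀ j, j < m → U j ≠ 0

/-- The state before `checkRestored`. -/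
theorem restore_aux {n m : ℕ} {U V : ℕ → ℕ} {s : Store} (h3 : 3 ≤ n) (h : Labelled n m U V s) :
    ∃ z : Store, restore.exec s = checkRestored.exec z ∧ z.reg N = 2 * n + 3 ∧ z.reg Reg.n = n ∧
      ParentSpec n m U V (z.arr par) (z.reg good) ∧ Ascending n (z.arr par) ∧
      AscSpec n (z.reg f) (z.arr asc) ∧
      (Checked n (z.reg f) (z.arr asc) → Layout n (z.reg f) (fun x => z.arr asc x = 1) (z.arr ps) ∧
        IsTarget n (z.arr ps) (z.arr q)) ∧
      ∀ {f₀ a : ℕ} {A : ℕ → Prop} {Q : ℕ → ℕ}, Forest n Q (z.arr par) → Shape n f₀ a A Q →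
        z.reg f = f₀ ∧ ∀ x, n < x → x ≤ 2 * n + 1 → (z.arr asc x = 1 ↔ A x) := by
  obtain ⟨c1, h1⟩ := readForest_spec h.N_eq h.n_eq h.M_eq h.src_eq h.dst_eq h.src_lt h.dst_lt
  have f1 := readForest.exec_same s
  have c2 := findFixed_spec h1
  have f2 := findFixed.exec_same (readForest.exec s)
  have h2 := h1.of_same f2
  have c3 := findAscending_spec h2 c2.1
  have f3 := findAscending.exec_same (findFixed.exec (readForest.exec s))
  have f4 := findPreorder.exec_same (findAscending.exec (findFixed.exec (readForest.exec s)))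
  have f5 := restoreTree.exec_same
    (findPreorder.exec (findAscending.exec (findFixed.exec (readForest.exec s))))
  have c4 := findPreorder_spec
    (s := findAscending.exec (findFixed.exec (readForest.exec s))) h3
    ((f3.reg N rfl).trans h2.N_eq) ((f3.reg Reg.n rfl).trans h2.n_eq)
  have c5 : ∀ {f : ℕ} {A : ℕ → Prop}, _ → _ → _ := fun {f A} => restoreTree_spec (n := n) (f := f)
    (A := A)
    (s := findPreorder.exec (findAscending.exec (findFixed.exec (readForest.exec s))))
  refine ⟨restoreTree.exec
    (findPreorder.exec (findAscending.exec (findFixed.exec (readForest.exec s)))), rfl, ?_⟩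
  rw [f5.reg N rfl, f5.reg Reg.n rfl, f5.arr par rfl, f5.reg good rfl, f5.reg f rfl,
    f5.arr asc rfl, f5.arr ps rfl]
  rw [f4.reg N rfl, f4.reg two rfl, f3.reg N rfl, f3.reg two rfl, f2.reg two rfl,
    f1.reg two rfl] at c5
  rw [f4.reg N rfl, f4.reg Reg.n rfl, f4.arr par rfl, f4.reg good rfl, f4.reg f rfl,
    f4.arr asc rfl]
  rw [f3.reg f rfl] at c4
  rw [f3.reg N rfl, f3.reg Reg.n rfl, f3.arr par rfl, f3.reg good rfl, f3.reg f rfl]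
  rw [f2.arr par rfl] at c3
  rw [f2.arr par rfl, f2.reg good rfl]
  refine ⟨h2.N_eq, h2.n_eq, c1, h1.asc, c3.1, fun hC => ?_, fun {f₀ a A Q} F S => ?_⟩
  · have L := c4 c3.1 c2.1 hC
    exact ⟨L, c5 h2.N_eq h.two_eq L⟩
  · have hf := c2.2 F S
    exact ⟨hf, c3.2 F (by rw [hf]; exact S)⟩

/-- The check tests ascending edges against the restored tree, and `readForest` has verified that
the others are path edges. An accepted labelling thus embeds the input into some watermark of the
same size, about whose key nothing is claimed yet. -/
theorem restore_sound {n m : ℕ} {U V : ℕ → ℕ} {s : Store} (h3 : 3 ≤ n) (h : Labelled n m U V s)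
    (hg : (restore.exec s).reg good = 1) :
    ∃ (f : ℕ) (A : ℕ → Prop) (P Q : ℕ → ℕ), Layout n f A P ∧ IsTarget n P Q ∧
      ∀ j, j < m → Edge n Q (U j) (V j) := by
  obtain ⟨z, e, hN, hn, c1, hasc, -, c3, -⟩ := restore_aux h3 h
  rw [e, checkRestored_spec hN hn] at hg
  obtain ⟨g1, g2, g3⟩ := hg
  obtain ⟨L, T⟩ := c3 g2
  refine ⟨_, _, _, _, L, T, fun j hj => ?_⟩
  have h0 := h.src_ne j hj
  have h1 := h.src_lt j hj
  have h2 := h.dst_lt j hj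
  rcases c1.edge g1 j hj with h | h
  · right
    refine ⟨by omega, by omega, ?_⟩
    rw [← g3 _ (by omega) (by omega) (by omega), h.2]
  · exact Or.inl ⟨by omega, by omega, h.symm⟩

/-- Under the true labelling the ascending edges form a `Forest` of the tree, so the rules find the
true `f` and `A`; these determine the permutation and the tree, which then contains every given
edge. -/
theorem restore_complete {n m f : ℕ} {U V P Q : ℕ → ℕ} {A : ℕ → Prop} {s : Store}
    (h : Labelled n m U V s) (L : Layout n f A P) (T : IsTarget n P Q)
    (hE : ∀ j, j < m → Edge n Q (U j) (V j))
    (hinj : ∀ j j', j < m → j' < m → U j = U j' → V j = V j' → j = j')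
    (htwo : ∀ u v w, 1 ≤ u → u ≤ 2 * n + 1 → 1 ≤ v → v ≤ 2 * n + 1 → 1 ≤ w → w ≤ 2 * n + 1 →
      (∀ j, j < m → ¬ (U j = u ∧ V j = Q u)) → (∀ j, j < m → ¬ (U j = v ∧ V j = Q v)) →
      (∀ j, j < m → ¬ (U j = w ∧ V j = Q w)) → u = v ∨ u = w ∨ v = w) :
    (restore.exec s).reg good = 1 ∧
      ∀ x, n < x → x ≤ 2 * n → ((restore.exec s).arr asc x ≤ 1 ∧
        ((restore.exec s).arr asc x = 1 ↔ A x)) := by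
  have S := L.shape T
  obtain ⟨z, e, hN, hn, c1, hasc, c2, c3, c4⟩ := restore_aux L.three_le h
  have hlt := S.lt
  have hup : ∀ j, j < m → U j < V j → V j = Q (U j) ∧ 1 ≤ U j ∧ U j ≤ 2 * n + 1 := fun j hj h => by
    rcases hE j hj with h' | h'
    · omega
    · exact ⟨h'.2.2, h'.1, h'.2.1⟩
  have hg : z.reg good = 1 := by
    by_contra h0
    have := c1.good_le
    rcases c1.bad (by omega) with ⟨j, hj, h1, h2⟩ | ⟨j, j', hjj, hj', h1, h2, h3⟩
    · rcases hE j hj with h' | h'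
      · omega
      · have := hlt _ h'.1 h'.2.1
        omega
    · have e1 := hup j (by omega) h1
      have e2 := hup j' hj' h2
      have := hinj j j' (by omega) hj' h3 (by rw [e1.1, e2.1, h3])
      omega
  have hpar : ∀ j, j < m → ∀ u, 1 ≤ u → u ≤ 2 * n + 1 → U j = u → V j = Q u →
      z.arr par u ≠ 0 := fun j hj u hu hu' h1 h2 => by
    have := hlt u hu hu'
    rcases c1.edge hg j hj with h | h
    · rw [← h1]
      omega
    · omega
  have F : Forest n Q (z.arr par) := by
    refine ⟨fun u hu hu' => ?_, hasc.root, fun u v w hu hu' hv hv' hw hw' h1 h2 h3 => ?_⟩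
    · rcases c1.par_eq u (by omega) with h | ⟨j, hj, h1, h2, h3⟩
      · exact Or.inl h
      · right
        rw [← h2, ← h1]
        exact (hup j hj (by omega)).1
    · exact htwo u v w hu hu' hv hv' hw hw' (fun j hj hh => hpar j hj u hu hu' hh.1 hh.2 h1)
        (fun j hj hh => hpar j hj v hv hv' hh.1 hh.2 h2)
        (fun j hj hh => hpar j hj w hw hw' hh.1 hh.2 h3)
  obtain ⟨hf, hA⟩ := c4 F S
  have hC : Checked n (z.reg Reg.f) (z.arr asc) := by
    rw [hf]
    refine ⟨S.le_fixed, fun hne => ?_, fun x hx hx' hxf => ?_⟩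
    · have := (hA (2 * n + 1) (by omega) le_rfl).2 (S.asc_last (by have := S.fixed_le; omega))
      omega
    · have := (hA x hx (by omega)).2 (S.asc_of_lt x hx hxf)
      omega
  obtain ⟨L', T'⟩ := c3 hC
  rw [hf] at L'
  -- The layout found by the program belongs to the predicate `asc x = 1`, which agrees with `A` on
  -- the large vertices only. Its axioms are transferred one by one so that `Layout.unique` applies.
  have L'' : Layout n f A (z.arr ps) := by
    refine ⟨L.three_le, L.le_fixed, L.fixed_le, L.asc_of_lt, L.not_asc_fixed, L.asc_last, L'.pos,
      L'.le, L'.invol, L'.fix, L'.large, L'.small, fun x y hx hx' hy hy' hyf h1 h2 => ?_,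
      fun x y hx hxy hy' h1 h2 => ?_, fun x y hx hxy hy' hxf hyf h1 h2 => ?_⟩
    · exact L'.asc_desc x y hx hx' hy hy' hyf ((hA x hx hx').2 h1)
        (fun h => h2 ((hA y hy hy').1 h))
    · exact L'.asc_mono x y hx hxy hy' ((hA x hx (by omega)).2 h1) ((hA y (by omega) hy').2 h2)
    · exact L'.desc_anti x y hx hxy hy' hxf hyf (fun h => h1 ((hA x hx (by omega)).1 h))
        (fun h => h2 ((hA y (by omega) hy').1 h))
  have hQ : ∀ u, 1 ≤ u → u ≤ 2 * n + 1 → Q u = z.arr q u :=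
    IsTarget.unique L (fun x hx hx' => L.unique L'' x hx hx') T T'
  have f6 := checkRestored.exec_same z
  rw [e]
  refine ⟨?_, fun x hx hx' => ?_⟩
  · rw [checkRestored_spec hN hn]
    refine ⟨hg, hC, fun u hu hu' h0 => ?_⟩
    rw [← hQ u hu hu']
    exact (F.eq u hu hu').resolve_left h0
  · rw [f6.arr asc rfl]
    exact ⟨c2.le_one x hx (by omega), hA x hx (by omega)⟩

end Watermark

namespace Watermark

/-! ### Adjacency lists and labelled paths -/

/-- The edges into `v` among the first `m` ones, the last one first. -/
def inEdges (D : ℕ → ℕ) (m v : ℕ) : List ℕ := ((List.range m).filter (fun j => D j = v)).reverse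

theorem mem_inEdges {D : ℕ → ℕ} {m v j : ℕ} : j ∈ inEdges D m v ↔ j < m ∧ D j = v := by
  simp [inEdges]

theorem inEdges_succ (D : ℕ → ℕ) (m v : ℕ) :
    inEdges D (m + 1) v = if D m = v then m :: inEdges D m v else inEdges D m v := by
  by_cases h : D m = v <;> simp [inEdges, List.range_succ, List.filter_append, h]

theorem nodup_inEdges (D : ℕ → ℕ) (m v : ℕ) : (inEdges D m v).Nodup :=
  List.nodup_reverse.2 (List.nodup_range.filter _)

/-- The linked list that starts at `e` has the elements `l`, each increased by `1`. -/
def Linked (nxt : ℕ → ℕ) : ℕ → List ℕ → Prop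
  | _, [] => True
  | e, j :: l => e = j + 1 ∧ Linked nxt (nxt j) l

theorem Linked.congr {nxt nxt' : ℕ → ℕ} : ∀ {l : List ℕ} {e : ℕ}, Linked nxt e l →
    (∀ j ∈ l, nxt' j = nxt j) → Linked nxt' e l
  | [], _, _, _ => trivial
  | j :: l, _, hl, hj => ⟨hl.1, by
      rw [hj j (by simp)]
      exact hl.2.congr fun k hk => hj k (by simp [hk])⟩

open Reg Arr Cmd Test

/-- The memory after `readGraph`, for the edges `(S j, D j)`, `j < m`. -/
structure Ready (n m : ℕ) (S D : ℕ → ℕ) (t : Store) : Prop where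
  N_eq : t.reg N = 2 * n + 3
  n_eq : t.reg Reg.n = n
  M_eq : t.reg M = m
  two_eq : t.reg two = 2 * (2 * n + 3)
  src_eq : t.arr src = S
  dst_eq : t.arr dst = D
  deg_eq : ∀ v, t.arr deg v = ((Finset.range m).filter (fun j => S j = v)).card
  ind_eq : ∀ v, t.arr ind v = (inEdges D m v).length
  linked : ∀ v, Linked (t.arr nxt) (t.arr head v) (inEdges D m v)
  cand_lt : ∀ a, a < t.reg Reg.s → t.arr cand a < 2 * n + 3
  exists_cand : ∀ v, v < 2 * n + 3 → ((Finset.range m).filter (fun j => S j = v)).card < 2 →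
    ∃ a, a < t.reg Reg.s ∧ t.arr cand a = v
  s_eq : t.reg Reg.s = ((Finset.range (2 * n + 3)).filter
    (fun v => ((Finset.range m).filter (fun j => S j = v)).card < 2)).card

theorem Ready.of_same {n m : ℕ} {S D : ℕ → ℕ} {C : Cmd} {s t : Store} (h : Ready n m S D s)
    (e : Same C s t)
    (h1 : C.setsReg N = false := by rfl) (h2 : C.setsReg Reg.n = false := by rfl)
    (h3 : C.setsReg M = false := by rfl) (h4 : C.setsReg two = false := by rfl)
    (h5 : C.setsReg Reg.s = false := by rfl) (h6 : C.setsArr src = false := by rfl)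
    (h7 : C.setsArr dst = false := by rfl) (h8 : C.setsArr deg = false := by rfl)
    (h9 : C.setsArr ind = false := by rfl) (h10 : C.setsArr nxt = false := by rfl)
    (h11 : C.setsArr head = false := by rfl) (h12 : C.setsArr cand = false := by rfl) :
    Ready n m S D t := by
  refine ⟨?_, ?_, ?_, ?_, ?_, ?_, ?_, ?_, ?_, ?_, ?_, ?_⟩
  · rw [e.reg N h1, h.N_eq]
  · rw [e.reg Reg.n h2, h.n_eq]
  · rw [e.reg M h3, h.M_eq]
  · rw [e.reg two h4, h.two_eq]
  · rw [e.arr src h6, h.src_eq]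
  · rw [e.arr dst h7, h.dst_eq]
  · rw [e.arr deg h8]
    exact h.deg_eq
  · rw [e.arr ind h9]
    exact h.ind_eq
  · rw [e.arr nxt h10, e.arr head h11]
    exact h.linked
  · rw [e.reg Reg.s h5, e.arr cand h12]
    exact h.cand_lt
  · rw [e.reg Reg.s h5, e.arr cand h12]
    exact h.exists_cand
  · rw [e.reg Reg.s h5, h.s_eq]

/-- The first loop of `readGraph`. -/
def readEdges : Cmd :=
  forTo j M (
    put deg (src j) (Expr.succ (deg (src j))) ;;
    put ind (dst j) (Expr.succ (ind (dst j))) ;;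
    put nxt j (head (dst j)) ;;
    put head (dst j) (Expr.succ j))

/-- The second loop of `readGraph`. -/
def listEnds : Cmd := forTo v N (ifThen (deg v ≺ 2) (put cand Reg.s v ;; inc Reg.s))

theorem readGraph_eq : readGraph = (readEdges ;; Reg.s ::= 0 ;; listEnds) := rfl

theorem readEdges_spec {m : ℕ} {s : Store} (hM : s.reg M = m) (h1 : ∀ v, s.arr deg v = 0)
    (h2 : ∀ v, s.arr ind v = 0) :
    let t := readEdges.exec s
    (∀ v, t.arr deg v = ((Finset.range m).filter (fun j => s.arr src j = v)).card) ∧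
    (∀ v, t.arr ind v = (inEdges (s.arr dst) m v).length) ∧
    ∀ v, Linked (t.arr nxt) (t.arr head v) (inEdges (s.arr dst) m v) := by
  refine Cmd.forTo_induction (I := fun k t =>
    (∀ v, t.arr deg v = ((Finset.range k).filter (fun j => s.arr src j = v)).card) ∧
    (∀ v, t.arr ind v = (inEdges (s.arr dst) k v).length) ∧
    ∀ v, Linked (t.arr nxt) (t.arr head v) (inEdges (s.arr dst) k v))
    (by simpa using hM) ⟨by simpa using h1, by simpa [inEdges] using h2, fun v => by
      simp [inEdges, Linked]⟩ (fun k hk t hs ht => ?_)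
  obtain ⟨a1, a2, a3⟩ := ht
  have es : t.arr src = s.arr src := hs.arr src rfl
  have ed : t.arr dst = s.arr dst := hs.arr dst rfl
  refine ⟨fun v => ?_, fun v => ?_, fun v => ?_⟩
  · rw [card_filter_range_succ, ← a1]
    by_cases hv : s.arr src k = v
    · simp [es, hv]
    · simp [es, hv, Ne.symm hv]
  · rw [inEdges_succ]
    by_cases hv : s.arr dst k = v
    · simp [ed, hv, a2]
    · simp [ed, hv, Ne.symm hv, a2]
  · rw [inEdges_succ]
    by_cases hv : s.arr dst k = v
    · rw [if_pos hv]
      refine ⟨by simp [ed, hv], ?_⟩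
      have := a3 v
      simp only [exec_seq, exec_put, Expr.eval_get, Expr.eval_reg, Expr.eval_succ,
        Store.setArr_arr, Store.setArr_reg, Store.setReg_reg, Store.setReg_arr, reduceCtorEq,
        if_true, if_false, false_and, true_and, ed, hv]
      refine this.congr fun j hj => ?_
      have := (mem_inEdges.1 hj).1
      have hne : ¬ j = k := by omega
      simp [hne]
    · rw [if_neg hv]
      have hv' : ¬ v = s.arr dst k := Ne.symm hv
      simp only [exec_seq, exec_put, Expr.eval_get, Expr.eval_reg, Expr.eval_succ,
        Store.setArr_arr, Store.setArr_reg, Store.setReg_reg, Store.setReg_arr, reduceCtorEq,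
        if_true, if_false, false_and, true_and, ed, hv']
      refine (a3 v).congr fun j hj => ?_
      have := (mem_inEdges.1 hj).1
      have hne : ¬ j = k := by omega
      simp [hne]

theorem listEnds_spec {n : ℕ} {s : Store} (hN : s.reg N = 2 * n + 3) (h0 : s.reg Reg.s = 0) :
    let t := listEnds.exec s
    (∀ a, a < t.reg Reg.s → t.arr cand a < 2 * n + 3) ∧
    (∀ v, v < 2 * n + 3 → s.arr deg v < 2 → ∃ a, a < t.reg Reg.s ∧ t.arr cand a = v) ∧
    t.reg Reg.s = ((Finset.range (2 * n + 3)).filter (fun v => s.arr deg v < 2)).card := by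
  refine Cmd.forTo_induction (I := fun k t => (∀ a, a < t.reg Reg.s → t.arr cand a < k) ∧
    (∀ v, v < k → s.arr deg v < 2 → ∃ a, a < t.reg Reg.s ∧ t.arr cand a = v) ∧
    t.reg Reg.s = ((Finset.range k).filter (fun v => s.arr deg v < 2)).card)
    (by simpa using hN) ⟨fun a ha => by omega, fun v hv => by omega, by simpa using h0⟩
    (fun k hk t hs ht => ?_)
  obtain ⟨a1, a2, a3⟩ := ht
  have ed : t.arr deg = s.arr deg := hs.arr deg rfl
  rw [card_filter_range_succ, ← a3]
  by_cases hd : s.arr deg k < 2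
  · refine ⟨fun a ha => ?_, fun v hv hv' => ?_, by simp [ed, hd]⟩
    · by_cases hat : a = t.reg Reg.s
      · simp [ed, hd, hat]
      · simp [ed, hd] at ha
        have := a1 a (by omega)
        simp [ed, hd, hat]
        omega
    · by_cases hvk : v = k
      · exact ⟨t.reg Reg.s, by simp [ed, hd], by simp [ed, hd, hvk]⟩
      · obtain ⟨a, ha, ha'⟩ := a2 v (by omega) hv'
        have : ¬ a = t.reg Reg.s := by omega
        exact ⟨a, by simp [ed, hd]; omega, by simp [ed, hd, this, ha']⟩
  · refine ⟨fun a ha => ?_, fun v hv hv' => ?_, by simp [ed, hd]⟩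
    · simp [ed, hd] at ha
      have := a1 a (by omega)
      simp [ed, hd]
      omega
    · by_cases hvk : v = k
      · exact absurd (hvk ▸ hv') hd
      · obtain ⟨a, ha, ha'⟩ := a2 v (by omega) hv'
        exact ⟨a, by simp [ed, hd, ha], by simp [ed, hd, ha']⟩

theorem readGraph_spec {n m : ℕ} {s : Store} (hN : s.reg N = 2 * n + 3) (hn : s.reg Reg.n = n)
    (hM : s.reg M = m) (htwo : s.reg two = 2 * (2 * n + 3)) (h1 : ∀ v, s.arr deg v = 0)
    (h2 : ∀ v, s.arr ind v = 0) : Ready n m (s.arr src) (s.arr dst) (readGraph.exec s) := by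
  rw [readGraph_eq]
  simp only [exec_seq]
  have c1 := readEdges_spec hM h1 h2
  have f1 := readEdges.exec_same s
  generalize readEdges.exec s = s1 at c1 f1
  have c2 := listEnds_spec (n := n) (s := (Reg.s ::= 0).exec s1) (by simp [f1.reg N rfl, hN])
    (by simp)
  have f2 := listEnds.exec_same ((Reg.s ::= 0).exec s1)
  generalize listEnds.exec ((Reg.s ::= 0).exec s1) = s2 at c2 f2
  have hd : ((Reg.s ::= (0 : Expr)).exec s1).arr deg =
      fun v => ((Finset.range m).filter (fun j => s.arr src j = v)).card := funext c1.1
  rw [hd] at c2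
  refine ⟨?_, ?_, ?_, ?_, ?_, ?_, ?_, ?_, ?_, c2.1, c2.2.1, c2.2.2⟩
  · rw [f2.reg N rfl]
    simp [f1.reg N rfl, hN]
  · rw [f2.reg Reg.n rfl]
    simp [f1.reg Reg.n rfl, hn]
  · rw [f2.reg M rfl]
    simp [f1.reg M rfl, hM]
  · rw [f2.reg two rfl]
    simp [f1.reg two rfl, htwo]
  · rw [f2.arr src rfl]
    exact f1.arr src rfl
  · rw [f2.arr dst rfl]
    exact f1.arr dst rfl
  · rw [f2.arr deg rfl]
    exact c1.1
  · rw [f2.arr ind rfl]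
    exact c1.2.1
  · rw [f2.arr nxt rfl, f2.arr head rfl]
    exact c1.2.2

/-- The scan of the edges into the current vertex. -/
def scanEdges : Cmd :=
  forTo j (ind cur) (
    w ::= src (e - 1) ;;
    ifThen (mark w ≐ 0) (inc c ;; x ::= w) ;;
    e ::= nxt (e - 1))

/-- One step of `climb`. -/
def climbStep : Cmd :=
  put lab cur cnt ;; put mark cur 1 ;; inc cnt ;;
  c ::= 0 ;; e ::= head cur ;; scanEdges ;;
  ite (c ≐ 1) (cur ::= x) (go ::= 0)

theorem climb_eq : climb =
    ifThen (mark cur ≐ 0) (go ::= 1 ;; forTo i N (ifThen (go ≐ 1) climbStep)) := rfl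

theorem scanEdges_spec {n m : ℕ} {S D : ℕ → ℕ} {s : Store} (h : Ready n m S D s)
    (hc : s.reg c = 0) (he : s.reg e = s.arr head (s.reg cur)) :
    let t := scanEdges.exec s
    let p := fun j => decide (s.arr mark (S j) = 0)
    t.reg c = ((inEdges D m (s.reg cur)).filter p).length ∧
      (t.reg c ≠ 0 → ∃ j ∈ inEdges D m (s.reg cur), s.arr mark (S j) = 0 ∧ t.reg x = S j) := by
  intro t p
  have := Cmd.forTo_induction (y := j) (p := ind cur) (C := w ::= src (e - 1) ;;
    ifThen (mark w ≐ 0) (inc c ;; x ::= w) ;; e ::= nxt (e - 1)) (s := s)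
    (I := fun k t => Linked (s.arr nxt) (t.reg e) ((inEdges D m (s.reg cur)).drop k) ∧
      t.reg c = (((inEdges D m (s.reg cur)).take k).filter p).length ∧
      (t.reg c ≠ 0 → ∃ j ∈ inEdges D m (s.reg cur), s.arr mark (S j) = 0 ∧ t.reg x = S j))
    (k := (inEdges D m (s.reg cur)).length) (by simp [h.ind_eq])
    ⟨by rw [he]; exact h.linked _, by simp [hc], fun h => absurd hc h⟩ (fun k hk t hs ht => ?_)
  · rw [List.take_length] at this
    exact this.2
  obtain ⟨a1, a2, a3⟩ := ht
  have es : t.arr src = S := (hs.arr src rfl).trans h.src_eq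
  have em : t.arr mark = s.arr mark := hs.arr mark rfl
  have en : t.arr nxt = s.arr nxt := hs.arr nxt rfl
  rw [List.drop_eq_getElem_cons hk] at a1
  have hmem : (inEdges D m (s.reg cur))[k] ∈ inEdges D m (s.reg cur) := List.getElem_mem hk
  obtain ⟨b1, b2⟩ := a1
  rw [List.take_succ_eq_append_getElem hk, List.filter_append, List.length_append, ← a2]
  generalize (inEdges D m (s.reg cur))[k] = j₀ at b1 b2 hmem
  by_cases hj : s.arr mark (S j₀) = 0
  · simp [es, em, en, b1, hj, p]
    exact ⟨b2, j₀, hmem, hj, rfl⟩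
  · simp [es, em, en, b1, hj, p]
    exact ⟨b2, a3⟩

/-- The current vertex is marked before its in-neighbours are scanned, so the relevant marks are
those after the step. -/
theorem climbStep_spec {n m : ℕ} {S D : ℕ → ℕ} {s : Store} (h : Ready n m S D s) :
    let t := climbStep.exec s
    let l := (inEdges D m (s.reg cur)).filter (fun j => decide (t.arr mark (S j) = 0))
    (∀ v, t.arr lab v = if v = s.reg cur then s.reg cnt else s.arr lab v) ∧
    (∀ v, t.arr mark v = if v = s.reg cur then 1 else s.arr mark v) ∧
    t.reg cnt = s.reg cnt + 1 ∧
    (l.length = 1 → t.reg go = s.reg go ∧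
      ∃ j ∈ inEdges D m (s.reg cur), t.arr mark (S j) = 0 ∧ t.reg cur = S j) ∧
    (l.length ≠ 1 → t.reg go = 0) := by
  intro t l
  have et : t = climbStep.exec s := rfl
  unfold climbStep at et
  simp only [exec_seq] at et
  have hr : Ready n m S D ((e ::= head cur).exec ((c ::= 0).exec ((inc cnt).exec
    ((put mark cur 1).exec ((put lab cur cnt).exec s))))) :=
    ((((h.of_same (Cmd.exec_same _ _)).of_same (Cmd.exec_same _ _)).of_same
      (Cmd.exec_same _ _)).of_same (Cmd.exec_same _ _)).of_same (Cmd.exec_same _ _)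
  generalize e1 : (e ::= head cur).exec ((c ::= 0).exec ((inc cnt).exec
    ((put mark cur 1).exec ((put lab cur cnt).exec s)))) = s1 at et hr
  have b1 : s1.reg c = 0 ∧ s1.reg cur = s.reg cur ∧ s1.reg e = s1.arr head (s1.reg cur) ∧
      (∀ v, s1.arr lab v = if v = s.reg cur then s.reg cnt else s.arr lab v) ∧
      (∀ v, s1.arr mark v = if v = s.reg cur then 1 else s.arr mark v) ∧
      s1.reg cnt = s.reg cnt + 1 ∧ s1.reg go = s.reg go := by
    subst e1
    simp
  have c2 := scanEdges_spec hr b1.1 b1.2.2.1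
  have f2 := scanEdges.exec_same s1
  generalize scanEdges.exec s1 = s2 at et c2 f2
  have f3 : t.arr = s2.arr ∧ t.reg cnt = s2.reg cnt := by
    rw [et]
    by_cases hc : s2.reg c = 1 <;> simp [hc]
  have hm : t.arr mark = s1.arr mark := by rw [f3.1, f2.arr mark rfl]
  refine ⟨?_, ?_, ?_, fun hl => ?_, fun hl => ?_⟩
  · rw [f3.1, f2.arr lab rfl]
    exact b1.2.2.2.1
  · rw [hm]
    exact b1.2.2.2.2.1
  · rw [f3.2, f2.reg cnt rfl, b1.2.2.2.2.2.1]
  · have hl' : s2.reg c = 1 := by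
      rw [c2.1, b1.2.1, ← hl]
      simp only [l, hm]
    obtain ⟨j, hj, hj', hx⟩ := c2.2 (by omega)
    rw [b1.2.1] at hj
    rw [hm]
    refine ⟨?_, j, hj, hj', ?_⟩
    · rw [et]
      simp [hl', f2.reg go rfl, b1]
    · rw [et]
      simp [hl', hx]
  · have hl' : ¬ s2.reg c = 1 := by
      rw [c2.1, b1.2.1]
      simp only [l, hm] at hl
      exact hl
    rw [et]
    simp [hl']

/-- The marked vertices have the labels `0, …, cnt - 1`, each once. -/
structure Labels (n : ℕ) (t : Store) : Prop where
  cnt_eq : t.reg cnt = ((Finset.range (2 * n + 3)).filter (fun v => t.arr mark v ≠ 0)).card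
  lt : ∀ v, v < 2 * n + 3 → t.arr mark v ≠ 0 → t.arr lab v < t.reg cnt
  inj : ∀ v w, v < 2 * n + 3 → w < 2 * n + 3 → t.arr mark v ≠ 0 → t.arr mark w ≠ 0 →
    t.arr lab v = t.arr lab w → v = w

/-- `t` extends the labelling of `s`. -/
def Extends (s t : Store) : Prop :=
  ∀ v, s.arr mark v ≠ 0 → t.arr mark v ≠ 0 ∧ t.arr lab v = s.arr lab v

theorem Extends.refl (s : Store) : Extends s s := fun _ h => ⟨h, rfl⟩

theorem Extends.trans {s t u : Store} (h : Extends s t) (h' : Extends t u) : Extends s u :=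
  fun v hv => ⟨(h' v (h v hv).1).1, (h' v (h v hv).1).2.trans (h v hv).2⟩

theorem climbStep_labels {n m : ℕ} {S D : ℕ → ℕ} {s : Store} (h : Ready n m S D s)
    (hS : ∀ j, j < m → S j < 2 * n + 3) (hl : Labels n s) (hc : s.reg cur < 2 * n + 3)
    (h0 : s.arr mark (s.reg cur) = 0) :
    let t := climbStep.exec s
    Labels n t ∧ Extends s t ∧ t.arr mark (s.reg cur) ≠ 0 ∧ t.arr lab (s.reg cur) = s.reg cnt ∧
      (t.reg go = 1 → t.reg cur < 2 * n + 3 ∧ t.arr mark (t.reg cur) = 0) := by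
  intro t
  obtain ⟨c1, c2, c3, c4, c5⟩ := climbStep_spec h
  change ∀ v, t.arr lab v = _ at c1
  change ∀ v, t.arr mark v = _ at c2
  change t.reg cnt = _ at c3
  have hne : ∀ v, s.arr mark v ≠ 0 → v ≠ s.reg cur := fun v hv h => hv (h ▸ h0)
  have hm : ∀ v, t.arr mark v ≠ 0 → v ≠ s.reg cur → s.arr mark v ≠ 0 := fun v hv h => by
    rw [c2, if_neg h] at hv
    exact hv
  refine ⟨⟨?_, fun v hv hv' => ?_, fun v w hv hw hv' hw' he => ?_⟩, fun v hv => ?_, ?_, ?_,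
    fun hgo => ?_⟩
  · rw [c3, hl.cnt_eq]
    have : (Finset.range (2 * n + 3)).filter (fun v => t.arr mark v ≠ 0) =
        insert (s.reg cur) ((Finset.range (2 * n + 3)).filter (fun v => s.arr mark v ≠ 0)) := by
      ext v
      simp only [Finset.mem_filter, Finset.mem_range, Finset.mem_insert]
      by_cases hv : v = s.reg cur
      · simp [hv, c2, hc]
      · simp [hv, c2]
    rw [this, Finset.card_insert_of_notMem (by simp [h0])]
  · rw [c1, c3]
    by_cases h : v = s.reg cur
    · rw [if_pos h]
      omega
    · rw [if_neg h]
      have := hl.lt v hv (hm v hv' h)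
      omega
  · rw [c1, c1] at he
    by_cases h : v = s.reg cur <;> by_cases h' : w = s.reg cur
    · rw [h, h']
    · rw [if_pos h, if_neg h'] at he
      have := hl.lt w hw (hm w hw' h')
      omega
    · rw [if_neg h, if_pos h'] at he
      have := hl.lt v hv (hm v hv' h)
      omega
    · rw [if_neg h, if_neg h'] at he
      exact hl.inj v w hv hw (hm v hv' h) (hm w hw' h') he
  · rw [c1, c2, if_neg (hne v hv), if_neg (hne v hv)]
    exact ⟨hv, rfl⟩
  · rw [c2, if_pos rfl]
    omega
  · rw [c1, if_pos rfl]
  · by_cases hlen : ((inEdges D m (s.reg cur)).filter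
        (fun j => decide (t.arr mark (S j) = 0))).length = 1
    · obtain ⟨-, j, hj, hj', he⟩ := c4 hlen
      change t.reg cur = S j at he
      rw [he]
      exact ⟨hS j (mem_inEdges.1 hj).1, hj'⟩
    · have := c5 hlen
      change t.reg go = 0 at this
      omega

/-- For an arbitrary choice of ends nothing is known of the path that is traced. Rigidity only needs
that the labels are distinct and in range. -/
theorem climb_labels {n m : ℕ} {S D : ℕ → ℕ} {s : Store} (h : Ready n m S D s)
    (hS : ∀ j, j < m → S j < 2 * n + 3) (hl : Labels n s) (hc : s.reg cur < 2 * n + 3) :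
    let t := climb.exec s
    Labels n t ∧ Extends s t ∧
      (s.arr mark (s.reg cur) = 0 → t.arr mark (s.reg cur) ≠ 0 ∧
        t.arr lab (s.reg cur) = s.reg cnt) := by
  intro t
  have et : t = climb.exec s := rfl
  rw [climb_eq, exec_ifThen] at et
  by_cases h0 : s.arr mark (s.reg cur) = 0
  · rw [if_pos (by simp [h0]), exec_seq] at et
    have := Cmd.forTo_induction (y := i) (p := N) (C := ifThen (go ≐ 1) climbStep)
      (s := (go ::= 1).exec s)
      (I := fun k z => (Labels n z ∧ Extends s z ∧
        ((k = 0 ∧ z.reg cur = s.reg cur ∧ z.reg go = 1 ∧ z.reg cnt = s.reg cnt) ∨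
          (z.arr mark (s.reg cur) ≠ 0 ∧ z.arr lab (s.reg cur) = s.reg cnt))) ∧
        (z.reg go = 1 → z.reg cur < 2 * n + 3 ∧ z.arr mark (z.reg cur) = 0))
      (k := 2 * n + 3) (by simp [h.N_eq]) ?_ (fun k hk z hs hz => ?_)
    · rw [← et] at this
      refine ⟨this.1.1, this.1.2.1, fun _ => ?_⟩
      rcases this.1.2.2 with h | h
      · omega
      · exact h
    · refine ⟨⟨⟨hl.cnt_eq, hl.lt, hl.inj⟩, Extends.refl s, Or.inl ?_⟩, fun _ => ⟨hc, h0⟩⟩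
      simp
    · obtain ⟨⟨a1, a2, a3⟩, a4⟩ := hz
      have hr : Ready n m S D ((i ::= 0).exec z) :=
        ((h.of_same (Cmd.exec_same _ _)).of_same hs).of_same (Cmd.exec_same _ _)
      have hr' : Ready n m S D (z.setReg i k) :=
        ((h.of_same (Cmd.exec_same (go ::= 1) _)).of_same hs).of_same (C := i ::= 0)
          ⟨fun y hy => by
            simp only [Cmd.setsReg, decide_eq_false_iff_not] at hy
            simp [Ne.symm hy], fun _ _ => rfl⟩
      have hl' : Labels n (z.setReg i k) := ⟨a1.cnt_eq, a1.lt, a1.inj⟩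
      rw [exec_ifThen]
      by_cases hg : z.reg go = 1
      · rw [if_pos (by simp [hg])]
        obtain ⟨d1, d2, d3, d4, d5⟩ := climbStep_labels hr' hS hl'
          (by simpa using (a4 hg).1) (by simpa using (a4 hg).2)
        refine ⟨⟨d1, fun v hv => ?_, Or.inr ?_⟩, d5⟩
        · exact a2.trans d2 v hv
        · rcases a3 with ⟨-, x1, x2, x3⟩ | x1
          · rw [show (z.setReg i k).reg cur = s.reg cur by simp [x1]] at d3 d4
            refine ⟨d3, d4.trans ?_⟩
            simp [x3]
          · have := d2 (s.reg cur) x1.1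
            exact ⟨this.1, this.2.trans x1.2⟩
      · rw [if_neg (by simp [hg])]
        refine ⟨⟨hl', a2, Or.inr ?_⟩, fun h => absurd (by simpa using h) hg⟩
        rcases a3 with x1 | x1
        · exact absurd x1.2.2.1 hg
        · exact x1
  · rw [if_neg (by simp [h0])] at et
    rw [et]
    exact ⟨hl, Extends.refl s, fun h => absurd h h0⟩

/-- The first loop of `sewPaths`. -/
def clearMarks : Cmd := forTo v N (put mark v 0)

theorem sewPaths_eq : sewPaths = (clearMarks ;; cnt ::= 0 ;;
    ifThen (deg (cand a) ≐ 0) (cur ::= cand a ;; climb ;; cur ::= cand b ;; climb ;;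
      cur ::= cand d ;; climb)) := rfl

theorem clearMarks_spec {n : ℕ} {s : Store} (hN : s.reg N = 2 * n + 3) :
    ∀ v, v < 2 * n + 3 → (clearMarks.exec s).arr mark v = 0 :=
  Cmd.forTo_induction (I := fun m t => ∀ v, v < m → t.arr mark v = 0) (by simpa using hN)
    (by simp) (fun m _ t _ ht v hv => by
      by_cases h : v = m
      · simp [h]
      · simp [h, ht v (by omega)])

theorem Labels.congr {n : ℕ} {s t : Store} (h : Labels n s) (h1 : t.reg cnt = s.reg cnt)
    (h2 : t.arr = s.arr) : Labels n t := by
  refine ⟨?_, ?_, ?_⟩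
  · rw [h1, h2]
    exact h.cnt_eq
  · rw [h1, h2]
    exact h.lt
  · rw [h2]
    exact h.inj

/-- If all vertices have been visited, then the labels are a permutation, and no edge leaves the
vertex with the label `0`. -/
theorem sewPaths_labels {n m : ℕ} {S D : ℕ → ℕ} {s : Store} (h : Ready n m S D s)
    (hS : ∀ j, j < m → S j < 2 * n + 3) (ha : s.reg a < s.reg Reg.s) (hb : s.reg b < s.reg Reg.s)
    (hd : s.reg d < s.reg Reg.s) (hc : (sewPaths.exec s).reg cnt = 2 * n + 3) :
    let t := sewPaths.exec s
    (∀ v, v < 2 * n + 3 → t.arr lab v < 2 * n + 3) ∧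
    (∀ v w, v < 2 * n + 3 → w < 2 * n + 3 → t.arr lab v = t.arr lab w → v = w) ∧
    ∀ j, j < m → t.arr lab (S j) ≠ 0 := by
  intro t
  change t.reg cnt = _ at hc
  have et : t = sewPaths.exec s := rfl
  rw [sewPaths_eq] at et
  simp only [exec_seq] at et
  have c1 := clearMarks_spec h.N_eq
  have f1 := clearMarks.exec_same s
  generalize clearMarks.exec s = s1 at et c1 f1
  have h1 := h.of_same f1
  generalize e2 : (cnt ::= 0).exec s1 = s2 at et
  have h2 : Ready n m S D s2 := by
    subst e2
    exact h1.of_same (Cmd.exec_same _ _)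
  have b2 : s2.reg cnt = 0 ∧ s2.arr mark = s1.arr mark ∧ s2.reg a = s.reg a ∧ s2.reg b = s.reg b ∧
      s2.reg d = s.reg d ∧ s2.reg Reg.s = s.reg Reg.s := by
    subst e2
    simp [f1.reg a rfl, f1.reg b rfl, f1.reg d rfl, f1.reg Reg.s rfl]
  have l2 : Labels n s2 := by
    refine ⟨?_, fun v hv hv' => ?_, fun v w hv hw hv' => ?_⟩
    · rw [b2.1, b2.2.1, Finset.filter_eq_empty_iff.2, Finset.card_empty]
      intro v hv
      simpa using c1 v (by simpa using hv)
    · rw [b2.2.1] at hv'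
      exact absurd (c1 v hv) hv'
    · rw [b2.2.1] at hv'
      exact absurd (c1 v hv) hv'
  by_cases h0 : s2.arr deg (s2.arr cand (s2.reg a)) = 0
  · rw [exec_ifThen, if_pos (by simp [h0])] at et
    simp only [exec_seq] at et
    generalize e3 : (cur ::= cand a).exec s2 = s3 at et
    have h3 : Ready n m S D s3 := by
      subst e3
      exact h2.of_same (Cmd.exec_same _ _)
    have b3 : s3.reg cur = s2.arr cand (s2.reg a) ∧ s3.reg cnt = 0 ∧ s3.arr = s2.arr ∧
        s3.reg b = s.reg b ∧ s3.reg d = s.reg d ∧ s3.reg Reg.s = s.reg Reg.s := by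
      subst e3
      simp [b2]
    have hcur3 : s3.reg cur < 2 * n + 3 := by
      rw [b3.1]
      exact h2.cand_lt _ (by omega)
    obtain ⟨l4, x4, z4⟩ := climb_labels h3 hS (l2.congr (b3.2.1.trans b2.1.symm) b3.2.2.1) hcur3
    have f4 := climb.exec_same s3
    generalize climb.exec s3 = s4 at et l4 x4 z4 f4
    have h4 := h3.of_same f4
    generalize e5 : (cur ::= cand b).exec s4 = s5 at et
    have h5 : Ready n m S D s5 := by
      subst e5
      exact h4.of_same (Cmd.exec_same _ _)
    have b5 : s5.reg cur = s4.arr cand (s4.reg b) ∧ s5.reg cnt = s4.reg cnt ∧ s5.arr = s4.arr ∧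
        s5.reg d = s.reg d ∧ s5.reg Reg.s = s.reg Reg.s ∧ s4.reg Reg.s = s.reg Reg.s ∧
        s4.reg b = s.reg b := by
      subst e5
      simp [f4.reg b rfl, f4.reg d rfl, f4.reg Reg.s rfl, b3]
    obtain ⟨l6, x6, -⟩ := climb_labels h5 hS (l4.congr b5.2.1 b5.2.2.1)
      (by rw [b5.1]; exact h4.cand_lt _ (by omega))
    have f6 := climb.exec_same s5
    generalize climb.exec s5 = s6 at et l6 x6 f6
    have h6 := h5.of_same f6
    generalize e7 : (cur ::= cand d).exec s6 = s7 at et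
    have h7 : Ready n m S D s7 := by
      subst e7
      exact h6.of_same (Cmd.exec_same _ _)
    have b7 : s7.reg cur = s6.arr cand (s6.reg d) ∧ s7.reg cnt = s6.reg cnt ∧ s7.arr = s6.arr ∧
        s6.reg Reg.s = s.reg Reg.s ∧ s6.reg d = s.reg d := by
      subst e7
      simp [f6.reg d rfl, f6.reg Reg.s rfl, b5]
    obtain ⟨l8, x8, -⟩ := climb_labels h7 hS (l6.congr b7.2.1 b7.2.2.1)
      (by rw [b7.1]; exact h6.cand_lt _ (by omega))
    rw [← et] at l8 x8
    have hall : ∀ v, v < 2 * n + 3 → t.arr mark v ≠ 0 := fun v hv => by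
      have e := l8.cnt_eq
      rw [hc] at e
      have := Finset.eq_of_subset_of_card_le
        (Finset.filter_subset (fun v => t.arr mark v ≠ 0) (Finset.range (2 * n + 3)))
        (by rw [← e, Finset.card_range])
      have hv' : v ∈ (Finset.range (2 * n + 3)).filter (fun v => t.arr mark v ≠ 0) := by
        rw [this]
        simpa using hv
      exact (Finset.mem_filter.1 hv').2
    have hzero : t.arr lab (s3.reg cur) = 0 := by
      have hm : s3.arr mark (s3.reg cur) = 0 := by
        rw [b3.2.2.1, b2.2.1]
        exact c1 _ hcur3
      obtain ⟨y1, y2⟩ := z4 hm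
      have y3 := x6 (s3.reg cur) (by rw [b5.2.2.1]; exact y1)
      have y4 := x8 (s3.reg cur) (by rw [b7.2.2.1]; exact y3.1)
      rw [y4.2, b7.2.2.1, y3.2, b5.2.2.1, y2, b3.2.1]
    refine ⟨fun v hv => ?_, fun v w hv hw => l8.inj v w hv hw (hall v hv) (hall w hw),
      fun j hj hj0 => ?_⟩
    · have := l8.lt v hv (hall v hv)
      omega
    · have he := l8.inj _ _ (hS j hj) hcur3 (hall _ (hS j hj)) (hall _ hcur3) (hj0.trans hzero.symm)
      rw [h2.deg_eq, Finset.card_eq_zero, Finset.filter_eq_empty_iff] at h0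
      exact h0 (Finset.mem_range.2 hj) (he.trans b3.1)
  · rw [exec_ifThen, if_neg (by simp [h0])] at et
    rw [et, b2.1] at hc
    omega

end Watermark

namespace Watermark

/-! ### The true labelling -/

/-- The edges `(S j, D j)`, `j < m`, are the images under the renaming `σ` of the edges of a
watermark, at most two of which, those in `R`, may be missing. -/
structure Copy (n m : ℕ) (q σ S D : ℕ → ℕ) (R : Finset (ℕ × ℕ)) : Prop where
  lt : ∀ u, u < 2 * n + 3 → σ u < 2 * n + 3
  inj : ∀ u w, u < 2 * n + 3 → w < 2 * n + 3 → σ u = σ w → u = w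
  surj : ∀ v, v < 2 * n + 3 → ∃ u, u < 2 * n + 3 ∧ σ u = v
  up : ∀ u, 1 ≤ u → u ≤ 2 * n + 1 → u < q u ∧ q u ≤ 2 * n + 2
  edge : ∀ j, j < m → ∃ u v, u < 2 * n + 3 ∧ v < 2 * n + 3 ∧ S j = σ u ∧ D j = σ v ∧ Edge n q u v
  edge_inj : ∀ j j', j < m → j' < m → S j = S j' → D j = D j' → j = j'
  missing : ∀ u v, Edge n q u v → (u, v) ∉ R → ∃ j, j < m ∧ S j = σ u ∧ D j = σ v
  card_le : R.card ≤ 2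

namespace Copy

variable {n m : ℕ} {q σ S D : ℕ → ℕ} {R : Finset (ℕ × ℕ)}

/-- The path edge into `p` is present. -/
def HasPath (m : ℕ) (σ S D : ℕ → ℕ) (p : ℕ) : Prop := ∃ j, j < m ∧ S j = σ (p + 1) ∧ D j = σ p

theorem mem_of_not_hasPath (C : Copy n m q σ S D R) {p : ℕ} (hp : p + 1 < 2 * n + 3)
    (h : ¬ HasPath m σ S D p) : (p + 1, p) ∈ R := by
  by_contra hR
  obtain ⟨j, hj⟩ := C.missing (p + 1) p (Or.inl ⟨by omega, by omega, rfl⟩) hR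
  exact h ⟨j, hj⟩

/-- The number of edges that leave a vertex. -/
def outDeg (m : ℕ) (S : ℕ → ℕ) (v : ℕ) : ℕ := ((Finset.range m).filter (fun j => S j = v)).card

theorem outDeg_zero (C : Copy n m q σ S D R) : outDeg m S (σ 0) = 0 := by
  rw [outDeg, Finset.card_eq_zero, Finset.filter_eq_empty_iff]
  intro j hj e
  obtain ⟨u, v, hu, hv, e1, e2, he⟩ := C.edge j (Finset.mem_range.1 hj)
  have := C.inj u 0 hu (by omega) (e1.symm.trans e)
  rw [this] at he
  exact not_edge_zero he

/-- Only the tree edge can still leave such a vertex; this is why the breaks of the path are among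
the candidates. -/
theorem outDeg_of_not_hasPath (C : Copy n m q σ S D R) {p : ℕ} (hp : p + 1 < 2 * n + 3)
    (h : ¬ HasPath m σ S D p) : outDeg m S (σ (p + 1)) < 2 := by
  have key : ∀ j, j < m → S j = σ (p + 1) → D j = σ (q (p + 1)) := fun j hj e => by
    obtain ⟨u, v, hu, hv, e1, e2, he⟩ := C.edge j hj
    have hup := C.inj u (p + 1) hu hp (e1.symm.trans e)
    rcases he with he | he
    · have : v = p := by omega
      exact absurd ⟨j, hj, e, this ▸ e2⟩ h
    · rw [e2, he.2.2, hup]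
  have : outDeg m S (σ (p + 1)) ≤ 1 := by
    rw [outDeg, Finset.card_le_one]
    intro j hj j' hj'
    rw [Finset.mem_filter, Finset.mem_range] at hj hj'
    exact C.edge_inj j j' hj.1 hj'.1 (hj.2.trans hj'.2.symm)
      ((key j hj.1 hj.2).trans (key j' hj'.1 hj'.2).symm)
  omega

/-- The first vertex above `p` that the path into `p` does not reach. -/
def NextEnd (n m : ℕ) (σ S D : ℕ → ℕ) (p p' : ℕ) : Prop :=
  p < p' ∧ p' ≤ 2 * n + 3 ∧ (p' = 2 * n + 3 ∨ ¬ HasPath m σ S D (p' - 1)) ∧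
    ∀ i, p ≤ i → i + 1 < p' → HasPath m σ S D i

theorem exists_nextEnd {p : ℕ} (hp : p < 2 * n + 3) : ∃ p', NextEnd n m σ S D p p' := by
  classical
  have hex : ∃ p', p < p' ∧ (p' = 2 * n + 3 ∨ ¬ HasPath m σ S D (p' - 1)) :=
    ⟨2 * n + 3, hp, Or.inl rfl⟩
  refine ⟨Nat.find hex, (Nat.find_spec hex).1, Nat.find_min' hex ⟨hp, Or.inl rfl⟩,
    (Nat.find_spec hex).2, fun i hi hi' => ?_⟩
  by_contra h
  exact Nat.find_min hex hi' ⟨by omega, Or.inr h⟩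

/-- At most two path edges are missing. -/
theorem nextEnd_last (C : Copy n m q σ S D R) {p₁ p₂ p₃ : ℕ} (h1 : 1 ≤ p₁)
    (hp : ¬ HasPath m σ S D (p₁ - 1)) (hp' : p₁ < 2 * n + 3) (h2 : NextEnd n m σ S D p₁ p₂)
    (h2' : p₂ < 2 * n + 3) (h3 : NextEnd n m σ S D p₂ p₃) : p₃ = 2 * n + 3 := by
  by_contra hne
  obtain ⟨a1, a2, a3, -⟩ := h2
  obtain ⟨b1, b2, b3, -⟩ := h3
  have m1 := C.mem_of_not_hasPath (p := p₁ - 1) (by omega) hp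
  have m2 := C.mem_of_not_hasPath (p := p₂ - 1) (by omega) (a3.resolve_left (by omega))
  have m3 := C.mem_of_not_hasPath (p := p₃ - 1) (by omega) (b3.resolve_left hne)
  have hsub : ({(p₁ - 1 + 1, p₁ - 1), (p₂ - 1 + 1, p₂ - 1), (p₃ - 1 + 1, p₃ - 1)} :
      Finset (ℕ × ℕ)) ⊆ R := by
    intro x hx
    simp only [Finset.mem_insert, Finset.mem_singleton] at hx
    rcases hx with rfl | rfl | rfl
    · exact m1
    · exact m2
    · exact m3
  have := Finset.card_le_card hsub
  rw [Finset.card_insert_of_notMem, Finset.card_insert_of_notMem, Finset.card_singleton] at this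
  · have := C.card_le
    omega
  · simp only [Finset.mem_singleton, Prod.mk.injEq]
    omega
  · simp only [Finset.mem_insert, Finset.mem_singleton, Prod.mk.injEq]
    omega

end Copy

open Reg Arr Cmd Test Copy

/-- The vertices that precede `p` on the Hamiltonian path have been visited in order. -/
structure Visited (n p : ℕ) (σ : ℕ → ℕ) (t : Store) : Prop where
  cnt_eq : t.reg cnt = p
  mark_iff : ∀ u, u < 2 * n + 3 → (t.arr mark (σ u) ≠ 0 ↔ u < p)
  lab_eq : ∀ u, u < p → t.arr lab (σ u) = u

theorem Visited.congr {n p : ℕ} {σ : ℕ → ℕ} {s t : Store} (h : Visited n p σ s)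
    (h1 : t.reg cnt = s.reg cnt) (h2 : t.arr = s.arr) : Visited n p σ t := by
  refine ⟨h1.trans h.cnt_eq, ?_, ?_⟩
  · rw [h2]
    exact h.mark_iff
  · rw [h2]
    exact h.lab_eq

/-- Tree edges ascend, so those into `p` come from vertices visited before. The only in-neighbour of
`p` that can be unvisited is `p + 1`, through the path edge. -/
theorem climbStep_visited {n m p : ℕ} {q σ S D : ℕ → ℕ} {R : Finset (ℕ × ℕ)} {s : Store}
    (C : Copy n m q σ S D R) (h : Ready n m S D s) (hp : p < 2 * n + 3) (hv : Visited n p σ s)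
    (hc : s.reg cur = σ p) :
    let t := climbStep.exec s
    Visited n (p + 1) σ t ∧
      (HasPath m σ S D p → p + 1 < 2 * n + 3 → t.reg go = s.reg go ∧ t.reg cur = σ (p + 1)) ∧
      (¬ HasPath m σ S D p ∨ p + 1 = 2 * n + 3 → t.reg go = 0) := by
  intro t
  obtain ⟨c1, c2, c3, c4, c5⟩ := climbStep_spec h
  change ∀ v, t.arr lab v = _ at c1
  change ∀ v, t.arr mark v = _ at c2
  change t.reg cnt = _ at c3
  rw [hc] at c1 c2 c4 c5
  have hm : ∀ u, u < 2 * n + 3 → (t.arr mark (σ u) ≠ 0 ↔ u < p + 1) := fun u hu => by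
    rw [c2]
    by_cases hup : u = p
    · rw [if_pos (by rw [hup])]
      omega
    · rw [if_neg (fun h => hup (C.inj u p hu hp h)), hv.mark_iff u hu]
      omega
  have key : ∀ j, j ∈ (inEdges D m (σ p)).filter (fun j => decide (t.arr mark (S j) = 0)) ↔
      j < m ∧ D j = σ p ∧ S j = σ (p + 1) ∧ p + 1 < 2 * n + 3 := fun j => by
    rw [List.mem_filter, mem_inEdges, decide_eq_true_eq]
    constructor
    · rintro ⟨⟨hj, hD⟩, hmk⟩
      obtain ⟨u, v, hu, hv, e1, e2, he⟩ := C.edge j hj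
      have hvp := C.inj v p hv hp (e2.symm.trans hD)
      have hu' : ¬ u < p + 1 := fun h => (hm u hu).2 h (by rw [← e1]; exact hmk)
      rcases he with he | he
      · have : u = p + 1 := by omega
        exact ⟨hj, hD, this ▸ e1, by omega⟩
      · have := C.up u he.1 he.2.1
        omega
    · rintro ⟨hj, hD, hS, hlt⟩
      refine ⟨⟨hj, hD⟩, ?_⟩
      by_contra hne
      rw [hS] at hne
      have := (hm _ hlt).1 hne
      omega
  refine ⟨⟨by rw [c3, hv.cnt_eq], hm, fun u hu => ?_⟩, fun hP hlt => ?_, fun hP => c5 ?_⟩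
  · rw [c1]
    by_cases hup : u = p
    · rw [if_pos (by rw [hup]), hv.cnt_eq, hup]
    · rw [if_neg (fun h => hup (C.inj u p (by omega) hp h)), hv.lab_eq u (by omega)]
  · obtain ⟨j, hj, e1, e2⟩ := hP
    have hl : (inEdges D m (σ p)).filter (fun j => decide (t.arr mark (S j) = 0)) = [j] := by
      have hnd := (nodup_inEdges D m (σ p)).filter (fun j => decide (t.arr mark (S j) = 0))
      refine List.perm_singleton.1 ((List.perm_ext_iff_of_nodup hnd (by simp)).2 fun j' => ?_)
      rw [key, List.mem_singleton]
      constructor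
      · rintro ⟨hj', hD, hS, -⟩
        exact C.edge_inj _ _ hj' hj (hS.trans e1.symm) (hD.trans e2.symm)
      · rintro rfl
        exact ⟨hj, e2, e1, hlt⟩
    obtain ⟨d1, j', d2, d3, d4⟩ := c4 (by simp only [t] at hl; rw [hl]; rfl)
    refine ⟨d1, ?_⟩
    have : j' ∈ (inEdges D m (σ p)).filter (fun j => decide (t.arr mark (S j) = 0)) :=
      List.mem_filter.2 ⟨d2, by simpa using d3⟩
    change t.reg cur = S j' at d4
    rw [d4]
    exact ((key j').1 this).2.2.1
  · have hl : (inEdges D m (σ p)).filter (fun j => decide (t.arr mark (S j) = 0)) = [] := by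
      refine List.eq_nil_iff_forall_not_mem.2 fun j hj => ?_
      obtain ⟨x1, x2, x3, x4⟩ := (key j).1 hj
      rcases hP with hP | hP
      · exact hP ⟨j, x1, x3, x2⟩
      · omega
    simp only [t] at hl
    rw [hl]
    simp

theorem climb_visited {n m p p' : ℕ} {q σ S D : ℕ → ℕ} {R : Finset (ℕ × ℕ)} {s : Store}
    (C : Copy n m q σ S D R) (h : Ready n m S D s) (hp : p < 2 * n + 3) (hv : Visited n p σ s)
    (hc : s.reg cur = σ p) (hp' : NextEnd n m σ S D p p') : Visited n p' σ (climb.exec s) := by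
  rw [climb_eq, exec_ifThen]
  have h0 : s.arr mark (s.reg cur) = 0 := by
    by_contra hne
    rw [hc] at hne
    have := (hv.mark_iff p hp).1 hne
    omega
  rw [if_pos (by simp [h0]), exec_seq]
  have := Cmd.forTo_induction (y := i) (p := N) (C := ifThen (go ≐ 1) climbStep)
    (s := (go ::= 1).exec s)
    (I := fun k z => (z.reg go = 1 ∧ p + k < p' ∧ Visited n (p + k) σ z ∧ z.reg cur = σ (p + k)) ∨
      (z.reg go = 0 ∧ Visited n p' σ z))
    (k := 2 * n + 3) (by simp [h.N_eq]) ?_ (fun k hk z hs hz => ?_)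
  · rcases this with h | h
    · have := hp'.2.1
      omega
    · exact h.2
  · exact Or.inl ⟨by simp, hp'.1, hv.congr (by simp) rfl, by simpa using hc⟩
  · have hr : Ready n m S D (z.setReg i k) :=
      ((h.of_same (Cmd.exec_same (go ::= 1) _)).of_same hs).of_same (C := i ::= 0)
        ⟨fun y hy => by
          simp only [Cmd.setsReg, decide_eq_false_iff_not] at hy
          simp [Ne.symm hy], fun _ _ => rfl⟩
    rw [exec_ifThen]
    rcases hz with ⟨z1, z2, z3, z4⟩ | ⟨z1, z2⟩
    · rw [if_pos (by simp [z1])]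
      have hle := hp'.2.1
      obtain ⟨d1, d2, d3⟩ := climbStep_visited C hr (p := p + k) (by omega)
        (z3.congr (by simp) rfl) (by simpa using z4)
      by_cases hlast : p + k + 1 = p'
      · right
        refine ⟨d3 ?_, hlast ▸ d1⟩
        rcases hp'.2.2.1 with h | h
        · exact Or.inr (by omega)
        · left
          rwa [show p' - 1 = p + k from by omega] at h
      · left
        obtain ⟨e1, e2⟩ := d2 (hp'.2.2.2 (p + k) (by omega) (by omega)) (by omega)
        refine ⟨?_, by omega, d1, e2⟩
        rw [e1]
        simpa using z1
    · rw [if_neg (by simp [z1])]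
      exact Or.inr ⟨by simpa using z1, z2.congr (by simp) rfl⟩

theorem climb_skip {s : Store} (h : s.arr mark (s.reg cur) ≠ 0) : climb.exec s = s := by
  rw [climb_eq, exec_ifThen, if_neg (by simp [h])]

/-- The effect of one stage of `sewPaths`, started at the candidate `w`. -/
theorem stage_visited {n m p p' w : ℕ} {q σ S D : ℕ → ℕ} {R : Finset (ℕ × ℕ)} {s : Store}
    (C : Copy n m q σ S D R) (h : Ready n m S D s) (hv : Visited n p σ s) (hp0 : 0 < p)
    (hw : s.reg cur = w)
    (hc : (p < 2 * n + 3 ∧ w = σ p ∧ NextEnd n m σ S D p p') ∨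
      (p = 2 * n + 3 ∧ p' = p ∧ w = σ 0)) :
    Visited n p' σ (climb.exec s) := by
  rcases hc with ⟨h1, h2, h3⟩ | ⟨h1, h2, h3⟩
  · exact climb_visited C h h1 hv (hw.trans h2) h3
  · rw [h2, climb_skip]
    · exact hv
    · rw [hw, h3, hv.mark_iff 0 (by omega)]
      exact hp0

/-- The ends are `0` and the vertices just above the missing path edges. There are at most two such
breaks, so three pieces exhaust the path. If fewer pieces exist, the superfluous ends are taken to
be `0`, which is visited already and is skipped. -/
theorem exists_choice {n m : ℕ} {q σ S D : ℕ → ℕ} {R : Finset (ℕ × ℕ)}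
    (C : Copy n m q σ S D R) {s₀ : Store} (h₀ : Ready n m S D s₀) :
    ∃ a₀ b₀ d₀, a₀ < s₀.reg Reg.s ∧ b₀ < s₀.reg Reg.s ∧ d₀ < s₀.reg Reg.s ∧
      ∀ s : Store, Ready n m S D s → s.arr cand = s₀.arr cand → s.reg a = a₀ → s.reg b = b₀ →
        s.reg d = d₀ → Visited n (2 * n + 3) σ (sewPaths.exec s) := by
  have hcand : ∀ u, u < 2 * n + 3 → outDeg m S (σ u) < 2 →
      ∃ a, a < s₀.reg Reg.s ∧ s₀.arr cand a = σ u := fun u hu h => h₀.exists_cand _ (C.lt u hu) h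
  have hbreak : ∀ p, 1 ≤ p → p < 2 * n + 3 → ¬ HasPath m σ S D (p - 1) →
      ∃ a, a < s₀.reg Reg.s ∧ s₀.arr cand a = σ p := fun p hp hp' h => by
    obtain ⟨k, rfl⟩ : ∃ k, p = k + 1 := ⟨p - 1, by omega⟩
    exact hcand _ hp' (C.outDeg_of_not_hasPath hp' h)
  obtain ⟨a₀, ha, ea⟩ := hcand 0 (by omega) (by rw [C.outDeg_zero]; omega)
  obtain ⟨p₁, h1⟩ := exists_nextEnd (m := m) (σ := σ) (S := S) (D := D) (n := n) (p := 0) (by omega)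
  have step : ∀ p, 1 ≤ p → p ≤ 2 * n + 3 → (p = 2 * n + 3 ∨ ¬ HasPath m σ S D (p - 1)) →
      ∃ a p', a < s₀.reg Reg.s ∧ ((p < 2 * n + 3 ∧ s₀.arr cand a = σ p ∧ NextEnd n m σ S D p p') ∨
      (p = 2 * n + 3 ∧ p' = p ∧ s₀.arr cand a = σ 0)) := fun p hp hp' hb => by
    by_cases hlt : p < 2 * n + 3
    · obtain ⟨a, ha, ea⟩ := hbreak p hp hlt (hb.resolve_left (by omega))
      obtain ⟨p', h'⟩ := exists_nextEnd (m := m) (σ := σ) (S := S) (D := D) (n := n) hlt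
      exact ⟨a, p', ha, Or.inl ⟨hlt, ea, h'⟩⟩
    · exact ⟨a₀, p, ha, Or.inr ⟨by omega, rfl, ea⟩⟩
  obtain ⟨b₀, p₂, hb, h2⟩ := step p₁ h1.1 h1.2.1 h1.2.2.1
  have h2' : 1 ≤ p₂ ∧ p₂ ≤ 2 * n + 3 ∧ (p₂ = 2 * n + 3 ∨ ¬ HasPath m σ S D (p₂ - 1)) := by
    rcases h2 with ⟨x1, -, x2⟩ | ⟨x1, x2, -⟩
    · exact ⟨by have := x2.1; omega, x2.2.1, x2.2.2.1⟩
    · exact ⟨by omega, by omega, by omega⟩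
  obtain ⟨d₀, p₃, hd, h3⟩ := step p₂ h2'.1 h2'.2.1 h2'.2.2
  have hlast : p₃ = 2 * n + 3 := by
    rcases h3 with ⟨x1, -, x2⟩ | ⟨x1, x2, -⟩
    · rcases h2 with ⟨y1, -, y2⟩ | ⟨y1, y2, -⟩
      · exact C.nextEnd_last h1.1 (h1.2.2.1.resolve_left (by omega)) y1 y2 x1 x2
      · omega
    · omega
  refine ⟨a₀, b₀, d₀, ha, hb, hd, fun s h hs ha' hb' hd' => ?_⟩
  rw [sewPaths_eq]
  simp only [exec_seq]
  have c1 := clearMarks_spec h.N_eq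
  have f1 := clearMarks.exec_same s
  generalize clearMarks.exec s = s1 at c1 f1
  have r1 := h.of_same f1
  generalize e2 : (cnt ::= 0).exec s1 = s2
  have r2 : Ready n m S D s2 := by
    subst e2
    exact r1.of_same (Cmd.exec_same _ _)
  have b2 : s2.reg cnt = 0 ∧ s2.arr mark = s1.arr mark ∧ s2.reg a = a₀ ∧ s2.reg b = b₀ ∧
      s2.reg d = d₀ ∧ s2.arr cand = s₀.arr cand := by
    subst e2
    simp [f1.reg a rfl, f1.reg b rfl, f1.reg d rfl, f1.arr cand rfl, ha', hb', hd', hs]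
  have v2 : Visited n 0 σ s2 := by
    refine ⟨b2.1, fun u hu => ?_, fun u hu => by omega⟩
    rw [b2.2.1, c1 _ (C.lt u hu)]
    simp
  have h0 : s2.arr deg (s2.arr cand (s2.reg a)) = 0 := by
    rw [b2.2.2.1, b2.2.2.2.2.2, ea, r2.deg_eq]
    exact C.outDeg_zero
  rw [exec_ifThen, if_pos (by simp [h0])]
  simp only [exec_seq]
  generalize e3 : (cur ::= cand a).exec s2 = s3
  have r3 : Ready n m S D s3 := by
    subst e3
    exact r2.of_same (Cmd.exec_same _ _)
  have b3 : s3.reg cur = σ 0 ∧ s3.reg cnt = s2.reg cnt ∧ s3.arr = s2.arr ∧ s3.reg b = b₀ ∧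
      s3.reg d = d₀ := by
    subst e3
    simp [b2, ea]
  have v4 := climb_visited C r3 (by omega) (v2.congr b3.2.1 b3.2.2.1) b3.1 h1
  have f4 := climb.exec_same s3
  generalize climb.exec s3 = s4 at v4 f4
  have r4 := r3.of_same f4
  generalize e5 : (cur ::= cand b).exec s4 = s5
  have r5 : Ready n m S D s5 := by
    subst e5
    exact r4.of_same (Cmd.exec_same _ _)
  have b5 : s5.reg cur = s₀.arr cand b₀ ∧ s5.reg cnt = s4.reg cnt ∧ s5.arr = s4.arr ∧
      s5.reg d = d₀ ∧ s5.arr cand = s₀.arr cand := by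
    subst e5
    simp [f4.reg b rfl, f4.reg d rfl, f4.arr cand rfl, b3, b2]
  have v6 := stage_visited C r5 (v4.congr b5.2.1 b5.2.2.1) h1.1 b5.1 h2
  have f6 := climb.exec_same s5
  generalize climb.exec s5 = s6 at v6 f6
  have r6 := r5.of_same f6
  generalize e7 : (cur ::= cand d).exec s6 = s7
  have r7 : Ready n m S D s7 := by
    subst e7
    exact r6.of_same (Cmd.exec_same _ _)
  have b7 : s7.reg cur = s₀.arr cand d₀ ∧ s7.reg cnt = s6.reg cnt ∧ s7.arr = s6.arr := by
    subst e7
    simp [f6.reg d rfl, f6.arr cand rfl, b5]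
  have v8 := stage_visited C r7 (v6.congr b7.2.1 b7.2.2) h2'.1 b7.1 h3
  rw [hlast] at v8
  exact v8

end Watermark

namespace Watermark

/-! ### Only the true labelling is accepted -/

theorem atMostTwo_of_card_le {B : ℕ → ℕ → Prop} {R : Finset (ℕ × ℕ)} (hR : R.card ≤ 2)
    (h : ∀ u v, B u v → (u, v) ∈ R) : AtMostTwo B := by
  intro u₁ v₁ u₂ v₂ u₃ v₃ h₁ h₂ h₃
  by_contra hne
  have := Finset.two_lt_card.2 ⟨_, h _ _ h₁, _, h _ _ h₂, _, h _ _ h₃, by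
    simp only [ne_eq, Prod.mk.injEq]
    tauto⟩
  omega

/-- The listing of a damaged copy of a watermark. -/
theorem IsListing.copy {ω : ℕ} {R : Finset (ℕ × ℕ)} {L : List (ℕ × ℕ)} (h3 : 2 < size ω)
    (hR : R.card ≤ 2) (hL : IsListing (2 * size ω + 3) (watermark ω \ R) L) :
    ∃ σ, Copy (size ω) L.length (treeTarget ω) σ (fun j => (L.getD j (0, 0)).1)
      (fun j => (L.getD j (0, 0)).2) R := by
  obtain ⟨hnd, σ, hσ, hE⟩ := hL
  have S := treeShape h3
  have hget : ∀ j (hj : j < L.length), L.getD j (0, 0) = L[j] := fun j hj =>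
    List.getD_eq_getElem _ _ hj
  have hlt : ∀ u v, Edge (size ω) (treeTarget ω) u v → u < 2 * size ω + 3 ∧ v < 2 * size ω + 3 := by
    rintro u v (h | h)
    · omega
    · have := S.le u h.1 h.2.1
      omega
  refine ⟨σ, fun u hu => hσ.mapsTo hu, fun u w hu hw h => hσ.injOn hu hw h,
    fun v hv => ?_, fun u hu hu' => ⟨S.lt u hu hu', S.le u hu hu'⟩, fun j hj => ?_,
    fun j j' hj hj' h1 h2 => ?_, fun u v h hn => ?_, hR⟩
  · obtain ⟨u, hu, e⟩ := hσ.surjOn hv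
    exact ⟨u, hu, e⟩
  · have hmem : L[j] ∈ L.toFinset := List.mem_toFinset.2 (List.getElem_mem _)
    rw [hE, Finset.mem_image] at hmem
    obtain ⟨⟨u, v⟩, he, e⟩ := hmem
    rw [Finset.mem_sdiff, watermark_eq, mem_edgeFinset] at he
    have := hlt u v he.1
    refine ⟨u, v, this.1, this.2, ?_, ?_, he.1⟩ <;> simp only [hget j hj, ← e]
  · have e : L[j] = L[j'] := by
      rw [← hget j hj, ← hget j' hj']
      exact Prod.ext h1 h2
    exact (hnd.getElem_inj_iff).1 e
  · have hmem : (σ u, σ v) ∈ L.toFinset := by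
      rw [hE, Finset.mem_image]
      exact ⟨(u, v), Finset.mem_sdiff.2 ⟨by rw [watermark_eq, mem_edgeFinset]; exact h, hn⟩, rfl⟩
    obtain ⟨j, hj, e⟩ := List.getElem_of_mem (List.mem_toFinset.1 hmem)
    refine ⟨j, hj, ?_, ?_⟩ <;> simp only [hget j hj, e]

namespace Copy

variable {n m : ℕ} {q σ S D : ℕ → ℕ} {R : Finset (ℕ × ℕ)}

theorem le_length (C : Copy n m q σ S D R) : 4 * n + 1 ≤ m := by
  have h1 := card_edgeFinset (n := n) (q := q) fun u hu hu' => (C.up u hu hu').1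
  have h2 : (edgeFinset n q \ R).card ≤ ((Finset.range m).image (fun j => (S j, D j))).card := by
    refine Finset.card_le_card_of_injOn (fun e => (σ e.1, σ e.2)) ?_ ?_
    · rintro ⟨u, v⟩ h
      rw [Finset.mem_coe, Finset.mem_sdiff, mem_edgeFinset] at h
      obtain ⟨j, hj, e1, e2⟩ := C.missing u v h.1 h.2
      exact Finset.mem_coe.2 (Finset.mem_image.2 ⟨j, Finset.mem_range.2 hj, by rw [e1, e2]⟩)
    · have hlt : ∀ u v, Edge n q u v → u < 2 * n + 3 ∧ v < 2 * n + 3 := by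
        rintro u v (h | h)
        · omega
        · have := C.up u h.1 h.2.1
          omega
      rintro ⟨u, v⟩ h ⟨u', v'⟩ h' e
      rw [Finset.mem_coe, Finset.mem_sdiff, mem_edgeFinset] at h h'
      have a := hlt u v h.1
      have a' := hlt u' v' h'.1
      rw [Prod.mk.injEq] at e
      rw [C.inj u u' a.1 a'.1 e.1, C.inj v v' a.2 a'.2 e.2]
  have h3 := Finset.card_image_le (s := Finset.range m) (f := fun j => (S j, D j))
  have h4 := Finset.le_card_sdiff R (edgeFinset n q)
  have := C.card_le
  rw [Finset.card_range] at h3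
  omega

theorem length_le (C : Copy n m q σ S D R) : m ≤ 4 * n + 3 := by
  rw [← card_edgeFinset (n := n) (q := q) fun u hu hu' => (C.up u hu hu').1]
  have h2 : (Finset.range m).card ≤ ((edgeFinset n q).image (fun e => (σ e.1, σ e.2))).card := by
    refine Finset.card_le_card_of_injOn (fun j => (S j, D j)) ?_ ?_
    · intro j hj
      obtain ⟨u, v, -, -, e1, e2, he⟩ := C.edge j (Finset.mem_range.1 hj)
      exact Finset.mem_coe.2 (Finset.mem_image.2 ⟨(u, v), mem_edgeFinset.2 he,
        by simp only [e1, e2]⟩)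
    · intro j hj j' hj' e
      rw [Prod.mk.injEq] at e
      exact C.edge_inj j j' (Finset.mem_range.1 hj) (Finset.mem_range.1 hj') e.1 e.2
  rw [Finset.card_range] at h2
  exact h2.trans Finset.card_image_le

theorem src_lt (C : Copy n m q σ S D R) {j : ℕ} (hj : j < m) : S j < 2 * n + 3 := by
  obtain ⟨u, v, hu, -, e, -⟩ := C.edge j hj
  exact e ▸ C.lt u hu

theorem dst_lt (C : Copy n m q σ S D R) {j : ℕ} (hj : j < m) : D j < 2 * n + 3 := by
  obtain ⟨u, v, -, hv, -, e, -⟩ := C.edge j hj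
  exact e ▸ C.lt v hv

/-- A labelling under which the edges form a subgraph of a watermark is the true one. -/
theorem label_eq {f a f' a' : ℕ} {A A' : ℕ → Prop} {Q l : ℕ → ℕ} (C : Copy n m q σ S D R)
    (hq : Shape n f a A q) (hQ : Shape n f' a' A' Q) (hl : ∀ v, v < 2 * n + 3 → l v < 2 * n + 3)
    (hinj : ∀ v w, v < 2 * n + 3 → w < 2 * n + 3 → l v = l w → v = w)
    (hE : ∀ j, j < m → Edge n Q (l (S j)) (l (D j))) : ∀ u, u < 2 * n + 3 → l (σ u) = u := by
  have hsurj : ∀ w, ∃ u, w < 2 * n + 3 → u < 2 * n + 3 ∧ l (σ u) = w := fun w => by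
    by_cases hw : w < 2 * n + 3
    · obtain ⟨u, hu, e⟩ := Finset.surjOn_of_injOn_of_card_le (s := Finset.range (2 * n + 3))
        (t := Finset.range (2 * n + 3)) (fun u => l (σ u))
        (fun u hu => by
          simp only [Finset.coe_range, Set.mem_Iio] at hu ⊢
          exact hl _ (C.lt u hu))
        (fun u hu u' hu' e => by
          simp only [Finset.coe_range, Set.mem_Iio] at hu hu'
          exact C.inj u u' hu hu' (hinj _ _ (C.lt u hu) (C.lt u' hu') e))
        le_rfl (by simpa using hw)
      exact ⟨u, fun _ => ⟨by simpa using hu, e⟩⟩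
    · exact ⟨0, fun h => absurd h hw⟩
  choose mu hmu using hsurj
  have hleft : ∀ u, u < 2 * n + 3 → mu (l (σ u)) = u := fun u hu => by
    have h1 := hl _ (C.lt u hu)
    obtain ⟨h2, h3⟩ := hmu _ h1
    exact C.inj _ _ h2 hu (hinj _ _ (C.lt _ h2) (C.lt u hu) h3)
  -- In one direction, only edges of `R` can be lost.
  have hN : Near n q Q (fun u => l (σ u)) mu := by
    refine ⟨fun u hu => ?_, fun u hu => ?_, fun u hu => hleft u (by omega),
      fun u hu => (hmu u (by omega)).2, ?_, ?_⟩
    · have := hl _ (C.lt u (by omega))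
      omega
    · have := (hmu u (by omega)).1
      omega
    · refine atMostTwo_of_card_le C.card_le fun u v ⟨h1, h2⟩ => ?_
      by_contra hn
      obtain ⟨j, hj, e1, e2⟩ := C.missing u v h1 hn
      have := hE j hj
      rw [e1, e2] at this
      exact h2 this
    -- In the other direction, the labelled input provides at least `4n + 1` of the `4n + 3` edges
    -- of the second watermark, and these are edges of the first one as well.
    · have hsub : (Finset.range m).image (fun j => (l (S j), l (D j))) ⊆ edgeFinset n Q := by
        intro e he
        obtain ⟨j, hj, rfl⟩ := Finset.mem_image.1 he
        exact mem_edgeFinset.2 (hE j (Finset.mem_range.1 hj))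
      refine atMostTwo_of_card_le
        (R := edgeFinset n Q \ (Finset.range m).image (fun j => (l (S j), l (D j)))) ?_
        fun u v ⟨h1, h2⟩ => ?_
      · rw [Finset.card_sdiff_of_subset hsub, card_edgeFinset hQ.lt, Finset.card_image_of_injOn,
          Finset.card_range]
        · have := C.le_length
          omega
        · intro j hj j' hj' e
          have hj := Finset.mem_range.1 hj
          have hj' := Finset.mem_range.1 hj'
          rw [Prod.mk.injEq] at e
          exact C.edge_inj j j' hj hj' (hinj _ _ (C.src_lt hj) (C.src_lt hj') e.1)
            (hinj _ _ (C.dst_lt hj) (C.dst_lt hj') e.2)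
      · refine Finset.mem_sdiff.2 ⟨mem_edgeFinset.2 h1, fun hmem => h2 ?_⟩
        obtain ⟨j, hj, e⟩ := Finset.mem_image.1 hmem
        obtain ⟨u', v', hu', hv', e1, e2, he⟩ := C.edge j (Finset.mem_range.1 hj)
        rw [Prod.mk.injEq, e1, e2] at e
        rw [← e.1, ← e.2, hleft u' hu', hleft v' hv']
        exact he
  exact fun u hu => hN.eq_id hq hQ u (by omega)

end Copy

open Reg Arr Cmd Test

/-- The body of the search for the ends. -/
def tryEnds : Cmd :=
  sewPaths ;;
  ifThen (cnt ≐ N) (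
    readForest ;; findFixed ;; findAscending ;; findPreorder ;; restoreTree ;; checkRestored ;;
    ifThen (good ≐ 1) (done ::= 1 ;; writeKey))

/-- The search for the ends. -/
def search : Cmd :=
  forTo a Reg.s (forTo b Reg.s (forTo d Reg.s (ifThen (done ≐ 0) tryEnds)))

theorem decode_eq : decode =
    (countEdges ;; ite (2 ≺ k) skip (readGraph ;; done ::= 0 ;; search)) := rfl

/-- Either nothing has been written, or the key `ω` has been. -/
def Partly (ω : ℕ) (t : Store) : Prop :=
  (t.reg done = 0 ∧ ∀ p, t.arr key p = 0) ∨ (t.reg done = 1 ∧ ∀ p, t.arr key p = ω / 2 ^ p % 2)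

theorem labelled_of_sewPaths {n m : ℕ} {q σ S D : ℕ → ℕ} {R : Finset (ℕ × ℕ)} {s : Store}
    (C : Copy n m q σ S D R) (h : Ready n m S D s) (ha : s.reg a < s.reg Reg.s)
    (hb : s.reg b < s.reg Reg.s) (hd : s.reg d < s.reg Reg.s)
    (hc : (sewPaths.exec s).reg cnt = 2 * n + 3) :
    Labelled n m (fun j => (sewPaths.exec s).arr lab (S j))
      (fun j => (sewPaths.exec s).arr lab (D j)) (sewPaths.exec s) := by
  obtain ⟨h1, h2, h3⟩ := sewPaths_labels h (fun j hj => C.src_lt hj) ha hb hd hc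
  have r := h.of_same (sewPaths.exec_same s)
  exact ⟨r.N_eq, r.n_eq, r.M_eq, r.two_eq, fun j _ => by rw [r.src_eq], fun j _ => by rw [r.dst_eq],
    fun j hj => h1 _ (C.src_lt hj), fun j hj => h1 _ (C.dst_lt hj), h3⟩

theorem digit_eq_zero {ω p : ℕ} (h : size ω ≤ p) : ω / 2 ^ p % 2 = 0 := by
  rw [Nat.div_eq_of_lt]
  exact lt_of_lt_of_le (Nat.lt_base_pow_length_digits (b := 2) (by omega))
    (Nat.pow_le_pow_right (by omega) (by rwa [← size_eq]))

/-- An accepted trial is correct although the check does not know `ω`: rigidity turns acceptance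
into truth of the labelling, and the true labelling leads to the true ascending vertices. A trial
that visits the path in its order is always accepted. -/
theorem tryEnds_spec {ω m : ℕ} {σ S D : ℕ → ℕ} {R : Finset (ℕ × ℕ)} {s : Store}
    (h3 : 2 < size ω) (C : Copy (size ω) m (treeTarget ω) σ S D R) (h : Ready (size ω) m S D s)
    (ha : s.reg a < s.reg Reg.s) (hb : s.reg b < s.reg Reg.s) (hd : s.reg d < s.reg Reg.s)
    (h0 : s.reg done = 0) (hk : ∀ p, s.arr key p = 0) :
    Partly ω (tryEnds.exec s) ∧
      (Visited (size ω) (2 * size ω + 3) σ (sewPaths.exec s) → (tryEnds.exec s).reg done = 1) := by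
  have e : tryEnds.exec s = if (sewPaths.exec s).reg cnt = 2 * size ω + 3 then
      (ifThen (good ≐ 1) (done ::= 1 ;; writeKey)).exec (restore.exec (sewPaths.exec s))
      else sewPaths.exec s := by
    have r := h.of_same (sewPaths.exec_same s)
    simp only [tryEnds, restore, exec_seq, exec_ifThen, Test.eval_eq, Expr.eval_reg, r.N_eq,
      decide_eq_true_eq]
  have f1 := sewPaths.exec_same s
  rw [e]
  by_cases hc : (sewPaths.exec s).reg cnt = 2 * size ω + 3
  swap
  · rw [if_neg hc]
    exact ⟨Or.inl ⟨(f1.reg done rfl).trans h0, fun p => by rw [f1.arr key rfl]; exact hk p⟩,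
      fun hv => absurd hv.cnt_eq hc⟩
  rw [if_pos hc]
  have hl := labelled_of_sewPaths C h ha hb hd hc
  obtain ⟨l1, l2, -⟩ := sewPaths_labels h (fun j hj => C.src_lt hj) ha hb hd hc
  have L := layout h3
  have T := isTarget h3
  have f2 := restore.exec_same (sewPaths.exec s)
  have true_label : (∀ u, u < 2 * size ω + 3 → (sewPaths.exec s).arr lab (σ u) = u) →
      (restore.exec (sewPaths.exec s)).reg good = 1 ∧ ∀ x, size ω < x → x ≤ 2 * size ω →
        ((restore.exec (sewPaths.exec s)).arr asc x ≤ 1 ∧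
          ((restore.exec (sewPaths.exec s)).arr asc x = 1 ↔ Asc ω x)) := fun hid => by
    refine restore_complete hl L T (fun j hj => ?_) (fun j j' hj hj' e1 e2 => ?_) ?_
    · obtain ⟨u, v, hu, hv, e1, e2, he⟩ := C.edge j hj
      rw [e1, e2, hid u hu, hid v hv]
      exact he
    · exact C.edge_inj j j' hj hj' (l2 _ _ (C.src_lt hj) (C.src_lt hj') e1)
        (l2 _ _ (C.dst_lt hj) (C.dst_lt hj') e2)
    · intro u v w hu hu' hv hv' hw hw' n1 n2 n3
      have hm : ∀ u, 1 ≤ u → u ≤ 2 * size ω + 1 → (∀ j, j < m →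
          ¬ ((sewPaths.exec s).arr lab (S j) = u ∧
            (sewPaths.exec s).arr lab (D j) = treeTarget ω u)) → (u, treeTarget ω u) ∈ R :=
        fun u hu hu' hn => by
          by_contra hR
          obtain ⟨j, hj, e1, e2⟩ := C.missing u _ (Or.inr ⟨hu, hu', rfl⟩) hR
          have := C.up u hu hu'
          exact hn j hj ⟨by rw [e1, hid u (by omega)], by rw [e2, hid _ (by omega)]⟩
      rcases atMostTwo_of_card_le C.card_le (fun _ _ h => h) _ _ _ _ _ _ (hm u hu hu' n1)
        (hm v hv hv' n2) (hm w hw hw' n3) with h | h | h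
      · exact Or.inl h.1
      · exact Or.inr (Or.inl h.1)
      · exact Or.inr (Or.inr h.1)
  by_cases hg : (restore.exec (sewPaths.exec s)).reg good = 1
  swap
  · rw [exec_ifThen, if_neg (by simp [hg])]
    refine ⟨Or.inl ⟨?_, fun p => ?_⟩, fun hv => absurd (true_label hv.lab_eq).1 hg⟩
    · rw [f2.reg done rfl, f1.reg done rfl, h0]
    · rw [f2.arr key rfl, f1.arr key rfl, hk p]
  -- The watermark obtained here is an unknown one of the same size; `Copy.label_eq` shows that the
  -- labelling is nevertheless the true one.
  obtain ⟨f', A', P', Q', L', T', hE⟩ := restore_sound L.three_le hl hg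
  have hasc := (true_label (C.label_eq (treeShape h3) (L'.shape T') l1 l2 hE)).2
  rw [exec_ifThen, if_pos (by simp [hg]), exec_seq]
  have g1 : (restore.exec (sewPaths.exec s)).reg N = 2 * size ω + 3 :=
    (f2.reg N rfl).trans hl.N_eq
  have g2 : (restore.exec (sewPaths.exec s)).reg Reg.n = size ω := (f2.reg Reg.n rfl).trans hl.n_eq
  have g3 : ∀ p, (restore.exec (sewPaths.exec s)).arr key p = 0 := fun p => by
    rw [f2.arr key rfl, f1.arr key rfl, hk p]
  clear f2 e true_label hg
  generalize restore.exec (sewPaths.exec s) = z at *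
  have hw := writeKey_spec (n := size ω) (s := (done ::= 1).exec z) (by simp [g1]) (by simp [g2])
  have hdone : (writeKey.exec ((done ::= 1).exec z)).reg done = 1 := by
    rw [(writeKey.exec_same _).reg done rfl]
    simp
  refine ⟨Or.inr ⟨hdone, fun p => ?_⟩, fun _ => hdone⟩
  rw [hw p, exec_assign, Store.setReg_arr, g3]
  split
  · rename_i hp
    obtain ⟨h1, h2⟩ := hasc (2 * size ω - p) (by omega) (by omega)
    rw [asc_iff_digit (by omega) (by omega) h3, show 2 * size ω - (2 * size ω - p) = p by omega] at h2
    have := Nat.mod_lt (ω / 2 ^ p) (show 2 > 0 by omega)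
    omega
  · rename_i hp
    rw [digit_eq_zero (by omega)]

/-- The rule for a loop that looks for something. -/
theorem Cmd.forTo_search {y : Reg} {p : Expr} {C : Cmd} {s : Store} (I F : Store → Prop)
    {G : Prop} {k k₀ : ℕ} (hk : p.eval s = k) (h₀ : k₀ < k) (hI : I s)
    (hs : ∀ m, m < k → ∀ t, Same (Cmd.forTo y p C) s t → I t →
      I (C.exec (t.setReg y m)) ∧ (F t ∨ (m = k₀ ∧ G) → F (C.exec (t.setReg y m)))) :
    I ((Cmd.forTo y p C).exec s) ∧ (F s ∨ G → F ((Cmd.forTo y p C).exec s)) := by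
  have := Cmd.forTo_induction (y := y) (p := p) (C := C) (s := s)
    (I := fun m t => I t ∧ (F s ∨ (k₀ < m ∧ G) → F t)) hk
    ⟨hI, fun h => h.resolve_right (by simp)⟩ (fun m hm t ht hIt => by
      obtain ⟨h1, h2⟩ := hs m hm t ht hIt.1
      refine ⟨h1, fun h => h2 ?_⟩
      by_cases hmk : m = k₀
      · rcases h with h | h
        · exact Or.inl (hIt.2 (Or.inl h))
        · exact Or.inr ⟨hmk, h.2⟩
      · refine Or.inl (hIt.2 (h.imp id fun h => ⟨by omega, h.2⟩)))
  exact ⟨this.1, fun h => this.2 (h.imp id fun h => ⟨h₀, h⟩)⟩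

/-- `Partly` survives every trial: a rejected one writes nothing, and after an accepted one no
further trial is run. Some trial must be accepted, at the latest the one with the ends of
`exists_choice`. -/
theorem search_spec {ω m : ℕ} {σ S D : ℕ → ℕ} {R : Finset (ℕ × ℕ)} {s : Store}
    (h3 : 2 < size ω) (C : Copy (size ω) m (treeTarget ω) σ S D R) (h : Ready (size ω) m S D s)
    (h0 : s.reg done = 0) (hk : ∀ p, s.arr key p = 0) :
    ∀ p, (search.exec s).arr key p = ω / 2 ^ p % 2 := by
  obtain ⟨a₀, b₀, d₀, ha, hb, hd, hv⟩ := exists_choice C h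
  let I : Store → Prop := fun t => Ready (size ω) m S D t ∧ t.arr cand = s.arr cand ∧
    t.reg Reg.s = s.reg Reg.s ∧ Partly ω t
  have hI : ∀ y i t, y = a ∨ y = b ∨ y = d → I t → I (t.setReg y i) := fun y i t hy ht => by
    obtain ⟨h1, h2, h3, h4⟩ := ht
    refine ⟨h1.of_same (C := a ::= 0 ;; b ::= 0 ;; d ::= 0) ⟨fun z hz => ?_, fun _ _ => rfl⟩, h2, ?_, ?_⟩
    · simp only [Cmd.setsReg, Bool.or_eq_false_iff, decide_eq_false_iff_not] at hz
      rcases hy with rfl | rfl | rfl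
      · simp [Ne.symm hz.1]
      · simp [Ne.symm hz.2.1]
      · simp [Ne.symm hz.2.2]
    · rcases hy with rfl | rfl | rfl <;> simpa using h3
    · unfold Partly
      rcases hy with rfl | rfl | rfl <;> simpa [Partly] using h4
  have body : ∀ t, I t → t.reg a < s.reg Reg.s → t.reg b < s.reg Reg.s → t.reg d < s.reg Reg.s →
      I ((ifThen (done ≐ 0) tryEnds).exec t) ∧ (t.reg done = 1 ∨ (t.reg a = a₀ ∧ t.reg b = b₀ ∧
        t.reg d = d₀) → ((ifThen (done ≐ 0) tryEnds).exec t).reg done = 1) := by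
    intro t ht h1 h2 h3'
    obtain ⟨t1, t2, t3, t4⟩ := ht
    rw [exec_ifThen]
    rcases t4 with t4 | t4
    · rw [if_pos (by simp [t4.1])]
      have f := tryEnds.exec_same t
      obtain ⟨c1, c2⟩ := tryEnds_spec h3 C t1 (by omega) (by omega) (by omega) t4.1 t4.2
      refine ⟨⟨t1.of_same f, (f.arr cand rfl).trans t2, (f.reg Reg.s rfl).trans t3, c1⟩, fun hh => ?_⟩
      rcases hh with hh | hh
      · omega
      · exact c2 (hv t t1 t2 hh.1 hh.2.1 hh.2.2)
    · rw [if_neg (by simp [t4.1])]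
      exact ⟨⟨t1, t2, t3, Or.inr t4⟩, fun _ => t4.1⟩
  have loop_d : ∀ t, I t → t.reg a < s.reg Reg.s → t.reg b < s.reg Reg.s →
      I ((forTo d Reg.s (ifThen (done ≐ 0) tryEnds)).exec t) ∧ (t.reg done = 1 ∨ (t.reg a = a₀ ∧
        t.reg b = b₀) → ((forTo d Reg.s (ifThen (done ≐ 0) tryEnds)).exec t).reg done = 1) := by
    intro t ht h1 h2
    refine Cmd.forTo_search I (fun t => t.reg done = 1) (k := s.reg Reg.s) ht.2.2.1 hd ht
      fun i hi z hz hIz => ?_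
    have ea : z.reg a = t.reg a := hz.reg a rfl
    have eb : z.reg b = t.reg b := hz.reg b rfl
    have := body (z.setReg d i) (hI d i z (by simp) hIz) (by simpa [ea] using h1)
      (by simpa [eb] using h2) (by simpa using hi)
    refine ⟨this.1, fun hh => this.2 (hh.imp (by simp) fun hh => ?_)⟩
    simp [ea, eb, hh]
  have loop_b : ∀ t, I t → t.reg a < s.reg Reg.s →
      I ((forTo b Reg.s (forTo d Reg.s (ifThen (done ≐ 0) tryEnds))).exec t) ∧
        (t.reg done = 1 ∨ t.reg a = a₀ →
          ((forTo b Reg.s (forTo d Reg.s (ifThen (done ≐ 0) tryEnds))).exec t).reg done = 1) := by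
    intro t ht h1
    refine Cmd.forTo_search I (fun t => t.reg done = 1) (k := s.reg Reg.s) ht.2.2.1 hb ht
      fun i hi z hz hIz => ?_
    have ea : z.reg a = t.reg a := hz.reg a rfl
    have := loop_d (z.setReg b i) (hI b i z (by simp) hIz) (by simpa [ea] using h1)
      (by simpa using hi)
    refine ⟨this.1, fun hh => this.2 (hh.imp (by simp) fun hh => ?_)⟩
    simp [ea, hh]
  have := Cmd.forTo_search (s := s) (y := a) (p := Reg.s)
    (C := forTo b Reg.s (forTo d Reg.s (ifThen (done ≐ 0) tryEnds))) I (fun t => t.reg done = 1)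
    (G := True) (k := s.reg Reg.s) rfl ha ⟨h, rfl, rfl, Or.inl ⟨h0, hk⟩⟩ fun i hi z hz hIz => by
      have := loop_b (z.setReg a i) (hI a i z (by simp) hIz) (by simpa using hi)
      refine ⟨this.1, fun hh => this.2 (hh.imp (by simp) fun hh => ?_)⟩
      simp [hh]
  have hdone := this.2 (Or.inr trivial)
  rcases this.1.2.2.2 with hh | hh
  · exact absurd (hh.1.symm.trans hdone) (by decide)
  · exact hh.2

/-- The state in which the search starts. -/
theorem exec_decode {ω : ℕ} {σ : ℕ → ℕ} {R : Finset (ℕ × ℕ)} {L : List (ℕ × ℕ)}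
    (C : Copy (size ω) L.length (treeTarget ω) σ (fun j => (L.getD j (0, 0)).1)
      (fun j => (L.getD j (0, 0)).2) R) :
    let s := input (2 * size ω + 3) L
    let t := (done ::= 0).exec (readGraph.exec (countEdges.exec s))
    decode.exec s = search.exec t ∧
    decode.time s = countEdges.time s + ((2 ≺ k).cost + 1 + (readGraph.time (countEdges.exec s) +
      ((done ::= 0).time (readGraph.exec (countEdges.exec s)) + search.time t))) ∧
    Ready (size ω) L.length (fun j => (L.getD j (0, 0)).1) (fun j => (L.getD j (0, 0)).2) t ∧
    t.reg done = 0 ∧ ∀ p, t.arr key p = 0 := by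
  intro s t
  have hN : s.reg N = 2 * size ω + 3 := rfl
  obtain ⟨h1, h2, h3⟩ := exec_countEdges hN
  have f1 := countEdges.exec_same s
  have hM : s.reg M = L.length := rfl
  have hk : (2 ≺ k).eval (countEdges.exec s) = false := by
    have := C.le_length
    rw [hM] at h3
    simp only [Test.eval_lt, Expr.eval_two, Expr.eval_reg, h3, decide_eq_false_iff_not]
    omega
  have hz : ∀ z, z ≠ src → z ≠ dst → ∀ p, s.arr z p = 0 := fun z h h' p => by simp [s, input, h, h']
  have r := readGraph_spec (n := size ω) (m := L.length) (s := countEdges.exec s)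
    ((f1.reg N rfl).trans hN) h2 ((f1.reg M rfl).trans hM) h1
    (fun v => by rw [f1.arr deg rfl]; exact hz deg (by simp) (by simp) v)
    (fun v => by rw [f1.arr ind rfl]; exact hz ind (by simp) (by simp) v)
  rw [f1.arr src rfl, f1.arr dst rfl] at r
  have f2 := readGraph.exec_same (countEdges.exec s)
  have f3 := (done ::= 0).exec_same (readGraph.exec (countEdges.exec s))
  refine ⟨?_, ?_, r.of_same f3, by simp [t], fun p => ?_⟩
  · rw [decode_eq, exec_seq, exec_ite, if_neg (by simp only [hk, Bool.false_eq_true, not_false_eq_true])]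
    rfl
  · rw [decode_eq]
    simp only [Cmd.time]
    rw [if_neg (by simp only [hk, Bool.false_eq_true, not_false_eq_true])]
  · rw [f3.arr key rfl, f2.arr key rfl, f1.arr key rfl]
    exact hz key (by simp) (by simp) p

end Watermark

namespace Watermark

/-! ### The running time -/

/-- The program contains no loop. -/
def Cmd.loopFree : Cmd → Bool
  | skip => true
  | assign _ _ => true
  | put _ _ _ => true
  | seq C C' => C.loopFree && C'.loopFree
  | ite _ C C' => C.loopFree && C'.loopFree
  | forTo _ _ _ => false

/-- A weight that bounds the number of steps of a program without loops. -/
def Cmd.weight : Cmd → ℕ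
  | skip => 1
  | assign _ p => p.cost + 1
  | put _ p p' => p.cost + p'.cost + 1
  | seq C C' => C.weight + C'.weight
  | ite T C C' => T.cost + 1 + (C.weight + C'.weight)
  | forTo _ p C => (p.cost + 1) * (C.weight + 2)

/-- The value is, up to a constant, at most the value of a register in `K`. -/
def Expr.tame (K : List Reg) : Expr → Bool
  | lit _ => false
  | reg y => decide (y ∈ K)
  | get _ _ => false
  | succ p => p.tame K
  | sub p _ => p.tame K

/-- The loops are not nested, and their bounds are controlled by the registers in `K`. -/
def Cmd.shallow (K : List Reg) : Cmd → Bool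
  | skip => true
  | assign _ _ => true
  | put _ _ _ => true
  | seq C C' => C.shallow K && C'.shallow K
  | ite _ C C' => C.shallow K && C'.shallow K
  | forTo _ p C => p.tame K && C.loopFree

theorem Expr.eval_le {K : List Reg} {B : ℕ} {s : Store} (hs : ∀ y ∈ K, s.reg y ≤ B) :
    ∀ p : Expr, p.tame K = true → p.eval s ≤ B + p.cost
  | lit _, h => by simp [Expr.tame] at h
  | reg y, h => by
    have := hs y (by simpa [Expr.tame] using h)
    simp only [Expr.eval]
    omega
  | get _ _, h => by simp [Expr.tame] at h
  | succ p, h => by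
    have := Expr.eval_le hs p h
    simp only [Expr.eval, Expr.cost]
    omega
  | sub p p', h => by
    have := Expr.eval_le hs p h
    simp only [Expr.eval, Expr.cost]
    omega

theorem Cmd.time_le_of_loopFree (C : Cmd) : ∀ s, C.loopFree = true → C.time s ≤ C.weight := by
  induction C with
  | skip => exact fun _ _ => le_rfl
  | assign y p => exact fun _ _ => le_rfl
  | put y p p' => exact fun _ _ => le_rfl
  | seq C C' ih ih' =>
    intro s h
    simp only [Cmd.loopFree, Bool.and_eq_true] at h
    exact Nat.add_le_add (ih _ h.1) (ih' _ h.2)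
  | ite T C C' ih ih' =>
    intro s h
    simp only [Cmd.loopFree, Bool.and_eq_true] at h
    have h1 := ih s h.1
    have h2 := ih' s h.2
    simp only [Cmd.time, Cmd.weight]
    split <;> omega
  | forTo y p C ih => exact fun _ h => by simp [Cmd.loopFree] at h

/-- Amortized analysis of a loop, with the potential `Φ`. -/
theorem Cmd.time_forTo {y : Reg} {p : Expr} {C : Cmd} {s : Store} (I : Store → Prop)
    (Φ : Store → ℕ) {c k : ℕ} (hk : p.eval s ≤ k) (h0 : I s)
    (hs : ∀ m t, m < p.eval s → Same (Cmd.forTo y p C) s t → I t → I (C.exec (t.setReg y m)) ∧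
      C.time (t.setReg y m) + Φ t ≤ c + Φ (C.exec (t.setReg y m))) :
    I ((Cmd.forTo y p C).exec s) ∧ (Cmd.forTo y p C).time s + Φ s ≤
      p.cost + 1 + k * (c + 1) + Φ ((Cmd.forTo y p C).exec s) := by
  have key : ∀ j, j ≤ p.eval s →
      Same (Cmd.forTo y p C) s (iter (fun m s' => C.exec (s'.setReg y m)) j s) ∧
      I (iter (fun m s' => C.exec (s'.setReg y m)) j s) ∧
      ∑ m ∈ Finset.range j,
        (1 + C.time ((iter (fun m' s' => C.exec (s'.setReg y m')) m s).setReg y m)) + Φ s ≤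
        j * (c + 1) + Φ (iter (fun m s' => C.exec (s'.setReg y m)) j s) := by
    intro j
    induction j with
    | zero => exact fun _ => ⟨⟨fun _ _ => rfl, fun _ _ => rfl⟩, h0, by simp [iter]⟩
    | succ j ih =>
      intro hj
      obtain ⟨h1, h2, h3⟩ := ih (by omega)
      obtain ⟨h4, h5⟩ := hs j _ (by omega) h1 h2
      refine ⟨⟨fun z hz => ?_, fun z hz => ?_⟩, h4, ?_⟩
      · have hz' := hz
        simp only [Cmd.setsReg, Bool.or_eq_false_iff, decide_eq_false_iff_not] at hz'
        simp only [iter]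
        rw [(C.exec_same _).reg z hz'.2, Store.setReg_reg, if_neg (Ne.symm hz'.1), h1.reg z hz]
      · simp only [iter]
        rw [(C.exec_same _).arr z hz, Store.setReg_arr, h1.arr z hz]
      · rw [Finset.sum_range_succ, Nat.succ_mul]
        simp only [iter]
        omega
  obtain ⟨-, hI, h⟩ := key _ le_rfl
  refine ⟨hI, ?_⟩
  have h' : p.eval s * (c + 1) ≤ k * (c + 1) := Nat.mul_le_mul_right _ hk
  simp only [Cmd.time, Cmd.exec]
  omega

theorem Cmd.time_forTo_le {y : Reg} {p : Expr} {C : Cmd} {s : Store} (I : Store → Prop)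
    {c k : ℕ} (hk : p.eval s ≤ k) (h0 : I s)
    (hs : ∀ m t, m < p.eval s → Same (Cmd.forTo y p C) s t → I t → I (C.exec (t.setReg y m)) ∧
      C.time (t.setReg y m) ≤ c) :
    (Cmd.forTo y p C).time s ≤ p.cost + 1 + k * (c + 1) :=
  (Cmd.time_forTo I (fun _ => 0) hk h0 hs).2

theorem Cmd.time_ite_le (T : Test) (C C' : Cmd) (s : Store) :
    (Cmd.ite T C C').time s ≤ T.cost + 1 + (C.time s + C'.time s) := by
  simp only [Cmd.time]
  split <;> omega

theorem Cmd.time_ifThen_le (T : Test) (C : Cmd) (s : Store) :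
    (Cmd.ifThen T C).time s ≤ T.cost + 2 + C.time s := by
  have := Cmd.time_ite_le T C Cmd.skip s
  simp only [Cmd.time] at this
  simp only [Cmd.ifThen, Cmd.time]
  omega

theorem Cmd.time_seq (C C' : Cmd) (s : Store) :
    (Cmd.seq C C').time s = C.time s + C'.time (C.exec s) := rfl

theorem Cmd.time_le_of_shallow {K : List Reg} {B : ℕ} (C : Cmd) :
    ∀ s, C.shallow K = true → (∀ y ∈ K, C.setsReg y = false) → (∀ y ∈ K, s.reg y ≤ B) →
      C.time s ≤ C.weight * (B + 1) := by
  induction C with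
  | skip => exact fun _ _ _ _ => Nat.le_mul_of_pos_right _ (by omega)
  | assign y p => exact fun _ _ _ _ => Nat.le_mul_of_pos_right _ (by omega)
  | put y p p' => exact fun _ _ _ _ => Nat.le_mul_of_pos_right _ (by omega)
  | seq C C' ih ih' =>
    intro s h hK hs
    simp only [Cmd.shallow, Bool.and_eq_true] at h
    simp only [Cmd.setsReg, Bool.or_eq_false_iff] at hK
    have h1 := ih s h.1 (fun y hy => (hK y hy).1) hs
    have h2 := ih' (C.exec s) h.2 (fun y hy => (hK y hy).2) (fun y hy => by
      rw [(C.exec_same s).reg y (hK y hy).1]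
      exact hs y hy)
    simp only [Cmd.time, Cmd.weight, Nat.add_mul]
    omega
  | ite T C C' ih ih' =>
    intro s h hK hs
    simp only [Cmd.shallow, Bool.and_eq_true] at h
    simp only [Cmd.setsReg, Bool.or_eq_false_iff] at hK
    have h1 := ih s h.1 (fun y hy => (hK y hy).1) hs
    have h2 := ih' s h.2 (fun y hy => (hK y hy).2) hs
    have h3 := Cmd.time_ite_le T C C' s
    have h4 : T.cost + 1 ≤ (T.cost + 1) * (B + 1) := Nat.le_mul_of_pos_right _ (by omega)
    rw [Cmd.weight, Nat.add_mul (T.cost + 1), Nat.add_mul C.weight]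
    omega
  | forTo y p C ih =>
    intro s h hK hs
    simp only [Cmd.shallow, Bool.and_eq_true] at h
    have h1 := Expr.eval_le hs p h.1
    have h2 := Cmd.time_forTo_le (s := s) (y := y) (C := C) (fun _ => True) h1 trivial
      fun m t _ _ _ => ⟨trivial, C.time_le_of_loopFree _ h.2⟩
    refine h2.trans ?_
    rw [Cmd.weight]
    nlinarith [Nat.zero_le (p.cost * C.weight), Nat.zero_le (p.cost * B),
      Nat.zero_le (p.cost * C.weight * B), Nat.zero_le (B * C.weight)]

/-- A program with shallow loops takes linear time. -/
theorem Cmd.time_le (K : List Reg) (C : Cmd) {B : ℕ} {s : Store} (hs : ∀ y ∈ K, s.reg y ≤ B)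
    (h : (C.shallow K && K.all (fun y => !C.setsReg y)) = true := by rfl) :
    C.time s ≤ C.weight * (B + 1) := by
  rw [Bool.and_eq_true, List.all_eq_true] at h
  exact C.time_le_of_shallow s h.1 (fun y hy => by simpa using h.2 y hy) hs

open Reg Arr Cmd Test

/-- The loops are nested, but the inner ones run only when `tries` is increased, which happens at
most twice. The potential `tries` times the cost of an attempt pays for them. -/
theorem findFixed2_time_le : ∃ κ, ∀ (B : ℕ) (s : Store), s.reg N ≤ B → s.reg Reg.n ≤ B →
    findFixed2.time s ≤ κ * (B + 1) := by
  refine ⟨tryFixed.weight * 2 + 100, fun B s hN hn => ?_⟩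
  rw [findFixed2_eq, time_seq]
  have h1 := Cmd.time_forTo (y := Reg.h) (p := Reg.n) (C := x ::= N - 3 - Reg.h ;;
      ifThen (Test.and (f ≐ 0) (tries ≺ 2)) (
        ifThen (Test.and (Test.not (cc x ≐ 0)) (Test.not (Reg.n ≺ mc x))) (
          inc tries ;; tryFixed))) (s := (tries ::= 0).exec s)
    (I := fun t => t.reg tries ≤ 2) (Φ := fun t => t.reg tries * (tryFixed.weight * (B + 1)))
    (c := 50) (k := B) (by simpa using hn) (by simp) (fun m t _ ht hI => by
      have eN : t.reg N ≤ B := by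
        rw [ht.reg N rfl]
        simpa using hN
      have en : t.reg Reg.n ≤ B := by
        rw [ht.reg Reg.n rfl]
        simpa using hn
      rw [time_seq, exec_seq]
      have ex : ((x ::= N - 3 - Reg.h).exec (t.setReg Reg.h m)).reg tries = t.reg tries ∧
          ((x ::= N - 3 - Reg.h).exec (t.setReg Reg.h m)).reg N ≤ B ∧
          ((x ::= N - 3 - Reg.h).exec (t.setReg Reg.h m)).reg Reg.n ≤ B := by simp [eN, en]
      have e1 : (x ::= N - 3 - Reg.h).time (t.setReg Reg.h m) = 6 := rfl
      rw [e1]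
      generalize (x ::= N - 3 - Reg.h).exec (t.setReg Reg.h m) = z at ex
      obtain ⟨x1, x2, x3⟩ := ex
      simp only [ifThen, Cmd.time, exec_ite]
      have ec : (Test.and (f ≐ 0) (tries ≺ 2)).cost = 7 := rfl
      have ec' : (Test.and (Test.not (cc x ≐ 0)) (Test.not (Reg.n ≺ mc x))).cost = 11 := rfl
      rw [ec, ec']
      by_cases hT : (Test.and (f ≐ 0) (tries ≺ 2)).eval z = true
      · have hlt : z.reg tries < 2 := by
          simp only [Test.eval_and, Test.eval_eq, Test.eval_lt, Expr.eval_reg, Expr.eval_two,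
            Bool.and_eq_true] at hT
          exact of_decide_eq_true hT.2
        rw [if_pos hT, if_pos hT]
        split
        · have f1 := tryFixed.exec_same ((inc tries).exec z)
          have t1 := Cmd.time_le [N, Reg.n] tryFixed (B := B) (s := (inc tries).exec z)
            (by simp [x2, x3])
          have e2 : (inc tries).time z = 3 := rfl
          rw [exec_seq, f1.reg tries rfl, e2]
          have e3 : ((inc tries).exec z).reg tries = t.reg tries + 1 := by simp [x1]
          rw [e3, Nat.succ_mul]
          omega
        · rw [exec_skip, x1]
          omega
      · rw [if_neg hT, if_neg hT, exec_skip, x1]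
        omega)
  have h2 := Nat.mul_le_mul_right (tryFixed.weight * (B + 1)) h1.1
  have h3 := h1.2
  have e1 : (tries ::= 0).time s = 2 := rfl
  have e2 : (Expr.reg Reg.n).cost = 1 := rfl
  rw [e2] at h3
  rw [e1, Nat.add_mul, Nat.mul_comm tryFixed.weight 2, Nat.mul_assoc]
  omega

theorem findFixed_time_le : ∃ κ, ∀ (B : ℕ) (s : Store), s.reg N ≤ B → s.reg Reg.n ≤ B →
    findFixed.time s ≤ κ * (B + 1) := by
  obtain ⟨κ, hκ⟩ := findFixed2_time_le
  refine ⟨testLastFixed.weight + findFixed1.weight + findFixed3.weight + κ + 100,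
    fun B s hN hn => ?_⟩
  have hK : ∀ C : Cmd, C.setsReg N = false → C.setsReg Reg.n = false → ∀ s : Store,
      s.reg N ≤ B ∧ s.reg Reg.n ≤ B → (C.exec s).reg N ≤ B ∧ (C.exec s).reg Reg.n ≤ B :=
    fun C h1 h2 s h => by
      rw [(C.exec_same s).reg N h1, (C.exec_same s).reg Reg.n h2]
      exact h
  have h0 : s.reg N ≤ B ∧ s.reg Reg.n ≤ B := ⟨hN, hn⟩
  have t1 := Cmd.time_le [N, Reg.n] testLastFixed (B := B) (s := s) (by simpa using h0)
  unfold findFixed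
  rw [time_seq]
  replace h0 := hK testLastFixed rfl rfl _ h0
  generalize testLastFixed.exec s = s1 at h0 ⊢
  have t2 := Cmd.time_ite_le (t ≐ 1) (f ::= N - 2) (f ::= 0 ;; findFixed1 ;;
    ifThen (f ≐ 0) findFixed2 ;; ifThen (f ≐ 0) findFixed3) s1
  rw [time_seq, time_seq, time_seq] at t2
  replace h0 := hK (f ::= 0) rfl rfl _ h0
  generalize (f ::= 0).exec s1 = s2 at h0 t2
  have t3 := Cmd.time_le [N, Reg.n] findFixed1 (B := B) (s := s2) (by simpa using h0)
  replace h0 := hK findFixed1 rfl rfl _ h0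
  generalize findFixed1.exec s2 = s3 at h0 t2
  have t4 := Cmd.time_ifThen_le (f ≐ 0) findFixed2 s3
  have t5 := hκ B s3 h0.1 h0.2
  replace h0 := hK (ifThen (f ≐ 0) findFixed2) rfl rfl _ h0
  generalize (ifThen (f ≐ 0) findFixed2).exec s3 = s4 at h0 t2
  have t6 := Cmd.time_ifThen_le (f ≐ 0) findFixed3 s4
  have t7 := Cmd.time_le [N, Reg.n] findFixed3 (B := B) (s := s4) (by simpa using h0)
  have e1 : (t ≐ 1).cost = 3 := rfl
  have e2 : (f ≐ 0).cost = 3 := rfl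
  have e3 : (f ::= N - 2).time s1 = 4 := rfl
  have e4 : (f ::= 0).time s1 = 2 := rfl
  rw [e1, e3, e4] at t2
  rw [e2] at t4 t6
  simp only [Nat.add_mul _ _ (B + 1)]
  omega

theorem climbStep_time_le : ∃ κ, ∀ s : Store,
    climbStep.time s ≤ κ + κ * s.arr ind (s.reg cur) := by
  refine ⟨100, fun s => ?_⟩
  have key : ∀ z : Store, scanEdges.time z ≤ 3 + z.arr ind (z.reg cur) * 51 := fun z =>
    Cmd.time_forTo_le (fun _ => True) le_rfl trivial fun m t _ _ _ =>
      ⟨trivial, (Cmd.time_le_of_loopFree _ _ rfl).trans (by decide)⟩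
  have h1 := key ((e ::= head cur).exec ((c ::= 0).exec ((inc cnt).exec
    ((put mark cur 1).exec ((put lab cur cnt).exec s)))))
  have h2 := Cmd.time_ite_le (c ≐ 1) (cur ::= x) (go ::= 0)
    (scanEdges.exec ((e ::= head cur).exec ((c ::= 0).exec ((inc cnt).exec
      ((put mark cur 1).exec ((put lab cur cnt).exec s))))))
  have e1 : ((e ::= head cur).exec ((c ::= 0).exec ((inc cnt).exec
    ((put mark cur 1).exec ((put lab cur cnt).exec s))))).arr ind = s.arr ind := by
    funext v
    simp
  have e2 : ((e ::= head cur).exec ((c ::= 0).exec ((inc cnt).exec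
    ((put mark cur 1).exec ((put lab cur cnt).exec s))))).reg cur = s.reg cur := by simp
  rw [e1, e2] at h1
  unfold climbStep
  simp only [time_seq]
  have c1 : (put lab cur cnt).time s = 3 := rfl
  have c2 : ∀ z, (put mark cur 1).time z = 3 := fun _ => rfl
  have c3 : ∀ z, (inc cnt).time z = 3 := fun _ => rfl
  have c4 : ∀ z, (c ::= 0).time z = 2 := fun _ => rfl
  have c5 : ∀ z, (e ::= head cur).time z = 3 := fun _ => rfl
  have c6 : ∀ z, (cur ::= x).time z = 2 := fun _ => rfl
  have c7 : ∀ z, (go ::= 0).time z = 2 := fun _ => rfl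
  have c8 : (c ≐ 1).cost = 3 := rfl
  rw [c6, c7, c8] at h2
  rw [c1, c2, c3, c4, c5]
  omega

/-- The in-degrees of the marked vertices add up to at most the number of the edges. -/
theorem sum_inEdges_le (D : ℕ → ℕ) (m : ℕ) (T : Finset ℕ) :
    ∑ v ∈ T, (inEdges D m v).length ≤ m := by
  have h : ∀ v, (inEdges D m v).length = ((Finset.range m).filter (fun j => D j = v)).card :=
    fun v => by
      rw [← List.toFinset_card_of_nodup (nodup_inEdges D m v)]
      congr 1
      ext j
      simp [mem_inEdges]
  simp only [h]
  rw [← Finset.card_biUnion fun v _ w _ hvw => Finset.disjoint_left.2 fun j hj hj' =>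
    hvw ((Finset.mem_filter.1 hj).2.symm.trans (Finset.mem_filter.1 hj').2)]
  calc _ ≤ (Finset.range m).card := Finset.card_le_card fun j hj => by
        obtain ⟨v, -, hj⟩ := Finset.mem_biUnion.1 hj
        exact (Finset.mem_filter.1 hj).1
    _ = m := Finset.card_range m

/-- Each vertex is visited at most once, so that tracing a path backwards takes linear time. -/
theorem climb_time_le : ∃ κ, ∀ (n m : ℕ) (S D : ℕ → ℕ) (s : Store), Ready n m S D s →
    (∀ j, j < m → S j < 2 * n + 3) → s.reg cur < 2 * n + 3 →
    climb.time s ≤ κ * (n + 1) + κ * m := by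
  obtain ⟨κ, hκ⟩ := climbStep_time_le
  refine ⟨3 * κ + 100, fun n m S D s h hS hc => ?_⟩
  let marked : Store → Finset ℕ := fun z =>
    (Finset.range (2 * n + 3)).filter (fun v => z.arr mark v ≠ 0)
  have e1 : (mark cur ≐ 0).cost = 4 := rfl
  rw [climb_eq]
  by_cases h0 : s.arr mark (s.reg cur) = 0
  swap
  · simp only [ifThen, Cmd.time, e1]
    rw [if_neg (by simp [h0])]
    nlinarith
  have key := Cmd.time_forTo (y := i) (p := N) (C := ifThen (go ≐ 1) climbStep)
    (s := (go ::= 1).exec s)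
    (I := fun z => z.reg go = 1 → z.reg cur < 2 * n + 3 ∧ z.arr mark (z.reg cur) = 0)
    -- The potential is `κ` times the number of edges into marked vertices. Each step pays for its
    -- scan by marking the current vertex, and in total there are at most `m` edges.
    (Φ := fun z => κ * ∑ v ∈ marked z, (inEdges D m v).length) (c := κ + 10) (k := 2 * n + 3)
    (by simp [h.N_eq]) (fun _ => by simpa using ⟨hc, h0⟩) (fun k z _ hs hI => by
      have hr : Ready n m S D (z.setReg i k) :=
        ((h.of_same (Cmd.exec_same (go ::= 1) _)).of_same hs).of_same (C := i ::= 0)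
          ⟨fun y hy => by
            simp only [Cmd.setsReg, decide_eq_false_iff_not] at hy
            simp [Ne.symm hy], fun _ _ => rfl⟩
      have ec : (go ≐ 1).cost = 3 := rfl
      simp only [ifThen, Cmd.time, exec_ite, ec]
      by_cases hg : z.reg go = 1
      swap
      · rw [if_neg (by simp [hg]), if_neg (by simp [hg])]
        exact ⟨fun h => absurd (by simpa using h) hg, by
          rw [exec_skip, show marked (z.setReg i k) = marked z from rfl]
          omega⟩
      obtain ⟨i1, i2⟩ := hI hg
      rw [if_pos (by simp [hg]), if_pos (by simp [hg])]
      obtain ⟨-, c2, -, c4, c5⟩ := climbStep_spec hr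
      have ht := hκ (z.setReg i k)
      generalize climbStep.exec (z.setReg i k) = w at *
      have ecur : (z.setReg i k).reg cur = z.reg cur := by simp
      rw [ecur] at c2 c4 c5 ht
      refine ⟨fun hgo => ?_, ?_⟩
      · by_cases hlen : ((inEdges D m (z.reg cur)).filter
            (fun j => decide (w.arr mark (S j) = 0))).length = 1
        · obtain ⟨-, j, hj, hj', he⟩ := c4 hlen
          rw [he]
          exact ⟨hS j (mem_inEdges.1 hj).1, hj'⟩
        · have := c5 hlen
          omega
      · have hm : marked w = insert (z.reg cur) (marked z) := by
          ext v
          simp only [marked, Finset.mem_filter, Finset.mem_range, Finset.mem_insert]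
          by_cases hv : v = z.reg cur
          · simp [hv, c2, i1]
          · simp [hv, c2]
        rw [hm, Finset.sum_insert (by simp [marked, i2]), Nat.mul_add]
        rw [hr.ind_eq] at ht
        omega)
  have h1 := (Nat.le_add_right _ _).trans key.2
  have h2 := Nat.mul_le_mul_left κ (sum_inEdges_le D m
    (marked ((forTo i N (ifThen (go ≐ 1) climbStep)).exec ((go ::= 1).exec s))))
  have h3 := Cmd.time_ifThen_le (mark cur ≐ 0)
    (go ::= 1 ;; forTo i N (ifThen (go ≐ 1) climbStep)) s
  have e2 : (Expr.reg N).cost = 1 := rfl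
  have e3 : (go ::= 1).time s = 2 := rfl
  rw [e2] at h1
  rw [e1, time_seq, e3] at h3
  nlinarith [Nat.zero_le (κ * n), Nat.zero_le (κ * m)]

theorem sewPaths_time_le : ∃ κ, ∀ (n m : ℕ) (S D : ℕ → ℕ) (s : Store), Ready n m S D s →
    (∀ j, j < m → S j < 2 * n + 3) → s.reg a < s.reg Reg.s → s.reg b < s.reg Reg.s →
    s.reg d < s.reg Reg.s → sewPaths.time s ≤ κ * (n + 1) + κ * m := by
  obtain ⟨κ, hκ⟩ := climb_time_le
  refine ⟨3 * κ + 4 * clearMarks.weight + 100, fun n m S D s h hS ha hb hd => ?_⟩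
  have t1 := Cmd.time_le [N] clearMarks (B := 2 * n + 3) (s := s) (by simp [h.N_eq])
  rw [sewPaths_eq, time_seq, time_seq]
  have b0 : ∀ C : Cmd, C.setsReg a = false → C.setsReg b = false → C.setsReg d = false →
      C.setsReg Reg.s = false → ∀ s : Store,
      (s.reg a < s.reg Reg.s ∧ s.reg b < s.reg Reg.s ∧ s.reg d < s.reg Reg.s) →
      ((C.exec s).reg a < (C.exec s).reg Reg.s ∧ (C.exec s).reg b < (C.exec s).reg Reg.s ∧
        (C.exec s).reg d < (C.exec s).reg Reg.s) := fun C h1 h2 h3 h4 s h => by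
    rw [(C.exec_same s).reg a h1, (C.exec_same s).reg b h2, (C.exec_same s).reg d h3,
      (C.exec_same s).reg Reg.s h4]
    exact h
  have hB := b0 clearMarks rfl rfl rfl rfl s ⟨ha, hb, hd⟩
  replace h := h.of_same (clearMarks.exec_same s)
  generalize clearMarks.exec s = s1 at *
  replace hB := b0 (cnt ::= 0) rfl rfl rfl rfl s1 hB
  replace h := h.of_same ((cnt ::= 0).exec_same s1)
  have e1 : (cnt ::= 0).time s1 = 2 := rfl
  rw [e1]
  generalize (cnt ::= 0).exec s1 = s2 at *
  have t2 := Cmd.time_ifThen_le (deg (cand a) ≐ 0) (cur ::= cand a ;; climb ;; cur ::= cand b ;;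
    climb ;; cur ::= cand d ;; climb) s2
  simp only [time_seq] at t2
  have e2 : (cur ::= cand a).time s2 = 3 := rfl
  have e3 : ∀ z, (cur ::= cand b).time z = 3 := fun _ => rfl
  have e4 : ∀ z, (cur ::= cand d).time z = 3 := fun _ => rfl
  have e5 : (deg (cand a) ≐ 0).cost = 5 := rfl
  rw [e2, e3, e4, e5] at t2
  have l1 : ((cur ::= cand a).exec s2).reg cur < 2 * n + 3 := by
    simpa using h.cand_lt _ hB.1
  replace hB := b0 (cur ::= cand a) rfl rfl rfl rfl s2 hB
  replace h := h.of_same ((cur ::= cand a).exec_same s2)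
  generalize (cur ::= cand a).exec s2 = s3 at *
  have t3 := hκ n m S D s3 h hS l1
  replace hB := b0 climb rfl rfl rfl rfl s3 hB
  replace h := h.of_same (climb.exec_same s3)
  generalize climb.exec s3 = s4 at *
  have l2 : ((cur ::= cand b).exec s4).reg cur < 2 * n + 3 := by
    simpa using h.cand_lt _ hB.2.1
  replace hB := b0 (cur ::= cand b) rfl rfl rfl rfl s4 hB
  replace h := h.of_same ((cur ::= cand b).exec_same s4)
  generalize (cur ::= cand b).exec s4 = s5 at *
  have t4 := hκ n m S D s5 h hS l2
  replace hB := b0 climb rfl rfl rfl rfl s5 hB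
  replace h := h.of_same (climb.exec_same s5)
  generalize climb.exec s5 = s6 at *
  have l3 : ((cur ::= cand d).exec s6).reg cur < 2 * n + 3 := by
    simpa using h.cand_lt _ hB.2.2
  replace h := h.of_same ((cur ::= cand d).exec_same s6)
  generalize (cur ::= cand d).exec s6 = s7 at *
  have t5 := hκ n m S D s7 h hS l3
  nlinarith

/-- One loop of `findPreorder` is bounded in terms of `f`, so the bound on `f` from `findFixed_spec`
is needed for wrong labellings too. -/
theorem tryEnds_time_le : ∃ κ, ∀ (n m : ℕ) (q σ S D : ℕ → ℕ) (R : Finset (ℕ × ℕ)) (s : Store),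
    Copy n m q σ S D R → Ready n m S D s → s.reg a < s.reg Reg.s → s.reg b < s.reg Reg.s →
    s.reg d < s.reg Reg.s → tryEnds.time s ≤ κ * (n + 1) := by
  obtain ⟨κ₁, hκ₁⟩ := sewPaths_time_le
  obtain ⟨κ₂, hκ₂⟩ := findFixed_time_le
  -- The factor `5` comes from `m ≤ 4 * (n + 1)`, and the factor `7` from loop bounds of at most `4n
  -- + 6`, since `4n + 7 ≤ 7 * (n + 1)`.
  refine ⟨5 * κ₁ + 7 * (readForest.weight + κ₂ + findAscending.weight + findPreorder.weight +
    restoreTree.weight + checkRestored.weight + writeKey.weight) + 100,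
    fun n m q σ S D R s C h ha hb hd => ?_⟩
  have t1 := hκ₁ n m S D s h (fun j hj => C.src_lt hj) ha hb hd
  have hm := C.length_le
  have hm' := Nat.mul_le_mul_left κ₁ (show m ≤ 4 * (n + 1) by omega)
  have e0 : (cnt ≐ N).cost = 3 := rfl
  unfold tryEnds
  rw [time_seq]
  by_cases hc : (sewPaths.exec s).reg cnt = 2 * n + 3
  swap
  · have r := h.of_same (sewPaths.exec_same s)
    simp only [ifThen, Cmd.time, e0]
    rw [if_neg (by simp [hc, r.N_eq])]
    simp only [Nat.add_mul _ _ (n + 1)]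
    have : κ₁ * (4 * (n + 1)) = 4 * κ₁ * (n + 1) := by ring
    have : 5 * κ₁ * (n + 1) = κ₁ * (n + 1) + 4 * κ₁ * (n + 1) := by ring
    omega
  have hl := labelled_of_sewPaths C h ha hb hd hc
  generalize sewPaths.exec s = s1 at *
  have t2 := Cmd.time_ifThen_le (cnt ≐ N) (readForest ;; findFixed ;; findAscending ;;
    findPreorder ;; restoreTree ;; checkRestored ;; ifThen (good ≐ 1) (done ::= 1 ;; writeKey)) s1
  simp only [time_seq] at t2
  have b0 : ∀ C : Cmd, C.setsReg N = false → C.setsReg Reg.n = false → C.setsReg M = false →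
      C.setsReg two = false → ∀ s : Store, (s.reg N ≤ 4 * n + 6 ∧ s.reg Reg.n ≤ 4 * n + 6 ∧
        s.reg M ≤ 4 * n + 6 ∧ s.reg two ≤ 4 * n + 6) →
      ((C.exec s).reg N ≤ 4 * n + 6 ∧ (C.exec s).reg Reg.n ≤ 4 * n + 6 ∧
        (C.exec s).reg M ≤ 4 * n + 6 ∧ (C.exec s).reg two ≤ 4 * n + 6) :=
    fun C h1 h2 h3 h4 s h => by
    rw [(C.exec_same s).reg N h1, (C.exec_same s).reg Reg.n h2, (C.exec_same s).reg M h3,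
      (C.exec_same s).reg two h4]
    exact h
  have hB : s1.reg N ≤ 4 * n + 6 ∧ s1.reg Reg.n ≤ 4 * n + 6 ∧ s1.reg M ≤ 4 * n + 6 ∧
      s1.reg two ≤ 4 * n + 6 := by
    rw [hl.N_eq, hl.n_eq, hl.M_eq, hl.two_eq]
    omega
  obtain ⟨-, hf⟩ := readForest_spec hl.N_eq hl.n_eq hl.M_eq hl.src_eq hl.dst_eq hl.src_lt hl.dst_lt
  have t3 := Cmd.time_le [N, M] readForest (s := s1) (B := 4 * n + 6) (by simp [hB])
  replace hB := b0 readForest rfl rfl rfl rfl _ hB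
  generalize readForest.exec s1 = s2 at *
  have t4 := hκ₂ (4 * n + 6) s2 hB.1 hB.2.1
  have hf' := (findFixed_spec hf).1
  replace hB := b0 findFixed rfl rfl rfl rfl _ hB
  generalize findFixed.exec s2 = s3 at *
  have t5 := Cmd.time_le [N, Reg.n] findAscending (s := s3) (B := 4 * n + 6) (by simp [hB])
  replace hf' : (findAscending.exec s3).reg f ≤ 4 * n + 6 := by
    rw [(findAscending.exec_same s3).reg f rfl]
    omega
  replace hB := b0 findAscending rfl rfl rfl rfl _ hB
  generalize findAscending.exec s3 = s4 at *
  have t6 := Cmd.time_le [N, Reg.n, f] findPreorder (s := s4) (B := 4 * n + 6) (by simp [hB, hf'])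
  replace hB := b0 findPreorder rfl rfl rfl rfl _ hB
  generalize findPreorder.exec s4 = s5 at *
  have t7 := Cmd.time_le [two] restoreTree (s := s5) (B := 4 * n + 6) (by simp [hB])
  replace hB := b0 restoreTree rfl rfl rfl rfl _ hB
  generalize restoreTree.exec s5 = s6 at *
  have t8 := Cmd.time_le [N, Reg.n] checkRestored (s := s6) (B := 4 * n + 6) (by simp [hB])
  replace hB := b0 checkRestored rfl rfl rfl rfl _ hB
  generalize checkRestored.exec s6 = s7 at *
  have t9 := Cmd.time_ifThen_le (good ≐ 1) (done ::= 1 ;; writeKey) s7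
  replace hB := b0 (done ::= 1) rfl rfl rfl rfl _ hB
  have e1 : (done ::= 1).time s7 = 2 := rfl
  have e2 : (good ≐ 1).cost = 3 := rfl
  rw [time_seq, e1, e2] at t9
  generalize (done ::= 1).exec s7 = s8 at *
  have t10 := Cmd.time_le [Reg.n] writeKey (s := s8) (B := 4 * n + 6) (by simp [hB])
  rw [e0] at t2
  have hw : ∀ w, w * (4 * n + 6 + 1) ≤ 7 * w * (n + 1) := fun w => by nlinarith
  have w1 := hw readForest.weight
  have w2 := hw κ₂
  have w3 := hw findAscending.weight
  have w4 := hw findPreorder.weight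
  have w5 := hw restoreTree.weight
  have w6 := hw checkRestored.weight
  have w7 := hw writeKey.weight
  have : κ₁ * (4 * (n + 1)) = 4 * κ₁ * (n + 1) := by ring
  have : 5 * κ₁ * (n + 1) = κ₁ * (n + 1) + 4 * κ₁ * (n + 1) := by ring
  simp only [Nat.mul_add 7, Nat.add_mul _ _ (n + 1)]
  omega

/-- At most four vertices have less than two outgoing edges. -/
theorem Copy.ends_le {n m : ℕ} {q σ S D : ℕ → ℕ} {R : Finset (ℕ × ℕ)} {s : Store}
    (C : Copy n m q σ S D R) (h : Ready n m S D s) : s.reg Reg.s ≤ 4 := by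
  rw [h.s_eq]
  have hsub : (Finset.range (2 * n + 3)).filter
      (fun v => ((Finset.range m).filter (fun j => S j = v)).card < 2) ⊆
      insert (σ 0) (insert (σ (2 * n + 2)) (R.image (fun e => σ e.1))) := by
    intro v hv
    rw [Finset.mem_filter, Finset.mem_range] at hv
    obtain ⟨u, hu, rfl⟩ := C.surj v hv.1
    by_contra hn
    simp only [Finset.mem_insert, Finset.mem_image, not_or] at hn
    have h0 : u ≠ 0 := fun h => hn.1 (h ▸ rfl)
    have h1 : u ≠ 2 * n + 2 := fun h => hn.2.1 (h ▸ rfl)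
    have hup := C.up u (by omega) (by omega)
    obtain ⟨j, hj, e1, e2⟩ := C.missing u (u - 1) (edge_path (by omega) (by omega))
      fun hR => hn.2.2 ⟨_, hR, rfl⟩
    obtain ⟨j', hj', e1', e2'⟩ := C.missing u (q u) (edge_tree (by omega) (by omega) rfl)
      fun hR => hn.2.2 ⟨_, hR, rfl⟩
    have hne : j ≠ j' := fun h => by
      subst h
      have := C.inj _ _ (by omega) (by omega) (e2.symm.trans e2')
      omega
    have : 1 < ((Finset.range m).filter (fun j => S j = σ u)).card := Finset.one_lt_card.2
      ⟨j, Finset.mem_filter.2 ⟨Finset.mem_range.2 hj, e1⟩, j',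
      Finset.mem_filter.2 ⟨Finset.mem_range.2 hj', e1'⟩, hne⟩
    omega
  have h1 := Finset.card_le_card hsub
  have h2 := Finset.card_insert_le (σ 0) (insert (σ (2 * n + 2)) (R.image (fun e => σ e.1)))
  have h3 := Finset.card_insert_le (σ (2 * n + 2)) (R.image (fun e => σ e.1))
  have h4 := Finset.card_image_le (s := R) (f := fun e => σ e.1)
  have := C.card_le
  omega

theorem Ready.setReg {n m : ℕ} {S D : ℕ → ℕ} {s : Store} (h : Ready n m S D s) {y : Reg}
    (hy : y = a ∨ y = b ∨ y = d) (i : ℕ) : Ready n m S D (s.setReg y i) := by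
  refine h.of_same (C := a ::= 0 ;; b ::= 0 ;; d ::= 0) ⟨fun z hz => ?_, fun _ _ => rfl⟩
  simp only [Cmd.setsReg, Bool.or_eq_false_iff, decide_eq_false_iff_not] at hz
  rcases hy with rfl | rfl | rfl
  · simp [Ne.symm hz.1]
  · simp [Ne.symm hz.2.1]
  · simp [Ne.symm hz.2.2]

/-- Three ends with at most four candidates each give `64` trials. -/
theorem search_time_le : ∃ κ, ∀ (n m : ℕ) (q σ S D : ℕ → ℕ) (R : Finset (ℕ × ℕ)) (s : Store),
    Copy n m q σ S D R → Ready n m S D s → search.time s ≤ κ * (n + 1) := by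
  obtain ⟨κ, hκ⟩ := tryEnds_time_le
  refine ⟨64 * κ + 1000, fun n m q σ S D R s C h => ?_⟩
  have e0 : (Expr.reg Reg.s).cost = 1 := rfl
  have e1 : (done ≐ 0).cost = 3 := rfl
  have body : ∀ t, Ready n m S D t → t.reg a < t.reg Reg.s → t.reg b < t.reg Reg.s →
      t.reg d < t.reg Reg.s → (ifThen (done ≐ 0) tryEnds).time t ≤ 5 + κ * (n + 1) :=
    fun t ht h1 h2 h3 => by
      have t1 := Cmd.time_ifThen_le (done ≐ 0) tryEnds t
      have t2 := hκ n m q σ S D R t C ht h1 h2 h3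
      omega
  have loop_d : ∀ t, Ready n m S D t → t.reg a < t.reg Reg.s → t.reg b < t.reg Reg.s →
      (forTo d Reg.s (ifThen (done ≐ 0) tryEnds)).time t ≤ 2 + 4 * (5 + κ * (n + 1) + 1) :=
    fun t ht h1 h2 => by
      have := Cmd.time_forTo_le (y := d) (p := Reg.s) (C := ifThen (done ≐ 0) tryEnds) (s := t)
        (Ready n m S D) (c := 5 + κ * (n + 1)) (C.ends_le ht) ht fun i z hi hz hI =>
          ⟨(hI.setReg (by simp) i).of_same (Cmd.exec_same _ _),
            body _ (hI.setReg (by simp) i) (by simpa [hz.reg a rfl, hz.reg Reg.s rfl] using h1)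
            (by simpa [hz.reg b rfl, hz.reg Reg.s rfl] using h2)
            (by simpa [hz.reg Reg.s rfl] using hi)⟩
      omega
  have loop_b : ∀ t, Ready n m S D t → t.reg a < t.reg Reg.s →
      (forTo b Reg.s (forTo d Reg.s (ifThen (done ≐ 0) tryEnds))).time t ≤
        2 + 4 * (2 + 4 * (5 + κ * (n + 1) + 1) + 1) :=
    fun t ht h1 => by
      have := Cmd.time_forTo_le (y := b) (p := Reg.s)
        (C := forTo d Reg.s (ifThen (done ≐ 0) tryEnds)) (s := t) (Ready n m S D)
        (c := 2 + 4 * (5 + κ * (n + 1) + 1)) (C.ends_le ht) ht fun i z hi hz hI =>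
          ⟨(hI.setReg (by simp) i).of_same (Cmd.exec_same _ _),
            loop_d _ (hI.setReg (by simp) i) (by simpa [hz.reg a rfl, hz.reg Reg.s rfl] using h1)
            (by simpa [hz.reg Reg.s rfl] using hi)⟩
      omega
  have := Cmd.time_forTo_le (y := a) (p := Reg.s)
    (C := forTo b Reg.s (forTo d Reg.s (ifThen (done ≐ 0) tryEnds))) (s := s) (Ready n m S D)
    (c := 2 + 4 * (2 + 4 * (5 + κ * (n + 1) + 1) + 1)) (C.ends_le h) h fun i z hi hz hI =>
      ⟨(hI.setReg (by simp) i).of_same (Cmd.exec_same _ _),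
        loop_b _ (hI.setReg (by simp) i) (by simpa [hz.reg Reg.s rfl] using hi)⟩
  unfold search
  nlinarith

theorem decode_time_le : ∃ κ, ∀ (ω : ℕ) (σ : ℕ → ℕ) (R : Finset (ℕ × ℕ)) (L : List (ℕ × ℕ)),
    Copy (size ω) L.length (treeTarget ω) σ (fun j => (L.getD j (0, 0)).1)
      (fun j => (L.getD j (0, 0)).2) R →
    decode.time (input (2 * size ω + 3) L) ≤ κ * (size ω + 1) := by
  obtain ⟨κ, hκ⟩ := search_time_le
  refine ⟨κ + 4 * countEdges.weight + 4 * readGraph.weight + 100, fun ω σ R L C => ?_⟩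
  obtain ⟨-, e, h, -, -⟩ := exec_decode C
  rw [e]
  have t1 := Cmd.time_le [N] countEdges (s := input (2 * size ω + 3) L) (B := 2 * size ω + 3)
    (by simp [input])
  have f1 := countEdges.exec_same (input (2 * size ω + 3) L)
  have hM := C.length_le
  have t2 := Cmd.time_le [N, M] readGraph (s := countEdges.exec (input (2 * size ω + 3) L))
    (B := 4 * size ω + 3) (by
      simp only [List.mem_cons, List.not_mem_nil, or_false, forall_eq_or_imp, forall_eq]
      rw [f1.reg N rfl, f1.reg M rfl]
      exact ⟨by simp only [input, if_true]; omega, by simpa [input] using hM⟩)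
  have t3 := hκ _ _ _ _ _ _ _ _ C h
  have e1 : (done ::= 0).time
    (readGraph.exec (countEdges.exec (input (2 * size ω + 3) L))) = 2 := rfl
  have e2 : (2 ≺ k).cost = 3 := rfl
  rw [e1, e2]
  nlinarith

end Watermark

/-! ### Correctness and running time combined. -/

theorem mainTheorem3 :
    ∃ C : ℕ, ∀ ω : ℕ, 2 < Watermark.size ω →
      ∀ R ⊆ Watermark.watermark ω, R.card ≤ 2 →
        ∀ L : List (ℕ × ℕ),
          Watermark.IsListing (2 * Watermark.size ω + 3) (Watermark.watermark ω \ R) L →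
            (∀ p : ℕ,
              (Watermark.decode.exec (Watermark.input (2 * Watermark.size ω + 3) L)).arr
                Watermark.Arr.key p = ω / 2 ^ p % 2) ∧
            Watermark.decode.time (Watermark.input (2 * Watermark.size ω + 3) L) ≤
              C * Watermark.size ω := by
  obtain ⟨κ, hκ⟩ := Watermark.decode_time_le
  -- The constant doubles because `n + 1 ≤ 2n`.
  refine ⟨2 * κ, fun ω h3 R _ hR L hL => ?_⟩
  obtain ⟨σ, C⟩ := hL.copy h3 hR
  obtain ⟨e, -, h, h0, hk⟩ := Watermark.exec_decode C
  refine ⟨?_, (hκ ω σ R L C).trans ?_⟩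
  · rw [e]
    exact Watermark.search_spec h3 C h h0 hk
  · rw [Nat.mul_comm 2 κ, Nat.mul_assoc]
    exact Nat.mul_le_mul_left κ (by omega)
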